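/- Let $d>2$ be a real number, let $\widetilde{\mathbb R}=(-\infty,-1]\cup[1,\infty)$ (the broken line) with the measure $d\mu(r)=|r|^{d-1}\,dr$, and write $\|\cdot\|_p$ for the norm of $L^p(\widetilde{\mathbb R},d\mu)$. The points $-1$ and $1$ are identified in the following sense: $C^1(\widetilde{\mathbb R})$ is the space of continuously differentiable functions $f$ on $\widetilde{\mathbb R}$ (one-sided derivatives at $\pm1$) with $f(-1)=f(1)$ and $f'(-1)=f'(1)$; $C_c^\infty(\widetilde{\mathbb R})$ is the space of smooth, compactly supported functions $f$ on $\widetilde{\mathbb R}$ with $f^{(k)}(-1)=f^{(k)}(1)$ for all $k\ge 0$; and $S_0(\widetilde{\mathbb R})$ is the subspace of those $f\in C_c^\infty(\widetilde{\mathbb R})$ with $f(-1)=f(1)=0$. Functions are complex-valued. Let $\Delta_d$ be the nonnegative self-adjoint operator on $L^2(\widetilde{\mathbb R},d\mu)$ associated with the closure of the quadratic form $$Q(f,g)=\int_{\widetilde{\mathbb R}} f'(r)\,\overline{g'(r)}\,d\mu(r),\qquad f,g\in C^1(\widetilde{\mathbb R})\ \text{with}\ f,f',g,g'\in L^2(\widetilde{\mathbb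 R},d\mu),$$ and let $\Delta_d^{1/2}$ be its nonnegative square root. Then for every $p$ with $\max\left(\frac{d}{2d-3},1\right)<p<\infty$ there is a constant $C$, depending only on $d$ and $p$, such that every $f\in S_0(\widetilde{\mathbb R})$ belongs to the domain of $\Delta_d^{1/2}$ and $$\|\Delta_d^{1/2}f\|_p\le C\,\|f'\|_p .$$ In particular, if $d\ge 3$, this holds for all $p\in(1,\infty)$. -/

import Mathlib

open MeasureTheory Set
open scoped ContDiff InnerProductSpace ComplexOrder

noncomputable section

namespace BrokenLine

section Form

variable {H K : Type*} [NormedAddCommGroup H] [InnerProductSpace ℂ H] [CompleteSpace H]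
  [NormedAddCommGroup K] [InnerProductSpace ℂ K]

/-- `V` is the graph `{(u, D u)}` of a closed operator `D` from `H` to `K`, hence it encodes the
closed nonnegative form `Q (u, v) = ⟪D u, D v⟫`.  The graph of the self-adjoint operator associated
with the form: `(u, w)` belongs to it iff `u` is in the form domain and `Q (v, u) = ⟪v, w⟫` for all
`v` in the form domain. -/
def formGraph (V : Submodule ℂ (WithLp 2 (H × K))) : Submodule ℂ (H × H) where
  carrier := {q | ∃ z ∈ V, z.fst = q.1 ∧ ∀ v ∈ V, ⟪v.snd, z.snd⟫_ℂ = ⟪v.fst, q.2⟫_ℂ}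
  zero_mem' := ⟨0, V.zero_mem, by simp, fun v _ => by simp⟩
  add_mem' := by
    rintro a b ⟨z, hz, hz1, hz2⟩ ⟨y, hy, hy1, hy2⟩
    refine ⟨z + y, V.add_mem hz hy, by simp [hz1, hy1], fun v hv => ?_⟩
    simp [hz2 v hv, hy2 v hv]
  smul_mem' := by
    rintro c a ⟨z, hz, hz1, hz2⟩
    refine ⟨c • z, V.smul_mem c hz, by simp [hz1], fun v hv => ?_⟩
    simp [hz2 v hv]

/-- The self-adjoint operator `A` associated with the form. -/
def formOperator (V : Submodule ℂ (WithLp 2 (H × K))) : H →ₗ.[ℂ] H :=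
  (formGraph V).toLinearPMap

/-- The inclusion `(u, D u) ↦ u` of the form domain, with its form norm, into `H`. -/
def formInclusion (V : Submodule ℂ (WithLp 2 (H × K))) : V →L[ℂ] H :=
  (WithLp.fstL 2 ℂ H K) ∘L V.subtypeL

/-- The bounded operator `(1 + A)⁻¹`; see `mem_formGraph_iff`. -/
def formResolvent (V : Submodule ℂ (WithLp 2 (H × K))) [CompleteSpace V] : H →L[ℂ] H :=
  formInclusion V ∘L ContinuousLinearMap.adjoint (formInclusion V)

theorem mem_formGraph_iff (V : Submodule ℂ (WithLp 2 (H × K))) [CompleteSpace V] (u w : H) :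
    (u, w) ∈ formGraph V ↔ formResolvent V (u + w) = u := by
  constructor
  · rintro ⟨z, hz, hz1, hz2⟩
    have key : ContinuousLinearMap.adjoint (formInclusion V) (u + w) = ⟨z, hz⟩ := by
      refine ext_inner_left ℂ fun v => ?_
      rw [ContinuousLinearMap.adjoint_inner_right, Submodule.coe_inner, WithLp.prod_inner_apply]
      have := hz2 v v.2
      simp only at hz1 this
      change ⟪(v : WithLp 2 (H × K)).fst, u + w⟫_ℂ =
        ⟪(v : WithLp 2 (H × K)).fst, z.fst⟫_ℂ + ⟪(v : WithLp 2 (H × K)).snd, z.snd⟫_ℂ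
      rw [this, hz1, inner_add_right]
    change formInclusion V (ContinuousLinearMap.adjoint (formInclusion V) (u + w)) = u
    rw [key]
    exact hz1
  · intro h
    refine ⟨(ContinuousLinearMap.adjoint (formInclusion V) (u + w)).1, Subtype.property _, h,
      fun v hv => ?_⟩
    have e := ContinuousLinearMap.adjoint_inner_right (formInclusion V) ⟨v, hv⟩ (u + w)
    rw [Submodule.coe_inner, WithLp.prod_inner_apply] at e
    change ⟪v.fst, formResolvent V (u + w)⟫_ℂ + ⟪v.snd, _⟫_ℂ = ⟪v.fst, u + w⟫_ℂ at e
    rw [h, inner_add_right] at e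
    exact add_left_cancel e

theorem formResolvent_isPositive (V : Submodule ℂ (WithLp 2 (H × K))) [CompleteSpace V] :
    (formResolvent V).IsPositive :=
  ContinuousLinearMap.isPositive_self_comp_adjoint _

theorem formResolvent_le_one (V : Submodule ℂ (WithLp 2 (H × K))) [CompleteSpace V] :
    ‖formResolvent V‖ ≤ 1 := by
  have h1 : ‖formInclusion V‖ ≤ 1 := by
    refine ContinuousLinearMap.opNorm_le_bound _ zero_le_one fun v => ?_
    rw [one_mul]
    exact WithLp.norm_fst_le _ (v : WithLp 2 (H × K))
  calc ‖formResolvent V‖ ≤ ‖formInclusion V‖ * ‖ContinuousLinearMap.adjoint (formInclusion V)‖ :=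
        ContinuousLinearMap.opNorm_comp_le _ _
    _ ≤ 1 * 1 := by
        rw [LinearIsometryEquiv.norm_map]
        gcongr
    _ = 1 := one_mul 1

/-- The graph of the square root of `A` given by the functional calculus.  With `R = (1 + A)⁻¹`
one has `A = (1 - R) R⁻¹`, so that `A ^ (1/2)` maps `R ^ (1/2) h` to `(1 - R) ^ (1/2) h`. -/
def formSqrtGraph (V : Submodule ℂ (WithLp 2 (H × K))) [CompleteSpace V] :
    Submodule ℂ (H × H) :=
  LinearMap.range
    ((cfc (fun t : ℝ => √t) (formResolvent V)).toLinearMap.prod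
      (cfc (fun t : ℝ => √(1 - t)) (formResolvent V)).toLinearMap)

/-- The square root of the self-adjoint operator associated with the form. -/
def formSqrt (V : Submodule ℂ (WithLp 2 (H × K))) [CompleteSpace V] : H →ₗ.[ℂ] H :=
  (formSqrtGraph V).toLinearPMap

theorem formResolvent_spectrum (V : Submodule ℂ (WithLp 2 (H × K))) [CompleteSpace V] {t : ℝ}
    (ht : t ∈ spectrum ℝ (formResolvent V)) : 0 ≤ t ∧ t ≤ 1 := by
  refine ⟨spectrum_nonneg_of_nonneg
    ((ContinuousLinearMap.nonneg_iff_isPositive _).2 (formResolvent_isPositive V)) ht, ?_⟩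
  rcases subsingleton_or_nontrivial H with hH | hH
  · exact absurd ht (by rw [spectrum.of_subsingleton]; exact notMem_empty t)
  · exact (le_abs_self t).trans
      ((spectrum.norm_le_norm_of_mem ht).trans (formResolvent_le_one V))

theorem cfc_sqrt_mul_self (V : Submodule ℂ (WithLp 2 (H × K))) [CompleteSpace V] :
    cfc (fun t : ℝ => √t) (formResolvent V) * cfc (fun t : ℝ => √t) (formResolvent V) =
      formResolvent V := by
  have hsa : IsSelfAdjoint (formResolvent V) := (formResolvent_isPositive V).isSelfAdjoint
  rw [← cfc_mul _ _ _ (by fun_prop) (by fun_prop)]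
  conv_rhs => rw [← cfc_id ℝ (formResolvent V) hsa]
  exact cfc_congr fun t ht => Real.mul_self_sqrt (formResolvent_spectrum V ht).1

theorem cfc_sqrt_one_sub_mul_self (V : Submodule ℂ (WithLp 2 (H × K))) [CompleteSpace V] :
    cfc (fun t : ℝ => √(1 - t)) (formResolvent V) * cfc (fun t : ℝ => √(1 - t)) (formResolvent V) =
      1 - formResolvent V := by
  have hsa : IsSelfAdjoint (formResolvent V) := (formResolvent_isPositive V).isSelfAdjoint
  rw [← cfc_mul _ _ _ (by fun_prop) (by fun_prop)]
  have h : cfc (fun t : ℝ => 1 - t) (formResolvent V) = 1 - formResolvent V := by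
    rw [cfc_sub _ _ _ (by fun_prop) (by fun_prop), cfc_const_one ℝ _ hsa, cfc_id' ℝ _ hsa]
  rw [← h]
  refine cfc_congr fun t ht => Real.mul_self_sqrt ?_
  linarith [(formResolvent_spectrum V ht).2]

/-- `A ^ (1/2)` composed with itself is `A`, with equality of domains. -/
theorem mem_formGraph_iff_sqrt (V : Submodule ℂ (WithLp 2 (H × K))) [CompleteSpace V] (u w : H) :
    (u, w) ∈ formGraph V ↔ ∃ v, (u, v) ∈ formSqrtGraph V ∧ (v, w) ∈ formSqrtGraph V := by
  have hS := fun h : H => congrArg (fun F : H →L[ℂ] H => F h) (cfc_sqrt_mul_self V)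
  have hT := fun h : H => congrArg (fun F : H →L[ℂ] H => F h) (cfc_sqrt_one_sub_mul_self V)
  have hST := fun h : H => congrArg (fun F : H →L[ℂ] H => F h)
    (cfc_commute_cfc (fun t : ℝ => √t) (fun t : ℝ => √(1 - t)) (formResolvent V)).eq
  rw [mem_formGraph_iff]
  unfold formSqrtGraph
  generalize cfc (fun t : ℝ => √t) (formResolvent V) = S at *
  generalize cfc (fun t : ℝ => √(1 - t)) (formResolvent V) = T at *
  generalize formResolvent V = R at *
  simp only [mul_apply_eq_comp, sub_apply, one_apply_eq_self] at hS hT hST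
  constructor
  · intro h
    refine ⟨S (T (u + w)), ⟨S (u + w), Prod.ext ?_ ?_⟩, ⟨T (u + w), Prod.ext rfl ?_⟩⟩
    · change S (S (u + w)) = u
      rw [hS, h]
    · exact (hST _).symm
    · change T (T (u + w)) = w
      rw [hT, h, add_sub_cancel_left]
  · rintro ⟨v, ⟨a, ha⟩, ⟨b, hb⟩⟩
    have ha1 : S a = u := congrArg Prod.fst ha
    have ha2 : T a = v := congrArg Prod.snd ha
    have hb1 : S b = v := congrArg Prod.fst hb
    have hb2 : T b = w := congrArg Prod.snd hb
    have e : S (u + w) = a := by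
      rw [← ha1, ← hb2, map_add, hS, hST, hb1, ← ha2, hT, add_sub_cancel]
    rw [← hS, e, ha1]

/-- `A ^ (1/2)` is nonnegative. -/
theorem formSqrtGraph_nonneg (V : Submodule ℂ (WithLp 2 (H × K))) [CompleteSpace V] {u v : H}
    (h : (u, v) ∈ formSqrtGraph V) : 0 ≤ ⟪u, v⟫_ℂ := by
  obtain ⟨a, ha⟩ := h
  obtain rfl : cfc (fun t : ℝ => √t) (formResolvent V) a = u := congrArg Prod.fst ha
  obtain rfl : cfc (fun t : ℝ => √(1 - t)) (formResolvent V) a = v := congrArg Prod.snd ha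
  have hS : IsSelfAdjoint (cfc (fun t : ℝ => √t) (formResolvent V)) := cfc_predicate _ _
  have hP : (0 : H →L[ℂ] H) ≤ cfc (fun t : ℝ => √t * √(1 - t)) (formResolvent V) :=
    cfc_nonneg fun t _ => by positivity
  rw [cfc_mul _ _ _ (by fun_prop) (by fun_prop)] at hP
  have := ((ContinuousLinearMap.nonneg_iff_isPositive _).1 hP).inner_nonneg_right a
  rw [mul_apply_eq_comp] at this
  rwa [← ContinuousLinearMap.adjoint_inner_right, hS.adjoint_eq]

theorem formResolvent_injective (V : Submodule ℂ (WithLp 2 (H × K))) [CompleteSpace V]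
    (hV : ∀ h : H, (∀ v ∈ V, ⟪v.fst, h⟫_ℂ = 0) → h = 0) (h : H) (h0 : formResolvent V h = 0) :
    h = 0 := by
  have e : ContinuousLinearMap.adjoint (formInclusion V) h = 0 := by
    rw [← inner_self_eq_zero (𝕜 := ℂ), ContinuousLinearMap.adjoint_inner_left]
    change ⟪h, formResolvent V h⟫_ℂ = 0
    rw [h0, inner_zero_right]
  refine hV h fun v hv => ?_
  have := ContinuousLinearMap.adjoint_inner_right (formInclusion V) ⟨v, hv⟩ h
  rw [e, inner_zero_right] at this
  exact this.symm

/-- If the form domain is dense, `formGraph V` is the graph of an operator. -/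
theorem formOperator_graph (V : Submodule ℂ (WithLp 2 (H × K))) [CompleteSpace V]
    (hV : ∀ h : H, (∀ v ∈ V, ⟪v.fst, h⟫_ℂ = 0) → h = 0) :
    (formOperator V).graph = formGraph V := by
  refine Submodule.toLinearPMap_graph_eq _ ?_
  rintro ⟨u, w⟩ h (rfl : u = 0)
  rw [mem_formGraph_iff, zero_add] at h
  exact formResolvent_injective V hV w h

/-- If the form domain is dense, `formSqrtGraph V` is the graph of an operator. -/
theorem formSqrt_graph (V : Submodule ℂ (WithLp 2 (H × K))) [CompleteSpace V]
    (hV : ∀ h : H, (∀ v ∈ V, ⟪v.fst, h⟫_ℂ = 0) → h = 0) :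
    (formSqrt V).graph = formSqrtGraph V := by
  refine Submodule.toLinearPMap_graph_eq _ ?_
  rintro ⟨u, w⟩ ⟨h, hh⟩ (rfl : u = 0)
  have h1 : cfc (fun t : ℝ => √t) (formResolvent V) h = 0 := congrArg Prod.fst hh
  have h2 : cfc (fun t : ℝ => √(1 - t)) (formResolvent V) h = w := congrArg Prod.snd hh
  have h3 : h = 0 := by
    refine formResolvent_injective V hV h ?_
    rw [← cfc_sqrt_mul_self V, mul_apply_eq_comp, h1, map_zero]
  rw [← h2, h3, map_zero]

end Form

/-- The broken line `(-∞, -1] ∪ [1, ∞)`. -/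
def line : Set ℝ := Iic (-1) ∪ Ici 1

/-- The measure `|r| ^ (d - 1) dr` on the broken line. -/
def lineMeasure (d : ℝ) : Measure ℝ :=
  (volume.restrict line).withDensity fun r => ENNReal.ofReal (|r| ^ (d - 1))

/-- The Hilbert space `L²` of the broken line. -/
abbrev L2 (d : ℝ) : Type := Lp ℂ 2 (lineMeasure d)

/-- The derivative of a function on the broken line, one-sided at `-1` and at `1`.
The values of `f` off the broken line play no role. -/
def lineDeriv (f : ℝ → ℂ) : ℝ → ℂ := derivWithin f line

/-- `C¹` functions on the broken line, the points `-1` and `1` being identified. -/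
structure IsC1 (f : ℝ → ℂ) : Prop where
  contDiffOn : ContDiffOn ℝ 1 f line
  glue : f (-1) = f 1
  glue_deriv : lineDeriv f (-1) = lineDeriv f 1

/-- Smooth compactly supported functions on the broken line, the points `-1` and `1` being
identified. -/
structure IsTest (f : ℝ → ℂ) : Prop where
  contDiffOn : ContDiffOn ℝ ∞ f line
  compactSupport : ∃ ρ : ℝ, ∀ r ∈ line, ρ < |r| → f r = 0
  glue : ∀ k : ℕ, iteratedDerivWithin k f line (-1) = iteratedDerivWithin k f line 1

/-- The space `S₀` of test functions on the broken line that vanish at `-1` and `1`. -/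
structure IsS0 (f : ℝ → ℂ) : Prop extends IsTest f where
  vanish_neg : f (-1) = 0
  vanish_pos : f 1 = 0

theorem uniqueDiffOn_line : UniqueDiffOn ℝ line := by
  intro x hx
  rcases hx with hx | hx
  · exact (uniqueDiffOn_Iic (-1 : ℝ) x hx).mono subset_union_left
  · exact (uniqueDiffOn_Ici (1 : ℝ) x hx).mono subset_union_right

theorem neg_one_mem_line : (-1 : ℝ) ∈ line := Or.inl (mem_Iic.2 le_rfl)

theorem one_mem_line : (1 : ℝ) ∈ line := Or.inr (mem_Ici.2 le_rfl)

theorem measurableSet_line : MeasurableSet line := measurableSet_Iic.union measurableSet_Ici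

theorem ae_mem_line (d : ℝ) : ∀ᵐ r ∂lineMeasure d, r ∈ line :=
  (withDensity_absolutelyContinuous _ _).ae_le (ae_restrict_mem measurableSet_line)

theorem IsC1.differentiable {f : ℝ → ℂ} (hf : IsC1 f) {r : ℝ} (hr : r ∈ line) :
    DifferentiableWithinAt ℝ f line r :=
  hf.contDiffOn.differentiableOn one_ne_zero r hr

theorem lineDeriv_add {f g : ℝ → ℂ} (hf : IsC1 f) (hg : IsC1 g) {r : ℝ} (hr : r ∈ line) :
    lineDeriv (f + g) r = lineDeriv f r + lineDeriv g r :=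
  derivWithin_add (hf.differentiable hr) (hg.differentiable hr)

theorem lineDeriv_smul {f : ℝ → ℂ} (hf : IsC1 f) (c : ℂ) {r : ℝ} (hr : r ∈ line) :
    lineDeriv (c • f) r = c * lineDeriv f r :=
  derivWithin_const_mul c (hf.differentiable hr)

/-- The pairs `(f, f')` in `L² × L²` with `f` in `C¹` of the broken line: the domain on which the
form `Q (f, g) = ∫ f' g' dμ` is given initially. -/
def energyCore (d : ℝ) : Submodule ℂ (WithLp 2 (L2 d × L2 d)) where
  carrier := {z | ∃ f : ℝ → ℂ, IsC1 f ∧ z.fst =ᵐ[lineMeasure d] f ∧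
    z.snd =ᵐ[lineMeasure d] lineDeriv f}
  zero_mem' := by
    have h0 : lineDeriv (0 : ℝ → ℂ) = 0 := by
      funext x
      simp [lineDeriv]
    refine ⟨0, ⟨contDiffOn_const, rfl, by rw [h0]; rfl⟩, Lp.coeFn_zero _ _ _, ?_⟩
    rw [h0]
    exact Lp.coeFn_zero _ _ _
  add_mem' := by
    rintro a b ⟨f, hf, hf1, hf2⟩ ⟨g, hg, hg1, hg2⟩
    refine ⟨f + g, ⟨hf.contDiffOn.add hg.contDiffOn, ?_, ?_⟩, ?_, ?_⟩
    · simp [hf.glue, hg.glue]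
    · rw [lineDeriv_add hf hg neg_one_mem_line, lineDeriv_add hf hg one_mem_line, hf.glue_deriv,
        hg.glue_deriv]
    · exact (Lp.coeFn_add a.fst b.fst).trans (hf1.add hg1)
    · refine (Lp.coeFn_add a.snd b.snd).trans ?_
      filter_upwards [hf2, hg2, ae_mem_line d] with r h1 h2 hr
      rw [lineDeriv_add hf hg hr, Pi.add_apply, h1, h2]
  smul_mem' := by
    rintro c a ⟨f, hf, hf1, hf2⟩
    refine ⟨c • f, ⟨contDiffOn_const.smul hf.contDiffOn, ?_, ?_⟩, ?_, ?_⟩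
    · simp [hf.glue]
    · rw [lineDeriv_smul hf c neg_one_mem_line, lineDeriv_smul hf c one_mem_line, hf.glue_deriv]
    · refine (Lp.coeFn_smul c a.fst).trans ?_
      filter_upwards [hf1] with r h1
      simp [h1]
    · refine (Lp.coeFn_smul c a.snd).trans ?_
      filter_upwards [hf2, ae_mem_line d] with r h1 hr
      rw [lineDeriv_smul hf c hr, Pi.smul_apply, h1, smul_eq_mul]

/-- The closure of the form. -/
def energySpace (d : ℝ) : Submodule ℂ (WithLp 2 (L2 d × L2 d)) :=
  (energyCore d).topologicalClosure

instance instCompleteSpaceEnergySpace (d : ℝ) : CompleteSpace (energySpace d) :=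
  inferInstanceAs (CompleteSpace (energyCore d).topologicalClosure)

/-- The operator `Δ_d`: the Friedrichs extension attached to the form `∫ f' g' dμ`. -/
def laplacian (d : ℝ) : L2 d →ₗ.[ℂ] L2 d := formOperator (energySpace d)

/-- The operator `Δ_d ^ (1/2)`. -/
def sqrtLaplacian (d : ℝ) : L2 d →ₗ.[ℂ] L2 d := formSqrt (energySpace d)

instance instLocallyFinite (d : ℝ) : IsLocallyFiniteMeasure (lineMeasure d) := by
  refine ⟨fun x => ⟨Metric.closedBall x 1, Metric.closedBall_mem_nhds x one_pos, ?_⟩⟩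
  have hc : IsCompact (line ∩ Metric.closedBall x 1) :=
    (isCompact_closedBall x 1).inter_left (isClosed_Iic.union isClosed_Ici)
  have hcont : ContinuousOn (fun r : ℝ => |r| ^ (d - 1)) (line ∩ Metric.closedBall x 1) := by
    refine continuous_abs.continuousOn.rpow_const fun r hr => Or.inl ?_
    rcases hr.1 with h | h
    · exact abs_ne_zero.2 (by linarith [mem_Iic.1 h] : r < 0).ne
    · exact abs_ne_zero.2 (by linarith [mem_Ici.1 h] : 0 < r).ne'
  rw [lineMeasure, withDensity_apply _ Metric.isClosed_closedBall.measurableSet,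
    Measure.restrict_restrict Metric.isClosed_closedBall.measurableSet, inter_comm]
  exact (hcont.integrableOn_compact hc).lintegral_lt_top

theorem lineMeasure_singleton (d a : ℝ) : lineMeasure d {a} = 0 :=
  (withDensity_absolutelyContinuous _ _)
    (Measure.absolutelyContinuous_of_le Measure.restrict_le_self (by simp))

/-- The form domain is dense in `L²`. -/
theorem energySpace_dense (d : ℝ) (h : L2 d)
    (h0 : ∀ v ∈ energySpace d, ⟪v.fst, h⟫_ℂ = 0) : h = 0 := by
  have hU : IsOpen (Iio (-1) ∪ Ioi 1 : Set ℝ) := isOpen_Iio.union isOpen_Ioi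
  have hae : ∀ᵐ r ∂lineMeasure d, r ∈ (Iio (-1) ∪ Ioi 1 : Set ℝ) → h r = 0 := by
    refine hU.ae_eq_zero_of_integral_contDiff_smul_eq_zero
      (((Lp.memLp h).locallyIntegrable (by norm_num)).locallyIntegrableOn _) ?_
    intro g hg hgc hgs
    have hgz : ∀ a : ℝ, a ∉ (Iio (-1) ∪ Ioi 1 : Set ℝ) →
        (fun r => (g r : ℂ)) =ᶠ[nhds a] fun _ => 0 := by
      intro a ha
      have := notMem_tsupport_iff_eventuallyEq.1 fun hh => ha (hgs hh)
      filter_upwards [this] with r hr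
      simp [hr]
    have hz : ∀ a : ℝ, a ∉ (Iio (-1) ∪ Ioi 1 : Set ℝ) →
        lineDeriv (fun r => (g r : ℂ)) a = 0 := by
      intro a ha
      have e := hgz a ha
      rw [lineDeriv, Filter.EventuallyEq.derivWithin_eq (e.filter_mono nhdsWithin_le_nhds)
        e.self_of_nhds]
      simp
    have hm1 : (-1 : ℝ) ∉ (Iio (-1) ∪ Ioi 1 : Set ℝ) := by simp
    have hp1 : (1 : ℝ) ∉ (Iio (-1) ∪ Ioi 1 : Set ℝ) := by simp
    have hsm : ContDiff ℝ ∞ fun r => (g r : ℂ) := Complex.ofRealCLM.contDiff.comp hg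
    have hcs : HasCompactSupport fun r => (g r : ℂ) := hgc.comp_left Complex.ofReal_zero
    have hC1 : IsC1 fun r => (g r : ℂ) :=
      ⟨(hsm.of_le (by norm_num)).contDiffOn,
        (hgz _ hm1).self_of_nhds.trans (hgz _ hp1).self_of_nhds.symm,
        (hz _ hm1).trans (hz _ hp1).symm⟩
    have hL : MemLp (fun r => (g r : ℂ)) 2 (lineMeasure d) :=
      hsm.continuous.memLp_of_hasCompactSupport hcs
    have hL' : MemLp (deriv fun r => (g r : ℂ)) 2 (lineMeasure d) :=
      (hsm.continuous_deriv (by norm_num)).memLp_of_hasCompactSupport hcs.deriv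
    have hmem : WithLp.toLp 2 (hL.toLp _, hL'.toLp _) ∈ energySpace d := by
      refine Submodule.le_topologicalClosure _ ⟨_, hC1, hL.coeFn_toLp, ?_⟩
      filter_upwards [hL'.coeFn_toLp, ae_mem_line d] with r hr hrl
      change (hL'.toLp _ : ℝ → ℂ) r = _
      rw [hr]
      exact ((hsm.differentiable (by norm_num)).differentiableAt.derivWithin
        (uniqueDiffOn_line r hrl)).symm
    have hi := h0 _ hmem
    rw [L2.inner_def] at hi
    rw [← hi]
    refine integral_congr_ae ?_
    filter_upwards [hL.coeFn_toLp] with r hr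
    change _ = ⟪(hL.toLp _ : ℝ → ℂ) r, h r⟫_ℂ
    rw [hr]
    simp [mul_comm]
  refine (Lp.eq_zero_iff_ae_eq_zero).2 ?_
  have n1 : ∀ᵐ r ∂lineMeasure d, r ≠ -1 :=
    by simpa [ae_iff] using lineMeasure_singleton d (-1)
  have n2 : ∀ᵐ r ∂lineMeasure d, r ≠ 1 :=
    by simpa [ae_iff] using lineMeasure_singleton d 1
  filter_upwards [hae, n1, n2, ae_mem_line d] with r h1 h2 h3 h4
  refine h1 ?_
  rcases h4 with h4 | h4
  · exact Or.inl (lt_of_le_of_ne h4 h2)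
  · exact Or.inr (lt_of_le_of_ne h4 h3.symm)

theorem laplacian_graph (d : ℝ) : (laplacian d).graph = formGraph (energySpace d) :=
  formOperator_graph _ (energySpace_dense d)

theorem sqrtLaplacian_graph (d : ℝ) : (sqrtLaplacian d).graph = formSqrtGraph (energySpace d) :=
  formSqrt_graph _ (energySpace_dense d)

/-- The inequality `‖Δ_d ^ (1/2) f‖_p ≤ C ‖f'‖_p` for all `f` in `S₀`, with one constant `C`; it
includes that the class of `f` in `L²` lies in the domain of `Δ_d ^ (1/2)`. -/
def ReverseRiesz (d p : ℝ) : Prop :=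
  ∃ C : ℝ, ∀ f : ℝ → ℂ, IsS0 f →
    ∃ u : (sqrtLaplacian d).domain, (u : L2 d) =ᵐ[lineMeasure d] f ∧
      eLpNorm (sqrtLaplacian d u) (ENNReal.ofReal p) (lineMeasure d) ≤
        ENNReal.ofReal C * eLpNorm (lineDeriv f) (ENNReal.ofReal p) (lineMeasure d)

end BrokenLine

end

open Filter Topology
open scoped ENNReal NNReal

noncomputable section

namespace BrokenLine

/-! The square root is an integral of resolvents, Δ^{1/2} f = (2/π) ∫₀^∞ Δ(Δ+λ²)⁻¹ f dλ.
`exists_formSqrtGraph_tendsto` gives it as a limit in L² of truncations ∫₀^Λ. It is therefore enough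
to bound the truncations in L^p by ‖f'‖_p uniformly in Λ and to pass to the limit with Fatou's lemma
(`eLpNorm_le_of_tendsto_Lp`).

The resolvent is explicit. On each half-line the equation z'' + (d-1)/x z' = λ² z has a decaying
solution K(λx) and a solution I(λx) regular at the origin. Variation of constants solves the
inhomogeneous equation up to a multiple of K(λx), and that multiple is fixed by gluing value and
derivative at the identified points ±1. Since f(±1) = 0, integration by parts moves the derivative
onto f without boundary terms. By `IsHalfLine.sub_halfResolvent_eq`, on each side Δ(Δ+λ²)⁻¹ f is the
operator with kernel `gradKernel` applied to f', minus the gluing multiple of λ^d K(λx).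

The kernel term. Near the diagonal `gradKernel` is, to leading order, ½ (xy)^{-(d-1)/2} sgn(x-y)
e^{-λ|x-y|}; its integral over λ in (0, Λ] is a weighted truncated Hilbert kernel. On dyadic blocks
the weights are constant up to bounded factors, so M. Riesz's theorem, in the form
`exists_lintegral_truncatedHilbert_le`, applies block by block. The remainder needs no cancellation:
integrated in absolute value over λ it is dominated by a kernel homogeneous of degree -d
(`exists_lintegral_gradError_le`), and such kernels are bounded by
`lintegral_homogeneous_kernel_le`.

The gluing term. Absolute values suffice here too. The coefficient is at most `boundaryCoeff` times
moments of f against K(λy), with `boundaryCoeff` of size λ^{d-2} for small λ and e^{2λ} for large λ.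
For λ > 1 the integral over λ gives essentially e^{-(x+y-2)}/(x+y-2), which is a Stieltjes kernel in
x-1 and y-1. For λ ≤ 1 there are two estimates: the moment is expressed through f' when d/p < d-1;
when d/p ≥ d-1 it is kept in terms of f, and Hardy's inequality, valid since p < d, returns to f'.
Together they give every p > 1 (`exists_lintegral_correction_le`). -/

/-! ### Schur-type bounds for homogeneous and convolution kernels -/

theorem lintegral_mul_rpow_le {α : Type*} [MeasurableSpace α] {μ : Measure α} {p : ℝ} (hp : 1 < p)
    {w F : α → ℝ≥0∞} (hw : AEMeasurable w μ) (hF : AEMeasurable F μ) :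
    (∫⁻ x, w x * F x ∂μ) ^ p ≤ (∫⁻ x, w x ∂μ) ^ (p - 1) * ∫⁻ x, w x * F x ^ p ∂μ := by
  have hp0 : 0 < p := by linarith
  have hpq : p.HolderConjugate (p / (p - 1)) := Real.HolderConjugate.conjExponent hp
  have hq0 : 0 < p / (p - 1) := hpq.symm.pos
  set q := p / (p - 1) with hq
  -- Splitting the weight as w^{1/p} w^{1/q} makes Hölder's inequality into Jensen's inequality for
  -- the measure w dμ, with its total mass to the power p - 1.
  have e : ∀ x, w x * F x = (w x ^ (1 / p) * F x) * w x ^ (1 / q) := fun x => by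
    rw [mul_right_comm, ← ENNReal.rpow_add_of_nonneg _ _ (by positivity) (by positivity)]
    rw [show 1 / p + 1 / q = 1 by simpa using hpq.inv_add_inv_eq_one, ENNReal.rpow_one]
  have h := ENNReal.lintegral_mul_le_Lp_mul_Lq μ hpq ((hw.pow_const (1 / p)).mul hF)
    (hw.pow_const (1 / q))
  simp only [Pi.mul_apply] at h
  simp_rw [← e, ENNReal.mul_rpow_of_nonneg _ _ hp0.le, ← ENNReal.rpow_mul,
    one_div_mul_cancel hp0.ne', one_div_mul_cancel hq0.ne', ENNReal.rpow_one] at h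
  have h2 := ENNReal.rpow_le_rpow h hp0.le
  rw [ENNReal.mul_rpow_of_nonneg _ _ hp0.le, ← ENNReal.rpow_mul, ← ENNReal.rpow_mul,
    one_div_mul_cancel hp0.ne', ENNReal.rpow_one, mul_comm] at h2
  have : 1 / q * p = p - 1 := by rw [hq]; field_simp
  rwa [this] at h2

theorem lintegral_Ioi_comp_mul (φ : ℝ → ℝ≥0∞) {c : ℝ} (hc : 0 < c) :
    ∫⁻ y in Ioi 0, φ y = ENNReal.ofReal c * ∫⁻ ρ in Ioi 0, φ (ρ * c) := by
  rw [← lintegral_indicator measurableSet_Ioi, ← lintegral_indicator measurableSet_Ioi]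
  have h := Real.smul_map_volume_mul_right hc.ne'
  conv_lhs => rw [← h]
  rw [lintegral_smul_measure, abs_of_pos hc, smul_eq_mul]
  have h2 := (Homeomorph.mulRight₀ c hc.ne').measurableEmbedding.lintegral_map (μ := volume)
    ((Ioi 0).indicator φ)
  simp only [Homeomorph.coe_mulRight₀] at h2
  rw [h2]
  congr 2
  funext x
  simp [indicator, hc, mul_pos_iff_of_pos_right]

theorem ofReal_rpow_mul_ofReal_rpow {x : ℝ} (hx : 0 < x) (s t : ℝ) :
    ENNReal.ofReal (x ^ s) * ENNReal.ofReal (x ^ t) = ENNReal.ofReal (x ^ (s + t)) := by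
  rw [← ENNReal.ofReal_mul (by positivity), Real.rpow_add hx]

/-- The measure `r ^ (d - 1) dr` on `(0, ∞)`. -/
def radialMeasure (d : ℝ) : Measure ℝ :=
  (volume.restrict (Ioi 0)).withDensity fun r => ENNReal.ofReal (r ^ (d - 1))

theorem lintegral_radialMeasure (d : ℝ) {F : ℝ → ℝ≥0∞} (hF : Measurable F) :
    ∫⁻ r, F r ∂radialMeasure d = ∫⁻ r in Ioi 0, ENNReal.ofReal (r ^ (d - 1)) * F r := by
  rw [radialMeasure, lintegral_withDensity_eq_lintegral_mul _ (by fun_prop) hF]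
  rfl

instance (d : ℝ) : SFinite (radialMeasure d) := by
  unfold radialMeasure; infer_instance

theorem lintegral_radialMeasure_comp_mul (d : ℝ) {F : ℝ → ℝ≥0∞} (hF : Measurable F) {c : ℝ}
    (hc : 0 < c) :
    ∫⁻ r, F (c * r) ∂radialMeasure d = ENNReal.ofReal (c ^ (-d)) * ∫⁻ r, F r ∂radialMeasure d := by
  rw [lintegral_radialMeasure d hF, lintegral_radialMeasure d (by fun_prop),
    lintegral_Ioi_comp_mul (fun r => ENNReal.ofReal (r ^ (d - 1)) * F r) hc, ← mul_assoc,
    ← lintegral_const_mul _ (by fun_prop)]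
  refine setLIntegral_congr_fun measurableSet_Ioi fun (r : ℝ) (hr : 0 < r) => ?_
  rw [Real.mul_rpow hr.le hc.le, ENNReal.ofReal_mul (by positivity), mul_comm c r]
  have : ENNReal.ofReal (c ^ (-d)) * ENNReal.ofReal c * ENNReal.ofReal (c ^ (d - 1)) = 1 := by
    rw [← Real.rpow_one c, ← Real.rpow_mul hc.le, one_mul, ofReal_rpow_mul_ofReal_rpow hc,
       ← Real.rpow_mul hc.le, one_mul, ofReal_rpow_mul_ofReal_rpow hc]
    simp
  calc ENNReal.ofReal (r ^ (d - 1)) * F (r * c)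
      = (ENNReal.ofReal (c ^ (-d)) * ENNReal.ofReal c * ENNReal.ofReal (c ^ (d - 1))) *
        (ENNReal.ofReal (r ^ (d - 1)) * F (r * c)) := by rw [this, one_mul]
    _ = _ := by ring

/-- Integral operators with a nonnegative kernel homogeneous of degree `-d` are bounded on `L^p` of
`r ^ (d - 1) dr`. -/
theorem lintegral_homogeneous_kernel_le (d : ℝ) {p : ℝ} (hp : 1 < p) {η G : ℝ → ℝ≥0∞}
    (hη : Measurable η) (hG : Measurable G) :
    ∫⁻ x, (∫⁻ y, ENNReal.ofReal (x ^ (-d)) * η (y / x) * G y ∂radialMeasure d) ^ p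
        ∂radialMeasure d ≤
      (∫⁻ ρ in Ioi 0, η ρ * ENNReal.ofReal (ρ ^ (d - 1 - d / p))) ^ p *
        ∫⁻ x, G x ^ p ∂radialMeasure d := by
  have hp0 : 0 < p := by linarith
  -- The map G ↦ ρ^{d/p} G(ρ ·) is an isometry of L^p(r^{d-1} dr). After the substitution y = ρx the
  -- operator is a superposition of these isometries with weight w, so its norm is at most ∫ w.
  set w : ℝ → ℝ≥0∞ := fun ρ => η ρ * ENNReal.ofReal (ρ ^ (d - 1 - d / p)) with hw
  have hwm : Measurable w := by fun_prop
  have hA : ∀ x : ℝ, 0 < x → ∫⁻ y, ENNReal.ofReal (x ^ (-d)) * η (y / x) * G y ∂radialMeasure d =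
      ∫⁻ ρ in Ioi 0, w ρ * (ENNReal.ofReal (ρ ^ (d / p)) * G (ρ * x)) := by
    intro x hx
    rw [lintegral_radialMeasure d (by fun_prop), lintegral_Ioi_comp_mul _ hx,
      ← lintegral_const_mul _ (by fun_prop)]
    refine setLIntegral_congr_fun measurableSet_Ioi fun (r : ℝ) (hr : 0 < r) => ?_
    simp only [hw]
    rw [mul_div_cancel_right₀ _ hx.ne', Real.mul_rpow hr.le hx.le,
      ENNReal.ofReal_mul (by positivity)]
    have : ENNReal.ofReal x * ENNReal.ofReal (x ^ (d - 1)) * ENNReal.ofReal (x ^ (-d)) = 1 := by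
      conv_lhs => rw [← Real.rpow_one x, ← Real.rpow_mul hx.le, one_mul,
        ofReal_rpow_mul_ofReal_rpow hx, ← Real.rpow_mul hx.le, one_mul,
        ofReal_rpow_mul_ofReal_rpow hx]
      simp
    have h2 : ENNReal.ofReal (r ^ (d - 1 - d / p)) * ENNReal.ofReal (r ^ (d / p)) =
        ENNReal.ofReal (r ^ (d - 1)) := by
      rw [ofReal_rpow_mul_ofReal_rpow hr]; congr 2; ring
    calc _ = (ENNReal.ofReal x * ENNReal.ofReal (x ^ (d - 1)) * ENNReal.ofReal (x ^ (-d))) *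
          (η r * ENNReal.ofReal (r ^ (d - 1)) * G (r * x)) := by ring
      _ = η r * (ENNReal.ofReal (r ^ (d - 1 - d / p)) * ENNReal.ofReal (r ^ (d / p))) *
          G (r * x) := by rw [this, one_mul, h2]
      _ = _ := by ring
  have hpos : ∀ᵐ x ∂radialMeasure d, 0 < x :=
    (withDensity_absolutelyContinuous _ _).ae_le (ae_restrict_mem measurableSet_Ioi)
  calc _ ≤ ∫⁻ x, (∫⁻ ρ in Ioi 0, w ρ) ^ (p - 1) *
        (∫⁻ ρ in Ioi 0, w ρ * (ENNReal.ofReal (ρ ^ (d / p)) * G (ρ * x)) ^ p) ∂radialMeasure d := by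
        refine lintegral_mono_ae ?_
        filter_upwards [hpos] with x hx
        rw [hA x hx]
        exact lintegral_mul_rpow_le hp hwm.aemeasurable (by fun_prop)
    _ = (∫⁻ ρ in Ioi 0, w ρ) ^ (p - 1) * ∫⁻ ρ in Ioi 0, w ρ * ∫⁻ x, G x ^ p ∂radialMeasure d := by
        rw [lintegral_const_mul _ (by fun_prop), lintegral_lintegral_swap (by fun_prop)]
        congr 1
        refine setLIntegral_congr_fun measurableSet_Ioi fun (r : ℝ) (hr : 0 < r) => ?_
        rw [lintegral_const_mul _ (by fun_prop)]
        congr 1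
        simp_rw [ENNReal.mul_rpow_of_nonneg _ _ hp0.le]
        rw [lintegral_const_mul _ (by fun_prop),
          lintegral_radialMeasure_comp_mul d (F := fun x => G x ^ p) (by fun_prop) hr, ← mul_assoc,
          ENNReal.ofReal_rpow_of_nonneg (by positivity) hp0.le, ← Real.rpow_mul hr.le,
          div_mul_cancel₀ _ hp0.ne', ofReal_rpow_mul_ofReal_rpow hr]
        simp
    _ = _ := by
        rw [lintegral_mul_const _ hwm, ← mul_assoc]
        congr 1
        nth_rw 2 [← ENNReal.rpow_one (∫⁻ ρ in Ioi 0, w ρ)]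
        rw [← ENNReal.rpow_add_of_nonneg _ _ (by linarith) zero_le_one, sub_add_cancel]

/-- Young's inequality for a nonnegative L¹ kernel: Jensen for the measure w(x - t) dt, then
Tonelli. -/
theorem lintegral_convolution_rpow_le {p : ℝ} (hp : 1 < p) {w F : ℝ → ℝ≥0∞} (hw : Measurable w)
    (hF : Measurable F) :
    ∫⁻ x, (∫⁻ t, w (x - t) * F t) ^ p ≤ (∫⁻ s, w s) ^ p * ∫⁻ t, F t ^ p := by
  calc ∫⁻ x, (∫⁻ t, w (x - t) * F t) ^ p
      ≤ ∫⁻ x, (∫⁻ s, w s) ^ (p - 1) * ∫⁻ t, w (x - t) * F t ^ p := by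
        refine lintegral_mono fun x => ?_
        refine (lintegral_mul_rpow_le hp (by fun_prop) (by fun_prop)).trans_eq ?_
        rw [lintegral_sub_left_eq_self w x]
    _ = (∫⁻ s, w s) ^ (p - 1) * ∫⁻ t, (∫⁻ s, w s) * F t ^ p := by
        rw [lintegral_const_mul _ (by fun_prop), lintegral_lintegral_swap (by fun_prop)]
        congr 2
        funext t
        rw [lintegral_mul_const _ (by fun_prop), lintegral_sub_right_eq_self w t]
    _ = _ := by
        rw [lintegral_const_mul _ (by fun_prop), ← mul_assoc]
        congr 1
        nth_rw 2 [← ENNReal.rpow_one (∫⁻ s, w s)]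
        rw [← ENNReal.rpow_add_of_nonneg _ _ (by linarith) zero_le_one, sub_add_cancel]

theorem lintegral_poisson_kernel {ε : ℝ} (hε : 0 < ε) :
    ∫⁻ s : ℝ, ENNReal.ofReal (ε / (s ^ 2 + ε ^ 2)) = ENNReal.ofReal Real.pi := by
  have e : ∀ s : ℝ, ε / (s ^ 2 + ε ^ 2) = ε⁻¹ * (1 + (s / ε) ^ 2)⁻¹ := fun s => by
    have : s ^ 2 + ε ^ 2 ≠ 0 := by positivity
    field_simp
    ring
  have hi : Integrable fun s : ℝ => ε / (s ^ 2 + ε ^ 2) := by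
    simp_rw [e]
    exact (integrable_inv_one_add_sq.comp_div hε.ne').const_mul _
  rw [← ofReal_integral_eq_lintegral_ofReal hi (Eventually.of_forall fun s => by positivity)]
  simp_rw [e]
  rw [integral_const_mul, Measure.integral_comp_div (fun s : ℝ => (1 + s ^ 2)⁻¹) ε,
    integral_univ_inv_one_add_sq, abs_of_pos hε, smul_eq_mul, inv_mul_cancel_left₀ hε.ne']

/-! ### M. Riesz's theorem for conjugate Poisson integrals -/

/-- Bounded measurable functions of bounded support. -/
structure IsBoundedCompact {E : Type*} [NormedAddCommGroup E] (f : ℝ → E) (M ρ : ℝ) : Prop where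
  meas : StronglyMeasurable f
  bound : ∀ t, ‖f t‖ ≤ M
  supp : ∀ t, ρ < |t| → f t = 0

theorem IsBoundedCompact.integrable {E : Type*} [NormedAddCommGroup E] {f : ℝ → E} {M ρ : ℝ}
    (hf : IsBoundedCompact f M ρ) : Integrable f := by
  have h : IntegrableOn f (Icc (-ρ) ρ) := by
    refine Measure.integrableOn_of_bounded (M := M) (by simp) hf.meas.aestronglyMeasurable
      (Eventually.of_forall hf.bound)
  refine h.integrable_of_forall_notMem_eq_zero fun t ht => hf.supp t ?_
  by_contra! hc
  exact ht (abs_le.1 hc)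

/-- The Cauchy transform of `f`, an analytic function on the upper half plane. -/
def cauchyTransform (f : ℝ → ℝ) (z : ℂ) : ℂ := ∫ t, (f t : ℂ) * (Complex.I / (z - t))

theorem norm_I_div_sub_le {z : ℂ} (hz : 0 < z.im) (t : ℝ) : ‖Complex.I / (z - t)‖ ≤ 1 / z.im := by
  rw [norm_div, Complex.norm_I]
  refine one_div_le_one_div_of_le hz ?_
  have := Complex.abs_im_le_norm (z - t)
  simp only [Complex.sub_im, Complex.ofReal_im, sub_zero] at this
  exact (le_abs_self _).trans this

theorem measurable_I_div_sub (z : ℂ) : Measurable fun t : ℝ => Complex.I / (z - t) := by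
  fun_prop

section Cauchy

variable {f : ℝ → ℝ} {M ρ : ℝ}

theorem integrable_cauchy (hf : IsBoundedCompact f M ρ) {z : ℂ} (hz : 0 < z.im) :
    Integrable fun t => (f t : ℂ) * (Complex.I / (z - t)) :=
  hf.integrable.ofReal.mul_bdd (measurable_I_div_sub z).aestronglyMeasurable
    (Eventually.of_forall fun t => norm_I_div_sub_le hz t)

theorem sub_ofReal_ne_zero {z : ℂ} (hz : 0 < z.im) (t : ℝ) : z - t ≠ 0 := fun h => by
  have := congrArg Complex.im h
  simp at this
  exact hz.ne' this

theorem differentiableAt_cauchyTransform (hf : IsBoundedCompact f M ρ) {z : ℂ} (hz : 0 < z.im) :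
    DifferentiableAt ℂ (cauchyTransform f) z := by
  have hb : ∀ x ∈ Metric.ball z (z.im / 2), z.im / 2 < x.im := by
    intro x hx
    have h1 := (Complex.abs_im_le_norm (x - z)).trans_lt (mem_ball_iff_norm.1 hx)
    rw [Complex.sub_im, abs_lt] at h1
    linarith [h1.1]
  refine (hasDerivAt_integral_of_dominated_loc_of_deriv_le (μ := volume)
    (F := fun z t => (f t : ℂ) * (Complex.I / (z - t)))
    (F' := fun z t => (f t : ℂ) * (-Complex.I / (z - t) ^ 2))
    (bound := fun t => |f t| * (1 / (z.im / 2)) ^ 2)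
    (Metric.ball_mem_nhds z (half_pos hz)) ?_ (integrable_cauchy hf hz) ?_ ?_ ?_ ?_).2.differentiableAt
  · refine Eventually.of_forall fun x => ?_
    exact (hf.integrable.ofReal.aestronglyMeasurable).mul
      (measurable_I_div_sub x).aestronglyMeasurable
  · refine hf.integrable.ofReal.aestronglyMeasurable.mul ?_
    exact Measurable.aestronglyMeasurable (by fun_prop)
  · refine Eventually.of_forall fun t x hx => ?_
    have h2 := hb x hx
    have hx0 : 0 < x.im := by linarith
    rw [norm_mul, Complex.norm_real, Real.norm_eq_abs]
    gcongr
    have h3 := (le_abs_self _).trans (Complex.abs_im_le_norm (x - t))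
    simp only [Complex.sub_im, Complex.ofReal_im, sub_zero] at h3
    rw [norm_div, norm_neg, Complex.norm_I, norm_pow, ← one_div_pow]
    gcongr
    exact h2.le.trans h3
  · exact hf.integrable.abs.mul_const _
  · refine Eventually.of_forall fun t x hx => ?_
    have hx0 : 0 < x.im := by linarith [hb x hx]
    have := ((hasDerivAt_const x Complex.I).fun_div ((hasDerivAt_id x).sub_const (t : ℂ))
      (sub_ofReal_ne_zero hx0 t)).const_mul (f t : ℂ)
    simpa using this

theorem norm_cauchyTransform_le (hf : IsBoundedCompact f M ρ) {z : ℂ} {r : ℝ} (hr : 0 < r)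
    (h : ∀ t : ℝ, |t| ≤ ρ → r ≤ ‖z - t‖) : ‖cauchyTransform f z‖ ≤ (∫ t, |f t|) / r := by
  rw [cauchyTransform, div_eq_mul_inv, ← integral_mul_const]
  refine norm_integral_le_of_norm_le (hf.integrable.abs.mul_const _) (Eventually.of_forall fun t => ?_)
  rw [norm_mul, Complex.norm_real, Real.norm_eq_abs, norm_div, Complex.norm_I, one_div]
  by_cases ht : |t| ≤ ρ
  · gcongr
    exact h t ht
  · rw [hf.supp t (not_le.1 ht)]
    simp

/-- The Poisson integral, without the factor `1 / π`. -/
def poissonIntegral (ε : ℝ) (f : ℝ → ℝ) (x : ℝ) : ℝ := ∫ t, f t * (ε / ((x - t) ^ 2 + ε ^ 2))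

/-- The conjugate Poisson integral, without the factor `1 / π`. -/
def conjPoissonIntegral (ε : ℝ) (f : ℝ → ℝ) (x : ℝ) : ℝ :=
  ∫ t, f t * ((x - t) / ((x - t) ^ 2 + ε ^ 2))

theorem I_div_re_im (x t ε : ℝ) :
    (Complex.I / ((x + ε * Complex.I : ℂ) - t)).re = ε / ((x - t) ^ 2 + ε ^ 2) ∧
    (Complex.I / ((x + ε * Complex.I : ℂ) - t)).im = (x - t) / ((x - t) ^ 2 + ε ^ 2) := by
  have e : (x + ε * Complex.I : ℂ) - t = ⟨x - t, ε⟩ := by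
    apply Complex.ext <;> simp
  rw [e]
  constructor <;> simp [Complex.div_re, Complex.div_im, Complex.normSq_apply, sq]

theorem cauchyTransform_eq (hf : IsBoundedCompact f M ρ) {ε : ℝ} (hε : 0 < ε) (x : ℝ) :
    (cauchyTransform f (x + ε * Complex.I)).re = poissonIntegral ε f x ∧
    (cauchyTransform f (x + ε * Complex.I)).im = conjPoissonIntegral ε f x := by
  have hi := integrable_cauchy hf (z := x + ε * Complex.I) (by simpa using hε)
  have h1 := integral_re hi
  have h2 := integral_im hi
  constructor
  · refine h1.symm.trans ?_
    refine integral_congr_ae (Eventually.of_forall fun t => ?_)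
    simp [(I_div_re_im x t ε).1]
  · refine h2.symm.trans ?_
    refine integral_congr_ae (Eventually.of_forall fun t => ?_)
    simp [(I_div_re_im x t ε).2]

end Cauchy

/-- For 1 < p < 3 the angle pπ/2 lies in (π/2, 3π/2), where the cosine is negative. Near θ = ±π/2
the term -B cos(pθ) alone exceeds 1; elsewhere cos θ is bounded below and a large A compensates.
Applied to θ = arg F this bounds |F|^p by A (Re F)^p - B Re F^p, the second term being the real part
of a holomorphic function. -/
theorem exists_one_le_cos {p : ℝ} (hp1 : 1 < p) (hp3 : p < 3) :
    ∃ A B : ℝ, 0 ≤ A ∧ 0 ≤ B ∧ ∀ θ : ℝ, |θ| ≤ Real.pi / 2 →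
      1 ≤ A * Real.cos θ ^ p - B * Real.cos (p * θ) := by
  have hpi := Real.pi_pos
  have hc : Real.cos (p * (Real.pi / 2)) < 0 :=
    Real.cos_neg_of_pi_div_two_lt_of_lt (by nlinarith) (by nlinarith)
  -- Normalized so that -B cos(pπ/2) = 2, which leaves room to stay above 1 in a neighbourhood.
  set B := 2 / (-Real.cos (p * (Real.pi / 2))) with hB
  have hB0 : 0 < B := by
    have : 0 < -Real.cos (p * (Real.pi / 2)) := by linarith
    positivity
  have hlim : ∀ᶠ θ in 𝓝 (Real.pi / 2), 1 < -(B * Real.cos (p * θ)) := by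
    have : Continuous fun θ : ℝ => -(B * Real.cos (p * θ)) := by fun_prop
    refine this.continuousAt.eventually_const_lt ?_
    have : -(B * Real.cos (p * (Real.pi / 2))) = 2 := by
      rw [hB, div_neg, neg_mul, neg_neg, div_mul_cancel₀ _ hc.ne]
    simp only [this]; norm_num
  obtain ⟨δ, hδ, h⟩ := Metric.eventually_nhds_iff.1 hlim
  set δ' := min (δ / 2) (Real.pi / 4) with hδ'
  have hδ0 : 0 < δ' := by positivity
  have hδ1 : δ' ≤ Real.pi / 4 := min_le_right _ _
  have hδ2 : δ' < δ := (min_le_left _ _).trans_lt (by linarith)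
  have hs : 0 < Real.sin δ' := Real.sin_pos_of_pos_of_lt_pi hδ0 (by linarith)
  refine ⟨(1 + B) / Real.sin δ' ^ p, B, by positivity, hB0.le, fun θ hθ => ?_⟩
  have key : ∀ θ : ℝ, 0 ≤ θ → θ ≤ Real.pi / 2 →
      1 ≤ (1 + B) / Real.sin δ' ^ p * Real.cos θ ^ p - B * Real.cos (p * θ) := by
    intro θ h0 h1
    have hcos : 0 ≤ Real.cos θ := Real.cos_nonneg_of_mem_Icc ⟨by linarith, h1⟩
    by_cases h2 : Real.pi / 2 - θ ≤ δ'
    · have h3 := h (y := θ) (by rw [Real.dist_eq, abs_lt]; constructor <;> linarith)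
      have : 0 ≤ (1 + B) / Real.sin δ' ^ p * Real.cos θ ^ p := by positivity
      linarith
    · have h4 : Real.sin δ' ≤ Real.cos θ := by
        rw [← Real.sin_pi_div_two_sub]
        exact Real.sin_le_sin_of_le_of_le_pi_div_two (by linarith) (by linarith) (by linarith)
      have h5 : (1 + B) ≤ (1 + B) / Real.sin δ' ^ p * Real.cos θ ^ p := by
        rw [div_mul_eq_mul_div, le_div_iff₀ (by positivity)]
        gcongr
      have h6 : B * Real.cos (p * θ) ≤ B * 1 := by gcongr; exact Real.cos_le_one _
      linarith
  have := key |θ| (abs_nonneg _) hθ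
  rw [Real.cos_abs] at this
  rcases abs_choice θ with h7 | h7
  · rwa [h7] at this
  · rw [h7, mul_neg, Real.cos_neg] at this
    exact this

section Cauchy

variable {f : ℝ → ℝ} {M ρ : ℝ}

theorem poissonIntegral_pos (hf : IsBoundedCompact f M ρ) (h0 : ∀ t, 0 ≤ f t)
    (hne : ¬ f =ᵐ[volume] 0) {ε : ℝ} (hε : 0 < ε) (x : ℝ) : 0 < poissonIntegral ε f x := by
  have hk : ∀ t, 0 < ε / ((x - t) ^ 2 + ε ^ 2) := fun t => by positivity
  have hi : Integrable fun t => f t * (ε / ((x - t) ^ 2 + ε ^ 2)) := by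
    refine hf.integrable.mul_bdd (c := 1 / ε) (Measurable.aestronglyMeasurable (by fun_prop))
      (Eventually.of_forall fun t => ?_)
    rw [Real.norm_eq_abs, abs_of_pos (hk t), div_le_div_iff₀ (by positivity) hε]
    nlinarith [sq_nonneg (x - t)]
  have hn : 0 ≤ fun t => f t * (ε / ((x - t) ^ 2 + ε ^ 2)) := fun t =>
    mul_nonneg (h0 t) (hk t).le
  refine lt_of_le_of_ne (integral_nonneg hn) fun h => hne ?_
  have := (integral_eq_zero_iff_of_nonneg hn hi).1 h.symm
  filter_upwards [this] with t ht
  exact (mul_eq_zero.1 ht).resolve_right (hk t).ne'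

/-- The Cauchy transform of a nonnegative function maps the upper half-plane into the right
half-plane, on which the principal branch of F^p is holomorphic. -/
theorem cauchyTransform_re_pos (hf : IsBoundedCompact f M ρ) (h0 : ∀ t, 0 ≤ f t)
    (hne : ¬ f =ᵐ[volume] 0) {z : ℂ} (hz : 0 < z.im) : 0 < (cauchyTransform f z).re := by
  have := (cauchyTransform_eq hf hz z.re).1
  rw [Complex.re_add_im] at this
  rw [this]
  exact poissonIntegral_pos hf h0 hne hz _

theorem norm_cpow_cauchyTransform_le (hf : IsBoundedCompact f M ρ) {p : ℝ} (hp : 1 < p) {z : ℂ}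
    (hz : 0 < (cauchyTransform f z).re) {r : ℝ} (hr : 0 < r)
    (h : ∀ t : ℝ, |t| ≤ ρ → r ≤ ‖z - t‖) :
    ‖cauchyTransform f z ^ (p : ℂ)‖ ≤ ((∫ t, |f t|) / r) ^ p := by
  have hne : cauchyTransform f z ≠ 0 := fun h => by simp [h] at hz
  rw [Complex.norm_cpow_of_ne_zero hne]
  simp only [Complex.ofReal_re, Complex.ofReal_im, mul_zero, Real.exp_zero, div_one]
  exact Real.rpow_le_rpow (norm_nonneg _) (norm_cauchyTransform_le hf hr h) (by linarith)

/-- Cauchy's theorem for F^p on the square [-R, R] × [ε, ε + R], read as a rectangle of height R.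
The other three sides have total length 4R and keep distance at least R - ρ from the support of f,
so |F| is at most ‖f‖₁/(R - ρ) there. As p > 1, the bound tends to 0 when R → ∞. -/
theorem norm_integral_cpow_cauchyTransform_le (hf : IsBoundedCompact f M ρ) (h0 : ∀ t, 0 ≤ f t)
    (hne : ¬ f =ᵐ[volume] 0) {p : ℝ} (hp : 1 < p) {ε : ℝ} (hε : 0 < ε) {R : ℝ} (hR0 : 0 < R)
    (hR : ρ < R) :
    ‖∫ x in (-R)..R, cauchyTransform f (x + ε * Complex.I) ^ (p : ℂ)‖ ≤
      4 * (((∫ t, |f t|) / (R - ρ)) ^ p * R) := by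
  set G : ℂ → ℂ := fun z => cauchyTransform f z ^ (p : ℂ) with hG
  have hre : ∀ z : ℂ, 0 < z.im → 0 < (cauchyTransform f z).re := fun z hz =>
    cauchyTransform_re_pos hf h0 hne hz
  have hrect := Complex.integral_boundary_rect_eq_zero_of_differentiableOn G
    ⟨-R, ε⟩ ⟨R, ε + R⟩ (by
      intro z hz
      have him : 0 < z.im := by
        have := hz.2
        simp only [mem_preimage, uIcc_of_le (by linarith : ε ≤ ε + R)] at this
        linarith [this.1]
      exact ((differentiableAt_cauchyTransform hf him).cpow_const
        (Or.inl (hre z him))).differentiableWithinAt)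
  simp only at hrect
  set K := ((∫ t, |f t|) / (R - ρ)) ^ p with hK
  have hRρ : 0 < R - ρ := by linarith
  have bnd : ∀ z : ℂ, 0 < z.im → (R ≤ |z.re| ∨ R ≤ z.im) → ‖G z‖ ≤ K := by
    intro z hz hor
    refine norm_cpow_cauchyTransform_le hf hp (hre z hz) hRρ fun t ht => ?_
    rcases hor with h | h
    · have h1 := Complex.abs_re_le_norm (z - t)
      simp only [Complex.sub_re, Complex.ofReal_re] at h1
      have h2 := abs_sub_abs_le_abs_sub z.re t
      linarith
    · have h1 := (le_abs_self _).trans (Complex.abs_im_le_norm (z - t))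
      simp only [Complex.sub_im, Complex.ofReal_im, sub_zero] at h1
      have := (abs_nonneg t).trans ht
      linarith
  have e1 : ‖∫ x in (-R)..R, G (x + (ε + R : ℝ) * Complex.I)‖ ≤ K * |R - -R| := by
    refine intervalIntegral.norm_integral_le_of_norm_le_const fun x _ => ?_
    refine bnd _ ?_ (Or.inr ?_) <;> simp <;> linarith
  have e2 : ‖∫ y in ε..(ε + R), G ((R : ℝ) + y * Complex.I)‖ ≤ K * |ε + R - ε| := by
    refine intervalIntegral.norm_integral_le_of_norm_le_const fun y hy => ?_
    rw [uIoc_of_le (by linarith)] at hy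
    refine bnd _ ?_ (Or.inl ?_) <;> simp
    · linarith [hy.1]
    · exact le_abs_self R
  have e3 : ‖∫ y in ε..(ε + R), G ((-R : ℝ) + y * Complex.I)‖ ≤ K * |ε + R - ε| := by
    refine intervalIntegral.norm_integral_le_of_norm_le_const fun y hy => ?_
    rw [uIoc_of_le (by linarith)] at hy
    refine bnd _ ?_ (Or.inl ?_) <;> simp
    · linarith [hy.1]
    · exact le_abs_self R
  rw [show R - -R = 2 * R by ring, abs_of_pos (by linarith)] at e1
  rw [add_sub_cancel_left, abs_of_pos hR0] at e2 e3
  set I1 := ∫ x in (-R)..R, G (x + (ε + R : ℝ) * Complex.I)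
  set I2 := ∫ y in ε..(ε + R), G ((R : ℝ) + y * Complex.I)
  set I3 := ∫ y in ε..(ε + R), G ((-R : ℝ) + y * Complex.I)
  have : ∫ x in (-R)..R, G (x + ε * Complex.I) = I1 - Complex.I • I2 + Complex.I • I3 := by
    linear_combination hrect
  rw [this]
  refine (norm_add_le _ _).trans ?_
  refine (add_le_add (norm_sub_le _ _) le_rfl).trans ?_
  rw [norm_smul, norm_smul, Complex.norm_I]
  linarith

theorem continuous_cauchyTransform_line (hf : IsBoundedCompact f M ρ) {ε : ℝ} (hε : 0 < ε) :
    Continuous fun x : ℝ => cauchyTransform f (x + ε * Complex.I) := by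
  refine continuous_iff_continuousAt.2 fun x => ?_
  have h := (differentiableAt_cauchyTransform hf (z := x + ε * Complex.I)
    (by simpa using hε)).continuousAt
  exact ContinuousAt.comp (f := fun x : ℝ => (x + ε * Complex.I : ℂ)) h (by fun_prop)

theorem continuous_conjPoissonIntegral (hf : IsBoundedCompact f M ρ) {ε : ℝ} (hε : 0 < ε) :
    Continuous (conjPoissonIntegral ε f) := by
  have := Complex.continuous_im.comp (continuous_cauchyTransform_line hf hε)
  refine this.congr fun x => (cauchyTransform_eq hf hε x).2

theorem continuous_poissonIntegral (hf : IsBoundedCompact f M ρ) {ε : ℝ} (hε : 0 < ε) :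
    Continuous (poissonIntegral ε f) := by
  have := Complex.continuous_re.comp (continuous_cauchyTransform_line hf hε)
  refine this.congr fun x => (cauchyTransform_eq hf hε x).1

theorem lintegral_poissonIntegral_rpow_le (hf : IsBoundedCompact f M ρ) {p : ℝ} (hp : 1 < p) {ε : ℝ}
    (hε : 0 < ε) :
    ∫⁻ x, ‖poissonIntegral ε f x‖ₑ ^ p ≤ ENNReal.ofReal Real.pi ^ p * ∫⁻ t, ‖f t‖ₑ ^ p := by
  rw [← lintegral_poisson_kernel hε]
  refine le_trans (lintegral_mono fun x => ?_) (lintegral_convolution_rpow_le hp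
    (w := fun s => ENNReal.ofReal (ε / (s ^ 2 + ε ^ 2))) (by fun_prop) hf.meas.enorm)
  gcongr
  refine (enorm_integral_le_lintegral_enorm _).trans (lintegral_mono fun t => ?_)
  simp only
  rw [enorm_mul, mul_comm, Real.enorm_of_nonneg (r := ε / _) (by positivity)]

theorem lintegral_rpow_lt_top (hf : IsBoundedCompact f M ρ) {p : ℝ} (hp : 1 < p) :
    ∫⁻ t, ‖f t‖ₑ ^ p < ⊤ := by
  have hM : 0 ≤ M := (norm_nonneg _).trans (hf.bound 0)
  calc ∫⁻ t, ‖f t‖ₑ ^ p ≤ ∫⁻ t in Icc (-ρ) ρ, ENNReal.ofReal M ^ p := by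
        rw [← lintegral_indicator measurableSet_Icc]
        refine lintegral_mono fun t => ?_
        by_cases ht : t ∈ Icc (-ρ) ρ
        · rw [indicator_of_mem ht]
          gcongr
          rw [← ofReal_norm]
          exact ENNReal.ofReal_le_ofReal (hf.bound t)
        · rw [hf.supp t (by by_contra! hc; exact ht (abs_le.1 hc))]
          simp [ENNReal.zero_rpow_of_pos (by linarith : 0 < p)]
    _ < ⊤ := by
        rw [setLIntegral_const]
        exact ENNReal.mul_lt_top (ENNReal.rpow_lt_top_of_nonneg (by linarith) (by simp)) (by simp)

end Cauchy

/-- M. Riesz's argument for nonnegative f. Write F = P + iQ for the Cauchy transform on the line Im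
z = ε. Integrating |Q|^p ≤ A P^p - B Re F^p over the line kills the holomorphic term, and P is a
convolution with a kernel of mass π. Neither constant depends on ε. -/
theorem exists_lintegral_conjPoissonIntegral_le_of_lt_three {p : ℝ} (hp1 : 1 < p) (hp3 : p < 3) :
    ∃ C : ℝ≥0, ∀ ε : ℝ, 0 < ε → ∀ (f : ℝ → ℝ) (M ρ : ℝ), IsBoundedCompact f M ρ → (∀ t, 0 ≤ f t) →
      ∫⁻ x, ‖conjPoissonIntegral ε f x‖ₑ ^ p ≤ C * ∫⁻ t, ‖f t‖ₑ ^ p := by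
  obtain ⟨A, B, hA, hB, hAB⟩ := exists_one_le_cos hp1 hp3
  have hp0 : 0 < p := by linarith
  refine ⟨(A * Real.pi ^ p).toNNReal, fun ε hε f M ρ hf h0 => ?_⟩
  -- The power F^p is differentiated only where Re F > 0, which fails for the zero function.
  by_cases hne : f =ᵐ[volume] 0
  · have : ∀ x, conjPoissonIntegral ε f x = 0 := fun x => by
      refine integral_eq_zero_of_ae ?_
      filter_upwards [hne] with t ht
      simp [ht]
    simp [this, ENNReal.zero_rpow_of_pos hp0]
  have hre : ∀ x : ℝ, 0 < (cauchyTransform f (x + ε * Complex.I)).re := fun x =>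
    cauchyTransform_re_pos hf h0 hne (by simpa using hε)
  have hpw : ∀ x : ℝ, |conjPoissonIntegral ε f x| ^ p ≤ A * poissonIntegral ε f x ^ p -
      B * (cauchyTransform f (x + ε * Complex.I) ^ (p : ℂ)).re := by
    intro x
    obtain ⟨h1, h2⟩ := cauchyTransform_eq hf hε x
    specialize hre x
    rw [← h1, ← h2]
    set F := cauchyTransform f (x + ε * Complex.I)
    have hF0 : F ≠ 0 := fun h => by simp [h] at hre
    have harg : |F.arg| ≤ Real.pi / 2 := (Complex.abs_arg_lt_pi_div_two_iff.2 (Or.inl hre)).le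
    have hcos : F.re = ‖F‖ * Real.cos F.arg := (Complex.norm_mul_cos_arg F).symm
    have hpow : (F ^ (p : ℂ)).re = ‖F‖ ^ p * Real.cos (p * F.arg) := by
      rw [Complex.cpow_ofReal_re, mul_comm p]
    have hc0 : 0 ≤ Real.cos F.arg := by
      refine Real.cos_nonneg_of_mem_Icc (abs_le.1 harg)
    rw [hpow, hcos, Real.mul_rpow (norm_nonneg _) hc0]
    calc |F.im| ^ p ≤ ‖F‖ ^ p := by
          gcongr
          exact Complex.abs_im_le_norm F
      _ = ‖F‖ ^ p * 1 := (mul_one _).symm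
      _ ≤ ‖F‖ ^ p * (A * Real.cos F.arg ^ p - B * Real.cos (p * F.arg)) := by
          gcongr
          exact hAB _ harg
      _ = _ := by ring
  have hpos : ∀ x, 0 ≤ poissonIntegral ε f x := fun x => (poissonIntegral_pos hf h0 hne hε x).le
  have hPfin : ∫⁻ x, ‖poissonIntegral ε f x‖ₑ ^ p < ⊤ :=
    (lintegral_poissonIntegral_rpow_le hf hp1 hε).trans_lt (ENNReal.mul_lt_top
      (ENNReal.rpow_lt_top_of_nonneg hp0.le (by simp)) (lintegral_rpow_lt_top hf hp1))
  have hcP := continuous_poissonIntegral hf hε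
  have hcQ := continuous_conjPoissonIntegral hf hε
  have hcF := continuous_cauchyTransform_line hf hε
  have eP : ∀ x, ‖poissonIntegral ε f x‖ₑ ^ p = ENNReal.ofReal (poissonIntegral ε f x ^ p) :=
    fun x => by
      rw [Real.enorm_of_nonneg (hpos x), ENNReal.ofReal_rpow_of_nonneg (hpos x) hp0.le]
  have eQ : ∀ x, ‖conjPoissonIntegral ε f x‖ₑ ^ p =
      ENNReal.ofReal (|conjPoissonIntegral ε f x| ^ p) := fun x => by
    rw [Real.enorm_eq_ofReal_abs, ENNReal.ofReal_rpow_of_nonneg (abs_nonneg _) hp0.le]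
  have hPi : Integrable fun x => poissonIntegral ε f x ^ p := by
    refine ⟨(hcP.rpow_const fun x => Or.inr hp0.le).aestronglyMeasurable, ?_⟩
    rw [hasFiniteIntegral_iff_ofReal (Eventually.of_forall fun x => Real.rpow_nonneg (hpos x) p)]
    simpa only [eP] using hPfin
  set U := ∫ x, poissonIntegral ε f x ^ p with hU
  set L := ∫ t, |f t|
  have hint : ∀ R : ℝ, 0 < R → ρ < R → ∫⁻ x in Ioc (-R) R, ‖conjPoissonIntegral ε f x‖ₑ ^ p ≤
      ENNReal.ofReal (A * U + B * (4 * ((L / (R - ρ)) ^ p * R))) := by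
    intro R hR0 hRρ
    have hle : -R ≤ R := by linarith
    simp_rw [eQ]
    have hQc : Continuous fun x => |conjPoissonIntegral ε f x| ^ p :=
      hcQ.abs.rpow_const fun x => Or.inr hp0.le
    have hPc : Continuous fun x => poissonIntegral ε f x ^ p :=
      hcP.rpow_const fun x => Or.inr hp0.le
    have hFc : Continuous fun x : ℝ => cauchyTransform f (x + ε * Complex.I) ^ (p : ℂ) :=
      hcF.cpow continuous_const fun x => Or.inl (hre x)
    have hFi := hFc.intervalIntegrable (μ := volume) (-R) R
    have hQi : IntegrableOn (fun x => |conjPoissonIntegral ε f x| ^ p) (Ioc (-R) R) :=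
      (intervalIntegrable_iff_integrableOn_Ioc_of_le hle).1 (hQc.intervalIntegrable _ _)
    rw [← ofReal_integral_eq_lintegral_ofReal hQi
      (Eventually.of_forall fun x => Real.rpow_nonneg (abs_nonneg _) p)]
    refine ENNReal.ofReal_le_ofReal ?_
    rw [← intervalIntegral.integral_of_le hle]
    calc ∫ x in (-R)..R, |conjPoissonIntegral ε f x| ^ p
        ≤ ∫ x in (-R)..R, (A * poissonIntegral ε f x ^ p -
            B * (cauchyTransform f (x + ε * Complex.I) ^ (p : ℂ)).re) := by
          refine intervalIntegral.integral_mono_on hle (hQc.intervalIntegrable _ _) ?_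
            fun x _ => hpw x
          exact ((hPc.const_mul A).sub ((Complex.continuous_re.comp hFc).const_mul
            B)).intervalIntegrable _ _
      _ = A * (∫ x in (-R)..R, poissonIntegral ε f x ^ p) -
            B * (∫ x in (-R)..R, cauchyTransform f (x + ε * Complex.I) ^ (p : ℂ)).re := by
          have hre' := intervalIntegral.integral_of_le (μ := volume) hle (f := fun x : ℝ =>
            (cauchyTransform f (x + ε * Complex.I) ^ (p : ℂ)).re)
          rw [intervalIntegral.integral_sub, intervalIntegral.integral_const_mul,
            intervalIntegral.integral_const_mul, hre', intervalIntegral.integral_of_le hle (f := fun x : ℝ =>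
            (cauchyTransform f (x + ε * Complex.I) ^ (p : ℂ)))]
          · have := integral_re (μ := volume.restrict (Ioc (-R) R)) hFi.1
            simp only [RCLike.re_to_complex] at this
            rw [this]
          · exact (hPc.const_mul A).intervalIntegrable _ _
          · exact ((Complex.continuous_re.comp hFc).const_mul B).intervalIntegrable _ _
      _ ≤ A * U + B * (4 * ((L / (R - ρ)) ^ p * R)) := by
          have hn := norm_integral_cpow_cauchyTransform_le hf h0 hne hp1 hε hR0 hRρ
          have h1 := (neg_le_abs _).trans ((Complex.abs_re_le_norm _).trans hn)
          have h2 : ∫ x in (-R)..R, poissonIntegral ε f x ^ p ≤ U := by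
            rw [intervalIntegral.integral_of_le hle]
            exact setIntegral_le_integral hPi
              (Eventually.of_forall fun x => Real.rpow_nonneg (hpos x) p)
          have h3 := mul_le_mul_of_nonneg_left h1 hB
          have h4 := mul_le_mul_of_nonneg_left h2 hA
          linarith
  have hlim : Tendsto (fun R : ℝ => ENNReal.ofReal (A * U + B * (4 * ((L / (R - ρ)) ^ p * R)))) atTop
      (𝓝 (ENNReal.ofReal (A * U))) := by
    refine (ENNReal.continuous_ofReal.tendsto _).comp ?_
    -- The contour error is L^p (R - ρ)^{-(p-1)} · R/(R - ρ), and p > 1 makes it vanish.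
    have h1 : Tendsto (fun R : ℝ => (L / (R - ρ)) ^ p * R) atTop (𝓝 0) := by
      have h2 : Tendsto (fun R : ℝ => (R - ρ) ^ (-(p - 1)) * (R / (R - ρ))) atTop (𝓝 (0 * 1)) := by
        refine Tendsto.mul ?_ ?_
        · exact (tendsto_rpow_neg_atTop (by linarith : 0 < p - 1)).comp
            (tendsto_atTop_add_const_right _ (-ρ) tendsto_id)
        · have h3 : Tendsto (fun R : ℝ => 1 + ρ * (R - ρ)⁻¹) atTop (𝓝 (1 + ρ * 0)) :=
            ((tendsto_inv_atTop_zero.comp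
              (tendsto_atTop_add_const_right _ (-ρ) tendsto_id)).const_mul ρ).const_add 1
          rw [mul_zero, add_zero] at h3
          refine h3.congr' ?_
          filter_upwards [eventually_gt_atTop ρ] with R hR
          have : R - ρ ≠ 0 := by linarith
          field_simp
          ring
      have h4 := h2.const_mul (L ^ p)
      rw [zero_mul, mul_zero] at h4
      refine h4.congr' ?_
      filter_upwards [eventually_gt_atTop ρ] with R hR
      have h5 : 0 < R - ρ := by linarith
      have hL : 0 ≤ L := integral_nonneg fun t => abs_nonneg _
      rw [Real.div_rpow hL h5.le, neg_sub, Real.rpow_sub h5, Real.rpow_one]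
      field_simp
    have := (((h1.const_mul 4).const_mul B).const_add (A * U))
    simpa using this
  have hcov : Tendsto (fun R : ℝ => ∫⁻ x in Ioc (-R) R, ‖conjPoissonIntegral ε f x‖ₑ ^ p) atTop
      (𝓝 (∫⁻ x, ‖conjPoissonIntegral ε f x‖ₑ ^ p)) :=
    (aecover_Ioc tendsto_neg_atTop_atBot tendsto_id).lintegral_tendsto_of_countably_generated
      (by fun_prop)
  have hfin : ∫⁻ x, ‖conjPoissonIntegral ε f x‖ₑ ^ p ≤ ENNReal.ofReal (A * U) := by
    refine le_of_tendsto_of_tendsto hcov hlim ?_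
    filter_upwards [eventually_gt_atTop ρ, eventually_gt_atTop 0] with R h1 h2
    exact hint R h2 h1
  refine hfin.trans ?_
  rw [ENNReal.ofReal_mul hA, hU, ofReal_integral_eq_lintegral_ofReal hPi
    (Eventually.of_forall fun x => Real.rpow_nonneg (hpos x) p)]
  simp_rw [← eP]
  calc ENNReal.ofReal A * ∫⁻ x, ‖poissonIntegral ε f x‖ₑ ^ p
      ≤ ENNReal.ofReal A * (ENNReal.ofReal Real.pi ^ p * ∫⁻ t, ‖f t‖ₑ ^ p) := by
        gcongr
        exact lintegral_poissonIntegral_rpow_le hf hp1 hε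
    _ = _ := by
        rw [← mul_assoc, ENNReal.ofReal_rpow_of_nonneg Real.pi_pos.le hp0.le,
          ← ENNReal.ofReal_mul hA]
        rfl

theorem abs_conjPoisson_kernel_le {ε : ℝ} (hε : 0 < ε) (s : ℝ) :
    |s / (s ^ 2 + ε ^ 2)| ≤ 1 / ε := by
  have h : 0 < s ^ 2 + ε ^ 2 := by positivity
  rw [abs_div, abs_of_pos h, div_le_div_iff₀ h hε]
  rw [← sq_abs s]
  nlinarith [sq_nonneg (|s| - ε), abs_nonneg s]

theorem integrable_conjPoisson {f : ℝ → ℝ} {M ρ : ℝ} (hf : IsBoundedCompact f M ρ) {ε : ℝ}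
    (hε : 0 < ε) (x : ℝ) : Integrable fun t => f t * ((x - t) / ((x - t) ^ 2 + ε ^ 2)) :=
  hf.integrable.mul_bdd (c := 1 / ε) (Measurable.aestronglyMeasurable (by fun_prop))
    (Eventually.of_forall fun t => abs_conjPoisson_kernel_le hε (x - t))

theorem conjPoissonIntegral_sub {f g : ℝ → ℝ} {M ρ M' ρ' : ℝ} (hf : IsBoundedCompact f M ρ)
    (hg : IsBoundedCompact g M' ρ') {ε : ℝ} (hε : 0 < ε) (x : ℝ) :
    conjPoissonIntegral ε (fun t => f t - g t) x =
      conjPoissonIntegral ε f x - conjPoissonIntegral ε g x := by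
  unfold conjPoissonIntegral
  rw [← integral_sub (integrable_conjPoisson hf hε x) (integrable_conjPoisson hg hε x)]
  simp_rw [sub_mul]

/-- Uniform `L^p` boundedness of the conjugate Poisson integrals on real functions. -/
def ConjPoissonBounded (p : ℝ) : Prop :=
  ∃ C : ℝ≥0, ∀ ε : ℝ, 0 < ε → ∀ (f : ℝ → ℝ) (M ρ : ℝ), IsBoundedCompact f M ρ →
    ∫⁻ x, ‖conjPoissonIntegral ε f x‖ₑ ^ p ≤ C * ∫⁻ t, ‖f t‖ₑ ^ p

theorem conjPoissonBounded_of_lt_three {p : ℝ} (hp1 : 1 < p) (hp3 : p < 3) :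
    ConjPoissonBounded p := by
  obtain ⟨C, hC⟩ := exists_lintegral_conjPoissonIntegral_le_of_lt_three hp1 hp3
  have hp0 : 0 < p := by linarith
  refine ⟨2 ^ (p - 1) * (C + C), fun ε hε f M ρ hf => ?_⟩
  have hm := hf.meas.measurable
  have h1 : IsBoundedCompact (fun t => max (f t) 0) M ρ := by
    refine ⟨(hm.max measurable_const).stronglyMeasurable, fun t => ?_, fun t ht => ?_⟩
    · refine le_trans ?_ (hf.bound t)
      rw [Real.norm_eq_abs, Real.norm_eq_abs, abs_of_nonneg (le_max_right _ _)]
      exact max_le (le_abs_self _) (abs_nonneg _)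
    · simp [hf.supp t ht]
  have h2 : IsBoundedCompact (fun t => max (-f t) 0) M ρ := by
    refine ⟨(hm.neg.max measurable_const).stronglyMeasurable, fun t => ?_, fun t ht => ?_⟩
    · refine le_trans ?_ (hf.bound t)
      rw [Real.norm_eq_abs, Real.norm_eq_abs, abs_of_nonneg (le_max_right _ _)]
      exact max_le (neg_le_abs _) (abs_nonneg _)
    · simp [hf.supp t ht]
  have hsub : f = fun t => max (f t) 0 - max (-f t) 0 := by
    funext t
    rcases le_total (f t) 0 with h | h
    · rw [max_eq_right h, max_eq_left (by linarith)]; ring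
    · rw [max_eq_left h, max_eq_right (by linarith)]; ring
  have e1 := hC ε hε _ M ρ h1 fun t => le_max_right _ _
  have e2 := hC ε hε _ M ρ h2 fun t => le_max_right _ _
  have l1 : ∫⁻ t, ‖max (f t) 0‖ₑ ^ p ≤ ∫⁻ t, ‖f t‖ₑ ^ p := by
    refine lintegral_mono fun t => ?_
    gcongr
    rw [enorm_le_iff_norm_le, Real.norm_eq_abs, Real.norm_eq_abs,
      abs_of_nonneg (le_max_right _ _)]
    exact max_le (le_abs_self _) (abs_nonneg _)
  have l2 : ∫⁻ t, ‖max (-f t) 0‖ₑ ^ p ≤ ∫⁻ t, ‖f t‖ₑ ^ p := by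
    refine lintegral_mono fun t => ?_
    gcongr
    rw [enorm_le_iff_norm_le, Real.norm_eq_abs, Real.norm_eq_abs,
      abs_of_nonneg (le_max_right _ _)]
    exact max_le (neg_le_abs _) (abs_nonneg _)
  have c1 := continuous_conjPoissonIntegral h1 hε
  have c2 := continuous_conjPoissonIntegral h2 hε
  calc ∫⁻ x, ‖conjPoissonIntegral ε f x‖ₑ ^ p
      ≤ ∫⁻ x, 2 ^ (p - 1) * (‖conjPoissonIntegral ε (fun t => max (f t) 0) x‖ₑ ^ p +
          ‖conjPoissonIntegral ε (fun t => max (-f t) 0) x‖ₑ ^ p) := by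
        refine lintegral_mono fun x => ?_
        refine le_trans ?_ (ENNReal.rpow_add_le_mul_rpow_add_rpow _ _ hp1.le)
        gcongr
        conv_lhs => rw [hsub, conjPoissonIntegral_sub h1 h2 hε x]
        exact enorm_sub_le
    _ = 2 ^ (p - 1) * ((∫⁻ x, ‖conjPoissonIntegral ε (fun t => max (f t) 0) x‖ₑ ^ p) +
          ∫⁻ x, ‖conjPoissonIntegral ε (fun t => max (-f t) 0) x‖ₑ ^ p) := by
        rw [lintegral_const_mul _ (by fun_prop), lintegral_add_left (by fun_prop)]
    _ ≤ 2 ^ (p - 1) * ((C * ∫⁻ t, ‖f t‖ₑ ^ p) + C * ∫⁻ t, ‖f t‖ₑ ^ p) := by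
        gcongr
        · exact e1.trans (by gcongr)
        · exact e2.trans (by gcongr)
    _ = _ := by
        push_cast
        rw [ENNReal.coe_rpow_of_nonneg _ (by linarith)]
        push_cast
        ring

theorem integral_conjPoissonIntegral_mul {f h : ℝ → ℝ} {M ρ M' ρ' : ℝ}
    (hf : IsBoundedCompact f M ρ) (hh : IsBoundedCompact h M' ρ') {ε : ℝ} (hε : 0 < ε) :
    ∫ x, conjPoissonIntegral ε f x * h x = -∫ t, f t * conjPoissonIntegral ε h t := by
  have hi : Integrable (fun z : ℝ × ℝ => (h z.1 * f z.2) *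
      ((z.1 - z.2) / ((z.1 - z.2) ^ 2 + ε ^ 2))) (volume.prod volume) :=
    (hh.integrable.mul_prod hf.integrable).mul_bdd (c := 1 / ε)
      (Measurable.aestronglyMeasurable (by fun_prop))
      (Eventually.of_forall fun z => abs_conjPoisson_kernel_le hε _)
  have e := integral_integral_swap (f := fun x t => (h x * f t) *
    ((x - t) / ((x - t) ^ 2 + ε ^ 2))) hi
  calc _ = ∫ x, ∫ t, (h x * f t) * ((x - t) / ((x - t) ^ 2 + ε ^ 2)) := by
        refine integral_congr_ae (Eventually.of_forall fun x => ?_)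
        simp only [conjPoissonIntegral]
        rw [mul_comm, ← integral_const_mul]
        simp_rw [mul_assoc]
    _ = ∫ t, ∫ x, (h x * f t) * ((x - t) / ((x - t) ^ 2 + ε ^ 2)) := e
    _ = _ := by
        rw [← integral_neg]
        refine integral_congr_ae (Eventually.of_forall fun t => ?_)
        simp only [conjPoissonIntegral]
        rw [← integral_const_mul, ← integral_neg]
        refine integral_congr_ae (Eventually.of_forall fun x => ?_)
        simp only
        rw [show (t - x) ^ 2 = (x - t) ^ 2 by ring, show t - x = -(x - t) by ring]
        ring

/-- Duality. The conjugate Poisson kernel is odd, so its transpose is its negative. The extremizer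
sgn(Q)|Q|^{p-1}, cut off to [-N, N] to remain admissible, is used as the test function; then N → ∞.
-/
theorem conjPoissonBounded_of_conjugate {p q : ℝ} (hpq : p.HolderConjugate q)
    (h : ConjPoissonBounded q) : ConjPoissonBounded p := by
  obtain ⟨C, hC⟩ := h
  have hp0 : 0 < p := hpq.pos
  have hq0 : 0 < q := hpq.symm.pos
  have hp1 : 1 < p := hpq.lt
  refine ⟨(C ^ (1 / q)) ^ p, fun ε hε f M ρ hf => ?_⟩
  have hcQ := continuous_conjPoissonIntegral hf hε
  -- The sign jumps where Q vanishes, but the factor |Q|^{p-1} with p > 1 removes the jump;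
  -- continuity yields measurability and a bound on [-N, N].
  have hcont : Continuous fun x => SignType.sign (conjPoissonIntegral ε f x) *
      |conjPoissonIntegral ε f x| ^ (p - 1) := by
    have : Continuous fun s : ℝ => (SignType.sign s : ℝ) * |s| ^ (p - 1) := by
      refine continuous_iff_continuousAt.2 fun s => ?_
      rcases eq_or_ne s 0 with rfl | hs
      · have h1 : Tendsto (fun s : ℝ => |s| ^ (p - 1)) (𝓝 0) (𝓝 0) := by
          have := (continuous_abs.rpow_const fun x : ℝ => Or.inr (by linarith : 0 ≤ p - 1)).tendsto
            (0 : ℝ)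
          simpa [Real.zero_rpow (by linarith : p - 1 ≠ 0)] using this
        have : ContinuousAt (fun s : ℝ => (SignType.sign s : ℝ) * |s| ^ (p - 1)) 0 := by
          rw [ContinuousAt]
          simp only [sign_zero, SignType.coe_zero, zero_mul]
          refine squeeze_zero_norm (fun s => ?_) h1
          rw [norm_mul, Real.norm_of_nonneg (by positivity : 0 ≤ |s| ^ (p - 1))]
          refine mul_le_of_le_one_left (by positivity) ?_
          rcases lt_trichotomy s 0 with hs | hs | hs <;> simp [hs]
        exact this
      · refine ContinuousAt.mul ?_ ?_
        · refine ContinuousAt.comp (f := SignType.sign) (g := fun x : SignType => (x : ℝ))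
            (continuous_of_discreteTopology.continuousAt) (continuousAt_sign_of_ne_zero hs)
        · exact continuous_abs.continuousAt.rpow_const (Or.inl (abs_ne_zero.2 hs))
    exact this.comp hcQ
  have key : ∀ N : ℝ, ∫⁻ x in Icc (-N) N, ‖conjPoissonIntegral ε f x‖ₑ ^ p ≤
      ((C ^ (1 / q)) ^ p : ℝ≥0) * ∫⁻ t, ‖f t‖ₑ ^ p := by
    intro N
    set hN : ℝ → ℝ := (Icc (-N) N).indicator fun x => SignType.sign (conjPoissonIntegral ε f x) *
      |conjPoissonIntegral ε f x| ^ (p - 1) with hN_def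
    obtain ⟨B, hB⟩ := (isCompact_Icc (a := -N) (b := N)).exists_bound_of_continuousOn
      hcont.continuousOn
    have hbc : IsBoundedCompact hN (max B 0) N := by
      refine ⟨hcont.stronglyMeasurable.indicator measurableSet_Icc, fun t => ?_, fun t ht => ?_⟩
      · by_cases htN : t ∈ Icc (-N) N
        · rw [hN_def, indicator_of_mem htN]
          exact (hB t htN).trans (le_max_left _ _)
        · rw [hN_def, indicator_of_notMem htN]
          simp
      · rw [hN_def, indicator_of_notMem]
        intro hc
        exact ht.not_ge (abs_le.2 hc)
    set X := ∫⁻ x in Icc (-N) N, ‖conjPoissonIntegral ε f x‖ₑ ^ p with hX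
    -- Finiteness is what permits division by X^{1/q} below; it is the reason for the cutoff.
    have hXfin : X ≠ ⊤ := by
      obtain ⟨B', hB'⟩ := (isCompact_Icc (a := -N) (b := N)).exists_bound_of_continuousOn
        hcQ.continuousOn
      refine ((setLIntegral_mono' (g := fun _ => ENNReal.ofReal B' ^ p) measurableSet_Icc
        fun x hx => ?_).trans_lt ?_).ne
      · gcongr
        rw [← ofReal_norm]
        exact ENNReal.ofReal_le_ofReal (hB' x hx)
      · rw [setLIntegral_const]
        exact ENNReal.mul_lt_top (ENNReal.rpow_lt_top_of_nonneg hp0.le (by simp)) (by simp)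
    have en : ∀ x, ‖conjPoissonIntegral ε f x * hN x‖ₑ =
        (Icc (-N) N).indicator (fun x => ‖conjPoissonIntegral ε f x‖ₑ ^ p) x := by
      intro x
      by_cases hx : x ∈ Icc (-N) N
      · rw [hN_def, indicator_of_mem hx, indicator_of_mem hx]
        set s := conjPoissonIntegral ε f x
        rw [← mul_assoc, mul_comm s, sign_mul_self]
        rw [Real.enorm_of_nonneg (by positivity), Real.enorm_eq_ofReal_abs,
          ENNReal.ofReal_rpow_of_nonneg (abs_nonneg _) hp0.le]
        congr 1
        rcases eq_or_ne s 0 with hs | hs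
        · simp [hs, Real.zero_rpow hp0.ne']
        · rw [Real.rpow_sub_one (abs_ne_zero.2 hs)]
          field_simp
      · rw [hN_def, indicator_of_notMem hx, indicator_of_notMem hx]
        simp
    have hnonneg : ∀ x, 0 ≤ conjPoissonIntegral ε f x * hN x := by
      intro x
      by_cases hx : x ∈ Icc (-N) N
      · rw [hN_def, indicator_of_mem hx, ← mul_assoc, mul_comm (conjPoissonIntegral ε f x),
          sign_mul_self]
        positivity
      · rw [hN_def, indicator_of_notMem hx, mul_zero]
    have hXeq : X = ‖∫ x, conjPoissonIntegral ε f x * hN x‖ₑ := by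
      rw [Real.enorm_of_nonneg (integral_nonneg hnonneg),
        ofReal_integral_eq_lintegral_ofReal ?_ (Eventually.of_forall hnonneg)]
      · rw [hX, ← lintegral_indicator measurableSet_Icc]
        refine lintegral_congr fun x => ?_
        rw [← en, Real.enorm_of_nonneg (hnonneg x)]
      · refine ⟨hcQ.aestronglyMeasurable.mul hbc.meas.aestronglyMeasurable, ?_⟩
        rw [HasFiniteIntegral]
        simp_rw [en]
        rw [lintegral_indicator measurableSet_Icc]
        exact hXfin.lt_top
    have hhq : ∫⁻ x, ‖hN x‖ₑ ^ q = X := by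
      rw [hX, ← lintegral_indicator measurableSet_Icc]
      refine lintegral_congr fun x => ?_
      by_cases hx : x ∈ Icc (-N) N
      · rw [hN_def, indicator_of_mem hx, indicator_of_mem hx]
        set s := conjPoissonIntegral ε f x
        rcases eq_or_ne s 0 with hs | hs
        · simp [hs, ENNReal.zero_rpow_of_pos, hp0, hq0]
        · have : ‖(SignType.sign s : ℝ) * |s| ^ (p - 1)‖ₑ = ENNReal.ofReal (|s| ^ (p - 1)) := by
            rw [Real.enorm_eq_ofReal_abs, abs_mul, abs_of_nonneg (by positivity : 0 ≤ |s| ^ (p - 1))]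
            rcases lt_or_gt_of_ne hs with h | h <;> simp [h]
          rw [this, ENNReal.ofReal_rpow_of_nonneg (by positivity) hq0.le,
            ← Real.rpow_mul (abs_nonneg _), hpq.sub_one_mul_conj, Real.enorm_eq_ofReal_abs,
            ENNReal.ofReal_rpow_of_nonneg (abs_nonneg _) hp0.le]
      · rw [hN_def, indicator_of_notMem hx, indicator_of_notMem hx]
        simp [ENNReal.zero_rpow_of_pos hq0]
    have hmain : X ≤ (∫⁻ t, ‖f t‖ₑ ^ p) ^ (1 / p) * (C * X) ^ (1 / q) := by
      calc X = ‖∫ t, f t * conjPoissonIntegral ε hN t‖ₑ := by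
            rw [hXeq, integral_conjPoissonIntegral_mul hf hbc hε, enorm_neg]
        _ ≤ ∫⁻ t, ‖f t‖ₑ * ‖conjPoissonIntegral ε hN t‖ₑ := by
            refine (enorm_integral_le_lintegral_enorm _).trans_eq ?_
            simp_rw [enorm_mul]
        _ ≤ (∫⁻ t, ‖f t‖ₑ ^ p) ^ (1 / p) * (∫⁻ t, ‖conjPoissonIntegral ε hN t‖ₑ ^ q) ^ (1 / q) :=
            ENNReal.lintegral_mul_le_Lp_mul_Lq volume hpq hf.meas.enorm.aemeasurable
              (continuous_conjPoissonIntegral hbc hε).enorm.aemeasurable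
        _ ≤ _ := by
            gcongr
            rw [← hhq]
            exact hC ε hε hN _ _ hbc
    rcases eq_or_ne X 0 with hX0 | hX0
    · rw [hX0]; exact zero_le
    have h3 : X ^ (1 / p) ≤ (∫⁻ t, ‖f t‖ₑ ^ p) ^ (1 / p) * (C : ℝ≥0∞) ^ (1 / q) := by
      have h4 : X ^ (1 / p) * X ^ (1 / q) ≤
          ((∫⁻ t, ‖f t‖ₑ ^ p) ^ (1 / p) * (C : ℝ≥0∞) ^ (1 / q)) * X ^ (1 / q) := by
        rw [← ENNReal.rpow_add _ _ hX0 hXfin, show 1 / p + 1 / q = 1 by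
          simpa using hpq.inv_add_inv_eq_one, ENNReal.rpow_one]
        rw [ENNReal.mul_rpow_of_nonneg _ _ (by positivity)] at hmain
        rwa [mul_assoc]
      refine (ENNReal.mul_le_mul_iff_left ?_ ?_).1 h4
      · simp [hX0, hXfin]
      · exact (ENNReal.rpow_lt_top_of_nonneg (by positivity) hXfin).ne
    have h5 := ENNReal.rpow_le_rpow h3 hp0.le
    rw [← ENNReal.rpow_mul, one_div_mul_cancel hp0.ne', ENNReal.rpow_one,
      ENNReal.mul_rpow_of_nonneg _ _ hp0.le, ← ENNReal.rpow_mul, one_div_mul_cancel hp0.ne',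
      ENNReal.rpow_one] at h5
    rw [ENNReal.coe_rpow_of_nonneg _ hp0.le, ENNReal.coe_rpow_of_nonneg _ (by positivity), mul_comm]
    exact h5
  have hcov : Tendsto (fun R : ℝ => ∫⁻ x in Icc (-R) R, ‖conjPoissonIntegral ε f x‖ₑ ^ p) atTop
      (𝓝 (∫⁻ x, ‖conjPoissonIntegral ε f x‖ₑ ^ p)) :=
    (aecover_Icc tendsto_neg_atTop_atBot tendsto_id).lintegral_tendsto_of_countably_generated
      (by fun_prop)
  exact le_of_tendsto' hcov key

/-- Exponents p ≥ 3 have conjugate exponent at most 3/2, hence below 3, and follow by duality. -/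
theorem conjPoissonBounded {p : ℝ} (hp : 1 < p) : ConjPoissonBounded p := by
  rcases lt_or_ge p 3 with h | h
  · exact conjPoissonBounded_of_lt_three hp h
  · have hpq : p.HolderConjugate (p / (p - 1)) := Real.HolderConjugate.conjExponent hp
    refine conjPoissonBounded_of_conjugate hpq (conjPoissonBounded_of_lt_three hpq.symm.lt ?_)
    rw [div_lt_iff₀ (by linarith)]
    linarith

/-! ### The truncated kernel of 1/s compared with the conjugate Poisson kernel -/

/-- The difference equals (1/(s²+1) - e^{-s})/s. For s ≤ 1 both terms of the numerator lie in [1 -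
s, 1]; for s ≥ 1 both are O(1/s²). So the two truncations of 1/s differ by a multiple of the Poisson
kernel, which has L¹ norm independent of the scale. -/
theorem abs_truncated_sub_conjPoisson_le_one {s : ℝ} (hs : 0 < s) :
    |(1 - Real.exp (-s)) / s - s / (s ^ 2 + 1)| ≤ 3 / (s ^ 2 + 1) := by
  have e : (1 - Real.exp (-s)) / s - s / (s ^ 2 + 1) = (1 / (s ^ 2 + 1) - Real.exp (-s)) / s := by
    field_simp
    ring
  have h1 : 1 - s ≤ Real.exp (-s) := by linarith [Real.add_one_le_exp (-s)]
  have h2 : Real.exp (-s) ≤ 1 := Real.exp_le_one_iff.2 (by linarith)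
  have h3 := Real.exp_pos (-s)
  have hD : 0 < s ^ 2 + 1 := by positivity
  rw [e, abs_div, abs_of_pos hs, div_le_div_iff₀ hs hD]
  rcases le_total s 1 with h | h
  · have h4 : |1 / (s ^ 2 + 1) - Real.exp (-s)| ≤ s := by
      have h5 : 1 - s ≤ 1 / (s ^ 2 + 1) := by
        rw [le_div_iff₀ hD]
        nlinarith [mul_nonneg hs.le (sub_nonneg.2 h)]
      have h6 : 1 / (s ^ 2 + 1) ≤ 1 := by
        rw [div_le_iff₀ hD]; nlinarith
      rw [abs_le]
      constructor <;> linarith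
    calc |1 / (s ^ 2 + 1) - Real.exp (-s)| * (s ^ 2 + 1) ≤ s * 2 := by
          gcongr
          nlinarith
      _ ≤ 3 * s := by linarith
  · have h4 : Real.exp (-s) * (s ^ 2 + 1) ≤ 2 := by
      have h5 := Real.quadratic_le_exp_of_nonneg hs.le
      rw [Real.exp_neg, inv_mul_le_iff₀ (Real.exp_pos s)]
      nlinarith
    calc |1 / (s ^ 2 + 1) - Real.exp (-s)| * (s ^ 2 + 1)
        ≤ (1 / (s ^ 2 + 1) + Real.exp (-s)) * (s ^ 2 + 1) := by
          gcongr
          rw [abs_le]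
          constructor <;> linarith [div_pos one_pos hD]
      _ ≤ 3 * s := by
          rw [add_mul, div_mul_cancel₀ _ hD.ne']
          linarith

/-- The kernel `∫₀^Λ sgn(s) e^(-λ |s|) dλ`, a truncation of `1 / s`. -/
def truncatedKernel (Λ s : ℝ) : ℝ := (1 - Real.exp (-(Λ * |s|))) / s

theorem abs_truncatedKernel_sub_le {Λ : ℝ} (hΛ : 0 < Λ) (s : ℝ) :
    |truncatedKernel Λ s - s / (s ^ 2 + Λ⁻¹ ^ 2)| ≤ 3 * (Λ⁻¹ / (s ^ 2 + Λ⁻¹ ^ 2)) := by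
  have pos : ∀ s : ℝ, 0 < s →
      |truncatedKernel Λ s - s / (s ^ 2 + Λ⁻¹ ^ 2)| ≤ 3 * (Λ⁻¹ / (s ^ 2 + Λ⁻¹ ^ 2)) := by
    intro s hs
    have h := abs_truncated_sub_conjPoisson_le_one (mul_pos hΛ hs)
    have hD : 0 < (Λ * s) ^ 2 + 1 := by positivity
    have e1 : truncatedKernel Λ s - s / (s ^ 2 + Λ⁻¹ ^ 2) =
        Λ * ((1 - Real.exp (-(Λ * s))) / (Λ * s) - (Λ * s) / ((Λ * s) ^ 2 + 1)) := by
      have : s ^ 2 + Λ⁻¹ ^ 2 = ((Λ * s) ^ 2 + 1) / Λ ^ 2 := by field_simp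
      rw [truncatedKernel, abs_of_pos hs, this]
      field_simp
    have e2 : 3 * (Λ⁻¹ / (s ^ 2 + Λ⁻¹ ^ 2)) = Λ * (3 / ((Λ * s) ^ 2 + 1)) := by
      have : s ^ 2 + Λ⁻¹ ^ 2 = ((Λ * s) ^ 2 + 1) / Λ ^ 2 := by field_simp
      rw [this]
      field_simp
    rw [e1, e2, abs_mul, abs_of_pos hΛ]
    gcongr
  rcases lt_trichotomy s 0 with hs | rfl | hs
  · have h := pos (-s) (by linarith)
    have e : truncatedKernel Λ (-s) = -truncatedKernel Λ s := by
      simp [truncatedKernel, div_neg]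
    rw [e, neg_sq, neg_div, ← neg_sub_neg, neg_neg, neg_neg, abs_sub_comm] at h
    exact h
  · simp [truncatedKernel]
    positivity
  · exact pos s hs

theorem measurable_truncatedKernel (Λ : ℝ) : Measurable (truncatedKernel Λ) := by
  unfold truncatedKernel
  fun_prop

theorem abs_truncatedKernel_le {Λ : ℝ} (hΛ : 0 < Λ) (s : ℝ) : |truncatedKernel Λ s| ≤ Λ := by
  rcases eq_or_ne s 0 with rfl | hs
  · simp [truncatedKernel, hΛ.le]
  · have hs' := abs_pos.2 hs
    rw [truncatedKernel, abs_div, div_le_iff₀ hs']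
    have h1 := Real.add_one_le_exp (-(Λ * |s|))
    have h2 : Real.exp (-(Λ * |s|)) ≤ 1 := Real.exp_le_one_iff.2 (by nlinarith)
    rw [abs_of_nonneg (by linarith)]
    linarith

/-- With ε = 1/Λ the kernel is the conjugate Poisson kernel plus an error below 3 times the Poisson
kernel, of mass 3π. Real and imaginary parts are treated separately because the conjugate Poisson
bound is for real functions. -/
theorem exists_lintegral_truncatedHilbert_le {p : ℝ} (hp : 1 < p) :
    ∃ C : ℝ≥0, ∀ Λ : ℝ, 0 < Λ → ∀ (G : ℝ → ℂ) (M ρ : ℝ), IsBoundedCompact G M ρ →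
      ∫⁻ x, ‖∫ y, (truncatedKernel Λ (x - y) : ℂ) * G y‖ₑ ^ p ≤ C * ∫⁻ y, ‖G y‖ₑ ^ p := by
  obtain ⟨C, hC⟩ := conjPoissonBounded hp
  have hp0 : 0 < p := by linarith
  set D : ℝ≥0 := (3 * Real.pi).toNNReal with hD
  refine ⟨2 ^ (p - 1) * (2 ^ (p - 1) * (C + C) + D ^ p), fun Λ hΛ G M ρ hG => ?_⟩
  set ε := Λ⁻¹ with hε_def
  have hε : 0 < ε := by positivity
  have hre : IsBoundedCompact (fun t => (G t).re) M ρ :=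
    ⟨(Complex.measurable_re.comp hG.meas.measurable).stronglyMeasurable,
      fun t => (Complex.abs_re_le_norm _).trans (hG.bound t), fun t ht => by simp [hG.supp t ht]⟩
  have him : IsBoundedCompact (fun t => (G t).im) M ρ :=
    ⟨(Complex.measurable_im.comp hG.meas.measurable).stronglyMeasurable,
      fun t => (Complex.abs_im_le_norm _).trans (hG.bound t), fun t ht => by simp [hG.supp t ht]⟩
  set w : ℝ → ℝ≥0∞ := fun s => ENNReal.ofReal (3 * (ε / (s ^ 2 + ε ^ 2))) with hw
  have hwm : Measurable w := by fun_prop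
  have hwi : ∫⁻ s, w s = D := by
    simp_rw [hw, ENNReal.ofReal_mul (show (0 : ℝ) ≤ 3 by norm_num)]
    rw [lintegral_const_mul _ (by fun_prop), lintegral_poisson_kernel hε,
      ← ENNReal.ofReal_mul (by norm_num)]
    rfl
  have hGm := hG.meas.measurable
  have hpt : ∀ x, ‖∫ y, (truncatedKernel Λ (x - y) : ℂ) * G y‖ₑ ≤
      (‖conjPoissonIntegral ε (fun t => (G t).re) x‖ₑ +
        ‖conjPoissonIntegral ε (fun t => (G t).im) x‖ₑ) + ∫⁻ y, w (x - y) * ‖G y‖ₑ := by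
    intro x
    have i1 : Integrable fun y => (((x - y) / ((x - y) ^ 2 + ε ^ 2) : ℝ) : ℂ) * G y :=
      hG.integrable.bdd_mul (c := 1 / ε) (Measurable.aestronglyMeasurable (by fun_prop))
        (Eventually.of_forall fun t => by
          rw [Complex.norm_real]; exact abs_conjPoisson_kernel_le hε (x - t))
    have i2 : Integrable fun y => (truncatedKernel Λ (x - y) : ℂ) * G y :=
      hG.integrable.bdd_mul (c := Λ) (Measurable.aestronglyMeasurable
          (by have := measurable_truncatedKernel Λ; fun_prop))
        (Eventually.of_forall fun t => by
          rw [Complex.norm_real]; exact abs_truncatedKernel_le hΛ (x - t))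
    have e : ∫ y, (truncatedKernel Λ (x - y) : ℂ) * G y =
        (∫ y, (((x - y) / ((x - y) ^ 2 + ε ^ 2) : ℝ) : ℂ) * G y) +
        ∫ y, ((truncatedKernel Λ (x - y) - (x - y) / ((x - y) ^ 2 + ε ^ 2) : ℝ) : ℂ) * G y := by
      rw [← integral_add' i1]
      · congr 1
        funext y
        simp only [Pi.add_apply]
        push_cast
        ring
      · refine (i2.sub i1).congr (Eventually.of_forall fun y => ?_)
        simp only [Pi.sub_apply]
        push_cast
        ring
    rw [e]
    refine (enorm_add_le _ _).trans (add_le_add ?_ ?_)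
    · set Z := ∫ y, (((x - y) / ((x - y) ^ 2 + ε ^ 2) : ℝ) : ℂ) * G y with hZ
      have z1 : Z.re = conjPoissonIntegral ε (fun t => (G t).re) x := by
        refine (integral_re i1).symm.trans ?_
        refine integral_congr_ae (Eventually.of_forall fun y => ?_)
        simp only [RCLike.re_to_complex, Complex.re_ofReal_mul]
        rw [mul_comm]
      have z2 : Z.im = conjPoissonIntegral ε (fun t => (G t).im) x := by
        refine (integral_im i1).symm.trans ?_
        refine integral_congr_ae (Eventually.of_forall fun y => ?_)
        simp only [RCLike.im_to_complex, Complex.im_ofReal_mul]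
        rw [mul_comm]
      rw [← z1, ← z2, Real.enorm_eq_ofReal_abs, Real.enorm_eq_ofReal_abs,
        ← ENNReal.ofReal_add (abs_nonneg _) (abs_nonneg _), ← ofReal_norm]
      exact ENNReal.ofReal_le_ofReal (Complex.norm_le_abs_re_add_abs_im Z)
    · refine (enorm_integral_le_lintegral_enorm _).trans (lintegral_mono fun y => ?_)
      simp only
      rw [enorm_mul]
      gcongr
      rw [← ofReal_norm, Complex.norm_real]
      exact ENNReal.ofReal_le_ofReal (abs_truncatedKernel_sub_le hΛ (x - y))
  have c1 := continuous_conjPoissonIntegral hre hε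
  have c2 := continuous_conjPoissonIntegral him hε
  have l1 : ∫⁻ t, ‖(G t).re‖ₑ ^ p ≤ ∫⁻ t, ‖G t‖ₑ ^ p := by
    refine lintegral_mono fun t => ?_
    gcongr
    rw [enorm_le_iff_norm_le]
    exact Complex.abs_re_le_norm _
  have l2 : ∫⁻ t, ‖(G t).im‖ₑ ^ p ≤ ∫⁻ t, ‖G t‖ₑ ^ p := by
    refine lintegral_mono fun t => ?_
    gcongr
    rw [enorm_le_iff_norm_le]
    exact Complex.abs_im_le_norm _
  set N := ∫⁻ t, ‖G t‖ₑ ^ p with hN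
  set q1 := fun x => ‖conjPoissonIntegral ε (fun t => (G t).re) x‖ₑ with hq1
  set q2 := fun x => ‖conjPoissonIntegral ε (fun t => (G t).im) x‖ₑ with hq2
  have m1 : Measurable q1 := c1.measurable.enorm
  have m2 : Measurable q2 := c2.measurable.enorm
  calc _ ≤ ∫⁻ x, 2 ^ (p - 1) * (2 ^ (p - 1) * (q1 x ^ p + q2 x ^ p) +
        (∫⁻ y, w (x - y) * ‖G y‖ₑ) ^ p) := by
        refine lintegral_mono fun x => ?_
        refine (ENNReal.rpow_le_rpow (hpt x) hp0.le).trans ?_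
        refine (ENNReal.rpow_add_le_mul_rpow_add_rpow _ _ hp.le).trans ?_
        gcongr
        exact ENNReal.rpow_add_le_mul_rpow_add_rpow _ _ hp.le
    _ = 2 ^ (p - 1) * (2 ^ (p - 1) * ((∫⁻ x, q1 x ^ p) + ∫⁻ x, q2 x ^ p) +
        ∫⁻ x, (∫⁻ y, w (x - y) * ‖G y‖ₑ) ^ p) := by
        rw [lintegral_const_mul _ (by fun_prop), lintegral_add_left (by fun_prop),
          lintegral_const_mul _ (by fun_prop), lintegral_add_left (by fun_prop)]
    _ ≤ 2 ^ (p - 1) * (2 ^ (p - 1) * (C * N + C * N) + D ^ p * N) := by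
        gcongr
        · exact (hC ε hε _ M ρ hre).trans (by gcongr)
        · exact (hC ε hε _ M ρ him).trans (by gcongr)
        · refine (lintegral_convolution_rpow_le hp hwm (by fun_prop)).trans_eq ?_
          rw [hwi]
    _ = _ := by
        push_cast
        rw [ENNReal.coe_rpow_of_nonneg _ (by linarith), ENNReal.coe_rpow_of_nonneg _ (by linarith)]
        push_cast
        ring

/-! ### The decaying Bessel solution: integral formula, equation, asymptotics -/

theorem exists_add_two_rpow_le_exp (c : ℝ) {δ : ℝ} (hδ : 0 < δ) :
    ∃ C : ℝ, 0 < C ∧ ∀ x : ℝ, 0 ≤ x → (x + 2) ^ c ≤ C * Real.exp (δ * x) := by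
  -- Since x + 2 ≥ 1, the exponent may be raised to a positive one; then y ≤ e^y with y = δ(x+2)/e
  -- is raised to the power e.
  set e := max c 1 with he
  have he0 : 0 < e := lt_of_lt_of_le one_pos (le_max_right _ _)
  refine ⟨(e / δ) ^ e * Real.exp (δ * 2), by positivity, fun x hx => ?_⟩
  calc (x + 2) ^ c ≤ (x + 2) ^ e :=
        Real.rpow_le_rpow_of_exponent_le (by linarith) (le_max_left _ _)
    _ ≤ (e / δ * Real.exp (δ / e * (x + 2))) ^ e := by
        refine Real.rpow_le_rpow (by linarith) ?_ he0.le
        have h := (lt_add_one _).le.trans (Real.add_one_le_exp (δ / e * (x + 2)))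
        calc x + 2 = e / δ * (δ / e * (x + 2)) := by field_simp
          _ ≤ _ := by gcongr
    _ = _ := by
        rw [Real.mul_rpow (by positivity) (Real.exp_pos _).le, ← Real.exp_mul,
          mul_assoc _ (Real.exp (δ * 2)), ← Real.exp_add]
        congr 2
        field_simp
        ring

theorem exists_rpow_le_exp {c : ℝ} (hc : 0 ≤ c) {δ : ℝ} (hδ : 0 < δ) :
    ∃ C : ℝ, 0 < C ∧ ∀ x : ℝ, 0 ≤ x → x ^ c ≤ C * Real.exp (δ * x) := by
  obtain ⟨C, hC, h⟩ := exists_add_two_rpow_le_exp c hδ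
  exact ⟨C, hC, fun x hx => (Real.rpow_le_rpow hx (by linarith) hc).trans (h x hx)⟩

theorem integrableOn_rpow_mul_exp {b : ℝ} (hb : -1 < b) {s : ℝ} (hs : 0 < s) :
    IntegrableOn (fun u : ℝ => u ^ b * Real.exp (-(s * u))) (Ioi 0) := by
  have := integrableOn_rpow_mul_exp_neg_mul_rpow hb one_pos hs
  simpa using this

theorem integrableOn_rpow_mul_rpow_mul_exp {b : ℝ} (hb : -1 < b) (c : ℝ) {s : ℝ} (hs : 0 < s) :
    IntegrableOn (fun u : ℝ => u ^ b * (u + 2) ^ c * Real.exp (-(s * u))) (Ioi 0) := by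
  obtain ⟨C, hC, h⟩ := exists_add_two_rpow_le_exp c (half_pos hs)
  refine Integrable.mono' ((integrableOn_rpow_mul_exp hb (half_pos hs)).const_mul C)
    (Measurable.aestronglyMeasurable (by fun_prop)) ?_
  refine (ae_restrict_iff' measurableSet_Ioi).2 (Eventually.of_forall fun u (hu : 0 < u) => ?_)
  rw [Real.norm_of_nonneg (by positivity)]
  calc u ^ b * (u + 2) ^ c * Real.exp (-(s * u))
      ≤ u ^ b * (C * Real.exp (s / 2 * u)) * Real.exp (-(s * u)) := by
        gcongr
        exact h u hu.le
    _ = C * (u ^ b * (Real.exp (s / 2 * u) * Real.exp (-(s * u)))) := by ring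
    _ = _ := by
        rw [← Real.exp_add]
        congr 3
        ring

/-- The decaying solution of `k'' + (d - 1) / s k' = k` on `(0, ∞)`; up to a constant factor it is
`s ^ (1 - d / 2) * K (s)` with the modified Bessel function `K` of order `d / 2 - 1`. -/
def besselK (d s : ℝ) : ℝ :=
  ∫ u in Ioi 0, Real.exp (-(s * (1 + u))) * (u * (u + 2)) ^ ((d - 3) / 2)

theorem integrableOn_besselK {d : ℝ} (hd : 1 < d) (c : ℝ) {s : ℝ} (hs : 0 < s) :
    IntegrableOn (fun u : ℝ => (u + 2) ^ c *
      (Real.exp (-(s * (1 + u))) * (u * (u + 2)) ^ ((d - 3) / 2))) (Ioi 0) := by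
  have h := (integrableOn_rpow_mul_rpow_mul_exp (b := (d - 3) / 2) (by linarith)
    (c + (d - 3) / 2) hs).const_mul (Real.exp (-s))
  refine IntegrableOn.congr_fun h (fun u (hu : 0 < u) => ?_) measurableSet_Ioi
  rw [Real.mul_rpow hu.le (by linarith), Real.rpow_add (by linarith : 0 < u + 2),
    show -(s * (1 + u)) = -s + -(s * u) by ring, Real.exp_add]
  ring

theorem integrableOn_besselK_one {d : ℝ} (hd : 1 < d) {s : ℝ} (hs : 0 < s) :
    IntegrableOn (fun u : ℝ => Real.exp (-(s * (1 + u))) * (u * (u + 2)) ^ ((d - 3) / 2))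
      (Ioi 0) := by
  simpa using integrableOn_besselK hd 0 hs

theorem integrableOn_one_add_mul_besselK {d : ℝ} (hd : 1 < d) {s : ℝ} (hs : 0 < s) :
    IntegrableOn (fun u : ℝ => (1 + u) *
      (Real.exp (-(s * (1 + u))) * (u * (u + 2)) ^ ((d - 3) / 2))) (Ioi 0) := by
  have h := (integrableOn_besselK hd 1 hs).sub (integrableOn_besselK hd 0 hs)
  refine h.congr_fun (fun u (hu : 0 < u) => ?_) measurableSet_Ioi
  simp only [Pi.sub_apply, Real.rpow_one, Real.rpow_zero]
  ring

theorem hasDerivAt_mul_add_two (u : ℝ) : HasDerivAt (fun u : ℝ => u * (u + 2)) (2 * (1 + u)) u := by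
  have := (hasDerivAt_id u).fun_mul ((hasDerivAt_id u).add_const (2 : ℝ))
  refine this.congr_deriv ?_
  simp
  ring

theorem hasDerivAt_mul_add_two_rpow (d : ℝ) {u : ℝ} (hu : 0 < u) :
    HasDerivAt (fun u : ℝ => (u * (u + 2)) ^ ((d - 1) / 2))
      ((d - 1) * (1 + u) * (u * (u + 2)) ^ ((d - 3) / 2)) u := by
  have := (hasDerivAt_mul_add_two u).rpow_const (p := (d - 1) / 2) (Or.inl (by positivity))
  refine this.congr_deriv ?_
  rw [show (d - 1) / 2 - 1 = (d - 3) / 2 by ring]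
  ring

theorem hasDerivAt_exp_neg_mul_one_add (s u : ℝ) :
    HasDerivAt (fun u : ℝ => Real.exp (-(s * (1 + u)))) (-s * Real.exp (-(s * (1 + u)))) u := by
  have := (((hasDerivAt_id u).const_add 1).const_mul s).neg.exp
  refine this.congr_deriv ?_
  simp
  ring

theorem tendsto_exp_mul_rpow_atTop (c : ℝ) (e : ℝ) {s : ℝ} (hs : 0 < s) :
    Tendsto (fun u : ℝ => (u + 2) ^ e * (Real.exp (-(s * (1 + u))) * (u * (u + 2)) ^ c)) atTop
      (𝓝 0) := by
  obtain ⟨C, hC, h⟩ := exists_add_two_rpow_le_exp (e + c) (show 0 < s / 4 by positivity)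
  have h1 := (tendsto_rpow_mul_exp_neg_mul_atTop_nhds_zero c (s / 2) (by positivity)).const_mul C
  rw [mul_zero] at h1
  refine squeeze_zero' ?_ ?_ h1
  · filter_upwards [eventually_gt_atTop 0] with u hu
    positivity
  · filter_upwards [eventually_gt_atTop 0] with u hu
    rw [Real.mul_rpow hu.le (by linarith)]
    calc (u + 2) ^ e * (Real.exp (-(s * (1 + u))) * (u ^ c * (u + 2) ^ c))
        = (u + 2) ^ (e + c) * u ^ c * Real.exp (-(s * (1 + u))) := by
          rw [Real.rpow_add (by linarith)]; ring
      _ ≤ (C * Real.exp (s / 4 * u)) * u ^ c * Real.exp (-(s * (1 + u))) := by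
          gcongr
          exact h u hu.le
      _ = C * (u ^ c * (Real.exp (s / 4 * u) * Real.exp (-(s * (1 + u))))) := by ring
      _ ≤ C * (u ^ c * Real.exp (-(s / 2) * u)) := by
          gcongr
          rw [← Real.exp_add]
          refine Real.exp_le_exp.2 ?_
          nlinarith

/-- With t = 1 + u the factor u(u+2) is t² - 1, and (t²-1)^{(d-1)/2} has derivative (d-1) t
(t²-1)^{(d-3)/2}. Integration by parts against e^{-st} trades the factor t for a shift of d by 2. -/
theorem integral_one_add_mul_besselK {d : ℝ} (hd : 1 < d) {s : ℝ} (hs : 0 < s) :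
    ∫ u in Ioi 0, (1 + u) * (Real.exp (-(s * (1 + u))) * (u * (u + 2)) ^ ((d - 3) / 2)) =
      s / (d - 1) * besselK (d + 2) s := by
  have hd1 : 0 < d - 1 := by linarith
  have i1 := integrableOn_one_add_mul_besselK hd hs
  have i2 := integrableOn_besselK_one (by linarith : 1 < d + 2) hs
  rw [show (d + 2 - 3) / 2 = (d - 1) / 2 by ring] at i2
  have h := integral_Ioi_of_hasDerivAt_of_tendsto (a := 0)
    (f := fun u : ℝ => Real.exp (-(s * (1 + u))) * (u * (u + 2)) ^ ((d - 1) / 2))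
    (f' := fun u => (d - 1) * ((1 + u) * (Real.exp (-(s * (1 + u))) *
      (u * (u + 2)) ^ ((d - 3) / 2))) -
      s * (Real.exp (-(s * (1 + u))) * (u * (u + 2)) ^ ((d - 1) / 2))) (m := 0) ?_ ?_ ?_ ?_
  · rw [integral_sub (i1.const_mul _) (i2.const_mul _), integral_const_mul, integral_const_mul] at h
    have e0 : Real.exp (-(s * (1 + 0))) * ((0 : ℝ) * (0 + 2)) ^ ((d - 1) / 2) = 0 := by
      rw [zero_mul, Real.zero_rpow (by positivity), mul_zero]
    rw [e0] at h
    have e : besselK (d + 2) s =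
        ∫ u in Ioi 0, Real.exp (-(s * (1 + u))) * (u * (u + 2)) ^ ((d - 1) / 2) := by
      rw [besselK, show (d + 2 - 3) / 2 = (d - 1) / 2 by ring]
    rw [← e] at h
    rw [div_mul_eq_mul_div, eq_div_iff hd1.ne']
    linarith
  · refine Continuous.continuousWithinAt ?_
    have : Continuous fun u : ℝ => (u * (u + 2)) ^ ((d - 1) / 2) :=
      (by fun_prop : Continuous fun u : ℝ => u * (u + 2)).rpow_const
        fun u => Or.inr (by positivity)
    fun_prop
  · intro u (hu : 0 < u)
    refine ((hasDerivAt_exp_neg_mul_one_add s u).fun_mul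
      (hasDerivAt_mul_add_two_rpow d hu)).congr_deriv ?_
    ring
  · exact (i1.const_mul _).sub (i2.const_mul _)
  · simpa using tendsto_exp_mul_rpow_atTop ((d - 1) / 2) 0 hs

/-- Differentiation under the integral brings down the factor -(1 + u), which the preceding
integration by parts turns into dimension d + 2. Derivatives of K thus stay in the same family and
obey the same estimates. -/
theorem hasDerivAt_besselK {d : ℝ} (hd : 1 < d) {s : ℝ} (hs : 0 < s) :
    HasDerivAt (besselK d) (-(s / (d - 1) * besselK (d + 2) s)) s := by
  have h := (hasDerivAt_integral_of_dominated_loc_of_deriv_le (μ := volume.restrict (Ioi 0))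
    (F := fun s u => Real.exp (-(s * (1 + u))) * (u * (u + 2)) ^ ((d - 3) / 2))
    (F' := fun s u => -((1 + u) * (Real.exp (-(s * (1 + u))) * (u * (u + 2)) ^ ((d - 3) / 2))))
    (bound := fun u => (1 + u) * (Real.exp (-(s / 2 * (1 + u))) * (u * (u + 2)) ^ ((d - 3) / 2)))
    (Metric.ball_mem_nhds s (half_pos hs)) ?_ (integrableOn_besselK_one hd hs) ?_ ?_ ?_ ?_).2
  · rw [integral_neg, integral_one_add_mul_besselK hd hs] at h
    exact h
  · exact Eventually.of_forall fun x => Measurable.aestronglyMeasurable (by fun_prop)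
  · exact Measurable.aestronglyMeasurable (by fun_prop)
  · refine (ae_restrict_iff' measurableSet_Ioi).2 (Eventually.of_forall fun u (hu : 0 < u) x hx => ?_)
    have hx' : s / 2 < x := by
      have := (abs_lt.1 (Metric.mem_ball.1 hx)).1
      linarith
    rw [norm_neg, Real.norm_of_nonneg (by positivity)]
    gcongr
  · exact integrableOn_one_add_mul_besselK hd (half_pos hs)
  · refine Eventually.of_forall fun u x _ => ?_
    have := (((hasDerivAt_id x).mul_const (1 + u)).neg.exp).mul_const
      ((u * (u + 2)) ^ ((d - 3) / 2))
    refine this.congr_deriv ?_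
    simp
    ring

/-- The total derivative of t e^{-st} (t²-1)^{(d-1)/2} integrates to zero over t > 1, and t² =
(t²-1) + 1 separates the terms. Since K' is a multiple of s times K in dimension d + 2, this
three-term relation is the Bessel equation. -/
theorem besselK_recurrence {d : ℝ} (hd : 1 < d) {s : ℝ} (hs : 0 < s) :
    s * (s / (d + 1) * besselK (d + 4) s) = d * besselK (d + 2) s + (d - 1) * besselK d s := by
  have hd1 : 0 < d - 1 := by linarith
  have i0 := integrableOn_besselK_one hd hs
  have i2 := integrableOn_besselK_one (by linarith : 1 < d + 2) hs
  have i3 := integrableOn_one_add_mul_besselK (by linarith : 1 < d + 2) hs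
  have e3 := integral_one_add_mul_besselK (by linarith : 1 < d + 2) hs
  rw [show d + 2 - 1 = d + 1 by ring, show d + 2 + 2 = d + 4 by ring] at e3
  rw [show (d + 2 - 3) / 2 = (d - 1) / 2 by ring] at i2 i3 e3
  have h := integral_Ioi_of_hasDerivAt_of_tendsto (a := 0)
    (f := fun u : ℝ => (1 + u) * (Real.exp (-(s * (1 + u))) * (u * (u + 2)) ^ ((d - 1) / 2)))
    (f' := fun u => d * (Real.exp (-(s * (1 + u))) * (u * (u + 2)) ^ ((d - 1) / 2)) +
      (d - 1) * (Real.exp (-(s * (1 + u))) * (u * (u + 2)) ^ ((d - 3) / 2)) -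
      s * ((1 + u) * (Real.exp (-(s * (1 + u))) * (u * (u + 2)) ^ ((d - 1) / 2)))) (m := 0)
      ?_ ?_ ?_ ?_
  · rw [integral_sub ((i2.const_mul _).fun_add (i0.const_mul _)) (i3.const_mul _),
      integral_add (i2.const_mul _) (i0.const_mul _), integral_const_mul, integral_const_mul,
      integral_const_mul, e3] at h
    have e0 : (1 + 0) * (Real.exp (-(s * (1 + 0))) * ((0 : ℝ) * (0 + 2)) ^ ((d - 1) / 2)) = 0 := by
      rw [zero_mul, Real.zero_rpow (by positivity), mul_zero, mul_zero]
    rw [e0] at h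
    have e : besselK (d + 2) s =
        ∫ u in Ioi 0, Real.exp (-(s * (1 + u))) * (u * (u + 2)) ^ ((d - 1) / 2) := by
      rw [besselK, show (d + 2 - 3) / 2 = (d - 1) / 2 by ring]
    rw [← e] at h
    simp only [besselK] at h ⊢
    linarith
  · refine Continuous.continuousWithinAt ?_
    have : Continuous fun u : ℝ => (u * (u + 2)) ^ ((d - 1) / 2) :=
      (by fun_prop : Continuous fun u : ℝ => u * (u + 2)).rpow_const
        fun u => Or.inr (by positivity)
    fun_prop
  · intro u (hu : 0 < u)
    have := ((hasDerivAt_id u).const_add 1).fun_mul ((hasDerivAt_exp_neg_mul_one_add s u).fun_mul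
      (hasDerivAt_mul_add_two_rpow d hu))
    refine this.congr_deriv ?_
    have e : (u * (u + 2)) ^ ((d - 1) / 2) = (u * (u + 2)) ^ ((d - 3) / 2) * (u * (u + 2)) := by
      rw [← Real.rpow_add_one (by positivity)]
      congr 1
      ring
    simp only [id, e]
    ring
  · exact ((i2.const_mul _).add (i0.const_mul _)).sub (i3.const_mul _)
  · have h1 := (tendsto_exp_mul_rpow_atTop ((d - 1) / 2) 1 hs).sub
      (tendsto_exp_mul_rpow_atTop ((d - 1) / 2) 0 hs)
    rw [sub_zero] at h1
    refine h1.congr fun u => ?_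
    simp only [Real.rpow_one, Real.rpow_zero]
    ring

theorem besselK_pos {d : ℝ} (hd : 1 < d) {s : ℝ} (hs : 0 < s) : 0 < besselK d s := by
  refine (setIntegral_pos_iff_support_of_nonneg_ae ?_ (integrableOn_besselK_one hd hs)).2 ?_
  · refine (ae_restrict_iff' measurableSet_Ioi).2 (Eventually.of_forall fun u (hu : 0 < u) => ?_)
    simp only [Pi.zero_apply]
    positivity
  · have : Ioi (0 : ℝ) ⊆ Function.support (fun u : ℝ => Real.exp (-(s * (1 + u))) *
        (u * (u + 2)) ^ ((d - 3) / 2)) ∩ Ioi 0 := by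
      intro u (hu : 0 < u)
      refine ⟨?_, hu⟩
      rw [Function.mem_support]
      positivity
    exact lt_of_lt_of_le (by simp) (measure_mono this)

/-- The equation `(s ^ (d - 1) k')' = s ^ (d - 1) k`. -/
theorem hasDerivAt_rpow_mul_deriv_besselK {d : ℝ} (hd : 1 < d) {s : ℝ} (hs : 0 < s) :
    HasDerivAt (fun s => s ^ (d - 1) * -(s / (d - 1) * besselK (d + 2) s))
      (s ^ (d - 1) * besselK d s) s := by
  have h1 := (Real.hasDerivAt_rpow_const (x := s) (p := d) (Or.inl hs.ne')).fun_mul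
    (hasDerivAt_besselK (by linarith : 1 < d + 2) hs)
  have h2 := h1.const_mul (-(1 / (d - 1)))
  have hd1 : d - 1 ≠ 0 := by linarith
  have hd2 : d + 1 ≠ 0 := by linarith
  have e : s ^ d = s ^ (d - 1) * s := by
    rw [← Real.rpow_add_one hs.ne', sub_add_cancel]
  refine (h2.congr_of_eventuallyEq ?_).congr_deriv ?_
  · filter_upwards [eventually_gt_nhds hs] with x hx
    rw [show x ^ d = x ^ (d - 1) * x by rw [← Real.rpow_add_one hx.ne', sub_add_cancel]]
    field_simp
  · have hr := besselK_recurrence hd hs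
    rw [show d + 2 - 1 = d + 1 by ring, show d + 2 + 2 = d + 4 by ring, e]
    calc _ = 1 / (d - 1) * s ^ (d - 1) *
        (s * (s / (d + 1) * besselK (d + 4) s) - d * besselK (d + 2) s) := by ring
      _ = _ := by rw [hr]; field_simp; ring

/-- The amplitude `s ^ ((d - 1) / 2) * exp s * besselK d s`. -/
def besselAmp (d s : ℝ) : ℝ :=
  ∫ v in Ioi 0, Real.exp (-v) * v ^ ((d - 3) / 2) * (v / s + 2) ^ ((d - 3) / 2)

/-- The substitution v = su isolates e^{-s} s^{-(d-1)/2}; the remaining amplitude converges to a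
positive constant at infinity. -/
theorem besselK_eq_amp (d : ℝ) {s : ℝ} (hs : 0 < s) :
    besselK d s = Real.exp (-s) * s ^ (-((d - 1) / 2)) * besselAmp d s := by
  have h := integral_comp_mul_left_Ioi (fun v : ℝ => Real.exp (-v) * (v / s) ^ ((d - 3) / 2) *
    (v / s + 2) ^ ((d - 3) / 2)) 0 hs
  rw [mul_zero] at h
  have e1 : besselK d s = Real.exp (-s) * ∫ u in Ioi 0, Real.exp (-(s * u)) *
      (s * u / s) ^ ((d - 3) / 2) * (s * u / s + 2) ^ ((d - 3) / 2) := by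
    rw [besselK, ← integral_const_mul]
    refine setIntegral_congr_fun measurableSet_Ioi fun u (hu : 0 < u) => ?_
    rw [mul_div_cancel_left₀ _ hs.ne', Real.mul_rpow hu.le (by linarith),
      show -(s * (1 + u)) = -s + -(s * u) by ring, Real.exp_add]
    ring
  rw [e1, h, besselAmp, mul_assoc, smul_eq_mul, ← integral_const_mul (s⁻¹),
    ← integral_const_mul (s ^ (-((d - 1) / 2)))]
  congr 1
  refine setIntegral_congr_fun measurableSet_Ioi fun (v : ℝ) (hv : 0 < v) => ?_
  rw [Real.div_rpow hv.le hs.le]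
  have : s⁻¹ * (s ^ ((d - 3) / 2))⁻¹ = s ^ (-((d - 1) / 2)) := by
    rw [← Real.rpow_neg hs.le, ← Real.rpow_neg_one, ← Real.rpow_add hs]
    congr 1
    ring
  rw [← this, div_eq_mul_inv]
  ring

theorem integrableOn_besselAmp {d : ℝ} (hd : 1 < d) {s : ℝ} (hs : 0 < s) :
    IntegrableOn (fun v : ℝ => Real.exp (-v) * v ^ ((d - 3) / 2) * (v / s + 2) ^ ((d - 3) / 2))
      (Ioi 0) := by
  have h := (integrableOn_rpow_mul_rpow_mul_exp (b := (d - 3) / 2) (by linarith)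
    ((d - 3) / 2) hs)
  have h2 := (integrableOn_Ioi_comp_mul_left_iff (fun v : ℝ => v ^ ((d - 3) / 2) *
    (v + 2) ^ ((d - 3) / 2) * Real.exp (-(s * v))) 0 (inv_pos.2 hs)).2 (by simpa using h)
  refine IntegrableOn.congr_fun (h2.const_mul (s ^ ((d - 3) / 2))) (fun v (hv : 0 < v) => ?_)
    measurableSet_Ioi
  rw [Real.mul_rpow (by positivity) hv.le, Real.inv_rpow hs.le, mul_inv_cancel_left₀ hs.ne',
    inv_mul_eq_div]
  have : s ^ ((d - 3) / 2) ≠ 0 := by positivity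
  field_simp

theorem integrableOn_exp_mul_rpow_mul_rpow {b : ℝ} (hb : -1 < b) (c : ℝ) :
    IntegrableOn (fun v : ℝ => Real.exp (-v) * v ^ b * (v + 2) ^ c) (Ioi 0) := by
  refine (integrableOn_rpow_mul_rpow_mul_exp hb c one_pos).congr_fun (fun v _ => ?_)
    measurableSet_Ioi
  simp only [one_mul]
  ring

/-- Since (v/s + 2)^b = s^{-b} (v + 2s)^b, only (v + 2s)^b has to be bounded uniformly, at the cost
of half of the exponential in s. -/
theorem exists_besselAmp_le {d : ℝ} (hd : 2 < d) :
    ∃ C : ℝ, 0 < C ∧ ∀ s : ℝ, 0 < s →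
      besselAmp d s ≤ C * s ^ (-((d - 3) / 2)) * Real.exp (s / 2) := by
  set b := (d - 3) / 2 with hb
  -- For b ≥ 0 the power is absorbed into exponentials. For b ≤ 0 it is at most v^b, and v^{2b} =
  -- v^{d-3} is integrable at 0 exactly because d > 2.
  have key : ∃ (K e : ℝ), 0 < K ∧ -1 < e ∧ ∀ s v : ℝ, 0 < s → 0 < v →
      v ^ b * (v + 2 * s) ^ b ≤ K * v ^ e * Real.exp (v / 4) * Real.exp (s / 2) := by
    rcases le_total 0 b with h0 | h0
    · obtain ⟨K, hK, h⟩ := exists_rpow_le_exp h0 (show (0 : ℝ) < 1 / 4 by norm_num)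
      refine ⟨K, b, hK, by linarith, fun s v hs hv => ?_⟩
      calc v ^ b * (v + 2 * s) ^ b ≤ v ^ b * (K * Real.exp (1 / 4 * (v + 2 * s))) := by
            gcongr
            exact h _ (by positivity)
        _ = _ := by
            rw [show 1 / 4 * (v + 2 * s) = v / 4 + s / 2 by ring, Real.exp_add]
            ring
    · refine ⟨1, b + b, one_pos, by linarith, fun s v hs hv => ?_⟩
      have h1 : (v + 2 * s) ^ b ≤ v ^ b :=
        Real.rpow_le_rpow_of_nonpos hv (by linarith) h0
      have h2 : 1 ≤ Real.exp (v / 4) := Real.one_le_exp (by positivity)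
      have h3 : 1 ≤ Real.exp (s / 2) := Real.one_le_exp (by positivity)
      calc v ^ b * (v + 2 * s) ^ b ≤ v ^ b * v ^ b := by gcongr
        _ = v ^ (b + b) * 1 * 1 := by rw [Real.rpow_add hv]; ring
        _ ≤ v ^ (b + b) * Real.exp (v / 4) * Real.exp (s / 2) := by gcongr
        _ = _ := by ring
  obtain ⟨K, e, hK, he, h⟩ := key
  have hi := integrableOn_rpow_mul_exp he (show (0 : ℝ) < 3 / 4 by norm_num)
  set D := ∫ v in Ioi 0, v ^ e * Real.exp (-(3 / 4 * v)) with hD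
  have hD0 : 0 ≤ D := setIntegral_nonneg measurableSet_Ioi fun v (hv : 0 < v) => by positivity
  refine ⟨K * D + 1, by positivity, fun s hs => ?_⟩
  have hle : besselAmp d s ≤ ∫ v in Ioi 0, (K * s ^ (-b) * Real.exp (s / 2)) *
      (v ^ e * Real.exp (-(3 / 4 * v))) := by
    refine setIntegral_mono_on (integrableOn_besselAmp (by linarith) hs) (hi.const_mul _)
      measurableSet_Ioi fun v (hv : 0 < v) => ?_
    have e1 : (v / s + 2) ^ b = s ^ (-b) * (v + 2 * s) ^ b := by
      rw [show v / s + 2 = s⁻¹ * (v + 2 * s) by field_simp, Real.mul_rpow (by positivity)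
        (by positivity), Real.inv_rpow hs.le, Real.rpow_neg hs.le]
    rw [e1]
    calc Real.exp (-v) * v ^ b * (s ^ (-b) * (v + 2 * s) ^ b)
        = Real.exp (-v) * s ^ (-b) * (v ^ b * (v + 2 * s) ^ b) := by ring
      _ ≤ Real.exp (-v) * s ^ (-b) * (K * v ^ e * Real.exp (v / 4) * Real.exp (s / 2)) := by
          exact mul_le_mul_of_nonneg_left (h s v hs hv) (by positivity)
      _ = (K * s ^ (-b) * Real.exp (s / 2)) * (v ^ e * (Real.exp (-v) * Real.exp (v / 4))) := by
          ring
      _ = _ := by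
          rw [← Real.exp_add]
          congr 3
          ring
  refine hle.trans ?_
  rw [integral_const_mul]
  have : 0 < s ^ (-b) * Real.exp (s / 2) := by positivity
  nlinarith

theorem integral_exp_mul_pos {d : ℝ} {φ : ℝ → ℝ} (hφ : ∀ v, 0 < v → 0 < φ v)
    (hi : IntegrableOn (fun v : ℝ => Real.exp (-v) * v ^ ((d - 3) / 2) * φ v) (Ioi 0)) :
    0 < ∫ v in Ioi 0, Real.exp (-v) * v ^ ((d - 3) / 2) * φ v := by
  have hpos : ∀ v : ℝ, 0 < v → 0 < Real.exp (-v) * v ^ ((d - 3) / 2) * φ v := fun v hv => by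
    have := hφ v hv
    positivity
  refine (setIntegral_pos_iff_support_of_nonneg_ae ?_ hi).2 ?_
  · exact (ae_restrict_iff' measurableSet_Ioi).2
      (Eventually.of_forall fun u (hu : 0 < u) => (hpos u hu).le)
  · have : Ioi (0 : ℝ) ⊆ Function.support (fun v : ℝ => Real.exp (-v) *
        v ^ ((d - 3) / 2) * φ v) ∩ Ioi 0 := fun u hu => ⟨(hpos u hu).ne', hu⟩
    exact lt_of_lt_of_le (by simp) (measure_mono this)

/-- For s ≤ 1 the number v + 2s lies between v and v + 2, so (v + 2s)^b is at least the smaller of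
the two end values, whatever the sign of b. -/
theorem exists_le_besselAmp_of_le_one {d : ℝ} (hd : 2 < d) :
    ∃ c : ℝ, 0 < c ∧ ∀ s : ℝ, 0 < s → s ≤ 1 → c * s ^ (-((d - 3) / 2)) ≤ besselAmp d s := by
  set b := (d - 3) / 2 with hb
  have hi : IntegrableOn (fun v : ℝ => Real.exp (-v) * v ^ b * min (v ^ b) ((v + 2) ^ b))
      (Ioi 0) := by
    refine (integrableOn_exp_mul_rpow_mul_rpow (b := b) (by linarith) b).mono'
      (Measurable.aestronglyMeasurable (by fun_prop)) ?_
    refine (ae_restrict_iff' measurableSet_Ioi).2 (Eventually.of_forall fun v (hv : 0 < v) => ?_)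
    rw [Real.norm_of_nonneg (by positivity)]
    gcongr
    exact min_le_right _ _
  refine ⟨_, integral_exp_mul_pos
    (fun v hv => by positivity : ∀ v : ℝ, 0 < v → 0 < min (v ^ b) ((v + 2) ^ b)) hi,
    fun s hs hs1 => ?_⟩
  rw [← integral_mul_const]
  refine setIntegral_mono_on (hi.mul_const _) (integrableOn_besselAmp (by linarith) hs)
      measurableSet_Ioi fun v (hv : 0 < v) => ?_
  have e1 : (v / s + 2) ^ b = (v + 2 * s) ^ b * s ^ (-b) := by
    rw [show v / s + 2 = s⁻¹ * (v + 2 * s) by field_simp, Real.mul_rpow (by positivity)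
      (by positivity), Real.inv_rpow hs.le, Real.rpow_neg hs.le, mul_comm]
  rw [e1, ← mul_assoc]
  gcongr
  rcases le_total 0 b with h0 | h0
  · exact (min_le_left _ _).trans (Real.rpow_le_rpow hv.le (by linarith) h0)
  · exact (min_le_right _ _).trans (Real.rpow_le_rpow_of_nonpos (by positivity) (by linarith) h0)

/-- For s ≥ 1 the number v/s + 2 lies between 2 and v + 2; again the smaller end value is a lower
bound for either sign of b. -/
theorem exists_le_besselAmp_of_one_le {d : ℝ} (hd : 2 < d) :
    ∃ c : ℝ, 0 < c ∧ ∀ s : ℝ, 1 ≤ s → c ≤ besselAmp d s := by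
  set b := (d - 3) / 2 with hb
  have hi : IntegrableOn (fun v : ℝ => Real.exp (-v) * v ^ b * min (2 ^ b) ((v + 2) ^ b))
      (Ioi 0) := by
    refine (integrableOn_exp_mul_rpow_mul_rpow (b := b) (by linarith) b).mono'
      (Measurable.aestronglyMeasurable (by fun_prop)) ?_
    refine (ae_restrict_iff' measurableSet_Ioi).2 (Eventually.of_forall fun v (hv : 0 < v) => ?_)
    rw [Real.norm_of_nonneg (by positivity)]
    gcongr
    exact min_le_right _ _
  refine ⟨_, integral_exp_mul_pos
    (fun v hv => by positivity : ∀ v : ℝ, 0 < v → 0 < min (2 ^ b) ((v + 2) ^ b)) hi,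
    fun s hs => ?_⟩
  have hs0 : 0 < s := by linarith
  refine setIntegral_mono_on hi (integrableOn_besselAmp (by linarith) hs0)
      measurableSet_Ioi fun v (hv : 0 < v) => ?_
  gcongr
  rcases le_total 0 b with h0 | h0
  · exact (min_le_left _ _).trans (Real.rpow_le_rpow (by norm_num)
      (by linarith [div_pos hv hs0]) h0)
  · refine (min_le_right _ _).trans (Real.rpow_le_rpow_of_nonpos (by positivity) ?_ h0)
    linarith [div_le_self hv.le hs]

/-- The limit of `besselAmp d` at infinity. -/
def besselConst (d : ℝ) : ℝ := 2 ^ ((d - 3) / 2) * Real.Gamma ((d - 1) / 2)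

theorem besselConst_pos {d : ℝ} (hd : 2 < d) : 0 < besselConst d :=
  mul_pos (by positivity) (Real.Gamma_pos_of_pos (by linarith))

/-- The amplitude of -K' is the amplitude in dimension d + 2 divided by d - 1, so this identity says
that K and -K' have the same leading asymptotics. -/
theorem besselConst_add_two {d : ℝ} (hd : 2 < d) :
    besselConst (d + 2) = (d - 1) * besselConst d := by
  rw [besselConst, besselConst, show (d + 2 - 1) / 2 = (d - 1) / 2 + 1 by ring,
    Real.Gamma_add_one (by linarith), show (d + 2 - 3) / 2 = (d - 3) / 2 + 1 by ring,
    Real.rpow_add_one (by norm_num)]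
  ring

theorem abs_two_add_rpow_sub_le (b : ℝ) {x v : ℝ} (hx : 0 ≤ x) (hxv : x ≤ v) :
    |(x + 2) ^ b - 2 ^ b| ≤ |b| * (v + 2) ^ |b| * x := by
  have h := (convex_Icc (0 : ℝ) x).norm_image_sub_le_of_norm_hasDerivWithin_le
    (f := fun y => (y + 2) ^ b) (f' := fun y => b * (y + 2) ^ (b - 1))
    (C := |b| * (v + 2) ^ |b|) (x := 0) (y := x) ?_ ?_ ⟨le_rfl, hx⟩ ⟨hx, le_rfl⟩
  · rw [zero_add, sub_zero, Real.norm_eq_abs, Real.norm_eq_abs, abs_of_nonneg hx] at h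
    exact h
  · intro y hy
    have := ((hasDerivAt_id y).add_const (2 : ℝ)).rpow_const (p := b)
      (Or.inl (by simp only [id]; linarith [hy.1]))
    simpa using this.hasDerivWithinAt
  · intro y hy
    have hy2 : 0 < y + 2 := by linarith [hy.1]
    rw [norm_mul, Real.norm_eq_abs, Real.norm_of_nonneg (by positivity)]
    gcongr
    calc (y + 2) ^ (b - 1) ≤ (y + 2) ^ |b| :=
          Real.rpow_le_rpow_of_exponent_le (by linarith [hy.1]) (by linarith [le_abs_self b])
      _ ≤ (v + 2) ^ |b| :=
          Real.rpow_le_rpow hy2.le (by linarith [hy.2]) (abs_nonneg _)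

/-- The limit is the same integral with v/s + 2 replaced by 2, which is a Gamma integral. The mean
value theorem bounds the difference by v/s times a power of v + 2, integrable against e^{-v}. -/
theorem exists_abs_besselAmp_sub_le {d : ℝ} (hd : 2 < d) :
    ∃ C : ℝ, 0 < C ∧ ∀ s : ℝ, 1 ≤ s → |besselAmp d s - besselConst d| ≤ C / s := by
  set b := (d - 3) / 2 with hb
  have h1 : -1 < b := by linarith
  have hi := integrableOn_exp_mul_rpow_mul_rpow (b := b + 1) (by linarith) |b|
  set D := ∫ v in Ioi 0, Real.exp (-v) * v ^ (b + 1) * (v + 2) ^ |b| with hD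
  have hD0 : 0 ≤ D := setIntegral_nonneg measurableSet_Ioi fun v (hv : 0 < v) => by positivity
  refine ⟨|b| * D + 1, by positivity, fun s hs => ?_⟩
  have hs0 : 0 < s := by linarith
  have hc : besselConst d = ∫ v in Ioi 0, Real.exp (-v) * v ^ b * 2 ^ b := by
    rw [integral_mul_const, besselConst, Real.Gamma_eq_integral (by linarith), mul_comm]
    congr 3
    funext v
    congr 2
    rw [hb]; ring
  have hic : IntegrableOn (fun v : ℝ => Real.exp (-v) * v ^ b * 2 ^ b) (Ioi 0) := by
    have := (integrableOn_exp_mul_rpow_mul_rpow h1 0).mul_const (2 ^ b)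
    simp only [Real.rpow_zero, mul_one] at this
    exact this
  rw [hc, besselAmp, ← integral_sub (integrableOn_besselAmp (by linarith) hs0) hic]
  calc ‖∫ v in Ioi 0, (Real.exp (-v) * v ^ b * (v / s + 2) ^ b - Real.exp (-v) * v ^ b * 2 ^ b)‖
      ≤ ∫ v in Ioi 0, (|b| / s) * (Real.exp (-v) * v ^ (b + 1) * (v + 2) ^ |b|) := by
        refine norm_integral_le_of_norm_le (hi.const_mul _) ?_
        refine (ae_restrict_iff' measurableSet_Ioi).2
          (Eventually.of_forall fun v (hv : 0 < v) => ?_)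
        rw [← mul_sub, norm_mul, Real.norm_of_nonneg (by positivity), Real.norm_eq_abs]
        calc _ ≤ Real.exp (-v) * v ^ b * (|b| * (v + 2) ^ |b| * (v / s)) := by
              gcongr
              exact abs_two_add_rpow_sub_le b (by positivity) (div_le_self hv.le hs)
          _ = _ := by
              rw [Real.rpow_add_one hv.ne']
              ring
    _ = |b| / s * D := by rw [integral_const_mul]
    _ ≤ _ := by
        rw [div_mul_eq_mul_div]
        gcongr
        linarith

/-! ### Limits with rate 1/s, and the growing solution by reduction of order -/

/-- `f s = L + O(1 / s)` on `[1, ∞)`. -/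
def HasLimitRate (f : ℝ → ℝ) (L : ℝ) : Prop :=
  ∃ C : ℝ, 0 < C ∧ ∀ s : ℝ, 1 ≤ s → |f s - L| ≤ C / s

theorem HasLimitRate.exists_bound {f : ℝ → ℝ} {L : ℝ} (hf : HasLimitRate f L) :
    ∃ C : ℝ, 0 < C ∧ ∀ s : ℝ, 1 ≤ s → |f s| ≤ C := by
  obtain ⟨C, hC, h⟩ := hf
  refine ⟨C + |L|, by positivity, fun s hs => ?_⟩
  have h1 := h s hs
  have h2 : C / s ≤ C := div_le_self hC.le hs
  have h3 := abs_sub_abs_le_abs_sub (f s) L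
  linarith

theorem HasLimitRate.mul {f g : ℝ → ℝ} {L M : ℝ} (hf : HasLimitRate f L) (hg : HasLimitRate g M) :
    HasLimitRate (fun s => f s * g s) (L * M) := by
  obtain ⟨B, hB, hb⟩ := hf.exists_bound
  obtain ⟨C, hC, h⟩ := hf
  obtain ⟨D, hD, h'⟩ := hg
  refine ⟨B * D + |M| * C, by positivity, fun s hs => ?_⟩
  calc |f s * g s - L * M| = |f s * (g s - M) + M * (f s - L)| := by ring_nf
    _ ≤ |f s| * |g s - M| + |M| * |f s - L| := by
        rw [← abs_mul, ← abs_mul]; exact abs_add_le _ _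
    _ ≤ B * (D / s) + |M| * (C / s) := by
        gcongr
        · exact hb s hs
        · exact h' s hs
        · exact h s hs
    _ = _ := by ring

theorem HasLimitRate.sub {f g : ℝ → ℝ} {L M : ℝ} (hf : HasLimitRate f L) (hg : HasLimitRate g M) :
    HasLimitRate (fun s => f s - g s) (L - M) := by
  obtain ⟨C, hC, h⟩ := hf
  obtain ⟨D, hD, h'⟩ := hg
  refine ⟨C + D, by positivity, fun s hs => ?_⟩
  calc |f s - g s - (L - M)| = |(f s - L) - (g s - M)| := by ring_nf
    _ ≤ |f s - L| + |g s - M| := abs_sub _ _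
    _ ≤ C / s + D / s := add_le_add (h s hs) (h' s hs)
    _ = _ := by ring

theorem HasLimitRate.inv {f : ℝ → ℝ} {L c : ℝ} (hf : HasLimitRate f L) (hL : 0 < L) (hc : 0 < c)
    (h0 : ∀ s, 1 ≤ s → c ≤ f s) : HasLimitRate (fun s => (f s)⁻¹) L⁻¹ := by
  obtain ⟨C, hC, h⟩ := hf
  refine ⟨C / (c * L), by positivity, fun s hs => ?_⟩
  have hfs := h0 s hs
  have hfs0 : 0 < f s := by linarith
  have e : (f s)⁻¹ - L⁻¹ = -(f s - L) / (f s * L) := by field_simp; ring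
  rw [e, abs_div, abs_neg, abs_of_pos (by positivity : 0 < f s * L)]
  calc |f s - L| / (f s * L) ≤ (C / s) / (c * L) := by
        gcongr
        exact h s hs
    _ = _ := by ring

theorem HasLimitRate.congr {f g : ℝ → ℝ} {L : ℝ} (hf : HasLimitRate f L)
    (h : ∀ s, 1 ≤ s → g s = f s) : HasLimitRate g L := by
  obtain ⟨C, hC, h'⟩ := hf
  exact ⟨C, hC, fun s hs => by rw [h s hs]; exact h' s hs⟩

/-- Minus the derivative of `besselK`. -/
def besselKD (d s : ℝ) : ℝ := s / (d - 1) * besselK (d + 2) s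

/-- The amplitude of `besselKD`. -/
def besselAmpD (d s : ℝ) : ℝ := besselAmp (d + 2) s / (d - 1)

/-- The integrating factor `1 / (s ^ (d - 1) k ^ 2)` of reduction of order. -/
def besselW (d s : ℝ) : ℝ := Real.exp (2 * s) * (besselAmp d s ^ 2)⁻¹

/-- The quotient of the growing and the decaying solution. -/
def besselM (d s : ℝ) : ℝ := ∫ σ in Ioc 0 s, besselW d σ

theorem besselM_eq (d : ℝ) {s : ℝ} (hs : 0 ≤ s) : besselM d s = ∫ σ in (0)..s, besselW d σ := by
  rw [besselM, intervalIntegral.integral_of_le hs]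

/-- The solution of `i'' + (d - 1) / s i' = i` regular at the origin, normalized by
`s ^ (d - 1) (i' k - i k') = 1`. -/
def besselI (d s : ℝ) : ℝ := besselK d s * besselM d s

/-- The derivative of `besselI`. -/
def besselID (d s : ℝ) : ℝ := s ^ (1 - d) / besselK d s - besselKD d s * besselM d s

theorem besselAmp_pos {d : ℝ} (hd : 2 < d) {s : ℝ} (hs : 0 < s) : 0 < besselAmp d s := by
  have h := besselK_pos (by linarith : 1 < d) hs
  rw [besselK_eq_amp d hs] at h
  exact (mul_pos_iff_of_pos_left (by positivity)).1 h

theorem besselKD_pos {d : ℝ} (hd : 2 < d) {s : ℝ} (hs : 0 < s) : 0 < besselKD d s := by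
  have h := besselK_pos (by linarith : 1 < d + 2) hs
  have : 0 < d - 1 := by linarith
  unfold besselKD
  positivity

theorem besselKD_eq_amp (d : ℝ) {s : ℝ} (hs : 0 < s) :
    besselKD d s = Real.exp (-s) * s ^ (-((d - 1) / 2)) * besselAmpD d s := by
  rw [besselKD, besselAmpD, besselK_eq_amp _ hs,
    show -((d - 1) / 2) = -((d + 2 - 1) / 2) + 1 by ring, Real.rpow_add_one hs.ne']
  ring

theorem hasDerivAt_besselK_neg {d : ℝ} (hd : 2 < d) {s : ℝ} (hs : 0 < s) :
    HasDerivAt (besselK d) (-besselKD d s) s :=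
  hasDerivAt_besselK (by linarith) hs

theorem hasDerivAt_rpow_mul_besselKD {d : ℝ} (hd : 2 < d) {s : ℝ} (hs : 0 < s) :
    HasDerivAt (fun s => s ^ (d - 1) * besselKD d s) (-(s ^ (d - 1) * besselK d s)) s := by
  have := (hasDerivAt_rpow_mul_deriv_besselK (by linarith : 1 < d) hs).neg
  refine this.congr_of_eventuallyEq (Eventually.of_forall fun x => ?_)
  simp [besselKD]

theorem besselW_eq {d : ℝ} (hd : 2 < d) {s : ℝ} (hs : 0 < s) : besselW d s = s ^ (1 - d) / besselK d s ^ 2 := by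
  have h := besselAmp_pos hd hs
  have e1 : s ^ (1 - d) = (s ^ (-((d - 1) / 2))) ^ 2 := by
    rw [← Real.rpow_natCast, ← Real.rpow_mul hs.le]
    congr 1
    push_cast
    ring
  rw [besselW, besselK_eq_amp d hs, e1, mul_pow, mul_pow, ← Real.exp_nat_mul,
    show 2 * s = -((2 : ℕ) * -s) by push_cast; ring, Real.exp_neg]
  have h1 : (s ^ (-((d - 1) / 2))) ≠ 0 := by positivity
  field_simp

theorem continuousOn_besselK {d : ℝ} (hd : 2 < d) : ContinuousOn (besselK d) (Ioi 0) := fun _ hs =>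
  (hasDerivAt_besselK (by linarith : 1 < d) hs).continuousAt.continuousWithinAt

theorem continuousOn_besselW {d : ℝ} (hd : 2 < d) : ContinuousOn (besselW d) (Ioi 0) := by
  have h : ContinuousOn (fun s => s ^ (1 - d) / besselK d s ^ 2) (Ioi 0) := by
    refine ContinuousOn.div ?_ ((continuousOn_besselK hd).pow 2) fun s hs =>
      (pow_pos (besselK_pos (by linarith : 1 < d) hs) 2).ne'
    exact continuousOn_id.rpow_const fun s hs => Or.inl (ne_of_gt hs)
  exact h.congr fun s hs => besselW_eq hd hs

theorem besselW_pos {d : ℝ} (hd : 2 < d) {s : ℝ} (hs : 0 < s) : 0 < besselW d s := by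
  have h := besselAmp_pos hd hs
  unfold besselW
  positivity

theorem exists_besselW_le {d : ℝ} (hd : 2 < d) : ∃ C : ℝ, 0 < C ∧ ∀ s : ℝ, 0 < s → s ≤ 1 →
    besselW d s ≤ C * s ^ (d - 3) := by
  obtain ⟨c, hc, h⟩ := exists_le_besselAmp_of_le_one hd
  refine ⟨Real.exp 2 * (c ^ 2)⁻¹, by positivity, fun s hs hs1 => ?_⟩
  have h1 := h s hs hs1
  have h2 : 0 < c * s ^ (-((d - 3) / 2)) := by positivity
  have e : s ^ (d - 3) = ((s ^ (-((d - 3) / 2))) ^ 2)⁻¹ := by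
    rw [← Real.rpow_natCast, ← Real.rpow_mul hs.le, ← Real.rpow_neg hs.le]
    congr 1
    push_cast
    ring
  rw [besselW, e]
  calc Real.exp (2 * s) * (besselAmp d s ^ 2)⁻¹
      ≤ Real.exp 2 * ((c * s ^ (-((d - 3) / 2))) ^ 2)⁻¹ := by
        gcongr
        linarith
    _ = _ := by rw [mul_pow, mul_inv]; ring

/-- The integrating factor is O(s^{d-3}) at the origin, so reduction of order can start from 0
because d > 2. This choice selects the solution regular at the origin. -/
theorem intervalIntegrable_besselW {d : ℝ} (hd : 2 < d) {s : ℝ} (hs : 0 < s) :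
    IntervalIntegrable (besselW d) volume 0 s := by
  obtain ⟨C, hC, h⟩ := exists_besselW_le hd
  have h1 : IntervalIntegrable (besselW d) volume 0 1 := by
    refine IntervalIntegrable.mono_fun' (g := fun s => C * s ^ (d - 3))
      ((intervalIntegral.intervalIntegrable_rpow' (by linarith)).const_mul C) ?_ ?_
    · rw [uIoc_of_le zero_le_one]
      exact ((continuousOn_besselW hd).mono Ioc_subset_Ioi_self).aestronglyMeasurable
        measurableSet_Ioc
    · rw [uIoc_of_le zero_le_one]
      refine (ae_restrict_iff' measurableSet_Ioc).2 (Eventually.of_forall fun s hs => ?_)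
      simp only
      rw [Real.norm_of_nonneg (besselW_pos hd hs.1).le]
      exact h s hs.1 hs.2
  refine h1.trans (ContinuousOn.intervalIntegrable ?_)
  refine (continuousOn_besselW hd).mono fun x hx => ?_
  exact lt_of_lt_of_le (lt_min one_pos hs) hx.1

theorem hasDerivAt_besselM {d : ℝ} (hd : 2 < d) {s : ℝ} (hs : 0 < s) : HasDerivAt (besselM d) (besselW d s) s := by
  refine HasDerivAt.congr_of_eventuallyEq (f := fun s => ∫ σ in (0)..s, besselW d σ) ?_
    ((eventually_gt_nhds hs).mono fun x hx => besselM_eq d hx.le)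
  refine intervalIntegral.integral_hasDerivAt_right (intervalIntegrable_besselW hd hs) ?_
    ((continuousOn_besselW hd).continuousAt (Ioi_mem_nhds hs))
  exact (continuousOn_besselW hd).stronglyMeasurableAtFilter isOpen_Ioi s hs

theorem besselM_nonneg {d : ℝ} (hd : 2 < d) (s : ℝ) : 0 ≤ besselM d s :=
  setIntegral_nonneg measurableSet_Ioc fun _ hx => (besselW_pos hd hx.1).le

theorem exists_besselM_le {d : ℝ} (hd : 2 < d) : ∃ C : ℝ, 0 < C ∧ ∀ s : ℝ, 0 < s → s ≤ 1 →
    besselM d s ≤ C * s ^ (d - 2) := by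
  obtain ⟨C, hC, h⟩ := exists_besselW_le hd
  have hd2 : 0 < d - 2 := by linarith
  refine ⟨C / (d - 2), by positivity, fun s hs hs1 => ?_⟩
  have hi : IntervalIntegrable (fun s => C * s ^ (d - 3)) volume 0 s :=
    (intervalIntegral.intervalIntegrable_rpow' (by linarith)).const_mul C
  calc besselM d s ≤ ∫ σ in (0)..s, C * σ ^ (d - 3) := by
        rw [besselM_eq d hs.le]
        refine intervalIntegral.integral_mono_on_of_le_Ioo hs.le (intervalIntegrable_besselW hd hs)
          hi fun x hx => h x hx.1 (by linarith [hx.2])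
    _ = _ := by
        rw [intervalIntegral.integral_const_mul, integral_rpow (Or.inl (by linarith)),
          show d - 3 + 1 = d - 2 by ring, Real.zero_rpow hd2.ne']
        ring

theorem hasLimitRate_besselAmp {d : ℝ} (hd : 2 < d) : HasLimitRate (besselAmp d) (besselConst d) :=
  exists_abs_besselAmp_sub_le hd

theorem hasLimitRate_besselAmpD {d : ℝ} (hd : 2 < d) : HasLimitRate (besselAmpD d) (besselConst d) := by
  obtain ⟨C, hC, h⟩ := exists_abs_besselAmp_sub_le (by linarith : 2 < d + 2)
  have hd1 : 0 < d - 1 := by linarith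
  refine ⟨C / (d - 1), by positivity, fun s hs => ?_⟩
  have h1 := h s hs
  rw [besselConst_add_two hd] at h1
  have e : besselAmpD d s - besselConst d =
      (besselAmp (d + 2) s - (d - 1) * besselConst d) / (d - 1) := by
    rw [besselAmpD]; field_simp
  rw [e, abs_div, abs_of_pos hd1]
  calc _ ≤ C / s / (d - 1) := by gcongr
    _ = _ := by ring

/-- Here W(σ) = e^{2σ} (c⁻² + O(1/σ)) with c = `besselConst d`. The main part integrates to
e^{2s}/(2c²), and the error together with everything below σ = 1 contributes O(e^{2s}/s). -/
theorem hasLimitRate_besselM {d : ℝ} (hd : 2 < d) :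
    HasLimitRate (fun s => Real.exp (-(2 * s)) * besselM d s) ((2 * besselConst d ^ 2)⁻¹) := by
  obtain ⟨c, hc, hlow⟩ := exists_le_besselAmp_of_one_le hd
  have hrate : HasLimitRate (fun s => (besselAmp d s ^ 2)⁻¹) ((besselConst d ^ 2)⁻¹) := by
    have := ((hasLimitRate_besselAmp hd).mul (hasLimitRate_besselAmp hd)).inv
      (mul_pos (besselConst_pos hd) (besselConst_pos hd)) (mul_pos hc hc) fun s hs => by
        have := hlow s hs
        exact mul_le_mul this this hc.le (by linarith)
    simpa only [← sq] using this
  obtain ⟨C, hC, h⟩ := hrate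
  set L := (besselConst d ^ 2)⁻¹ with hL
  have hL0 : 0 < L := by
    have := besselConst_pos hd
    positivity
  set B := |besselM d 1| + L * Real.exp 2 + C with hB
  refine ⟨B, by positivity, fun s hs => ?_⟩
  have hs0 : 0 < s := by linarith
  have hsub : besselM d s - besselM d 1 = ∫ σ in (1)..s, besselW d σ := by
    rw [besselM_eq d hs0.le, besselM_eq d zero_le_one]
    exact intervalIntegral.integral_interval_sub_left (intervalIntegrable_besselW hd hs0)
      (intervalIntegrable_besselW hd one_pos)
  have hcw : ContinuousOn (besselW d) (uIcc 1 s) := (continuousOn_besselW hd).mono fun x hx => by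
    rw [uIcc_of_le hs] at hx
    exact lt_of_lt_of_le one_pos hx.1
  have hce : Continuous fun σ : ℝ => Real.exp (2 * σ) * L := by fun_prop
  have hexp : ∫ σ in (1)..s, Real.exp (2 * σ) * L = (Real.exp (2 * s) - Real.exp 2) * (L / 2) := by
    have := intervalIntegral.integral_eq_sub_of_hasDerivAt
      (f := fun σ => Real.exp (2 * σ) * (L / 2)) (f' := fun σ => Real.exp (2 * σ) * L)
      (a := 1) (b := s) (fun x _ => by
        have := (((hasDerivAt_id x).const_mul 2).exp).mul_const (L / 2)
        refine this.congr_deriv ?_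
        simp; ring) (hce.intervalIntegrable _ _)
    rw [this]
    ring_nf
  -- The derivative of e^{2σ}/σ. For σ ≥ 1 it dominates e^{2σ}/σ, so the error ∫ e^{2σ}/σ is bounded
  -- without evaluating an exponential integral.
  have hcf : ContinuousOn (fun σ : ℝ => Real.exp (2 * σ) * (2 / σ - 1 / σ ^ 2)) (uIcc 1 s) := by
    rw [uIcc_of_le hs]
    refine ContinuousOn.mul (by fun_prop) (ContinuousOn.sub ?_ ?_)
    · exact continuousOn_const.div continuousOn_id fun x hx => by linarith [hx.1]
    · exact continuousOn_const.div (by fun_prop) fun x hx => pow_ne_zero 2 (by linarith [hx.1])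
  have hF := intervalIntegral.integral_eq_sub_of_hasDerivAt
      (f := fun σ => Real.exp (2 * σ) / σ) (f' := fun σ => Real.exp (2 * σ) * (2 / σ - 1 / σ ^ 2))
      (a := 1) (b := s) (fun x hx => by
        rw [uIcc_of_le hs] at hx
        have hx0 : x ≠ 0 := by linarith [hx.1]
        have := (((hasDerivAt_id x).const_mul 2).exp).fun_div (hasDerivAt_id x) hx0
        refine this.congr_deriv ?_
        simp; field_simp) hcf.intervalIntegrable
  have herr : |∫ σ in (1)..s, (besselW d σ - Real.exp (2 * σ) * L)| ≤ C * (Real.exp (2 * s) / s) := by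
    calc ‖∫ σ in (1)..s, (besselW d σ - Real.exp (2 * σ) * L)‖
        ≤ ∫ σ in (1)..s, C * (Real.exp (2 * σ) * (2 / σ - 1 / σ ^ 2)) := by
          refine intervalIntegral.norm_integral_le_of_norm_le hs ?_
            (hcf.intervalIntegrable.const_mul C)
          refine Eventually.of_forall fun σ hσ => ?_
          have hσ0 : 0 < σ := by linarith [hσ.1]
          rw [besselW, ← mul_sub, norm_mul, Real.norm_of_nonneg (Real.exp_pos _).le,
            Real.norm_eq_abs]
          calc _ ≤ Real.exp (2 * σ) * (C / σ) := by
                gcongr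
                exact h σ hσ.1.le
            _ ≤ Real.exp (2 * σ) * (C * (2 / σ - 1 / σ ^ 2)) := by
                gcongr
                rw [div_eq_mul_one_div]
                gcongr
                have : 1 / σ ^ 2 ≤ 1 / σ := by
                  refine one_div_le_one_div_of_le hσ0 ?_
                  nlinarith [hσ.1]
                have e : 2 / σ = 1 / σ + 1 / σ := by ring
                linarith
            _ = _ := by ring
      _ = C * (Real.exp (2 * s) / s - Real.exp (2 * 1) / 1) := by
          rw [intervalIntegral.integral_const_mul, hF]
      _ ≤ _ := by
          gcongr
          exact sub_le_self _ (by positivity)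
  rw [intervalIntegral.integral_sub hcw.intervalIntegrable (hce.intervalIntegrable _ _), ← hsub,
    hexp] at herr
  have hE : 0 < Real.exp (2 * s) := Real.exp_pos _
  have hL2 : (2 * besselConst d ^ 2)⁻¹ = L / 2 := by rw [mul_inv, hL]; ring
  have key : Real.exp (-(2 * s)) * besselM d s - (2 * besselConst d ^ 2)⁻¹ = Real.exp (-(2 * s)) *
      ((besselM d s - besselM d 1 - (Real.exp (2 * s) - Real.exp 2) * (L / 2)) +
        (besselM d 1 - Real.exp 2 * (L / 2))) := by
    rw [hL2, Real.exp_neg]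
    field_simp
    ring
  rw [key, abs_mul, abs_of_pos (Real.exp_pos _), Real.exp_neg, inv_mul_le_iff₀ hE]
  have hEs : 1 ≤ Real.exp (2 * s) / s := by
    rw [le_div_iff₀ hs0]
    linarith [Real.add_one_le_exp (2 * s)]
  calc _ ≤ C * (Real.exp (2 * s) / s) + |besselM d 1 - Real.exp 2 * (L / 2)| :=
        (abs_add_le _ _).trans (add_le_add herr le_rfl)
    _ ≤ C * (Real.exp (2 * s) / s) + (|besselM d 1| + L * Real.exp 2) := by
        gcongr
        refine (abs_sub _ _).trans ?_
        gcongr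
        rw [abs_of_pos (by positivity)]
        nlinarith [Real.exp_pos 2]
    _ ≤ C * (Real.exp (2 * s) / s) + (|besselM d 1| + L * Real.exp 2) * (Real.exp (2 * s) / s) := by
        gcongr
        exact le_mul_of_one_le_right (by positivity) hEs
    _ = _ := by rw [hB]; ring

theorem measurable_besselK (d : ℝ) : Measurable (besselK d) := by
  refine (StronglyMeasurable.integral_prod_right (ν := volume.restrict (Ioi 0)) (f := fun s u =>
    Real.exp (-(s * (1 + u))) * (u * (u + 2)) ^ ((d - 3) / 2)) ?_).measurable
  exact Measurable.stronglyMeasurable (by fun_prop)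

theorem measurable_besselAmp (d : ℝ) : Measurable (besselAmp d) := by
  refine (StronglyMeasurable.integral_prod_right (ν := volume.restrict (Ioi 0)) (f := fun s v =>
    Real.exp (-v) * v ^ ((d - 3) / 2) * (v / s + 2) ^ ((d - 3) / 2)) ?_).measurable
  exact Measurable.stronglyMeasurable (by fun_prop)

theorem measurable_besselM (d : ℝ) : Measurable (besselM d) := by
  have h := measurable_besselAmp d
  have e : besselM d = fun s => ∫ σ, {z : ℝ × ℝ | 0 < z.2 ∧ z.2 ≤ z.1}.indicator
      (fun z => besselW d z.2) (s, σ) := by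
    funext s
    rw [besselM, ← integral_indicator measurableSet_Ioc]
    rfl
  rw [e]
  refine (StronglyMeasurable.integral_prod_right' ?_).measurable
  refine Measurable.stronglyMeasurable (Measurable.indicator ?_ ?_)
  · unfold besselW
    fun_prop
  · exact (measurableSet_lt measurable_const measurable_snd).inter
      (measurableSet_le measurable_snd measurable_fst)

theorem measurable_besselKD (d : ℝ) : Measurable (besselKD d) := by
  have := measurable_besselK (d + 2)
  unfold besselKD
  fun_prop

theorem measurable_besselI (d : ℝ) : Measurable (besselI d) :=
  (measurable_besselK d).mul (measurable_besselM d)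

theorem measurable_besselID (d : ℝ) : Measurable (besselID d) := by
  have := measurable_besselK d
  have := measurable_besselKD d
  have := measurable_besselM d
  unfold besselID
  fun_prop

theorem besselI_nonneg {d : ℝ} (hd : 2 < d) {s : ℝ} (hs : 0 < s) : 0 ≤ besselI d s :=
  mul_nonneg (besselK_pos (by linarith : 1 < d) hs).le (besselM_nonneg hd s)

theorem besselI_wronskian {d : ℝ} (hd : 2 < d) {s : ℝ} (hs : 0 < s) :
    besselID d s * besselK d s + besselI d s * besselKD d s = s ^ (1 - d) := by
  have h := besselK_pos (by linarith : 1 < d) hs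
  rw [besselID, besselI]
  field_simp
  ring

theorem hasDerivAt_besselI {d : ℝ} (hd : 2 < d) {s : ℝ} (hs : 0 < s) :
    HasDerivAt (besselI d) (besselID d s) s := by
  have h := besselK_pos (by linarith : 1 < d) hs
  refine ((hasDerivAt_besselK_neg hd hs).fun_mul (hasDerivAt_besselM hd hs)).congr_deriv ?_
  rw [besselW_eq hd hs, besselID]
  field_simp
  ring

/-- The equation `(s ^ (d - 1) i')' = s ^ (d - 1) i`. -/
theorem hasDerivAt_rpow_mul_besselID {d : ℝ} (hd : 2 < d) {s : ℝ} (hs : 0 < s) :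
    HasDerivAt (fun s => s ^ (d - 1) * besselID d s) (s ^ (d - 1) * besselI d s) s := by
  have h := besselK_pos (by linarith : 1 < d) hs
  have h1 := ((hasDerivAt_besselK_neg hd hs).inv h.ne').sub
    ((hasDerivAt_rpow_mul_besselKD hd hs).fun_mul (hasDerivAt_besselM hd hs))
  have e : ∀ x : ℝ, 0 < x → x ^ (d - 1) * x ^ (1 - d) = 1 := fun x hx => by
    rw [← Real.rpow_add hx]; simp
  refine (h1.congr_of_eventuallyEq ?_).congr_deriv ?_
  · filter_upwards [eventually_gt_nhds hs] with x hx
    have hk := besselK_pos (by linarith : 1 < d) hx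
    simp only [besselID, Pi.sub_apply, Pi.inv_apply]
    rw [mul_sub, mul_div_assoc', e x hx, one_div]
    ring
  · rw [besselW_eq hd hs, besselI]
    have e1 := e s hs
    calc _ = besselKD d s / besselK d s ^ 2 + s ^ (d - 1) * (besselK d s * besselM d s) -
        (s ^ (d - 1) * s ^ (1 - d)) * (besselKD d s / besselK d s ^ 2) := by ring
      _ = _ := by rw [e1]; ring

theorem exists_besselK_le {d : ℝ} (hd : 2 < d) : ∃ C : ℝ, 0 < C ∧ ∀ s : ℝ, 0 < s →
    besselK d s ≤ C * s ^ (2 - d) * Real.exp (-(s / 2)) := by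
  obtain ⟨C, hC, h⟩ := exists_besselAmp_le hd
  refine ⟨C, hC, fun s hs => ?_⟩
  rw [besselK_eq_amp d hs]
  calc _ ≤ Real.exp (-s) * s ^ (-((d - 1) / 2)) * (C * s ^ (-((d - 3) / 2)) * Real.exp (s / 2)) := by
        gcongr
        exact h s hs
    _ = C * (s ^ (-((d - 1) / 2)) * s ^ (-((d - 3) / 2))) * (Real.exp (-s) * Real.exp (s / 2)) := by
        ring
    _ = _ := by
        rw [← Real.rpow_add hs, ← Real.exp_add]
        congr 3 <;> ring

theorem exists_besselKD_le {d : ℝ} (hd : 2 < d) : ∃ C : ℝ, 0 < C ∧ ∀ s : ℝ, 0 < s →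
    besselKD d s ≤ C * s ^ (1 - d) * Real.exp (-(s / 2)) := by
  obtain ⟨C, hC, h⟩ := exists_besselK_le (by linarith : 2 < d + 2)
  have hd1 : 0 < d - 1 := by linarith
  refine ⟨C / (d - 1), by positivity, fun s hs => ?_⟩
  rw [besselKD]
  calc _ ≤ s / (d - 1) * (C * s ^ (2 - (d + 2)) * Real.exp (-(s / 2))) := by
        gcongr
        exact h s hs
    _ = _ := by
        rw [show 1 - d = 2 - (d + 2) + 1 by ring, Real.rpow_add_one hs.ne']
        ring

theorem exists_le_besselKD {d : ℝ} (hd : 2 < d) : ∃ c : ℝ, 0 < c ∧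
    (∀ s : ℝ, 0 < s → s ≤ 1 → c * s ^ (1 - d) ≤ besselKD d s) ∧
    ∀ s : ℝ, 1 ≤ s → c ≤ besselAmpD d s := by
  obtain ⟨c, hc, h⟩ := exists_le_besselAmp_of_le_one (by linarith : 2 < d + 2)
  obtain ⟨c', hc', h'⟩ := exists_le_besselAmp_of_one_le (by linarith : 2 < d + 2)
  have hd1 : 0 < d - 1 := by linarith
  refine ⟨min (Real.exp (-1) * c) c' / (d - 1), by positivity, fun s hs hs1 => ?_, fun s hs => ?_⟩
  · rw [besselKD_eq_amp d hs, besselAmpD]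
    calc _ ≤ Real.exp (-1) * c / (d - 1) * s ^ (1 - d) := by
          gcongr
          exact min_le_left _ _
      _ = Real.exp (-1) * s ^ (-((d - 1) / 2)) * (c * s ^ (-((d + 2 - 3) / 2)) / (d - 1)) := by
          rw [show 1 - d = -((d - 1) / 2) + -((d + 2 - 3) / 2) by ring, Real.rpow_add hs]
          ring
      _ ≤ _ := by
          gcongr
          exact h s hs hs1
  · rw [besselAmpD]
    gcongr
    exact (min_le_right _ _).trans (h' s hs)

theorem exists_besselI_le_of_le_one {d : ℝ} (hd : 2 < d) : ∃ C : ℝ, 0 < C ∧ ∀ s : ℝ, 0 < s →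
    s ≤ 1 → besselI d s ≤ C := by
  obtain ⟨C, hC, h⟩ := exists_besselK_le hd
  obtain ⟨D, hD, h'⟩ := exists_besselM_le hd
  refine ⟨C * D, by positivity, fun s hs hs1 => ?_⟩
  have e : s ^ (2 - d) * s ^ (d - 2) = 1 := by rw [← Real.rpow_add hs]; simp
  calc besselI d s ≤ (C * s ^ (2 - d) * Real.exp (-(s / 2))) * (D * s ^ (d - 2)) :=
        mul_le_mul (h s hs) (h' s hs hs1) (besselM_nonneg hd s) (by positivity)
    _ = C * D * (s ^ (2 - d) * s ^ (d - 2)) * Real.exp (-(s / 2)) := by ring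
    _ ≤ C * D * 1 * 1 := by
        rw [e]
        gcongr
        exact Real.exp_le_one_iff.2 (by linarith)
    _ = C * D := by ring

/-- The initial condition of the regular solution. By reduction of order s^{d-1} I' = 1/K -
s^{d-1}(-K') M, and both terms are O(s^{d-2}). With it, the equation (s^{d-1} I')' = s^{d-1} I can
be integrated from 0. -/
theorem tendsto_rpow_mul_besselID {d : ℝ} (hd : 2 < d) :
    Tendsto (fun s => s ^ (d - 1) * besselID d s) (𝓝[>] 0) (𝓝 0) := by
  obtain ⟨c, hc, h⟩ := exists_le_besselAmp_of_le_one hd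
  obtain ⟨C, hC, hM⟩ := exists_besselM_le hd
  obtain ⟨D, hD, hK⟩ := exists_besselKD_le hd
  have hlim : Tendsto (fun s : ℝ => (Real.exp 1 / c + D * C) * s ^ (d - 2)) (𝓝[>] 0) (𝓝 0) := by
    have : ContinuousAt (fun s : ℝ => (Real.exp 1 / c + D * C) * s ^ (d - 2)) 0 :=
      continuousAt_const.mul (Real.continuousAt_rpow_const _ _ (Or.inr (by linarith)))
    have h2 := this.tendsto
    rw [Real.zero_rpow (by linarith), mul_zero] at h2
    exact h2.mono_left nhdsWithin_le_nhds
  refine squeeze_zero_norm' ?_ hlim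
  filter_upwards [Ioc_mem_nhdsGT (zero_lt_one' ℝ)] with s hs
  obtain ⟨hs, hs1⟩ := hs
  have hk := besselK_pos (by linarith : 1 < d) hs
  have e1 : s ^ (d - 1) * s ^ (1 - d) = 1 := by rw [← Real.rpow_add hs]; simp
  have hkl : (besselK d s)⁻¹ ≤ Real.exp 1 / c * s ^ (d - 2) := by
    rw [besselK_eq_amp d hs, inv_le_iff_one_le_mul₀ (by
      rw [← besselK_eq_amp d hs]; exact hk)]
    have h1 : 1 ≤ Real.exp 1 * Real.exp (-s) := by
      rw [← Real.exp_add]; exact Real.one_le_exp (by linarith)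
    have e2 : s ^ (d - 2) * s ^ (-((d - 1) / 2)) * s ^ (-((d - 3) / 2)) = 1 := by
      rw [← Real.rpow_add hs, ← Real.rpow_add hs,
        show d - 2 + -((d - 1) / 2) + -((d - 3) / 2) = 0 by ring, Real.rpow_zero]
    calc 1 ≤ Real.exp 1 * Real.exp (-s) := h1
      _ = Real.exp 1 / c * s ^ (d - 2) * (Real.exp (-s) * s ^ (-((d - 1) / 2)) *
          (c * s ^ (-((d - 3) / 2)))) := by
          rw [show Real.exp 1 / c * s ^ (d - 2) * (Real.exp (-s) * s ^ (-((d - 1) / 2)) *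
            (c * s ^ (-((d - 3) / 2)))) = (Real.exp 1 * Real.exp (-s)) * (c / c) *
            (s ^ (d - 2) * s ^ (-((d - 1) / 2)) * s ^ (-((d - 3) / 2))) by ring, e2,
            div_self hc.ne']
          ring
      _ ≤ _ := by
          gcongr
          exact h s hs hs1
  have hkd : s ^ (d - 1) * besselKD d s ≤ D := by
    calc _ ≤ s ^ (d - 1) * (D * s ^ (1 - d) * Real.exp (-(s / 2))) := by
          gcongr
          exact hK s hs
      _ = D * (s ^ (d - 1) * s ^ (1 - d)) * Real.exp (-(s / 2)) := by ring
      _ ≤ D * 1 * 1 := by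
          rw [e1]
          gcongr
          exact Real.exp_le_one_iff.2 (by linarith)
      _ = D := by ring
  have hkd0 := besselKD_pos hd hs
  have hM0 := besselM_nonneg hd s
  have e3 : s ^ (d - 1) * besselID d s =
      (besselK d s)⁻¹ - (s ^ (d - 1) * besselKD d s) * besselM d s := by
    rw [besselID, mul_sub, mul_div_assoc', e1, one_div]
    ring
  rw [e3, Real.norm_eq_abs]
  refine (abs_sub _ _).trans ?_
  rw [abs_of_pos (inv_pos.2 hk), abs_of_nonneg (by positivity), add_mul]
  refine add_le_add hkl ?_
  rw [mul_assoc D]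
  exact mul_le_mul hkd (hM s hs hs1) hM0 hD.le

/-- The formula for I' is a difference, so its sign is not visible; but s^{d-1} I' increases,
because I ≥ 0, and starts from 0. -/
theorem besselID_nonneg {d : ℝ} (hd : 2 < d) {s : ℝ} (hs : 0 < s) : 0 ≤ besselID d s := by
  have hmono : MonotoneOn (fun s => s ^ (d - 1) * besselID d s) (Ioi 0) := by
    refine monotoneOn_of_hasDerivWithinAt_nonneg (f' := fun s => s ^ (d - 1) * besselI d s)
      (convex_Ioi 0) (fun s hs =>
        (hasDerivAt_rpow_mul_besselID hd hs).continuousAt.continuousWithinAt) ?_ ?_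
    · rw [interior_Ioi]
      exact fun x hx => (hasDerivAt_rpow_mul_besselID hd hx).hasDerivWithinAt
    · rw [interior_Ioi]
      intro x hx
      have := besselI_nonneg hd hx
      have hx' : 0 < x := hx
      positivity
  have h : 0 ≤ s ^ (d - 1) * besselID d s := by
    refine le_of_tendsto (tendsto_rpow_mul_besselID hd) ?_
    filter_upwards [Ioc_mem_nhdsGT hs] with x hx
    exact hmono hx.1 hs hx.2
  exact nonneg_of_mul_nonneg_right h (by positivity)

/-- With I ≤ C near the origin, s^{d-1} I' grows no faster than C s^d/d. -/
theorem exists_besselID_le_of_le_one {d : ℝ} (hd : 2 < d) : ∃ C : ℝ, 0 < C ∧ ∀ s : ℝ, 0 < s →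
    s ≤ 1 → besselID d s ≤ C * s := by
  obtain ⟨C, hC, h⟩ := exists_besselI_le_of_le_one hd
  have hd0 : 0 < d := by linarith
  refine ⟨C / d, by positivity, fun s hs hs1 => ?_⟩
  have hder : ∀ x : ℝ, 0 < x → HasDerivAt (fun s => C / d * s ^ d - s ^ (d - 1) * besselID d s)
      (C * x ^ (d - 1) - x ^ (d - 1) * besselI d x) x := fun x hx => by
    have h1 := (Real.hasDerivAt_rpow_const (x := x) (p := d) (Or.inl hx.ne')).const_mul (C / d)
    refine (h1.fun_sub (hasDerivAt_rpow_mul_besselID hd hx)).congr_deriv ?_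
    field_simp
  have hmono : MonotoneOn (fun s => C / d * s ^ d - s ^ (d - 1) * besselID d s) (Ioc 0 1) := by
    refine monotoneOn_of_hasDerivWithinAt_nonneg
      (f' := fun x => C * x ^ (d - 1) - x ^ (d - 1) * besselI d x)
      (convex_Ioc 0 1) (fun s hs => (hder s hs.1).continuousAt.continuousWithinAt) ?_ ?_
    · rw [interior_Ioc]
      exact fun x hx => (hder x hx.1).hasDerivWithinAt
    · rw [interior_Ioc]
      intro x hx
      have h2 := h x hx.1 hx.2.le
      have hx' : 0 < x ^ (d - 1) := Real.rpow_pos_of_pos hx.1 _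
      nlinarith
  have hlim : Tendsto (fun s : ℝ => C / d * s ^ d - s ^ (d - 1) * besselID d s) (𝓝[>] 0) (𝓝 0) := by
    have : ContinuousAt (fun s : ℝ => C / d * s ^ d) 0 :=
      continuousAt_const.mul (Real.continuousAt_rpow_const _ _ (Or.inr hd0.le))
    have h2 := this.tendsto
    rw [Real.zero_rpow hd0.ne', mul_zero] at h2
    simpa using (h2.mono_left nhdsWithin_le_nhds).sub (tendsto_rpow_mul_besselID hd)
  have h0 : 0 ≤ C / d * s ^ d - s ^ (d - 1) * besselID d s := by
    refine le_of_tendsto hlim ?_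
    filter_upwards [Ioc_mem_nhdsGT hs] with x hx
    exact hmono ⟨hx.1, hx.2.trans hs1⟩ ⟨hs, hs1⟩ hx.2
  have e : s ^ d = s ^ (d - 1) * s := by
    rw [← Real.rpow_add_one hs.ne', sub_add_cancel]
  rw [e] at h0
  have : 0 ≤ s ^ (d - 1) * (C / d * s - besselID d s) := by linarith
  linarith [nonneg_of_mul_nonneg_right this (by positivity)]

theorem hasLimitRate_besselI {d : ℝ} (hd : 2 < d) :
    HasLimitRate (fun s => s ^ ((d - 1) / 2) * Real.exp (-s) * besselI d s)
      ((2 * besselConst d)⁻¹) := by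
  have hc := besselConst_pos hd
  have h := (hasLimitRate_besselAmp hd).mul (hasLimitRate_besselM hd)
  rw [show besselConst d * (2 * besselConst d ^ 2)⁻¹ = (2 * besselConst d)⁻¹ by field_simp] at h
  refine h.congr fun s hs => ?_
  have hs0 : 0 < s := by linarith
  have e : s ^ ((d - 1) / 2) * s ^ (-((d - 1) / 2)) = 1 := by rw [← Real.rpow_add hs0]; simp
  rw [besselI, besselK_eq_amp d hs0, show -(2 * s) = -s + -s by ring, Real.exp_add]
  calc _ = (s ^ ((d - 1) / 2) * s ^ (-((d - 1) / 2))) * (besselAmp d s *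
      (Real.exp (-s) * Real.exp (-s) * besselM d s)) := by ring
    _ = _ := by rw [e, one_mul]

/-- Both terms of I' are of leading order and do not cancel: with c = `besselConst d` the limits are
1/c and c · 1/(2c²) = 1/(2c). -/
theorem hasLimitRate_besselID {d : ℝ} (hd : 2 < d) :
    HasLimitRate (fun s => s ^ ((d - 1) / 2) * Real.exp (-s) * besselID d s)
      ((2 * besselConst d)⁻¹) := by
  have hc := besselConst_pos hd
  obtain ⟨c, hc', hlow⟩ := exists_le_besselAmp_of_one_le hd
  have h := ((hasLimitRate_besselAmp hd).inv hc hc' hlow).sub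
    ((hasLimitRate_besselAmpD hd).mul (hasLimitRate_besselM hd))
  rw [show (besselConst d)⁻¹ - besselConst d * (2 * besselConst d ^ 2)⁻¹ = (2 * besselConst d)⁻¹ by
    field_simp; norm_num] at h
  refine h.congr fun s hs => ?_
  have hs0 : 0 < s := by linarith
  have e : s ^ ((d - 1) / 2) * s ^ (-((d - 1) / 2)) = 1 := by rw [← Real.rpow_add hs0]; simp
  have e2 : s ^ (1 - d) = s ^ (-((d - 1) / 2)) * s ^ (-((d - 1) / 2)) := by
    rw [← Real.rpow_add hs0]; congr 1; ring
  have ha := besselAmp_pos hd hs0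
  have hx : 0 < s ^ (-((d - 1) / 2)) := by positivity
  have hE := Real.exp_pos (-s)
  rw [besselID, besselKD_eq_amp d hs0, besselK_eq_amp d hs0, e2,
    show -(2 * s) = -s + -s by ring, Real.exp_add, mul_sub]
  congr 1
  · calc _ = (s ^ ((d - 1) / 2) * s ^ (-((d - 1) / 2))) * (besselAmp d s)⁻¹ := by field_simp
      _ = _ := by rw [e, one_mul]
  · calc _ = (s ^ ((d - 1) / 2) * s ^ (-((d - 1) / 2))) * (besselAmpD d s *
      (Real.exp (-s) * Real.exp (-s) * besselM d s)) := by ring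
      _ = _ := by rw [e, one_mul]

theorem exists_le_exp_of_hasLimitRate {d : ℝ} (hd : 2 < d) {f : ℝ → ℝ} {L C : ℝ}
    (h : HasLimitRate (fun s => s ^ ((d - 1) / 2) * Real.exp (-s) * f s) L) (hC : 0 < C)
    (h1 : ∀ s : ℝ, 0 < s → s ≤ 1 → f s ≤ C) :
    ∃ D : ℝ, 0 < D ∧ ∀ s : ℝ, 0 < s → f s ≤ D * Real.exp s := by
  obtain ⟨B, hB, hb⟩ := h.exists_bound
  refine ⟨B + C, by positivity, fun s hs => ?_⟩
  have hE := Real.exp_pos s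
  rcases le_total s 1 with h2 | h2
  · have := h1 s hs h2
    have h3 : 1 ≤ Real.exp s := Real.one_le_exp hs.le
    nlinarith
  · have h3 := (le_abs_self _).trans (hb s h2)
    have h4 : 1 ≤ s ^ ((d - 1) / 2) := Real.one_le_rpow h2 (by linarith)
    rcases le_total (f s) 0 with h5 | h5
    · exact h5.trans (by positivity)
    · have : Real.exp (-s) * f s ≤ B := by
        refine le_trans ?_ h3
        rw [mul_assoc]
        exact le_mul_of_one_le_left (by positivity) h4
      rw [Real.exp_neg, inv_mul_le_iff₀ hE] at this
      nlinarith

theorem exists_besselI_le {d : ℝ} (hd : 2 < d) : ∃ C : ℝ, 0 < C ∧ ∀ s : ℝ, 0 < s →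
    besselI d s ≤ C * Real.exp s := by
  obtain ⟨C, hC, h⟩ := exists_besselI_le_of_le_one hd
  exact exists_le_exp_of_hasLimitRate hd (hasLimitRate_besselI hd) hC h

theorem exists_besselID_le {d : ℝ} (hd : 2 < d) : ∃ C : ℝ, 0 < C ∧ ∀ s : ℝ, 0 < s →
    besselID d s ≤ C * Real.exp s := by
  obtain ⟨C, hC, h⟩ := exists_besselID_le_of_le_one hd
  refine exists_le_exp_of_hasLimitRate hd (hasLimitRate_besselID hd) hC fun s hs hs1 => ?_
  exact (h s hs hs1).trans (mul_le_of_le_one_right hC.le hs1)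

/-- For s ≥ 1 both factors have rate O(1/s). For s ≤ 1 comparability forces t ≤ 16, and a crude
bound on the product gives O(1). The number 16 is the ratio allowed between neighbouring blocks of
base 4. -/
theorem HasLimitRate.mul_near {f g : ℝ → ℝ} {L M B : ℝ} (hf : HasLimitRate f L)
    (hg : HasLimitRate g M)
    (hB : ∀ s t, 0 < s → s ≤ 1 → s ≤ t → t ≤ 16 → |f s * g t| ≤ B) :
    ∃ C : ℝ, 0 < C ∧ ∀ s t : ℝ, 0 < s → s ≤ t → t ≤ 16 * s →
      |f s * g t - L * M| ≤ C * min 1 (1 / s) := by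
  obtain ⟨A, hA, ha⟩ := hf.exists_bound
  obtain ⟨C, hC, h⟩ := hf
  obtain ⟨D, hD, h'⟩ := hg
  refine ⟨(A * D + |M| * C) + (|B| + |L * M|), by positivity, fun s t hs hst ht => ?_⟩
  rcases le_total s 1 with h1 | h1
  · rw [min_eq_left (by rw [le_div_iff₀ hs]; linarith), mul_one]
    calc |f s * g t - L * M| ≤ |f s * g t| + |L * M| := abs_sub _ _
      _ ≤ |B| + |L * M| :=
          add_le_add ((hB s t hs h1 hst (by linarith)).trans (le_abs_self B)) le_rfl
      _ ≤ _ := le_add_of_nonneg_left (by positivity)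
  · rw [min_eq_right (by rw [div_le_iff₀ hs]; linarith)]
    calc |f s * g t - L * M| = |f s * (g t - M) + M * (f s - L)| := by ring_nf
      _ ≤ |f s| * |g t - M| + |M| * |f s - L| := by
          rw [← abs_mul, ← abs_mul]; exact abs_add_le _ _
      _ ≤ A * (D / s) + |M| * (C / s) := by
          gcongr
          · exact ha s h1
          · refine (h' t (h1.trans hst)).trans ?_
            gcongr
          · exact h s h1
      _ = (A * D + |M| * C) * (1 / s) := by ring
      _ ≤ _ := mul_le_mul_of_nonneg_right (le_add_of_nonneg_right (by positivity)) (by positivity)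

/-! ### The gradient kernel: leading term near the diagonal and the remainder -/

/-- The kernel, with respect to `y ^ (d - 1) dy`, of `D^* (D D^* + λ²)⁻¹` on `(0, ∞)`. -/
def gradKernel (d lam x y : ℝ) : ℝ :=
  if y < x then lam ^ (d - 1) * (besselID d (lam * y) * besselK d (lam * x))
  else -(lam ^ (d - 1) * (besselI d (lam * x) * besselKD d (lam * y)))

/-- The leading part of `gradKernel` near the diagonal. -/
def mainKernel (d lam x y : ℝ) : ℝ :=
  1 / 2 * (x ^ (-((d - 1) / 2)) * y ^ (-((d - 1) / 2))) *
    if y < x then Real.exp (-(lam * |x - y|)) else -Real.exp (-(lam * |x - y|))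

theorem exists_besselID_mul_besselK_near {d : ℝ} (hd : 2 < d) :
    ∃ C : ℝ, 0 < C ∧ ∀ s t : ℝ, 0 < s → s ≤ t → t ≤ 16 * s →
      |(s ^ ((d - 1) / 2) * Real.exp (-s) * besselID d s) * besselAmp d t - 1 / 2| ≤
        C * min 1 (1 / s) := by
  have hc := besselConst_pos hd
  obtain ⟨C, hC, h⟩ := exists_besselAmp_le hd
  obtain ⟨D, hD, h'⟩ := exists_besselID_le_of_le_one hd
  rw [show (1 : ℝ) / 2 = (2 * besselConst d)⁻¹ * besselConst d by field_simp]
  refine (hasLimitRate_besselID hd).mul_near (hasLimitRate_besselAmp hd)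
    -- With s ≤ 1 and t ≤ 16: e^{t/2} ≤ e⁸, and the powers of t combine to t ≤ 16.
    (B := D * (C * Real.exp 8) * 16) ?_
  intro s t hs hs1 hst ht
  have ht0 : 0 < t := by linarith
  have hI := besselID_nonneg hd hs
  have hA := (besselAmp_pos hd ht0).le
  have e : t ^ ((d - 1) / 2) * t ^ (-((d - 3) / 2)) = t := by
    rw [← Real.rpow_add ht0, show (d - 1) / 2 + -((d - 3) / 2) = 1 by ring, Real.rpow_one]
  rw [abs_of_nonneg (by positivity)]
  calc _ ≤ (t ^ ((d - 1) / 2) * 1 * D) * (C * t ^ (-((d - 3) / 2)) * Real.exp 8) := by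
        gcongr
        · linarith
        · exact Real.exp_le_one_iff.2 (by linarith)
        · exact (h' s hs hs1).trans (mul_le_of_le_one_right hD.le hs1)
        · refine (h t ht0).trans ?_
          gcongr
          linarith
    _ = D * (C * Real.exp 8) * (t ^ ((d - 1) / 2) * t ^ (-((d - 3) / 2))) := by ring
    _ ≤ _ := by
        rw [e]
        gcongr

theorem exists_besselI_mul_besselKD_near {d : ℝ} (hd : 2 < d) :
    ∃ C : ℝ, 0 < C ∧ ∀ s t : ℝ, 0 < s → s ≤ t → t ≤ 16 * s →
      |(s ^ ((d - 1) / 2) * Real.exp (-s) * besselI d s) * besselAmpD d t - 1 / 2| ≤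
        C * min 1 (1 / s) := by
  have hc := besselConst_pos hd
  have hd1 : 0 < d - 1 := by linarith
  obtain ⟨C, hC, h⟩ := exists_besselAmp_le (by linarith : 2 < d + 2)
  obtain ⟨D, hD, h'⟩ := exists_besselI_le_of_le_one hd
  rw [show (1 : ℝ) / 2 = (2 * besselConst d)⁻¹ * besselConst d by field_simp]
  refine (hasLimitRate_besselI hd).mul_near (hasLimitRate_besselAmpD hd)
    (B := D * (C * Real.exp 8 / (d - 1))) ?_
  intro s t hs hs1 hst ht
  have ht0 : 0 < t := by linarith
  have hI := besselI_nonneg hd hs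
  have hA := (besselAmp_pos (by linarith : 2 < d + 2) ht0).le
  have e : t ^ ((d - 1) / 2) * t ^ (-((d + 2 - 3) / 2)) = 1 := by
    rw [← Real.rpow_add ht0, show (d - 1) / 2 + -((d + 2 - 3) / 2) = 0 by ring, Real.rpow_zero]
  rw [besselAmpD, abs_of_nonneg (by positivity)]
  calc _ ≤ (t ^ ((d - 1) / 2) * 1 * D) * (C * t ^ (-((d + 2 - 3) / 2)) * Real.exp 8 / (d - 1)) := by
        gcongr
        · exact Real.exp_le_one_iff.2 (by linarith)
        · exact h' s hs hs1
        · refine (h t ht0).trans ?_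
          gcongr
          linarith
    _ = D * (C * Real.exp 8 / (d - 1)) * (t ^ ((d - 1) / 2) * t ^ (-((d + 2 - 3) / 2))) := by ring
    _ ≤ _ := by rw [e, mul_one]

theorem rpow_mul_scale {d lam x y : ℝ} (hl : 0 < lam) (hx : 0 < x) (hy : 0 < y) :
    lam ^ (d - 1) * (lam * x) ^ (-((d - 1) / 2)) * (lam * y) ^ (-((d - 1) / 2)) =
      x ^ (-((d - 1) / 2)) * y ^ (-((d - 1) / 2)) := by
  have e : lam ^ (d - 1) * lam ^ (-((d - 1) / 2)) * lam ^ (-((d - 1) / 2)) = 1 := by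
    rw [← Real.rpow_add hl, ← Real.rpow_add hl,
      show d - 1 + -((d - 1) / 2) + -((d - 1) / 2) = 0 by ring, Real.rpow_zero]
  rw [Real.mul_rpow hl.le hx.le, Real.mul_rpow hl.le hy.le]
  calc _ = (lam ^ (d - 1) * lam ^ (-((d - 1) / 2)) * lam ^ (-((d - 1) / 2))) *
      (x ^ (-((d - 1) / 2)) * y ^ (-((d - 1) / 2))) := by ring
    _ = _ := by rw [e, one_mul]

/-- Writing I, I', K, K' through their amplitudes, the powers of λ cancel and the exponentials
combine to e^{-λ|x-y|}. The product of amplitudes tends to ½ on either side of the diagonal, so the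
main kernel is antisymmetric and the correction is governed by the smaller argument. -/
theorem exists_abs_gradKernel_sub_le {d : ℝ} (hd : 2 < d) :
    ∃ C : ℝ, 0 < C ∧ ∀ lam x y : ℝ, 0 < lam → 0 < x → 0 < y → x ≤ 16 * y → y ≤ 16 * x →
      |gradKernel d lam x y - mainKernel d lam x y| ≤
        C * (x ^ (-((d - 1) / 2)) * y ^ (-((d - 1) / 2))) *
          (Real.exp (-(lam * |x - y|)) * min 1 (1 / (lam * min x y))) := by
  obtain ⟨C, hC, h⟩ := exists_besselID_mul_besselK_near hd
  obtain ⟨D, hD, h'⟩ := exists_besselI_mul_besselKD_near hd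
  refine ⟨C + D, by positivity, fun lam x y hl hx hy hxy hyx => ?_⟩
  have hlx : 0 < lam * x := by positivity
  have hly : 0 < lam * y := by positivity
  have inv : ∀ s : ℝ, 0 < s → s ^ (-((d - 1) / 2)) * Real.exp s *
      (s ^ ((d - 1) / 2) * Real.exp (-s)) = 1 := fun s hs => by
    rw [Real.rpow_neg hs.le, Real.exp_neg]
    have : s ^ ((d - 1) / 2) ≠ 0 := by positivity
    field_simp
  have hsc := rpow_mul_scale (d := d) hl hx hy
  set W := x ^ (-((d - 1) / 2)) * y ^ (-((d - 1) / 2)) with hW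
  have hW0 : 0 < W := by positivity
  by_cases hlt : y < x
  · have habs : |x - y| = x - y := abs_of_pos (by linarith)
    have h1 := h (lam * y) (lam * x) hly (by gcongr) (by nlinarith)
    set P := (lam * y) ^ ((d - 1) / 2) * Real.exp (-(lam * y)) * besselID d (lam * y) with hP
    have e1 : besselID d (lam * y) = (lam * y) ^ (-((d - 1) / 2)) * Real.exp (lam * y) * P := by
      rw [hP, ← mul_assoc, inv _ hly, one_mul]
    have e2 : gradKernel d lam x y = W * Real.exp (-(lam * |x - y|)) * (P * besselAmp d (lam * x)) := by
      rw [gradKernel, if_pos hlt, e1, besselK_eq_amp d hlx, ← hsc, habs,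
        show -(lam * (x - y)) = lam * y + -(lam * x) by ring, Real.exp_add]
      ring
    have e3 : mainKernel d lam x y = W * Real.exp (-(lam * |x - y|)) * (1 / 2) := by
      rw [mainKernel, if_pos hlt]; ring
    rw [e2, e3, ← mul_sub, abs_mul, abs_of_pos (by positivity), min_eq_right hlt.le]
    calc _ ≤ W * Real.exp (-(lam * |x - y|)) * (C * min 1 (1 / (lam * y))) := by gcongr
      _ ≤ W * Real.exp (-(lam * |x - y|)) * ((C + D) * min 1 (1 / (lam * y))) := by
          gcongr
          linarith
      _ = _ := by ring
  · have hle : x ≤ y := not_lt.1 hlt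
    have habs : |x - y| = y - x := by rw [abs_sub_comm, abs_of_nonneg (by linarith)]
    have h1 := h' (lam * x) (lam * y) hlx (by gcongr) (by nlinarith)
    set P := (lam * x) ^ ((d - 1) / 2) * Real.exp (-(lam * x)) * besselI d (lam * x) with hP
    have e1 : besselI d (lam * x) = (lam * x) ^ (-((d - 1) / 2)) * Real.exp (lam * x) * P := by
      rw [hP, ← mul_assoc, inv _ hlx, one_mul]
    have e2 : gradKernel d lam x y =
        -(W * Real.exp (-(lam * |x - y|)) * (P * besselAmpD d (lam * y))) := by
      rw [gradKernel, if_neg hlt, e1, besselKD_eq_amp d hly, ← hsc, habs,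
        show -(lam * (y - x)) = lam * x + -(lam * y) by ring, Real.exp_add]
      ring
    have e3 : mainKernel d lam x y = -(W * Real.exp (-(lam * |x - y|)) * (1 / 2)) := by
      rw [mainKernel, if_neg hlt]; ring
    rw [e2, e3, neg_sub_neg, abs_sub_comm, ← mul_sub, abs_mul, abs_of_pos (by positivity),
      min_eq_left hle]
    calc _ ≤ W * Real.exp (-(lam * |x - y|)) * (D * min 1 (1 / (lam * x))) := by gcongr
      _ ≤ W * Real.exp (-(lam * |x - y|)) * ((C + D) * min 1 (1 / (lam * x))) := by
          gcongr
          linarith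
      _ = _ := by ring

/-- Away from the diagonal I'(λy) ≤ C e^{λx/4} loses to K(λx) = O((λx)^{2-d} e^{-λx/2}). The power
of λ is written as 2 - 1 to match the Gamma integral with a = 2. -/
theorem exists_abs_gradKernel_le_of_le {d : ℝ} (hd : 2 < d) :
    ∃ C : ℝ, 0 < C ∧ ∀ lam x y : ℝ, 0 < lam → 0 < x → 0 < y → 4 * y ≤ x →
      |gradKernel d lam x y| ≤ C * x ^ (2 - d) * (lam ^ ((2 : ℝ) - 1) * Real.exp (-(x / 4 * lam))) := by
  obtain ⟨C, hC, h⟩ := exists_besselID_le hd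
  obtain ⟨D, hD, h'⟩ := exists_besselK_le hd
  refine ⟨C * D, by positivity, fun lam x y hl hx hy hxy => ?_⟩
  have hlx : 0 < lam * x := by positivity
  have hly : 0 < lam * y := by positivity
  have h1 := besselID_nonneg hd hly
  have h2 := besselK_pos (by linarith : 1 < d) hlx
  rw [gradKernel, if_pos (by linarith), abs_of_nonneg (by positivity)]
  calc _ ≤ lam ^ (d - 1) * ((C * Real.exp (lam * y)) *
        (D * (lam * x) ^ (2 - d) * Real.exp (-(lam * x / 2)))) := by
        gcongr
        · exact h _ hly
        · exact h' _ hlx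
    _ ≤ lam ^ (d - 1) * ((C * Real.exp (lam * x / 4)) *
        (D * (lam * x) ^ (2 - d) * Real.exp (-(lam * x / 2)))) := by
        gcongr
        nlinarith
    _ = C * D * x ^ (2 - d) * ((lam ^ (d - 1) * lam ^ (2 - d)) *
        (Real.exp (lam * x / 4) * Real.exp (-(lam * x / 2)))) := by
        rw [Real.mul_rpow hl.le hx.le]; ring
    _ = _ := by
        rw [← Real.rpow_add hl, ← Real.exp_add]
        congr 3 <;> ring_nf

theorem exists_abs_gradKernel_le_of_ge {d : ℝ} (hd : 2 < d) :
    ∃ C : ℝ, 0 < C ∧ ∀ lam x y : ℝ, 0 < lam → 0 < x → 0 < y → 4 * x ≤ y →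
      |gradKernel d lam x y| ≤ C * y ^ (1 - d) * (lam ^ ((1 : ℝ) - 1) * Real.exp (-(y / 4 * lam))) := by
  obtain ⟨C, hC, h⟩ := exists_besselI_le hd
  obtain ⟨D, hD, h'⟩ := exists_besselKD_le hd
  refine ⟨C * D, by positivity, fun lam x y hl hx hy hxy => ?_⟩
  have hlx : 0 < lam * x := by positivity
  have hly : 0 < lam * y := by positivity
  have h1 := besselI_nonneg hd hlx
  have h2 := besselKD_pos hd hly
  rw [gradKernel, if_neg (by linarith), abs_neg, abs_of_nonneg (by positivity)]
  calc _ ≤ lam ^ (d - 1) * ((C * Real.exp (lam * x)) *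
        (D * (lam * y) ^ (1 - d) * Real.exp (-(lam * y / 2)))) := by
        gcongr
        · exact h _ hlx
        · exact h' _ hly
    _ ≤ lam ^ (d - 1) * ((C * Real.exp (lam * y / 4)) *
        (D * (lam * y) ^ (1 - d) * Real.exp (-(lam * y / 2)))) := by
        gcongr
        nlinarith
    _ = C * D * y ^ (1 - d) * ((lam ^ (d - 1) * lam ^ (1 - d)) *
        (Real.exp (lam * y / 4) * Real.exp (-(lam * y / 2)))) := by
        rw [Real.mul_rpow hl.le hy.le]; ring
    _ = _ := by
        rw [← Real.rpow_add hl, ← Real.exp_add]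
        congr 3 <;> ring_nf

theorem lintegral_rpow_mul_exp {a r : ℝ} (ha : 0 < a) (hr : 0 < r) :
    ∫⁻ t in Ioi (0 : ℝ), ENNReal.ofReal (t ^ (a - 1) * Real.exp (-(r * t))) =
      ENNReal.ofReal ((1 / r) ^ a * Real.Gamma a) := by
  rw [← Real.integral_rpow_mul_exp_neg_mul_Ioi ha hr, ofReal_integral_eq_lintegral_ofReal]
  · exact integrableOn_rpow_mul_exp (by linarith) hr
  · exact (ae_restrict_iff' measurableSet_Ioi).2
      (Eventually.of_forall fun t (ht : 0 < t) => by positivity)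

/-- The integral has only a logarithmic singularity as δ/m → 0. The cruder power -1/2 is still
locally integrable in δ, which is all that is needed. The range is split at t = 1/m, where the
minimum changes. -/
theorem lintegral_exp_mul_min_le {m δ : ℝ} (hm : 0 < m) (hδ : 0 < δ) :
    ∫⁻ t in Ioi (0 : ℝ), ENNReal.ofReal (Real.exp (-(t * δ)) * min 1 (1 / (t * m))) ≤
      ENNReal.ofReal (1 / m + 2 * (m ^ (-(1 / 2) : ℝ) * δ ^ (-(1 / 2) : ℝ))) := by
  have hm1 : 0 < 1 / m := by positivity
  rw [← Ioc_union_Ioi_eq_Ioi hm1.le]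
  refine (lintegral_union_le _ _ _).trans ?_
  rw [ENNReal.ofReal_add hm1.le (by positivity)]
  refine add_le_add ?_ ?_
  · refine (setLIntegral_mono' (g := fun _ => 1) measurableSet_Ioc fun t ht => ?_).trans ?_
    · rw [ENNReal.ofReal_le_one]
      refine mul_le_one₀ (Real.exp_le_one_iff.2 ?_) ?_ (min_le_left _ _)
      · nlinarith [ht.1]
      · have := ht.1
        positivity
    · rw [setLIntegral_const, Real.volume_Ioc]
      simp
  · have hi : IntegrableOn (fun t : ℝ => t ^ (-(3 / 2) : ℝ)) (Ioi (1 / m)) :=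
      integrableOn_Ioi_rpow_of_lt (by norm_num) hm1
    calc _ ≤ ∫⁻ t in Ioi (1 / m), ENNReal.ofReal (δ ^ (-(1 / 2) : ℝ) * m⁻¹ *
          t ^ (-(3 / 2) : ℝ)) := by
          refine setLIntegral_mono' measurableSet_Ioi fun t (ht : 1 / m < t) => ?_
          have ht0 : 0 < t := hm1.trans ht
          refine ENNReal.ofReal_le_ofReal ?_
          -- From x^{1/2} ≤ x + 1 ≤ e^x. The extra t^{-1/2} makes the tail of 1/t integrable.
          have h1 : Real.exp (-(t * δ)) ≤ (t * δ) ^ (-(1 / 2) : ℝ) := by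
            rw [Real.rpow_neg (by positivity), Real.exp_neg]
            refine inv_anti₀ (by positivity) ?_
            have h2 := Real.add_one_le_exp (t * δ)
            have h3 : (t * δ) ^ (1 / 2 : ℝ) ≤ (t * δ + 1) ^ (1 : ℝ) :=
              (Real.rpow_le_rpow (by positivity) (by linarith) (by norm_num)).trans
                (Real.rpow_le_rpow_of_exponent_le (by nlinarith [mul_pos ht0 hδ]) (by norm_num))
            rw [Real.rpow_one] at h3
            linarith
          calc _ ≤ (t * δ) ^ (-(1 / 2) : ℝ) * (1 / (t * m)) := by
                gcongr
                exact min_le_right _ _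
            _ = δ ^ (-(1 / 2) : ℝ) * m⁻¹ * (t ^ (-(1 / 2) : ℝ) * t⁻¹) := by
                rw [Real.mul_rpow ht0.le hδ.le]
                field_simp
            _ = _ := by
                rw [← Real.rpow_neg_one t, ← Real.rpow_add ht0]
                norm_num
      _ = ENNReal.ofReal (∫ t in Ioi (1 / m), δ ^ (-(1 / 2) : ℝ) * m⁻¹ * t ^ (-(3 / 2) : ℝ)) := by
          rw [ofReal_integral_eq_lintegral_ofReal (hi.const_mul _)]
          exact (ae_restrict_iff' measurableSet_Ioi).2 (Eventually.of_forall
            fun t (ht : 1 / m < t) => by have := hm1.trans ht; positivity)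
      _ ≤ _ := by
          rw [integral_const_mul, integral_Ioi_rpow_of_lt (by norm_num) hm1]
          refine ENNReal.ofReal_le_ofReal (le_of_eq ?_)
          have e : (1 / m) ^ (-(3 / 2) + 1 : ℝ) = m ^ (1 / 2 : ℝ) := by
            rw [one_div, Real.inv_rpow hm.le, ← Real.rpow_neg hm.le]
            norm_num
          have e' : m ^ (-(1 / 2) : ℝ) = m ^ (1 / 2 : ℝ) / m := by
            rw [← Real.rpow_sub_one hm.ne']
            norm_num
          rw [e, e']
          ring

/-- The index `k` of the dyadic block `[4 ^ k, 4 ^ (k + 1))` that contains `x`. -/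
def blockIndex (x : ℝ) : ℤ := ⌊Real.logb 4 x⌋

/-- `x` and `y` lie in the same block or in neighbouring ones. -/
def IsNear (x y : ℝ) : Prop := |blockIndex x - blockIndex y| ≤ 1

theorem measurable_blockIndex : Measurable blockIndex :=
  (Real.measurable_log.div_const _).floor

theorem measurableSet_isNear : MeasurableSet {q : ℝ × ℝ | IsNear q.1 q.2} := by
  have h : Measurable fun q : ℝ × ℝ => blockIndex q.1 - blockIndex q.2 :=
    (measurable_blockIndex.comp measurable_fst).sub (measurable_blockIndex.comp measurable_snd)
  exact h (t := {n : ℤ | |n| ≤ 1}) (Set.to_countable _).measurableSet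

theorem logb_four_mul {n : ℕ} {x : ℝ} (hx : 0 < x) :
    Real.logb 4 (4 ^ n * x) = n + Real.logb 4 x := by
  rw [Real.logb_mul (by positivity) hx.ne', Real.logb_pow, Real.logb_self_eq_one (by norm_num),
    mul_one]

/-- Blocks have ratio 4. Indices differing by at most one force a ratio of at most 16, where the
near-diagonal expansion is available; indices differing by two or more force a ratio of at least 4,
where the off-diagonal decay is available. -/
theorem le_of_blockIndex_le {x y : ℝ} (hy : 0 < y) (h : blockIndex x ≤ blockIndex y + 1) :
    x ≤ 16 * y := by
  by_contra! hlt
  have h1 : Real.logb 4 (4 ^ 2 * y) < Real.logb 4 x :=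
    Real.logb_lt_logb (by norm_num) (by positivity) (by linarith)
  rw [logb_four_mul hy] at h1
  have h2 : blockIndex y + 2 ≤ blockIndex x := by
    rw [blockIndex, blockIndex, ← Int.floor_add_ofNat]
    refine Int.floor_le_floor ?_
    push_cast at h1
    linarith
  omega

theorem IsNear.le {x y : ℝ} (h : IsNear x y) (hy : 0 < y) : x ≤ 16 * y :=
  le_of_blockIndex_le hy (by have := abs_le.1 h; omega)

theorem IsNear.ge {x y : ℝ} (h : IsNear x y) (hx : 0 < x) : y ≤ 16 * x :=
  le_of_blockIndex_le hx (by have := abs_le.1 h; omega)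

theorem four_mul_le_of_blockIndex {x y : ℝ} (hx : 0 < x) (hy : 0 < y)
    (h : blockIndex x + 1 < blockIndex y) : 4 * x ≤ y := by
  by_contra! hlt
  have h1 : Real.logb 4 y < Real.logb 4 (4 ^ 1 * x) :=
    Real.logb_lt_logb (by norm_num) (by positivity) (by linarith)
  rw [logb_four_mul hx] at h1
  have h2 : blockIndex y ≤ blockIndex x + 1 := by
    rw [blockIndex, blockIndex, ← Int.floor_add_one]
    refine Int.floor_le_floor ?_
    push_cast at h1
    linarith
  omega

theorem four_mul_le_or_of_not_isNear {x y : ℝ} (hx : 0 < x) (hy : 0 < y) (h : ¬IsNear x y) :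
    4 * y ≤ x ∨ 4 * x ≤ y := by
  rcases lt_or_ge (blockIndex x + 1) (blockIndex y) with h1 | h1
  · exact Or.inr (four_mul_le_of_blockIndex hx hy h1)
  · refine Or.inl (four_mul_le_of_blockIndex hy hx ?_)
    by_contra! h2
    exact h (abs_le.2 ⟨by omega, by omega⟩)

open Classical in
/-- `gradKernel` minus its leading part near the diagonal. -/
def gradError (d lam x y : ℝ) : ℝ :=
  gradKernel d lam x y - if IsNear x y then mainKernel d lam x y else 0

/-- The profile of the homogeneous kernel that dominates the integral of `gradError`. -/
def errorProfile (d ρ : ℝ) : ℝ≥0∞ :=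
  (Iic 1).indicator 1 ρ +
    (Icc (1 / 16) 16).indicator (fun ρ => 1 + ENNReal.ofReal (|1 - ρ| ^ (-(1 / 2) : ℝ))) ρ +
    (Ici 4).indicator (fun ρ => ENNReal.ofReal (ρ ^ (-d))) ρ

theorem measurable_errorProfile (d : ℝ) : Measurable (errorProfile d) := by
  unfold errorProfile
  refine ((measurable_one.indicator measurableSet_Iic).add
    (Measurable.indicator ?_ measurableSet_Icc)).add (Measurable.indicator ?_ measurableSet_Ici)
  · fun_prop
  · fun_prop

/-- After integration over λ every region gives degree -d in (x, y): near the diagonal there is the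
integrable singularity |1 - y/x|^{-1/2}; for 4y ≤ x the bound is x^{-d}, and for 4x ≤ y it is
y^{-d}. -/
theorem exists_lintegral_gradError_le {d : ℝ} (hd : 2 < d) :
    ∃ C : ℝ≥0, ∀ x y : ℝ, 0 < x → 0 < y → y ≠ x →
      ∫⁻ lam in Ioi (0 : ℝ), ‖gradError d lam x y‖ₑ ≤
        C * (ENNReal.ofReal (x ^ (-d)) * errorProfile d (y / x)) := by
  obtain ⟨C₁, hC₁, h₁⟩ := exists_abs_gradKernel_sub_le hd
  obtain ⟨C₂, hC₂, h₂⟩ := exists_abs_gradKernel_le_of_le hd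
  obtain ⟨C₃, hC₃, h₃⟩ := exists_abs_gradKernel_le_of_ge hd
  have hd1 : 0 < d - 1 := by linarith
  -- One summand per region. In the first, 16^{(d-1)/2} replaces the weight of y by that of x, and
  -- the last 16 comes from min x y ≥ x/16. The factors 16 and 4 of the others are 4² Γ(2) and 4
  -- Γ(1).
  refine ⟨Real.toNNReal (C₁ * 16 ^ ((d - 1) / 2) * 16 + C₂ * 16 + C₃ * 4), fun x y hx hy hne => ?_⟩
  change _ ≤ ENNReal.ofReal _ * _
  set ρ := y / x with hρ
  have hρ0 : 0 < ρ := by positivity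
  have hyρ : y = x * ρ := by rw [hρ]; field_simp
  have e0 : ∀ c : ℝ, 0 ≤ c → ∀ F : ℝ → ℝ, (∀ t, 0 < t → 0 ≤ F t) → Measurable F →
      (∀ t, 0 < t → |gradError d t x y| ≤ c * F t) →
      ∫⁻ lam in Ioi (0 : ℝ), ‖gradError d lam x y‖ₑ ≤
        ENNReal.ofReal c * ∫⁻ t in Ioi (0 : ℝ), ENNReal.ofReal (F t) := by
    intro c hc F hF hFm h
    rw [← lintegral_const_mul _ hFm.ennreal_ofReal]
    refine setLIntegral_mono' measurableSet_Ioi fun t (ht : 0 < t) => ?_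
    rw [← ENNReal.ofReal_mul hc, Real.enorm_eq_ofReal_abs]
    exact ENNReal.ofReal_le_ofReal (h t ht)
  by_cases hn : IsNear x y
  · have hxy := hn.le hy
    have hyx := hn.ge hx
    have hδ : 0 < |x - y| := abs_pos.2 (sub_ne_zero.2 hne.symm)
    have hm : 0 < min x y := lt_min hx hy
    have hρm : ρ ∈ Icc (1 / 16 : ℝ) 16 := by
      constructor
      · rw [hρ, le_div_iff₀ hx]; linarith
      · rw [hρ, div_le_iff₀ hx]; linarith
    have hmx : x / 16 ≤ min x y := le_min (by linarith) (by linarith)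
    refine (e0 (C₁ * (x ^ (-((d - 1) / 2)) * y ^ (-((d - 1) / 2)))) (by positivity)
      (fun t => Real.exp (-(t * |x - y|)) * min 1 (1 / (t * min x y)))
      (fun t ht => by positivity) (by fun_prop) fun t ht => ?_).trans
      ((mul_le_mul_right (lintegral_exp_mul_min_le hm hδ) _).trans ?_)
    · rw [gradError, if_pos hn]
      exact h₁ t x y ht hx hy hxy hyx
    · have hprof : ENNReal.ofReal (1 + |1 - ρ| ^ (-(1 / 2) : ℝ)) ≤ errorProfile d ρ := by
        rw [errorProfile, indicator_of_mem hρm, ENNReal.ofReal_add one_pos.le (by positivity),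
          ENNReal.ofReal_one]
        exact le_add_right le_add_self
      refine le_trans ?_ (mul_le_mul_right (mul_le_mul_right hprof _) _)
      rw [← ENNReal.ofReal_mul (by positivity), ← ENNReal.ofReal_mul (by positivity),
        ← ENNReal.ofReal_mul (by positivity)]
      refine ENNReal.ofReal_le_ofReal ?_
      have a1 : y ^ (-((d - 1) / 2)) ≤ x ^ (-((d - 1) / 2)) * 16 ^ ((d - 1) / 2) := by
        rw [hyρ, Real.mul_rpow hx.le hρ0.le]
        gcongr
        rw [Real.rpow_neg hρ0.le, ← Real.inv_rpow hρ0.le]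
        gcongr
        rw [inv_le_comm₀ hρ0 (by norm_num)]
        linarith [hρm.1]
      have a2 : x ^ (-((d - 1) / 2)) * x ^ (-((d - 1) / 2)) = x ^ (1 - d) := by
        rw [← Real.rpow_add hx]; ring_nf
      have a3 : x ^ (1 - d) * x⁻¹ = x ^ (-d) := by
        rw [← Real.rpow_neg_one x, ← Real.rpow_add hx]; ring_nf
      have a4 : 1 / min x y ≤ 16 * x⁻¹ := by
        rw [div_le_iff₀ hm]
        calc 1 = 16 * x⁻¹ * (x / 16) := by field_simp
          _ ≤ _ := by gcongr
      have a5 : (min x y) ^ (-(1 / 2) : ℝ) ≤ 4 * x ^ (-(1 / 2) : ℝ) := by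
        have : (x / 16) ^ (-(1 / 2) : ℝ) = 4 * x ^ (-(1 / 2) : ℝ) := by
          rw [div_eq_mul_inv, Real.mul_rpow hx.le (by norm_num),
            show (16 : ℝ)⁻¹ = 4 ^ (-2 : ℝ) by
              rw [Real.rpow_neg (by norm_num), Real.rpow_two]; norm_num,
            ← Real.rpow_mul (by norm_num), mul_comm]
          norm_num
        rw [← this]
        exact Real.rpow_le_rpow_of_nonpos (by positivity) hmx (by norm_num)
      have a6 : |x - y| ^ (-(1 / 2) : ℝ) = x ^ (-(1 / 2) : ℝ) * |1 - ρ| ^ (-(1 / 2) : ℝ) := by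
        rw [← Real.mul_rpow hx.le (abs_nonneg _), hyρ, ← abs_of_pos hx, ← abs_mul,
          abs_of_pos hx]
        ring_nf
      have a7 : x ^ (-(1 / 2) : ℝ) * x ^ (-(1 / 2) : ℝ) = x⁻¹ := by
        rw [← Real.rpow_add hx, ← Real.rpow_neg_one x]; norm_num
      calc _ ≤ C₁ * (x ^ (-((d - 1) / 2)) * (x ^ (-((d - 1) / 2)) * 16 ^ ((d - 1) / 2))) *
            (16 * x⁻¹ + 2 * ((4 * x ^ (-(1 / 2) : ℝ)) * (x ^ (-(1 / 2) : ℝ) *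
              |1 - ρ| ^ (-(1 / 2) : ℝ)))) := by
            rw [← a6]
            gcongr
        _ = C₁ * 16 ^ ((d - 1) / 2) * (x ^ (-((d - 1) / 2)) * x ^ (-((d - 1) / 2))) *
            (16 * x⁻¹ + 8 * ((x ^ (-(1 / 2) : ℝ) * x ^ (-(1 / 2) : ℝ)) *
              |1 - ρ| ^ (-(1 / 2) : ℝ))) := by ring
        _ = C₁ * 16 ^ ((d - 1) / 2) * ((x ^ (1 - d) * x⁻¹) *
            (16 + 8 * |1 - ρ| ^ (-(1 / 2) : ℝ))) := by rw [a2, a7]; ring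
        _ ≤ C₁ * 16 ^ ((d - 1) / 2) * (x ^ (-d) *
            (16 + 16 * |1 - ρ| ^ (-(1 / 2) : ℝ))) := by rw [a3]; gcongr; norm_num
        _ = (C₁ * 16 ^ ((d - 1) / 2) * 16) * (x ^ (-d) * (1 + |1 - ρ| ^ (-(1 / 2) : ℝ))) := by
            ring
        _ ≤ _ := by
            gcongr
            linarith
  · have hE : ∀ t, gradError d t x y = gradKernel d t x y := fun t => by
      rw [gradError, if_neg hn, sub_zero]
    rcases four_mul_le_or_of_not_isNear hx hy hn with hyx | hxy
    · refine (e0 (C₂ * x ^ (2 - d)) (by positivity) (fun t => t ^ ((2 : ℝ) - 1) * Real.exp (-(x / 4 * t)))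
        (fun t ht => by positivity) (by fun_prop) fun t ht => ?_).trans ?_
      · rw [hE]
        exact h₂ t x y ht hx hy hyx
      · rw [lintegral_rpow_mul_exp (by norm_num) (by positivity), Real.Gamma_two, mul_one]
        have hprof : (1 : ℝ≥0∞) ≤ errorProfile d ρ := by
          rw [errorProfile, indicator_of_mem (show ρ ∈ Iic (1 : ℝ) from
            (div_le_one hx).2 (by linarith))]
          exact le_add_right (le_add_right le_rfl)
        refine le_trans ?_ (mul_le_mul_right (mul_le_mul_right hprof _) _)
        rw [mul_one, ← ENNReal.ofReal_mul (by positivity), ← ENNReal.ofReal_mul (by positivity)]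
        refine ENNReal.ofReal_le_ofReal ?_
        have a1 : x ^ (2 - d) * (1 / (x / 4)) ^ (2 : ℝ) = 16 * x ^ (-d) := by
          rw [show 2 - d = -d + 2 by ring, Real.rpow_add hx, Real.rpow_two, Real.rpow_two]
          field_simp
          norm_num
        rw [mul_assoc, a1]
        calc C₂ * (16 * x ^ (-d)) = (C₂ * 16) * x ^ (-d) := by ring
          _ ≤ _ := by
            gcongr
            have : 0 < C₁ * 16 ^ ((d - 1) / 2) * 16 := by positivity
            linarith
    · refine (e0 (C₃ * y ^ (1 - d)) (by positivity) (fun t => t ^ ((1 : ℝ) - 1) * Real.exp (-(y / 4 * t)))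
        (fun t ht => by positivity) (by fun_prop) fun t ht => ?_).trans ?_
      · rw [hE]
        exact h₃ t x y ht hx hy hxy
      · rw [lintegral_rpow_mul_exp (by norm_num) (by positivity), Real.Gamma_one, mul_one]
        have hprof : ENNReal.ofReal (ρ ^ (-d)) ≤ errorProfile d ρ := by
          rw [errorProfile, indicator_of_mem (show ρ ∈ Ici (4 : ℝ) from
            (le_div_iff₀ hx).2 (by linarith))]
          exact le_add_self
        refine le_trans ?_ (mul_le_mul_right (mul_le_mul_right hprof _) _)
        rw [← ENNReal.ofReal_mul (by positivity), ← ENNReal.ofReal_mul (by positivity),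
          ← ENNReal.ofReal_mul (by positivity)]
        refine ENNReal.ofReal_le_ofReal ?_
        rw [← Real.mul_rpow hx.le hρ0.le, ← hyρ]
        have a1 : y ^ (1 - d) * (1 / (y / 4)) ^ (1 : ℝ) = 4 * y ^ (-d) := by
          rw [show 1 - d = -d + 1 by ring, Real.rpow_add hy, Real.rpow_one, Real.rpow_one]
          field_simp
        rw [mul_assoc, a1]
        calc C₃ * (4 * y ^ (-d)) = (C₃ * 4) * y ^ (-d) := by ring
          _ ≤ _ := by
            gcongr
            have : 0 < C₁ * 16 ^ ((d - 1) / 2) * 16 := by positivity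
            linarith

theorem lintegral_Icc_abs_rpow_lt_top {r : ℝ} (hr : -1 < r) (a b : ℝ) :
    ∫⁻ t in Icc a b, ENNReal.ofReal (|t| ^ r) < ⊤ := by
  have key : ∀ a b : ℝ, ∫⁻ t in Icc a b, ENNReal.ofReal (t ^ r) < ⊤ := fun a b => by
    rcases le_or_gt a b with h | h
    · exact ((intervalIntegrable_iff_integrableOn_Icc_of_le h).1
        (intervalIntegral.intervalIntegrable_rpow' hr)).lintegral_lt_top
    · simp [Icc_eq_empty (not_le.2 h)]
  have key' : ∫⁻ t in Icc a b, ENNReal.ofReal ((-t) ^ r) < ⊤ := by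
    rcases le_or_gt a b with h | h
    · refine ((intervalIntegrable_iff_integrableOn_Icc_of_le h).1
        ?_).lintegral_lt_top
      simpa using ((intervalIntegral.intervalIntegrable_rpow' hr (a := -a) (b := -b))).comp_sub_left 0
    · simp [Icc_eq_empty (not_le.2 h)]
  calc _ ≤ ∫⁻ t in Icc a b, (ENNReal.ofReal (t ^ r) + ENNReal.ofReal ((-t) ^ r)) := by
        refine lintegral_mono fun t => ?_
        rcases abs_choice t with h | h
        · simp only [h]; exact le_self_add
        · simp only [h]; exact le_add_self
    _ = _ := lintegral_add_left (by fun_prop) _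
    _ < ⊤ := ENNReal.add_lt_top.2 ⟨key a b, key'⟩

/-- The profile is bounded at 0, has singularity |1-ρ|^{-1/2} at 1 and decays like ρ^{-d} at
infinity. For e = d - 1 - d/p the two conditions say d/p < d and d/p > 0. -/
theorem lintegral_errorProfile_lt_top {d e : ℝ} (he : -1 < e) (hde : e < d - 1) :
    ∫⁻ ρ in Ioi (0 : ℝ), errorProfile d ρ * ENNReal.ofReal (ρ ^ e) < ⊤ := by
  have hm : Measurable fun ρ : ℝ => ENNReal.ofReal (ρ ^ e) := by fun_prop
  unfold errorProfile
  simp only [add_mul]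
  rw [lintegral_add_left, lintegral_add_left, ENNReal.add_lt_top, ENNReal.add_lt_top]
  rotate_left
  · exact (measurable_one.indicator measurableSet_Iic).mul hm
  · refine ((measurable_one.indicator measurableSet_Iic).mul hm).add
      ((Measurable.indicator ?_ measurableSet_Icc).mul hm)
    fun_prop
  refine ⟨⟨?_, ?_⟩, ?_⟩
  · refine lt_of_le_of_lt ?_ (lintegral_Icc_abs_rpow_lt_top he 0 1)
    rw [← lintegral_indicator measurableSet_Ioi, ← lintegral_indicator measurableSet_Icc]
    refine lintegral_mono fun t => ?_
    by_cases h0 : 0 < t <;> by_cases h1 : t ≤ 1 <;> simp [indicator, h0, h1]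
    simp [h0.le, abs_of_pos h0]
  · calc _ ≤ ∫⁻ ρ in Icc (1 / 16 : ℝ) 16, (1 + ENNReal.ofReal (|1 - ρ| ^ (-(1 / 2) : ℝ))) *
          ENNReal.ofReal (16 ^ |e|) := by
          refine (setLIntegral_le_lintegral _ _).trans ?_
          rw [← lintegral_indicator measurableSet_Icc]
          refine lintegral_mono fun t => ?_
          by_cases ht : t ∈ Icc (1 / 16 : ℝ) 16
          swap
          · simp only [indicator_of_notMem ht, zero_mul, le_refl]
          simp only [indicator_of_mem ht]
          have ht0 : 0 < t := by linarith [ht.1]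
          refine mul_le_mul_right (ENNReal.ofReal_le_ofReal ?_) _
          rcases le_total 0 e with h | h
          · rw [abs_of_nonneg h]
            exact Real.rpow_le_rpow ht0.le ht.2 h
          · rw [abs_of_nonpos h, Real.rpow_neg (by norm_num), ← Real.inv_rpow (by norm_num)]
            exact Real.rpow_le_rpow_of_nonpos (by norm_num) (by linarith [ht.1]) h
      _ < ⊤ := by
          rw [lintegral_mul_const _ (by fun_prop), lintegral_add_left (by fun_prop)]
          refine ENNReal.mul_lt_top (ENNReal.add_lt_top.2 ⟨by simp, ?_⟩) ENNReal.ofReal_lt_top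
          have := lintegral_Icc_abs_rpow_lt_top (r := -(1 / 2)) (by norm_num) (-15) (15 / 16)
          refine lt_of_le_of_lt (le_of_eq ?_) this
          rw [← lintegral_indicator measurableSet_Icc, ← lintegral_indicator measurableSet_Icc,
            ← lintegral_sub_left_eq_self _ (1 : ℝ)]
          refine lintegral_congr fun t => ?_
          have : 1 - t ∈ Icc (1 / 16 : ℝ) 16 ↔ t ∈ Icc (-15 : ℝ) (15 / 16) := by
            simp only [mem_Icc]
            constructor <;> rintro ⟨h1, h2⟩ <;> constructor <;> linarith
          by_cases ht : t ∈ Icc (-15 : ℝ) (15 / 16)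
          · rw [indicator_of_mem ht, indicator_of_mem (this.2 ht)]
            simp
          · rw [indicator_of_notMem ht, indicator_of_notMem (fun h => ht (this.1 h))]
  · refine lt_of_le_of_lt ?_ (integrableOn_Ioi_rpow_of_lt (a := -d + e) (by linarith)
      (by norm_num : (0 : ℝ) < 1)).lintegral_lt_top
    rw [← lintegral_indicator measurableSet_Ioi, ← lintegral_indicator measurableSet_Ioi]
    refine lintegral_mono fun t => ?_
    by_cases h4 : t ∈ Ici (4 : ℝ)
    · have h0 : 0 < t := by linarith [mem_Ici.1 h4]
      rw [indicator_of_mem (mem_Ioi.2 h0), indicator_of_mem h4,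
        indicator_of_mem (mem_Ioi.2 (by linarith [mem_Ici.1 h4])), Real.rpow_add h0,
        ENNReal.ofReal_mul (by positivity)]
    · refine (indicator_le_self' (fun _ _ => zero_le) t).trans ?_
      simp only [indicator_of_notMem h4, zero_mul, zero_le]

/-! ### Dyadic blocks and the weighted Hilbert transform -/

theorem lintegral_radialMeasure_eq (d : ℝ) (F : ℝ → ℝ≥0∞) :
    ∫⁻ r, F r ∂radialMeasure d = ∫⁻ r in Ioi 0, ENNReal.ofReal (r ^ (d - 1)) * F r := by
  rw [radialMeasure, lintegral_withDensity_eq_lintegral_mul_non_measurable _ (by fun_prop)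
    (Eventually.of_forall fun _ => ENNReal.ofReal_lt_top)]
  rfl

theorem rpow_le_of_ratio {x y c : ℝ} (hx : 0 < x) (hy : 0 < y) (hc : 1 ≤ c) (hxy : x ≤ c * y)
    (hyx : y ≤ c * x) (q : ℝ) : x ^ q ≤ c ^ |q| * y ^ q := by
  have hc0 : 0 < c := by linarith
  rcases le_total 0 q with h | h
  · rw [abs_of_nonneg h, ← Real.mul_rpow hc0.le hy.le]
    exact Real.rpow_le_rpow hx.le hxy h
  · rw [abs_of_nonpos h, Real.rpow_neg hc0.le, ← Real.inv_rpow hc0.le,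
      ← Real.mul_rpow (by positivity) hy.le]
    refine Real.rpow_le_rpow_of_nonpos (by positivity) ?_ h
    rw [inv_mul_le_iff₀ hc0]
    exact hyx

theorem blockIndex_four_zpow (k : ℤ) : blockIndex ((4 : ℝ) ^ k) = k := by
  rw [blockIndex, ← Real.rpow_intCast, Real.logb_rpow (by norm_num) (by norm_num), Int.floor_intCast]

/-- The dyadic block `[4 ^ k, 4 ^ (k + 1))`. -/
def block (k : ℤ) : Set ℝ := Ioi 0 ∩ blockIndex ⁻¹' {k}

theorem measurableSet_block (k : ℤ) : MeasurableSet (block k) :=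
  measurableSet_Ioi.inter (measurable_blockIndex (measurableSet_singleton k))

theorem lintegral_Ioi_eq_tsum_block (F : ℝ → ℝ≥0∞) :
    ∫⁻ x in Ioi (0 : ℝ), F x = ∑' k : ℤ, ∫⁻ x in block k, F x := by
  have : Ioi (0 : ℝ) = ⋃ k, block k := by
    ext x
    simp [block]
  rw [this, lintegral_iUnion measurableSet_block]
  intro j k hjk
  refine Set.disjoint_left.2 fun x hx hx' => hjk ?_
  rw [← hx.2, ← hx'.2]

/-- A union of three neighbouring blocks. -/
def wideBlock (k : ℤ) : Set ℝ := {y | 0 < y ∧ |k - blockIndex y| ≤ 1}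

theorem wideBlock_subset (k : ℤ) : wideBlock k ⊆ (block (k - 1) ∪ block k) ∪ block (k + 1) := by
  rintro y ⟨hy, h⟩
  have h := abs_le.1 h
  simp only [block, mem_union, mem_inter_iff, mem_Ioi, mem_preimage, mem_singleton_iff, hy,
    true_and]
  omega

theorem measurableSet_wideBlock (k : ℤ) : MeasurableSet (wideBlock k) :=
  measurableSet_Ioi.inter (measurable_blockIndex (Set.to_countable {n : ℤ | |k - n| ≤ 1}).measurableSet)

theorem tsum_lintegral_wideBlock_le (F : ℝ → ℝ≥0∞) :
    ∑' k : ℤ, ∫⁻ x in wideBlock k, F x ≤ 3 * ∫⁻ x in Ioi (0 : ℝ), F x := by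
  have h1 : ∑' k : ℤ, ∫⁻ x in block (k - 1), F x = ∫⁻ x in Ioi (0 : ℝ), F x := by
    rw [lintegral_Ioi_eq_tsum_block]
    exact (Equiv.subRight (1 : ℤ)).tsum_eq fun k => ∫⁻ x in block k, F x
  have h2 : ∑' k : ℤ, ∫⁻ x in block (k + 1), F x = ∫⁻ x in Ioi (0 : ℝ), F x := by
    rw [lintegral_Ioi_eq_tsum_block]
    exact (Equiv.addRight (1 : ℤ)).tsum_eq fun k => ∫⁻ x in block k, F x
  calc _ ≤ ∑' k : ℤ, ((∫⁻ x in block (k - 1), F x) + (∫⁻ x in block k, F x) +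
        ∫⁻ x in block (k + 1), F x) := by
        refine ENNReal.tsum_le_tsum fun k => ?_
        refine (lintegral_mono_set (wideBlock_subset k)).trans ?_
        refine (lintegral_union_le _ _ _).trans ?_
        gcongr
        exact lintegral_union_le _ _ _
    _ = _ := by
        rw [ENNReal.tsum_add, ENNReal.tsum_add, h1, h2, ← lintegral_Ioi_eq_tsum_block]
        ring

open Classical in
/-- The part near the diagonal of the gradient transform, integrated over the spectral parameter. -/
def nearTransform (d Λ : ℝ) (g : ℝ → ℂ) (x : ℝ) : ℂ :=
  ∫ y in Ioi (0 : ℝ), ((if IsNear x y then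
    1 / 2 * (x ^ (-((d - 1) / 2)) * y ^ (-((d - 1) / 2))) * truncatedKernel Λ (x - y) * y ^ (d - 1)
    else 0 : ℝ) : ℂ) * g y

theorem isBoundedCompact_wideBlock {g : ℝ → ℂ} {M ρ : ℝ} (hg : IsBoundedCompact g M ρ) {a : ℝ}
    (ha : 0 ≤ a) (k : ℤ) :
    IsBoundedCompact ((wideBlock k).indicator fun y => ((y ^ a : ℝ) : ℂ) * g y)
      (|ρ| ^ a * |M|) ρ where
  meas := by
    refine StronglyMeasurable.indicator ?_ (measurableSet_wideBlock k)
    refine StronglyMeasurable.mul ?_ hg.meas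
    exact Measurable.stronglyMeasurable (by fun_prop)
  bound := fun t => by
    by_cases ht : t ∈ wideBlock k
    swap
    · rw [indicator_of_notMem ht, norm_zero]; positivity
    rw [indicator_of_mem ht, norm_mul, Complex.norm_real]
    have ht0 : 0 < t := ht.1
    by_cases hr : ρ < |t|
    · rw [hg.supp t hr, norm_zero, mul_zero]; positivity
    · rw [Real.norm_of_nonneg (by positivity)]
      gcongr
      · exact (le_abs_self t).trans ((not_lt.1 hr).trans (le_abs_self ρ))
      · exact (hg.bound t).trans (le_abs_self M)
  supp := fun t ht => by
    refine indicator_apply_eq_zero.2 fun _ => ?_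
    rw [hg.supp t ht, mul_zero]

/-- For x in one block only y in three neighbouring blocks contribute, and there all power weights
agree with powers of 4^k up to bounded factors. Each block is thus an unweighted truncated Hilbert
transform of a localized function, and the wide blocks overlap at most three times. -/
theorem exists_lintegral_nearTransform_le {d p : ℝ} (hd : 2 < d) (hp : 1 < p) :
    ∃ C : ℝ≥0, ∀ Λ : ℝ, 0 < Λ → ∀ (g : ℝ → ℂ) (M ρ : ℝ), IsBoundedCompact g M ρ →
      ∫⁻ x, ‖nearTransform d Λ g x‖ₑ ^ p ∂radialMeasure d ≤
        C * ∫⁻ y, ‖g y‖ₑ ^ p ∂radialMeasure d := by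
  obtain ⟨C, hC⟩ := exists_lintegral_truncatedHilbert_le hp
  set a := (d - 1) / 2 with ha
  have ha0 : 0 < a := by rw [ha]; linarith
  -- The output carries the weight x^{d-1} x^{-ap} = x^q. The input to the Hilbert transform is y^a
  -- g, and y^{ap} y^q = y^{d-1} restores the measure, so the two replacements by w^q cancel.
  set q := d - 1 - a * p with hq
  have hp0 : 0 < p := by linarith
  refine ⟨Real.toNNReal (16 ^ |q|) * Real.toNNReal (16 ^ |q|) * C * 3, fun Λ hΛ g M ρ hg => ?_⟩
  set G : ℤ → ℝ → ℂ := fun k => (wideBlock k).indicator fun y => ((y ^ a : ℝ) : ℂ) * g y with hG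
  have hnt : ∀ k x, x ∈ block k → ‖nearTransform d Λ g x‖ₑ ≤
      ENNReal.ofReal (x ^ (-a)) * ‖∫ y, (truncatedKernel Λ (x - y) : ℂ) * G k y‖ₑ := by
    intro k x hx
    have hx0 : 0 < x := hx.1
    have e : nearTransform d Λ g x =
        ((1 / 2 * x ^ (-a) : ℝ) : ℂ) * ∫ y, (truncatedKernel Λ (x - y) : ℂ) * G k y := by
      rw [nearTransform, ← integral_const_mul, ← integral_indicator measurableSet_Ioi]
      congr 1
      funext y
      by_cases hy : 0 < y
      · rw [indicator_of_mem (mem_Ioi.2 hy)]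
        have hk : IsNear x y ↔ y ∈ wideBlock k := by
          rw [IsNear, wideBlock, mem_ofPred_eq, ← hx.2]
          simp [hy]
        by_cases hn : IsNear x y
        · rw [if_pos hn, hG]
          simp only [indicator_of_mem (hk.1 hn)]
          have : y ^ (-a) * y ^ (d - 1) = y ^ a := by
            rw [← Real.rpow_add hy, ha]; ring_nf
          rw [← this]
          push_cast
          ring
        · rw [if_neg hn, hG]
          simp only [indicator_of_notMem (fun h => hn (hk.2 h))]
          simp
      · rw [indicator_of_notMem (by simpa using hy), hG]
        simp only [indicator_of_notMem (fun h : y ∈ wideBlock k => hy h.1)]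
        simp
    rw [e, enorm_mul]
    gcongr
    rw [← ofReal_norm, Complex.norm_real, Real.norm_of_nonneg (by positivity)]
    refine ENNReal.ofReal_le_ofReal ?_
    have : 0 < x ^ (-a) := by positivity
    linarith
  have hblock : ∀ k, ∫⁻ x in block k, ENNReal.ofReal (x ^ (d - 1)) * ‖nearTransform d Λ g x‖ₑ ^ p ≤
      ENNReal.ofReal (16 ^ |q|) * ENNReal.ofReal (16 ^ |q|) * C *
        ∫⁻ y in wideBlock k, ENNReal.ofReal (y ^ (d - 1)) * ‖g y‖ₑ ^ p := by
    intro k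
    set w : ℝ := (4 : ℝ) ^ k with hw
    have hw0 : 0 < w := by positivity
    have hb := isBoundedCompact_wideBlock hg ha0.le k
    calc _ ≤ ∫⁻ x in block k, ENNReal.ofReal (16 ^ |q| * w ^ q) *
          ‖∫ y, (truncatedKernel Λ (x - y) : ℂ) * G k y‖ₑ ^ p := by
          refine setLIntegral_mono' (measurableSet_block k) fun x hx => ?_
          have hx0 : 0 < x := hx.1
          have hn : IsNear x w := by
            rw [IsNear, hw, blockIndex_four_zpow, hx.2]; simp
          refine (mul_le_mul_right (ENNReal.rpow_le_rpow (hnt k x hx) hp0.le) _).trans ?_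
          rw [ENNReal.mul_rpow_of_nonneg _ _ hp0.le, ← mul_assoc]
          gcongr
          rw [ENNReal.ofReal_rpow_of_pos (by positivity), ← ENNReal.ofReal_mul (by positivity),
            ← Real.rpow_mul hx0.le, ← Real.rpow_add hx0]
          refine ENNReal.ofReal_le_ofReal ?_
          convert rpow_le_of_ratio hx0 hw0 (by norm_num : (1 : ℝ) ≤ 16) (hn.le hw0)
            (hn.ge hx0) q using 2
          rw [hq]; ring
      _ ≤ ENNReal.ofReal (16 ^ |q| * w ^ q) *
          ∫⁻ x, ‖∫ y, (truncatedKernel Λ (x - y) : ℂ) * G k y‖ₑ ^ p := by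
          rw [lintegral_const_mul' _ _ ENNReal.ofReal_ne_top]
          gcongr
          exact Measure.restrict_le_self
      _ ≤ ENNReal.ofReal (16 ^ |q| * w ^ q) * (C * ∫⁻ y, ‖G k y‖ₑ ^ p) := by
          gcongr
          exact hC Λ hΛ _ _ _ hb
      _ = ENNReal.ofReal (16 ^ |q|) * C *
          ∫⁻ y in wideBlock k, ENNReal.ofReal (w ^ q) * (ENNReal.ofReal (y ^ a) * ‖g y‖ₑ) ^ p := by
          rw [lintegral_const_mul' _ _ ENNReal.ofReal_ne_top, ENNReal.ofReal_mul (by positivity),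
            ← lintegral_indicator (measurableSet_wideBlock k)]
          have : ∀ y, ‖G k y‖ₑ ^ p = (wideBlock k).indicator
              (fun y => (ENNReal.ofReal (y ^ a) * ‖g y‖ₑ) ^ p) y := by
            intro y
            by_cases hy : y ∈ wideBlock k
            · have hy0 : 0 < y := hy.1
              simp only [hG, indicator_of_mem hy]
              rw [enorm_mul, ← ofReal_norm, Complex.norm_real,
                Real.norm_of_nonneg (by positivity)]
            · simp only [hG, indicator_of_notMem hy, enorm_zero, ENNReal.zero_rpow_of_pos hp0]
          simp only [this]
          ring
      _ ≤ ENNReal.ofReal (16 ^ |q|) * C * ∫⁻ y in wideBlock k,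
          ENNReal.ofReal (16 ^ |q|) * (ENNReal.ofReal (y ^ (d - 1)) * ‖g y‖ₑ ^ p) := by
          refine mul_le_mul_right (setLIntegral_mono' (measurableSet_wideBlock k) fun y hy => ?_) _
          have hy0 : 0 < y := hy.1
          have hn : IsNear w y := by
            rw [IsNear, hw, blockIndex_four_zpow]; exact hy.2
          rw [ENNReal.mul_rpow_of_nonneg _ _ hp0.le, ← mul_assoc, ← mul_assoc]
          refine mul_le_mul_left ?_ _
          rw [ENNReal.ofReal_rpow_of_pos (by positivity), ← ENNReal.ofReal_mul (by positivity),
            ← ENNReal.ofReal_mul (by positivity), ← Real.rpow_mul hy0.le]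
          refine ENNReal.ofReal_le_ofReal ?_
          calc _ ≤ (16 ^ |q| * y ^ q) * y ^ (a * p) := by
                gcongr
                exact rpow_le_of_ratio hw0 hy0 (by norm_num : (1 : ℝ) ≤ 16) (hn.le hy0)
                  (hn.ge hw0) q
            _ = _ := by
                rw [mul_assoc, ← Real.rpow_add hy0, hq]; ring_nf
      _ = _ := by
          rw [lintegral_const_mul' _ _ ENNReal.ofReal_ne_top]
          ring
  rw [lintegral_radialMeasure_eq, lintegral_radialMeasure_eq, lintegral_Ioi_eq_tsum_block]
  refine (ENNReal.tsum_le_tsum hblock).trans ?_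
  rw [ENNReal.tsum_mul_left]
  refine (mul_le_mul_right (tsum_lintegral_wideBlock_le _) _).trans (le_of_eq ?_)
  push_cast
  simp only [ENNReal.ofReal]
  ring

/-! ### The gradient transform integrated over the spectral parameter -/

theorem measurable_gradKernel (d : ℝ) :
    Measurable fun q : ℝ × ℝ × ℝ => gradKernel d q.1 q.2.1 q.2.2 := by
  have h1 := measurable_besselK d
  have h2 := measurable_besselKD d
  have h3 := measurable_besselI d
  have h4 := measurable_besselID d
  unfold gradKernel
  refine Measurable.ite (measurableSet_lt (by fun_prop) (by fun_prop)) ?_ ?_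
  · fun_prop
  · fun_prop

theorem measurable_mainKernel (d : ℝ) :
    Measurable fun q : ℝ × ℝ × ℝ => mainKernel d q.1 q.2.1 q.2.2 := by
  unfold mainKernel
  refine Measurable.mul (by fun_prop) ?_
  refine Measurable.ite (measurableSet_lt (by fun_prop) (by fun_prop)) ?_ ?_
  · fun_prop
  · fun_prop

open Classical in
/-- The part of `mainKernel` near the diagonal. -/
def nearKernel (d lam x y : ℝ) : ℝ := if IsNear x y then mainKernel d lam x y else 0

theorem measurable_nearKernel (d : ℝ) :
    Measurable fun q : ℝ × ℝ × ℝ => nearKernel d q.1 q.2.1 q.2.2 :=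
  Measurable.ite (measurableSet_isNear.preimage measurable_snd) (measurable_mainKernel d)
    measurable_const

theorem gradError_eq (d lam x y : ℝ) :
    gradError d lam x y = gradKernel d lam x y - nearKernel d lam x y := rfl

theorem measurable_gradError (d : ℝ) :
    Measurable fun q : ℝ × ℝ × ℝ => gradError d q.1 q.2.1 q.2.2 := by
  simp only [gradError_eq]
  exact (measurable_gradKernel d).sub (measurable_nearKernel d)

theorem integral_exp_neg_mul {Λ s : ℝ} (hΛ : 0 < Λ) (hs : s ≠ 0) :
    ∫ t in Ioc 0 Λ, Real.exp (-(t * s)) = (1 - Real.exp (-(Λ * s))) / s := by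
  rw [← intervalIntegral.integral_of_le hΛ.le]
  have : ∀ t ∈ uIcc 0 Λ, HasDerivAt (fun t => -(Real.exp (-(t * s)) / s)) (Real.exp (-(t * s))) t := by
    intro t _
    have h1 : HasDerivAt (fun t : ℝ => -(t * s)) (-(1 * s)) t :=
      ((hasDerivAt_id t).mul_const s).neg
    refine (h1.exp.div_const s).neg.congr_deriv ?_
    rw [one_mul, mul_neg, neg_div, neg_neg, mul_div_cancel_right₀ _ hs]
  rw [intervalIntegral.integral_eq_sub_of_hasDerivAt this
    (Continuous.intervalIntegrable (by fun_prop) _ _)]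
  simp
  ring

/-- Integrating e^{-λ|s|} over (0, Λ] gives (1 - e^{-Λ|s|})/|s|, and the sign built into the main
kernel turns this into the odd truncation of 1/s. -/
theorem integral_mainKernel {d Λ x y : ℝ} (hΛ : 0 < Λ) (hxy : y ≠ x) :
    ∫ lam in Ioc 0 Λ, mainKernel d lam x y =
      1 / 2 * (x ^ (-((d - 1) / 2)) * y ^ (-((d - 1) / 2))) * truncatedKernel Λ (x - y) := by
  unfold mainKernel
  rw [integral_const_mul]
  congr 1
  have h0 : |x - y| ≠ 0 := abs_ne_zero.2 (sub_ne_zero.2 hxy.symm)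
  by_cases h : y < x
  · simp only [if_pos h]
    rw [integral_exp_neg_mul hΛ h0, truncatedKernel, abs_of_pos (sub_pos.2 h)]
  · simp only [if_neg h]
    have h' : x - y < 0 := sub_neg.2 (lt_of_le_of_ne (not_lt.1 h) hxy.symm)
    rw [integral_neg, integral_exp_neg_mul hΛ h0, truncatedKernel, abs_of_neg h', div_neg, neg_neg]

/-- The integral operator with kernel `gradKernel`. -/
def gradTransform (d lam : ℝ) (g : ℝ → ℂ) (x : ℝ) : ℂ :=
  ∫ y in Ioi (0 : ℝ), ((gradKernel d lam x y * y ^ (d - 1) : ℝ) : ℂ) * g y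

theorem IsBoundedCompact.lintegral_radialMeasure_lt_top {g : ℝ → ℂ} {M ρ : ℝ}
    (hg : IsBoundedCompact g M ρ) {d p : ℝ} (hd : 0 < d) (hp : 0 < p) :
    ∫⁻ y, ‖g y‖ₑ ^ p ∂radialMeasure d < ⊤ := by
  have hm := hg.meas
  rw [lintegral_radialMeasure_eq]
  calc _ ≤ ∫⁻ y in Icc 0 |ρ|, ENNReal.ofReal (|y| ^ (d - 1)) * ENNReal.ofReal |M| ^ p := by
        rw [← lintegral_indicator measurableSet_Ioi, ← lintegral_indicator measurableSet_Icc]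
        refine lintegral_mono fun y => ?_
        by_cases hy : y ∈ Ioi (0 : ℝ)
        swap
        · rw [indicator_of_notMem hy]; exact zero_le
        rw [indicator_of_mem hy]
        by_cases hr : |y| ≤ ρ
        · have hmem : y ∈ Icc 0 |ρ| :=
            ⟨le_of_lt hy, ((le_abs_self y).trans hr).trans (le_abs_self ρ)⟩
          rw [indicator_of_mem hmem, abs_of_pos hy]
          gcongr
          rw [← ofReal_norm]
          exact ENNReal.ofReal_le_ofReal ((hg.bound y).trans (le_abs_self M))
        · rw [hg.supp y (not_le.1 hr), enorm_zero, ENNReal.zero_rpow_of_pos hp, mul_zero]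
          exact zero_le
    _ < ⊤ := by
        rw [lintegral_mul_const _ (by fun_prop)]
        exact ENNReal.mul_lt_top (lintegral_Icc_abs_rpow_lt_top (by linarith) _ _)
          (ENNReal.rpow_lt_top_of_nonneg hp.le ENNReal.ofReal_ne_top)

/-- Justifies Fubini for the main part. For fixed x > 0 the near region confines y to [x/16, 16x],
away from the singular weights, and λ ranges over a bounded interval. -/
theorem integrable_nearKernel {d Λ x : ℝ} (hx : 0 < x) {g : ℝ → ℂ} {M ρ : ℝ}
    (hg : IsBoundedCompact g M ρ) :
    Integrable (fun q : ℝ × ℝ => ((nearKernel d q.1 x q.2 * q.2 ^ (d - 1) : ℝ) : ℂ) * g q.2)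
      ((volume.restrict (Ioc 0 Λ)).prod (volume.restrict (Ioi 0))) := by
  set c : ℝ → ℝ := (Icc (x / 16) (16 * x)).indicator fun y =>
    (x ^ (-((d - 1) / 2)) * y ^ (-((d - 1) / 2))) * y ^ (d - 1) * |M|
  have hc : Integrable c (volume.restrict (Ioi 0)) := by
    refine Integrable.restrict ?_
    rw [integrable_indicator_iff measurableSet_Icc]
    refine ContinuousOn.integrableOn_compact isCompact_Icc ?_
    have hne : ∀ y ∈ Icc (x / 16) (16 * x), y ≠ 0 := fun y hy => by
      have : 0 < x / 16 := by positivity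
      exact (this.trans_le hy.1).ne'
    refine ((continuousOn_const.mul (continuousOn_id.rpow_const fun y hy => Or.inl (hne y hy))).mul
      (continuousOn_id.rpow_const fun y hy => Or.inl (hne y hy))).mul continuousOn_const
  refine (hc.comp_snd (volume.restrict (Ioc 0 Λ))).mono' ?_ ?_
  · refine (StronglyMeasurable.mul ?_ (hg.meas.comp_measurable measurable_snd)).aestronglyMeasurable
    refine Measurable.stronglyMeasurable (Complex.measurable_ofReal.comp ?_)
    have hm : Measurable fun q : ℝ × ℝ => (q.1, x, q.2) := by fun_prop
    exact ((measurable_nearKernel d).comp hm).mul (by fun_prop)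
  · rw [Measure.prod_restrict]
    refine (ae_restrict_iff' (measurableSet_Ioc.prod measurableSet_Ioi)).2
      (Eventually.of_forall ?_)
    rintro ⟨lam, y⟩ ⟨hl, hy⟩
    have hl0 : 0 < lam := hl.1
    have hy0 : 0 < y := hy
    simp only
    rw [norm_mul, Complex.norm_real, nearKernel]
    split_ifs with hn
    · have hmem : y ∈ Icc (x / 16) (16 * x) := ⟨by linarith [hn.le hy0], hn.ge hx⟩
      simp only [c, indicator_of_mem hmem]
      refine mul_le_mul ?_ ((hg.bound y).trans (le_abs_self M)) (norm_nonneg _) (by positivity)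
      rw [Real.norm_eq_abs, abs_mul, abs_of_pos (by positivity : 0 < y ^ (d - 1))]
      refine mul_le_mul_of_nonneg_right ?_ (by positivity)
      rw [mainKernel, abs_mul, abs_of_pos (by positivity)]
      have he : |if y < x then Real.exp (-(lam * |x - y|)) else -Real.exp (-(lam * |x - y|))| ≤ 1 := by
        have : Real.exp (-(lam * |x - y|)) ≤ 1 :=
          Real.exp_le_one_iff.2 (neg_nonpos.2 (by positivity))
        split_ifs
        · rwa [abs_of_pos (Real.exp_pos _)]
        · rwa [abs_neg, abs_of_pos (Real.exp_pos _)]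
      have hW : 0 < x ^ (-((d - 1) / 2)) * y ^ (-((d - 1) / 2)) := by positivity
      nlinarith
    · simp only [zero_mul, norm_zero]
      exact indicator_nonneg (fun y hy => by
        have : 0 < y := by have : 0 < x / 16 := by positivity
                           linarith [hy.1]
        positivity) _

/-- The main part uses cancellation through the truncated Hilbert transform. The remainder is taken
in absolute value and extended to all λ > 0, so its bound does not see Λ. -/
theorem exists_lintegral_gradTransform_le {d p : ℝ} (hd : 2 < d) (hp : 1 < p) :
    ∃ C : ℝ≥0, ∀ Λ : ℝ, 0 < Λ → ∀ (g : ℝ → ℂ) (M ρ : ℝ), IsBoundedCompact g M ρ →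
      ∫⁻ x, ‖∫ lam in Ioc 0 Λ, gradTransform d lam g x‖ₑ ^ p ∂radialMeasure d ≤
        C * ∫⁻ y, ‖g y‖ₑ ^ p ∂radialMeasure d := by
  obtain ⟨C₁, h₁⟩ := exists_lintegral_nearTransform_le hd hp
  obtain ⟨C₂, h₂⟩ := exists_lintegral_gradError_le hd
  have hp0 : 0 < p := by linarith
  have hdp : d / p < d := div_lt_self (by linarith) hp
  have hdp0 : 0 < d / p := by positivity
  have hfin := lintegral_errorProfile_lt_top (d := d) (e := d - 1 - d / p) (by linarith) (by linarith)
  set A := ∫⁻ ρ in Ioi (0 : ℝ), errorProfile d ρ * ENNReal.ofReal (ρ ^ (d - 1 - d / p)) with hA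
  have hCfin : (2 : ℝ≥0∞) ^ (p - 1) * ((C₂ : ℝ≥0∞) ^ p * A ^ p + C₁) ≠ ⊤ := by
    refine ENNReal.mul_ne_top (by simp) (ENNReal.add_ne_top.2
      ⟨ENNReal.mul_ne_top (by simp [hp0.le]) (ENNReal.rpow_ne_top_of_nonneg hp0.le hfin.ne), by simp⟩)
  refine ⟨(2 ^ (p - 1) * ((C₂ : ℝ≥0∞) ^ p * A ^ p + C₁)).toNNReal, fun Λ hΛ g M ρ hg => ?_⟩
  rw [ENNReal.coe_toNNReal hCfin]
  have hgm : Measurable fun y => ‖g y‖ₑ := hg.meas.measurable.enorm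
  set T : ℝ → ℝ≥0∞ := fun x => ∫⁻ y, ENNReal.ofReal (x ^ (-d)) * errorProfile d (y / x) * ‖g y‖ₑ
    ∂radialMeasure d with hT
  have hηm := measurable_errorProfile d
  have hTm : Measurable T := by
    refine Measurable.lintegral_prod_right' (f := fun q : ℝ × ℝ =>
      ENNReal.ofReal (q.1 ^ (-d)) * errorProfile d (q.2 / q.1) * ‖g q.2‖ₑ) ?_
    exact Measurable.mul (by fun_prop) (hgm.comp measurable_snd)
  have hTle : ∫⁻ x, T x ^ p ∂radialMeasure d ≤ A ^ p * ∫⁻ y, ‖g y‖ₑ ^ p ∂radialMeasure d :=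
    lintegral_homogeneous_kernel_le d hp hηm hgm
  -- The dominating operator maps into L^p, hence is finite almost everywhere; at such x the double
  -- integral of the error converges absolutely and Fubini applies.
  have hTfin : ∀ᵐ x ∂radialMeasure d, T x ^ p < ⊤ := by
    refine ae_lt_top (hTm.pow_const p) (ne_of_lt (hTle.trans_lt (ENNReal.mul_lt_top ?_
      (hg.lintegral_radialMeasure_lt_top (by linarith) hp0))))
    exact ENNReal.rpow_lt_top_of_nonneg hp0.le hfin.ne
  have hpos : ∀ᵐ x ∂radialMeasure d, x ∈ Ioi (0 : ℝ) :=
    (withDensity_absolutelyContinuous _ _).ae_le (ae_restrict_mem measurableSet_Ioi)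
  have key : ∀ᵐ x ∂radialMeasure d, ‖∫ lam in Ioc 0 Λ, gradTransform d lam g x‖ₑ ^ p ≤
      2 ^ (p - 1) * ((C₂ : ℝ≥0∞) ^ p * T x ^ p + ‖nearTransform d Λ g x‖ₑ ^ p) := by
    filter_upwards [hTfin, hpos] with x hTx (hx : 0 < x)
    have hTx' : T x < ⊤ := by
      by_contra! h
      rw [top_le_iff.1 h, ENNReal.top_rpow_of_pos hp0] at hTx
      exact lt_irrefl _ hTx
    set μ := volume.restrict (Ioc 0 Λ)
    set ν := volume.restrict (Ioi (0 : ℝ))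
    have i₂ := integrable_nearKernel (d := d) (Λ := Λ) hx hg
    set F₂ : ℝ × ℝ → ℂ := fun q => ((nearKernel d q.1 x q.2 * q.2 ^ (d - 1) : ℝ) : ℂ) * g q.2 with hF₂
    set F₁ : ℝ × ℝ → ℂ := fun q => ((gradError d q.1 x q.2 * q.2 ^ (d - 1) : ℝ) : ℂ) * g q.2 with hF₁
    have hF₁m : StronglyMeasurable F₁ := by
      refine StronglyMeasurable.mul ?_ (hg.meas.comp_measurable measurable_snd)
      refine Measurable.stronglyMeasurable (Complex.measurable_ofReal.comp ?_)
      have hm : Measurable fun q : ℝ × ℝ => (q.1, x, q.2) := by fun_prop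
      exact ((measurable_gradError d).comp hm).mul (by fun_prop)
    have hle : ∫⁻ q, ‖F₁ q‖ₑ ∂(μ.prod ν) ≤ C₂ * T x := by
      rw [lintegral_prod_symm' _ hF₁m.enorm, hT]
      simp only
      rw [lintegral_radialMeasure_eq, ← lintegral_const_mul' _ _ ENNReal.coe_ne_top]
      have hne : ∀ᵐ y ∂ν, y ≠ x := ae_restrict_of_ae (by simp [ae_iff])
      refine lintegral_mono_ae ?_
      filter_upwards [hne, ae_restrict_mem measurableSet_Ioi] with y hy (hy0 : 0 < y)
      have e : ∀ lam, ‖F₁ (lam, y)‖ₑ =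
          ‖gradError d lam x y‖ₑ * (ENNReal.ofReal (y ^ (d - 1)) * ‖g y‖ₑ) := fun lam => by
        simp only [hF₁]
        rw [enorm_mul, ← ofReal_norm, Complex.norm_real, norm_mul,
          ENNReal.ofReal_mul (norm_nonneg _), ofReal_norm,
          Real.norm_of_nonneg (by positivity : 0 ≤ y ^ (d - 1)), mul_assoc]
      simp only [e]
      have hm : Measurable fun lam : ℝ => (lam, x, y) := by fun_prop
      have hmE : Measurable fun lam => ‖gradError d lam x y‖ₑ :=
        ((measurable_gradError d).comp hm).enorm
      rw [lintegral_mul_const _ hmE]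
      calc _ ≤ (C₂ * (ENNReal.ofReal (x ^ (-d)) * errorProfile d (y / x))) *
            (ENNReal.ofReal (y ^ (d - 1)) * ‖g y‖ₑ) := by
            gcongr
            exact (lintegral_mono_set Ioc_subset_Ioi_self).trans (h₂ x y hx hy0 hy)
        _ = _ := by ring
    have i₁ : Integrable F₁ (μ.prod ν) :=
      ⟨hF₁m.aestronglyMeasurable, hle.trans_lt (ENNReal.mul_lt_top ENNReal.coe_lt_top hTx')⟩
    have e1 : ∫ lam in Ioc 0 Λ, gradTransform d lam g x =
        (∫ q, F₁ q ∂(μ.prod ν)) + ∫ q, F₂ q ∂(μ.prod ν) := by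
      rw [← integral_add i₁ i₂, integral_prod (f := fun q => F₁ q + F₂ q) (i₁.add i₂)]
      refine integral_congr_ae (Eventually.of_forall fun lam => ?_)
      simp only [gradTransform]
      refine integral_congr_ae (Eventually.of_forall fun y => ?_)
      simp only [hF₁, hF₂, gradError_eq]
      push_cast
      ring
    have e2 : ∫ q, F₂ q ∂(μ.prod ν) = nearTransform d Λ g x := by
      rw [integral_prod_symm _ i₂, nearTransform]
      have hne : ∀ᵐ y ∂ν, y ≠ x := ae_restrict_of_ae (by simp [ae_iff])
      refine integral_congr_ae ?_
      filter_upwards [hne] with y hy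
      simp only [hF₂]
      rw [integral_mul_const, integral_complex_ofReal, integral_mul_const]
      congr 2
      unfold nearKernel
      split_ifs
      · rw [integral_mainKernel hΛ hy]
      · simp
    rw [e1, e2]
    calc _ ≤ ((C₂ * T x) + ‖nearTransform d Λ g x‖ₑ) ^ p := by
          refine ENNReal.rpow_le_rpow ((enorm_add_le _ _).trans ?_) hp0.le
          gcongr
          exact (enorm_integral_le_lintegral_enorm _).trans hle
      _ ≤ _ := by
          refine (ENNReal.rpow_add_le_mul_rpow_add_rpow _ _ hp.le).trans ?_
          rw [ENNReal.mul_rpow_of_nonneg _ _ hp0.le]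
  calc _ ≤ _ := lintegral_mono_ae key
    _ = 2 ^ (p - 1) * ((C₂ : ℝ≥0∞) ^ p * (∫⁻ x, T x ^ p ∂radialMeasure d) +
        ∫⁻ x, ‖nearTransform d Λ g x‖ₑ ^ p ∂radialMeasure d) := by
        rw [lintegral_const_mul' _ _ (by simp), lintegral_add_left (by fun_prop),
          lintegral_const_mul' _ _ (by simp [hp0.le])]
    _ ≤ 2 ^ (p - 1) * ((C₂ : ℝ≥0∞) ^ p * (A ^ p * ∫⁻ y, ‖g y‖ₑ ^ p ∂radialMeasure d) +
        C₁ * ∫⁻ y, ‖g y‖ₑ ^ p ∂radialMeasure d) := by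
        gcongr
        exact h₁ Λ hΛ g M ρ hg
    _ = _ := by ring

/-! ### The boundary correction at ±1 -/

/-- The sum of the coefficients of the decaying solution in the Dirichlet and the Neumann resolvent
of `[1, ∞)`. -/
def boundaryCoeff (d lam : ℝ) : ℝ := besselM d lam + besselID d lam / besselKD d lam

theorem measurable_boundaryCoeff (d : ℝ) : Measurable (boundaryCoeff d) :=
  (measurable_besselM d).add ((measurable_besselID d).div (measurable_besselKD d))

theorem boundaryCoeff_nonneg {d : ℝ} (hd : 2 < d) {lam : ℝ} (hl : 0 < lam) :
    0 ≤ boundaryCoeff d lam :=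
  add_nonneg (besselM_nonneg hd lam)
    (div_nonneg (besselID_nonneg hd hl) (besselKD_pos hd hl).le)

/-- The Dirichlet coefficient I/K dominates at low frequency, with size s^{d-2}; the Neumann
coefficient I'/(-K') is O(s^d). -/
theorem exists_boundaryCoeff_le_of_le_one {d : ℝ} (hd : 2 < d) : ∃ C : ℝ, 0 < C ∧ ∀ s : ℝ, 0 < s →
    s ≤ 1 → boundaryCoeff d s ≤ C * s ^ (d - 2) := by
  obtain ⟨C₁, hC₁, h₁⟩ := exists_besselM_le hd
  obtain ⟨C₂, hC₂, h₂⟩ := exists_besselID_le_of_le_one hd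
  obtain ⟨c, hc, h₃, -⟩ := exists_le_besselKD hd
  refine ⟨C₁ + C₂ / c, by positivity, fun s hs hs1 => ?_⟩
  rw [boundaryCoeff, add_mul]
  refine add_le_add (h₁ s hs hs1) ?_
  calc besselID d s / besselKD d s ≤ C₂ * s / (c * s ^ (1 - d)) :=
        div_le_div₀ (by positivity) (h₂ s hs hs1) (by positivity) (h₃ s hs hs1)
    _ = C₂ / c * s ^ d := by
        rw [show 1 - d = -d + 1 by ring, Real.rpow_add hs, Real.rpow_neg hs.le, Real.rpow_one]
        have : s ^ d ≠ 0 := by positivity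
        field_simp
    _ ≤ C₂ / c * s ^ (d - 2) := by
        have := Real.rpow_le_rpow_of_exponent_ge hs hs1 (by linarith : d - 2 ≤ d)
        gcongr

/-- Both quotients grow like the ratio e^s/e^{-s} of the growing to the decaying solution. -/
theorem exists_boundaryCoeff_le_of_one_le {d : ℝ} (hd : 2 < d) : ∃ C : ℝ, 0 < C ∧ ∀ s : ℝ, 1 ≤ s →
    boundaryCoeff d s ≤ C * Real.exp (2 * s) := by
  obtain ⟨C₁, hC₁, h₁⟩ := (hasLimitRate_besselM hd).exists_bound
  obtain ⟨C₂, hC₂, h₂⟩ := (hasLimitRate_besselID hd).exists_bound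
  obtain ⟨c, hc, -, h₃⟩ := exists_le_besselKD hd
  refine ⟨C₁ + C₂ / c, by positivity, fun s hs1 => ?_⟩
  have hs : 0 < s := by linarith
  rw [boundaryCoeff, add_mul]
  refine add_le_add ?_ ?_
  · have h := (le_abs_self _).trans (h₁ s hs1)
    rw [Real.exp_neg, inv_mul_le_iff₀ (Real.exp_pos _)] at h
    linarith
  · have h := (le_abs_self _).trans (h₂ s hs1)
    have hsa : 0 < s ^ ((d - 1) / 2) := by positivity
    rw [besselKD_eq_amp d hs, div_le_iff₀
      (mul_pos (by positivity) (hc.trans_le (h₃ s hs1)))]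
    calc besselID d s = (s ^ ((d - 1) / 2) * Real.exp (-s) * besselID d s) *
          (Real.exp s * s ^ (-((d - 1) / 2))) := by
          rw [Real.rpow_neg hs.le, Real.exp_neg]
          field_simp
      _ ≤ C₂ * (Real.exp s * s ^ (-((d - 1) / 2))) := by gcongr
      _ = C₂ / c * (Real.exp s * s ^ (-((d - 1) / 2))) * c := by field_simp
      _ ≤ C₂ / c * (Real.exp s * s ^ (-((d - 1) / 2))) * besselAmpD d s := by
          gcongr
          exact h₃ s hs1
      _ = _ := by
          rw [show 2 * s = s + s by ring, Real.exp_add, Real.exp_neg]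
          field_simp

theorem lintegral_rpow_mul_one_add_rpow_lt_top {e k : ℝ} (he : -1 < e) (hk : 0 ≤ k)
    (hek : e - k < -1) :
    ∫⁻ ρ in Ioi (0 : ℝ), ENNReal.ofReal (ρ ^ e * (1 + ρ) ^ (-k)) < ⊤ := by
  rw [← Ioc_union_Ioi_eq_Ioi zero_le_one]
  refine (lintegral_union_le _ _ _).trans_lt (ENNReal.add_lt_top.2 ⟨?_, ?_⟩)
  · refine lt_of_le_of_lt ?_ (lintegral_Icc_abs_rpow_lt_top he 0 1)
    refine (setLIntegral_mono' measurableSet_Ioc fun t ht => ?_).trans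
      (lintegral_mono_set Ioc_subset_Icc_self)
    have ht0 : 0 < t := ht.1
    rw [abs_of_pos ht0]
    refine ENNReal.ofReal_le_ofReal (mul_le_of_le_one_right (by positivity) ?_)
    exact Real.rpow_le_one_of_one_le_of_nonpos (by linarith) (by linarith)
  · refine lt_of_le_of_lt (setLIntegral_mono' measurableSet_Ioi fun t (ht : 1 < t) => ?_)
      (integrableOn_Ioi_rpow_of_lt hek one_pos).lintegral_lt_top
    have ht0 : 0 < t := by linarith
    rw [sub_eq_add_neg, Real.rpow_add ht0]
    refine ENNReal.ofReal_le_ofReal (mul_le_mul_of_nonneg_left ?_ (by positivity))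
    exact Real.rpow_le_rpow_of_nonpos ht0 (by linarith) (by linarith)

theorem ae_radialMeasure_pos (d : ℝ) : ∀ᵐ x ∂radialMeasure d, x ∈ Ioi (0 : ℝ) :=
  (withDensity_absolutelyContinuous _ _).ae_le (ae_restrict_mem measurableSet_Ioi)

/-- The kernel has degree 2 - 2d, below -d. Since x and y are at least 1, it may be enlarged by
x^{2-d} ≤ x^{-β} and y^{k-d} ≤ y^{k-d+β}, which gives degree -d. The last two conditions on β are
integrability of the profile at 0 and at infinity. -/
theorem exists_lintegral_powerKernel_le {d p k β : ℝ} (hp : 1 < p) (hk : 0 ≤ k) (hβ : 0 ≤ β)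
    (hβd : β ≤ d - 2) (h1 : d / p - k < β) (h2 : β < d / p) :
    ∃ C : ℝ≥0, ∀ H : ℝ → ℝ≥0∞, Measurable H → (∀ y < 1, H y = 0) →
      ∫⁻ x in Ici 1, (∫⁻ y, ENNReal.ofReal (x ^ (2 - d) * y ^ (k - d) * (x + y) ^ (-k)) * H y
        ∂radialMeasure d) ^ p ∂radialMeasure d ≤ C * ∫⁻ y, H y ^ p ∂radialMeasure d := by
  have hp0 : 0 < p := by linarith
  set η : ℝ → ℝ≥0∞ := fun ρ => ENNReal.ofReal (ρ ^ (k - d + β) * (1 + ρ) ^ (-k)) with hη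
  have hfin : ∫⁻ ρ in Ioi 0, η ρ * ENNReal.ofReal (ρ ^ (d - 1 - d / p)) < ⊤ := by
    refine lt_of_le_of_lt (le_of_eq ?_)
      (lintegral_rpow_mul_one_add_rpow_lt_top (e := k - 1 + β - d / p) (k := k) (by linarith) hk (by linarith))
    refine setLIntegral_congr_fun measurableSet_Ioi fun ρ (hρ : 0 < ρ) => ?_
    simp only [hη]
    rw [← ENNReal.ofReal_mul (by positivity), mul_right_comm, ← Real.rpow_add hρ]
    ring_nf
  refine ⟨((∫⁻ ρ in Ioi 0, η ρ * ENNReal.ofReal (ρ ^ (d - 1 - d / p))) ^ p).toNNReal,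
    fun H hH h0 => ?_⟩
  rw [ENNReal.coe_toNNReal (ENNReal.rpow_ne_top_of_nonneg hp0.le hfin.ne)]
  refine le_trans ?_ (lintegral_homogeneous_kernel_le d hp (by fun_prop) hH)
  refine le_trans (setLIntegral_mono' measurableSet_Ici fun x (hx : 1 ≤ x) => ?_)
    (setLIntegral_le_lintegral _ _)
  refine ENNReal.rpow_le_rpow (lintegral_mono fun y => ?_) hp0.le
  rcases lt_or_ge y 1 with hy | hy
  · rw [h0 y hy]; simp
  have hx0 : 0 < x := by linarith
  have hy0 : 0 < y := by linarith
  refine mul_le_mul_left ?_ _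
  simp only [hη]
  rw [← ENNReal.ofReal_mul (by positivity)]
  refine ENNReal.ofReal_le_ofReal ?_
  have e1 : x ^ (2 - d) ≤ x ^ (-β) := Real.rpow_le_rpow_of_exponent_le hx (by linarith)
  have e2 : y ^ (k - d) ≤ y ^ (k - d + β) := Real.rpow_le_rpow_of_exponent_le hy (by linarith)
  have e3 : y = x * (y / x) := by field_simp
  have e4 : x + y = x * (1 + y / x) := by field_simp
  calc _ ≤ x ^ (-β) * y ^ (k - d + β) * (x + y) ^ (-k) := by gcongr
    _ = x ^ (-β) * (x ^ (k - d + β) * (y / x) ^ (k - d + β)) * (x ^ (-k) * (1 + y / x) ^ (-k)) := by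
        rw [← Real.mul_rpow hx0.le (by positivity), ← Real.mul_rpow hx0.le (by positivity), ← e3,
          ← e4]
    _ = (x ^ (-β) * x ^ (k - d + β) * x ^ (-k)) * ((y / x) ^ (k - d + β) * (1 + y / x) ^ (-k)) := by
        ring
    _ = _ := by
        rw [← Real.rpow_add hx0, ← Real.rpow_add hx0]
        ring_nf

/-- Hardy's inequality. -/
theorem exists_lintegral_hardy_le {d p : ℝ} (hp : 1 < p) (hpd : p < d) :
    ∃ C : ℝ≥0, ∀ G : ℝ → ℝ≥0∞, Measurable G →
      ∫⁻ x, (ENNReal.ofReal x⁻¹ * ∫⁻ t in Ioi x, G t) ^ p ∂radialMeasure d ≤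
        C * ∫⁻ y, G y ^ p ∂radialMeasure d := by
  have hp0 : 0 < p := by linarith
  -- Relative to y^{d-1} dy the Hardy operator has kernel x⁻¹ y^{1-d} on y > x, homogeneous of
  -- degree -d. Its profile against ρ^{d-1-d/p} is ρ^{-d/p}, integrable at infinity exactly when p <
  -- d.
  set η : ℝ → ℝ≥0∞ := (Ioi 1).indicator fun ρ => ENNReal.ofReal (ρ ^ (1 - d)) with hη
  have hfin : ∫⁻ ρ in Ioi 0, η ρ * ENNReal.ofReal (ρ ^ (d - 1 - d / p)) < ⊤ := by
    have : -(d / p) < -1 := neg_lt_neg ((one_lt_div hp0).2 hpd)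
    refine lt_of_le_of_lt ?_ (integrableOn_Ioi_rpow_of_lt this one_pos).lintegral_lt_top
    rw [← lintegral_indicator measurableSet_Ioi, ← lintegral_indicator measurableSet_Ioi]
    refine lintegral_mono fun ρ => ?_
    refine (indicator_le_self' (fun _ _ => zero_le) ρ).trans ?_
    by_cases hρ : ρ ∈ Ioi (1 : ℝ)
    · have hρ0 : 0 < ρ := one_pos.trans hρ
      simp only [hη, indicator_of_mem hρ]
      rw [← ENNReal.ofReal_mul (by positivity), ← Real.rpow_add hρ0]
      ring_nf
      rfl
    · simp only [hη, indicator_of_notMem hρ, zero_mul, zero_le]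
  refine ⟨((∫⁻ ρ in Ioi 0, η ρ * ENNReal.ofReal (ρ ^ (d - 1 - d / p))) ^ p).toNNReal,
    fun G hG => ?_⟩
  rw [ENNReal.coe_toNNReal (ENNReal.rpow_ne_top_of_nonneg hp0.le hfin.ne)]
  have hηm : Measurable η := Measurable.indicator (by fun_prop) measurableSet_Ioi
  refine le_trans (lintegral_mono_ae ?_) (lintegral_homogeneous_kernel_le d hp hηm hG)
  filter_upwards [ae_radialMeasure_pos d] with x (hx : 0 < x)
  refine ENNReal.rpow_le_rpow (le_of_eq ?_) hp0.le
  rw [lintegral_radialMeasure_eq, ← lintegral_indicator measurableSet_Ioi,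
    ← lintegral_indicator measurableSet_Ioi, ← lintegral_const_mul' _ _ ENNReal.ofReal_ne_top]
  refine lintegral_congr fun y => ?_
  by_cases hy : y ∈ Ioi x
  · have hy0 : 0 < y := hx.trans hy
    rw [indicator_of_mem hy, indicator_of_mem (mem_Ioi.2 hy0)]
    simp only [hη]
    rw [indicator_of_mem (show y / x ∈ Ioi (1 : ℝ) from (one_lt_div hx).2 hy),
      ← ENNReal.ofReal_mul (by positivity), ← mul_assoc, ← ENNReal.ofReal_mul (by positivity)]
    congr 2
    rw [Real.div_rpow hy0.le hx.le, show 1 - d = -(d - 1) by ring, Real.rpow_neg hy0.le,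
      Real.rpow_neg hx.le (d - 1), ← Real.rpow_neg_one x, show (-1 : ℝ) = -d + (d - 1) by ring,
      Real.rpow_add hx]
    field_simp
  · rw [indicator_of_notMem hy, mul_zero]
    symm
    refine indicator_apply_eq_zero.2 fun hy0 => ?_
    simp only [hη]
    rw [indicator_of_notMem (fun h : y / x ∈ Ioi (1 : ℝ) => hy ((one_lt_div hx).1 h))]
    simp

theorem lintegral_mul_lintegral_le {ν μ : Measure ℝ} [SFinite ν] [SFinite μ] {w G E : ℝ → ℝ≥0∞}
    {k : ℝ → ℝ → ℝ≥0∞} (hw : Measurable w) (hk : Measurable (Function.uncurry k))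
    (hG : Measurable G) (hE : ∀ᵐ y ∂μ, G y ≠ 0 → ∫⁻ t, w t * k t y ∂ν ≤ E y) :
    ∫⁻ t, w t * ∫⁻ y, k t y * G y ∂μ ∂ν ≤ ∫⁻ y, E y * G y ∂μ := by
  have hkt : ∀ t, Measurable (k t) := fun t => hk.comp measurable_prodMk_left
  have hky : ∀ y, Measurable fun t => k t y := fun y => hk.comp measurable_prodMk_right
  calc _ = ∫⁻ t, ∫⁻ y, w t * (k t y * G y) ∂μ ∂ν := by
        refine lintegral_congr fun t => ?_
        exact (lintegral_const_mul _ ((hkt t).mul hG)).symm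
    _ = ∫⁻ y, ∫⁻ t, w t * (k t y * G y) ∂ν ∂μ := by
        refine lintegral_lintegral_swap (Measurable.aemeasurable ?_)
        exact (hw.comp measurable_fst).mul (hk.mul (hG.comp measurable_snd))
    _ ≤ _ := by
        refine lintegral_mono_ae ?_
        filter_upwards [hE] with y hy
        simp only [← mul_assoc]
        rw [lintegral_mul_const (f := fun t => w t * k t y) _ (hw.mul (hky y))]
        by_cases h : G y = 0
        · simp [h]
        · exact mul_le_mul_left (hy h) _

theorem setLIntegral_Ici_radialMeasure (d : ℝ) (F : ℝ → ℝ≥0∞) :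
    ∫⁻ x in Ici 1, F x ∂radialMeasure d =
      ∫⁻ ξ in Ioi (0 : ℝ), ENNReal.ofReal ((1 + ξ) ^ (d - 1)) * F (1 + ξ) := by
  have h1 : ∫⁻ x in Ici 1, F x ∂radialMeasure d =
      ∫⁻ x in Ioi (1 : ℝ), ENNReal.ofReal (x ^ (d - 1)) * F x := by
    rw [← lintegral_indicator measurableSet_Ici, lintegral_radialMeasure_eq,
      ← Measure.restrict_congr_set (Ioi_ae_eq_Ici (a := (1 : ℝ))).symm, ← lintegral_indicator measurableSet_Ioi,
      ← lintegral_indicator measurableSet_Ici]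
    refine lintegral_congr fun x => ?_
    by_cases hx : x ∈ Ici (1 : ℝ)
    · rw [indicator_of_mem hx, indicator_of_mem (mem_Ioi.2 (one_pos.trans_le hx)),
        indicator_of_mem hx]
    · simp only [indicator_of_notMem hx]
      exact indicator_apply_eq_zero.2 fun _ => by rw [indicator_of_notMem hx, mul_zero]
  rw [h1, ← lintegral_indicator measurableSet_Ioi, ← lintegral_indicator measurableSet_Ioi,
    ← lintegral_add_left_eq_self _ (1 : ℝ)]
  refine lintegral_congr fun x => ?_
  by_cases hx : 0 < x
  · rw [indicator_of_mem (mem_Ioi.2 hx), indicator_of_mem (mem_Ioi.2 (by linarith))]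
  · rw [indicator_of_notMem (fun h => hx (mem_Ioi.1 h)),
      indicator_of_notMem (fun h => hx (by linarith [mem_Ioi.1 h]))]

theorem exists_rpow_mul_exp_le (q : ℝ) :
    ∃ C : ℝ, 0 < C ∧ ∀ x : ℝ, 1 ≤ x → x ^ q * Real.exp (-(x - 1)) ≤ C := by
  obtain ⟨C, hC, h⟩ := exists_rpow_le_exp (abs_nonneg q) one_pos
  refine ⟨C * Real.exp 1, by positivity, fun x hx => ?_⟩
  calc x ^ q * Real.exp (-(x - 1)) ≤ (C * Real.exp x) * Real.exp (-(x - 1)) := by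
        gcongr
        exact (Real.rpow_le_rpow_of_exponent_le hx (le_abs_self q)).trans
          (by simpa using h x (by linarith))
    _ = C * Real.exp 1 := by
        rw [mul_assoc, ← Real.exp_add]
        ring_nf

/-- In ξ = x - 1 and t = y - 1 the kernel is e^{-ξ-t}/(ξ+t) with power weights in 1 + ξ and 1 + t.
The exponentials absorb the weights, and 1/(ξ+t) is homogeneous of degree -1, hence bounded on
L^p(0, ∞). -/
theorem exists_lintegral_expKernel_le {p : ℝ} (d : ℝ) (hp : 1 < p) :
    ∃ C : ℝ≥0, ∀ G : ℝ → ℝ≥0∞, Measurable G → (∀ y < 1, G y = 0) →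
      ∫⁻ x in Ici 1, (∫⁻ y, ENNReal.ofReal (x ^ (-((d - 1) / 2)) * y ^ (-((d - 1) / 2)) *
        (Real.exp (-(x + y - 2)) / (x + y - 2))) * G y ∂radialMeasure d) ^ p ∂radialMeasure d ≤
        C * ∫⁻ y, G y ^ p ∂radialMeasure d := by
  have hp0 : 0 < p := by linarith
  have hpi : 1 / p < 1 := (div_lt_one hp0).2 hp
  have hpi0 : 0 < 1 / p := by positivity
  set a := (d - 1) / 2 with ha
  set b := (d - 1) / p with hb
  obtain ⟨C₁, hC₁, h₁⟩ := exists_rpow_mul_exp_le (b - a)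
  obtain ⟨C₂, hC₂, h₂⟩ := exists_rpow_mul_exp_le (d - 1 - a - b)
  set η : ℝ → ℝ≥0∞ := fun ρ => ENNReal.ofReal ((1 + ρ) ^ (-1 : ℝ)) with hη
  have hηm : Measurable η := by fun_prop
  have hfin : ∫⁻ ρ in Ioi 0, η ρ * ENNReal.ofReal (ρ ^ (1 - 1 - 1 / p)) < ⊤ := by
    refine lt_of_le_of_lt (le_of_eq ?_)
      (lintegral_rpow_mul_one_add_rpow_lt_top (e := 1 - 1 - 1 / p) (k := 1) (by linarith)
        zero_le_one (by linarith))
    refine setLIntegral_congr_fun measurableSet_Ioi fun ρ (hρ : 0 < ρ) => ?_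
    simp only [hη]
    rw [← ENNReal.ofReal_mul (by positivity), mul_comm]
  set A := ∫⁻ ρ in Ioi 0, η ρ * ENNReal.ofReal (ρ ^ (1 - 1 - 1 / p)) with hA
  refine ⟨(ENNReal.ofReal (C₁ * C₂) ^ p * A ^ p).toNNReal, fun G hG h0 => ?_⟩
  rw [ENNReal.coe_toNNReal (ENNReal.mul_ne_top
    (ENNReal.rpow_ne_top_of_nonneg hp0.le ENNReal.ofReal_ne_top)
    (ENNReal.rpow_ne_top_of_nonneg hp0.le hfin.ne))]
  set H : ℝ → ℝ≥0∞ := fun t => ENNReal.ofReal ((1 + t) ^ b) * G (1 + t) with hH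
  have hHm : Measurable H := by fun_prop
  -- `radialMeasure 1` is Lebesgue measure on (0, ∞), so the homogeneous kernel bound is used with
  -- dimension 1.
  set S : ℝ → ℝ≥0∞ := fun ξ => ∫⁻ t, ENNReal.ofReal (ξ ^ (-(1 : ℝ))) * η (t / ξ) * H t
    ∂radialMeasure 1 with hS
  have hpt : ∀ ξ : ℝ, 0 < ξ → ENNReal.ofReal ((1 + ξ) ^ b) *
      (∫⁻ y, ENNReal.ofReal ((1 + ξ) ^ (-a) * y ^ (-a) *
        (Real.exp (-(1 + ξ + y - 2)) / (1 + ξ + y - 2))) * G y ∂radialMeasure d) ≤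
      ENNReal.ofReal (C₁ * C₂) * S ξ := by
    intro ξ hξ
    have e1 : ∫⁻ y, ENNReal.ofReal ((1 + ξ) ^ (-a) * y ^ (-a) *
        (Real.exp (-(1 + ξ + y - 2)) / (1 + ξ + y - 2))) * G y ∂radialMeasure d =
        ∫⁻ y in Ici 1, ENNReal.ofReal ((1 + ξ) ^ (-a) * y ^ (-a) *
        (Real.exp (-(1 + ξ + y - 2)) / (1 + ξ + y - 2))) * G y ∂radialMeasure d := by
      rw [← lintegral_indicator measurableSet_Ici]
      refine lintegral_congr fun y => ?_
      by_cases hy : y ∈ Ici (1 : ℝ)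
      · rw [indicator_of_mem hy]
      · rw [indicator_of_notMem hy, h0 y (not_le.1 hy), mul_zero]
    rw [e1, setLIntegral_Ici_radialMeasure, hS]
    simp only
    rw [lintegral_radialMeasure_eq, ← lintegral_const_mul' _ _ ENNReal.ofReal_ne_top,
      ← lintegral_const_mul' _ _ ENNReal.ofReal_ne_top]
    refine setLIntegral_mono' measurableSet_Ioi fun t (ht : 0 < t) => ?_
    simp only [hη, hH]
    have hx1 : 0 < 1 + ξ := by linarith
    have hy1 : 0 < 1 + t := by linarith
    have hxy : 1 + ξ + (1 + t) - 2 = ξ + t := by ring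
    have hxy0 : 0 < ξ + t := by linarith
    rw [hxy, sub_self, Real.rpow_zero, ENNReal.ofReal_one, one_mul]
    simp only [← mul_assoc]
    refine mul_le_mul_left ?_ _
    rw [← ENNReal.ofReal_mul (by positivity), ← ENNReal.ofReal_mul (by positivity),
      ← ENNReal.ofReal_mul (by positivity), ← ENNReal.ofReal_mul (by positivity),
      ← ENNReal.ofReal_mul (by positivity)]
    refine ENNReal.ofReal_le_ofReal ?_
    have k1 := h₁ (1 + ξ) (by linarith)
    have k2 := h₂ (1 + t) (by linarith)
    rw [add_sub_cancel_left] at k1 k2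
    have k3 : ξ ^ (-(1 : ℝ)) * (1 + t / ξ) ^ (-1 : ℝ) = (ξ + t)⁻¹ := by
      rw [Real.rpow_neg_one, Real.rpow_neg_one, ← mul_inv]
      congr 1
      field_simp
    have k4 : (1 + ξ) ^ b * (1 + ξ) ^ (-a) = (1 + ξ) ^ (b - a) := by
      rw [← Real.rpow_add hx1]; ring_nf
    have k5 : (1 + t) ^ (d - 1) * (1 + t) ^ (-a) = (1 + t) ^ (d - 1 - a - b) * (1 + t) ^ b := by
      rw [← Real.rpow_add hy1, ← Real.rpow_add hy1]; ring_nf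
    calc _ = ((1 + ξ) ^ b * (1 + ξ) ^ (-a)) * ((1 + t) ^ (d - 1) * (1 + t) ^ (-a)) *
          (Real.exp (-ξ) * Real.exp (-t)) * (ξ + t)⁻¹ := by
          rw [← Real.exp_add, ← neg_add]
          ring
      _ = ((1 + ξ) ^ (b - a) * Real.exp (-ξ)) * ((1 + t) ^ (d - 1 - a - b) * Real.exp (-t)) *
          ((ξ + t)⁻¹ * (1 + t) ^ b) := by
          rw [k4, k5]
          ring
      _ ≤ C₁ * C₂ * ((ξ + t)⁻¹ * (1 + t) ^ b) := by gcongr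
      _ = _ := by
          rw [← k3]
          ring
  have hHint : ∫⁻ t, H t ^ p ∂radialMeasure 1 ≤ ∫⁻ y, G y ^ p ∂radialMeasure d := by
    refine le_trans ?_ (setLIntegral_le_lintegral (Ici 1) _)
    rw [setLIntegral_Ici_radialMeasure, lintegral_radialMeasure_eq]
    refine le_of_eq (setLIntegral_congr_fun measurableSet_Ioi fun t (ht : 0 < t) => ?_)
    have ht1 : 0 < 1 + t := by linarith
    simp only [hH]
    rw [ENNReal.mul_rpow_of_nonneg _ _ hp0.le, ENNReal.ofReal_rpow_of_pos (by positivity),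
      ← Real.rpow_mul ht1.le, hb, div_mul_cancel₀ _ hp0.ne']
    simp
  rw [setLIntegral_Ici_radialMeasure]
  calc _ ≤ ∫⁻ ξ in Ioi (0 : ℝ), (ENNReal.ofReal (C₁ * C₂) * S ξ) ^ p := by
        refine setLIntegral_mono' measurableSet_Ioi fun ξ (hξ : 0 < ξ) => ?_
        refine le_trans (le_of_eq ?_) (ENNReal.rpow_le_rpow (hpt ξ hξ) hp0.le)
        have hx1 : 0 < 1 + ξ := by linarith
        rw [ENNReal.mul_rpow_of_nonneg _ _ hp0.le, ENNReal.ofReal_rpow_of_pos (by positivity),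
          ← Real.rpow_mul hx1.le, hb, div_mul_cancel₀ _ hp0.ne']
    _ = ENNReal.ofReal (C₁ * C₂) ^ p * ∫⁻ ξ, S ξ ^ p ∂radialMeasure 1 := by
        rw [lintegral_radialMeasure_eq, ← lintegral_const_mul' _ _
          (ENNReal.rpow_ne_top_of_nonneg hp0.le ENNReal.ofReal_ne_top)]
        refine setLIntegral_congr_fun measurableSet_Ioi fun ξ _ => ?_
        rw [ENNReal.mul_rpow_of_nonneg _ _ hp0.le]
        simp
    _ ≤ ENNReal.ofReal (C₁ * C₂) ^ p * (A ^ p * ∫⁻ y, G y ^ p ∂radialMeasure d) := by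
        refine mul_le_mul_right ?_ _
        exact (lintegral_homogeneous_kernel_le 1 hp hηm hHm).trans (mul_le_mul_right hHint _)
    _ = _ := by ring

/-- The weight of the boundary correction to the resolvent. -/
def correctionWeight (d lam x : ℝ) : ℝ := lam ^ d * boundaryCoeff d lam * besselK d (lam * x)

theorem measurable_correctionWeight (d : ℝ) :
    Measurable fun q : ℝ × ℝ => correctionWeight d q.1 q.2 := by
  have h1 := measurable_boundaryCoeff d
  have h2 := measurable_besselK d
  unfold correctionWeight
  fun_prop

theorem correctionWeight_nonneg {d : ℝ} (hd : 2 < d) {lam x : ℝ} (hl : 0 < lam) (hx : 0 < x) :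
    0 ≤ correctionWeight d lam x :=
  mul_nonneg (mul_nonneg (by positivity) (boundaryCoeff_nonneg hd hl))
    (besselK_pos (by linarith : 1 < d) (by positivity)).le

theorem exists_correctionWeight_le_of_le_one {d : ℝ} (hd : 2 < d) : ∃ C : ℝ, 0 < C ∧
    ∀ lam x : ℝ, 0 < lam → lam ≤ 1 → 0 < x →
      correctionWeight d lam x ≤ C * x ^ (2 - d) * (lam ^ d * Real.exp (-(lam * x / 2))) := by
  obtain ⟨C, hC, h⟩ := exists_boundaryCoeff_le_of_le_one hd
  obtain ⟨D, hD, h'⟩ := exists_besselK_le hd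
  refine ⟨C * D, by positivity, fun lam x hl hl1 hx => ?_⟩
  have hB := boundaryCoeff_nonneg hd hl
  have hK := besselK_pos (by linarith : 1 < d) (mul_pos hl hx)
  have e : lam ^ (d - 2) * lam ^ (2 - d) = 1 := by
    rw [← Real.rpow_add hl]; simp
  calc _ ≤ lam ^ d * (C * lam ^ (d - 2)) *
        (D * (lam * x) ^ (2 - d) * Real.exp (-(lam * x / 2))) := by
        unfold correctionWeight
        gcongr
        · exact h lam hl hl1
        · exact h' _ (by positivity)
    _ = (C * D * x ^ (2 - d) * (lam ^ d * Real.exp (-(lam * x / 2)))) *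
        (lam ^ (d - 2) * lam ^ (2 - d)) := by
        rw [Real.mul_rpow hl.le hx.le]; ring
    _ = _ := by rw [e, mul_one]

theorem lintegral_correctionWeight_le {d C x y k b : ℝ} (hk : 0 < k)
    (hC : 0 ≤ C) (hx : 0 < x) (hy : 0 < y) {φ : ℝ → ℝ}
    (h : ∀ lam, 0 < lam → lam ≤ 1 → correctionWeight d lam x * φ lam ≤
      C * x ^ (2 - d) * y ^ b * (lam ^ (k - 1) * Real.exp (-((x + y) / 2 * lam)))) :
    ∫⁻ lam in Ioc (0 : ℝ) 1, ENNReal.ofReal (correctionWeight d lam x * φ lam) ≤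
      ENNReal.ofReal (C * (2 ^ k * Real.Gamma k)) *
        ENNReal.ofReal (x ^ (2 - d) * y ^ b * (x + y) ^ (-k)) := by
  have hG := Real.Gamma_pos_of_pos hk
  calc _ ≤ ∫⁻ lam in Ioc (0 : ℝ) 1, ENNReal.ofReal (C * x ^ (2 - d) * y ^ b) *
        ENNReal.ofReal (lam ^ (k - 1) * Real.exp (-((x + y) / 2 * lam))) := by
        refine setLIntegral_mono' measurableSet_Ioc fun t ht => ?_
        rw [← ENNReal.ofReal_mul (by positivity)]
        exact ENNReal.ofReal_le_ofReal (h t ht.1 ht.2)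
    _ ≤ ENNReal.ofReal (C * x ^ (2 - d) * y ^ b) *
        ENNReal.ofReal ((1 / ((x + y) / 2)) ^ k * Real.Gamma k) := by
        rw [lintegral_const_mul' _ _ ENNReal.ofReal_ne_top,
          ← lintegral_rpow_mul_exp hk (by positivity)]
        gcongr
        exact Ioc_subset_Ioi_self
    _ = _ := by
        rw [← ENNReal.ofReal_mul (by positivity), ← ENNReal.ofReal_mul (by positivity)]
        congr 1
        rw [one_div_div, Real.div_rpow (by norm_num) (by positivity), Real.rpow_neg (by positivity)]
        field_simp

/-- For λ ≤ 1 the coefficient λ^{d-2} cancels the singularity λ^{2-d} of K(λx), and the remaining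
powers of λ cancel as well, leaving ∫ e^{-λ(x+y)/2} dλ. -/
theorem exists_lintegral_correctionWeight_mul_besselKD_le {d : ℝ} (hd : 2 < d) :
    ∃ C : ℝ, 0 < C ∧ ∀ x y : ℝ, 0 < x → 0 < y →
      ∫⁻ lam in Ioc (0 : ℝ) 1,
        ENNReal.ofReal (correctionWeight d lam x * (lam⁻¹ * besselKD d (lam * y))) ≤
        ENNReal.ofReal C * ENNReal.ofReal (x ^ (2 - d) * y ^ (1 - d) * (x + y) ^ (-1 : ℝ)) := by
  obtain ⟨C, hC, h⟩ := exists_correctionWeight_le_of_le_one hd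
  obtain ⟨D, hD, h'⟩ := exists_besselKD_le hd
  refine ⟨C * D * (2 ^ (1 : ℝ) * Real.Gamma 1), by simp; positivity, fun x y hx hy => ?_⟩
  refine lintegral_correctionWeight_le one_pos (by positivity) hx hy fun lam hl hl1 => ?_
  have hK := besselKD_pos hd (mul_pos hl hy)
  have hw := correctionWeight_nonneg hd hl hx
  have e : lam ^ d * lam⁻¹ * lam ^ (1 - d) = lam ^ ((1 : ℝ) - 1) := by
    rw [← Real.rpow_neg_one, ← Real.rpow_add hl, ← Real.rpow_add hl]; ring_nf
  calc _ ≤ (C * x ^ (2 - d) * (lam ^ d * Real.exp (-(lam * x / 2)))) *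
        (lam⁻¹ * (D * (lam * y) ^ (1 - d) * Real.exp (-(lam * y / 2)))) := by
        gcongr
        · exact h lam x hl hl1 hx
        · exact h' _ (by positivity)
    _ = C * D * x ^ (2 - d) * y ^ (1 - d) * ((lam ^ d * lam⁻¹ * lam ^ (1 - d)) *
        (Real.exp (-(lam * x / 2)) * Real.exp (-(lam * y / 2)))) := by
        rw [Real.mul_rpow hl.le hy.le]; ring
    _ = _ := by
        rw [e, ← Real.exp_add]; ring_nf

/-- Compared with the estimate through K', the remaining power of λ is λ² instead of λ⁰, hence the
gain from (x+y)^{-1} to (x+y)^{-3}. -/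
theorem exists_lintegral_correctionWeight_mul_besselK_le {d : ℝ} (hd : 2 < d) :
    ∃ C : ℝ, 0 < C ∧ ∀ x y : ℝ, 0 < x → 0 < y →
      ∫⁻ lam in Ioc (0 : ℝ) 1,
        ENNReal.ofReal (correctionWeight d lam x * besselK d (lam * y)) ≤
        ENNReal.ofReal C * ENNReal.ofReal (x ^ (2 - d) * y ^ (2 - d) * (x + y) ^ (-3 : ℝ)) := by
  obtain ⟨C, hC, h⟩ := exists_correctionWeight_le_of_le_one hd
  obtain ⟨D, hD, h'⟩ := exists_besselK_le hd
  have hG : 0 < Real.Gamma 3 := Real.Gamma_pos_of_pos (by norm_num)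
  refine ⟨C * D * (2 ^ (3 : ℝ) * Real.Gamma 3), by positivity, fun x y hx hy => ?_⟩
  refine lintegral_correctionWeight_le (by norm_num) (by positivity) hx hy fun lam hl hl1 => ?_
  have hK := besselK_pos (by linarith : 1 < d) (mul_pos hl hy)
  have hw := correctionWeight_nonneg hd hl hx
  have e : lam ^ d * lam ^ (2 - d) = lam ^ ((3 : ℝ) - 1) := by
    rw [← Real.rpow_add hl]; ring_nf
  calc _ ≤ (C * x ^ (2 - d) * (lam ^ d * Real.exp (-(lam * x / 2)))) *
        (D * (lam * y) ^ (2 - d) * Real.exp (-(lam * y / 2))) := by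
        gcongr
        · exact h lam x hl hl1 hx
        · exact h' _ (by positivity)
    _ = C * D * x ^ (2 - d) * y ^ (2 - d) * ((lam ^ d * lam ^ (2 - d)) *
        (Real.exp (-(lam * x / 2)) * Real.exp (-(lam * y / 2)))) := by
        rw [Real.mul_rpow hl.le hy.le]; ring
    _ = _ := by
        rw [e, ← Real.exp_add]; ring_nf

/-- At high frequency the three exponentials e^{2λ}, e^{-λx}, e^{-λy} combine to e^{-λ(x+y-2)} and
all powers of λ cancel. Strictness of 1 < x makes x + y - 2 positive. -/
theorem exists_lintegral_correctionWeight_mul_besselKD_le_exp {d : ℝ} (hd : 2 < d) :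
    ∃ C : ℝ, 0 < C ∧ ∀ x y : ℝ, 1 < x → 1 ≤ y →
      ∫⁻ lam in Ioi (1 : ℝ),
        ENNReal.ofReal (correctionWeight d lam x * (lam⁻¹ * besselKD d (lam * y))) ≤
        ENNReal.ofReal C * ENNReal.ofReal (x ^ (-((d - 1) / 2)) * y ^ (-((d - 1) / 2)) *
          (Real.exp (-(x + y - 2)) / (x + y - 2))) := by
  obtain ⟨C₁, hC₁, h₁⟩ := exists_boundaryCoeff_le_of_one_le hd
  obtain ⟨C₂, hC₂, h₂⟩ := (hasLimitRate_besselAmp hd).exists_bound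
  obtain ⟨C₃, hC₃, h₃⟩ := (hasLimitRate_besselAmpD hd).exists_bound
  refine ⟨C₁ * C₂ * C₃, by positivity, fun x y hx hy => ?_⟩
  have hx0 : 0 < x := by linarith
  have hy0 : 0 < y := by linarith
  have hxy : 0 < x + y - 2 := by linarith
  have hpt : ∀ lam, 1 < lam → correctionWeight d lam x * (lam⁻¹ * besselKD d (lam * y)) ≤
      C₁ * C₂ * C₃ * (x ^ (-((d - 1) / 2)) * y ^ (-((d - 1) / 2))) *
        Real.exp (-(x + y - 2) * lam) := by
    intro lam hl1
    have hl : 0 < lam := by linarith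
    have hB := boundaryCoeff_nonneg hd hl
    have hlx : 1 ≤ lam * x := by nlinarith
    have hly : 1 ≤ lam * y := by nlinarith
    have a1 := (le_abs_self _).trans (h₂ _ hlx)
    have a2 := (le_abs_self _).trans (h₃ _ hly)
    have hA := (besselAmp_pos hd (by linarith : 0 < lam * x)).le
    have hK := (besselKD_pos hd (by linarith : 0 < lam * y)).le
    rw [← rpow_mul_scale hl hx0 hy0, correctionWeight, besselK_eq_amp d (by linarith : 0 < lam * x)]
    have hAD : 0 ≤ besselAmpD d (lam * y) :=
      div_nonneg (besselAmp_pos (by linarith) (by linarith : 0 < lam * y)).le (by linarith)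
    rw [besselKD_eq_amp d (by linarith : 0 < lam * y)]
    calc _ ≤ lam ^ d * (C₁ * Real.exp (2 * lam)) * (Real.exp (-(lam * x)) *
          (lam * x) ^ (-((d - 1) / 2)) * C₂) * (lam⁻¹ * (Real.exp (-(lam * y)) *
          (lam * y) ^ (-((d - 1) / 2)) * C₃)) := by
          gcongr
          exact h₁ lam hl1.le
      _ = C₁ * C₂ * C₃ * ((lam ^ d * lam⁻¹) * (lam * x) ^ (-((d - 1) / 2)) *
          (lam * y) ^ (-((d - 1) / 2))) *
          (Real.exp (2 * lam) * Real.exp (-(lam * x)) * Real.exp (-(lam * y))) := by ring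
      _ = _ := by
          rw [← Real.exp_add, ← Real.exp_add, ← Real.rpow_neg_one lam, ← Real.rpow_add hl,
            ← sub_eq_add_neg]
          congr 2
          ring
  calc _ ≤ ∫⁻ lam in Ioi (1 : ℝ), ENNReal.ofReal (C₁ * C₂ * C₃ *
          (x ^ (-((d - 1) / 2)) * y ^ (-((d - 1) / 2)))) *
          ENNReal.ofReal (Real.exp (-(x + y - 2) * lam)) := by
        refine setLIntegral_mono' measurableSet_Ioi fun t ht => ?_
        rw [← ENNReal.ofReal_mul (by positivity)]
        exact ENNReal.ofReal_le_ofReal (hpt t ht)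
    _ = _ := by
        rw [lintegral_const_mul' _ _ ENNReal.ofReal_ne_top, ← ofReal_integral_eq_lintegral_ofReal
          (integrableOn_exp_mul_Ioi (neg_lt_zero.2 hxy) 1)
          (Eventually.of_forall fun _ => (Real.exp_pos _).le),
          integral_exp_mul_Ioi (neg_lt_zero.2 hxy), mul_one, neg_div_neg_eq,
          ← ENNReal.ofReal_mul (by positivity), ← ENNReal.ofReal_mul (by positivity)]
        congr 1
        ring

theorem measurable_lintegral_Ioi (G : ℝ → ℝ≥0∞) : Measurable fun y => ∫⁻ t in Ioi y, G t :=
  Antitone.measurable fun _ _ h => lintegral_mono_set (Ioi_subset_Ioi h)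

/-- `κ` is dominated by the Bessel transform of a function supported in `[1, ∞)` whose derivative
is dominated by `G`; both forms of the bound are recorded. -/
structure IsBesselMoment (d : ℝ) (G κ : ℝ → ℝ≥0∞) : Prop where
  meas : Measurable G
  supp : ∀ y < 1, G y = 0
  le_deriv : ∀ lam, 0 < lam →
    κ lam ≤ ∫⁻ y, ENNReal.ofReal (lam⁻¹ * besselKD d (lam * y)) * G y ∂radialMeasure d
  le_self : ∀ lam, 0 < lam → κ lam ≤ ∫⁻ y, ENNReal.ofReal (besselK d (lam * y)) *
    (Ici 1).indicator (fun y => ∫⁻ t in Ioi y, G t) y ∂radialMeasure d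

theorem lintegral_correctionWeight_mul_le {d x : ℝ} (hd : 2 < d) (hx : 0 < x) {s : Set ℝ}
    (hs : s ⊆ Ioi 0) (hsm : MeasurableSet s) {κ F E : ℝ → ℝ≥0∞} (hF : Measurable F)
    {φ : ℝ → ℝ → ℝ} (hφ : Measurable (Function.uncurry φ))
    (hκ : ∀ lam, 0 < lam → κ lam ≤ ∫⁻ y, ENNReal.ofReal (φ lam y) * F y ∂radialMeasure d)
    (hE : ∀ y, 0 < y → F y ≠ 0 →
      ∫⁻ lam in s, ENNReal.ofReal (correctionWeight d lam x * φ lam y) ≤ E y) :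
    ∫⁻ lam in s, ENNReal.ofReal (correctionWeight d lam x) * κ lam ≤
      ∫⁻ y, E y * F y ∂radialMeasure d := by
  have hm : Measurable fun lam : ℝ => (lam, x) := by fun_prop
  calc _ ≤ ∫⁻ lam in s, ENNReal.ofReal (correctionWeight d lam x) *
        ∫⁻ y, ENNReal.ofReal (φ lam y) * F y ∂radialMeasure d :=
        setLIntegral_mono' hsm fun lam hl => mul_le_mul_right (hκ lam (hs hl)) _
    _ ≤ _ := by
        refine lintegral_mul_lintegral_le (k := fun lam y => ENNReal.ofReal (φ lam y))
          ((measurable_correctionWeight d).comp hm).ennreal_ofReal hφ.ennreal_ofReal hF ?_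
        filter_upwards [ae_radialMeasure_pos d] with y hy hFy
        refine le_trans (le_of_eq (setLIntegral_congr_fun hsm fun lam hl => ?_)) (hE y hy hFy)
        rw [← ENNReal.ofReal_mul (correctionWeight_nonneg hd (hs hl) hx)]

/-- The form of the moment with the derivative needs an exponent β with d/p - 1 < β ≤ d - 2, hence
d/p < d - 1. In the complementary range of small p the moment is kept in terms of the function
itself, whose kernel decays faster, and Hardy's inequality recovers the derivative. -/
theorem exists_lintegral_correction_low_le {d p : ℝ} (hd : 2 < d) (hp : 1 < p) :
    ∃ C : ℝ≥0, ∀ G κ : ℝ → ℝ≥0∞, IsBesselMoment d G κ →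
      ∫⁻ x in Ici 1, (∫⁻ lam in Ioc (0 : ℝ) 1, ENNReal.ofReal (correctionWeight d lam x) * κ lam) ^ p
        ∂radialMeasure d ≤ C * ∫⁻ y, G y ^ p ∂radialMeasure d := by
  have hp0 : 0 < p := by linarith
  have hdp : 0 < d / p := by positivity
  have hKm := measurable_besselK d
  have hKDm := measurable_besselKD d
  rcases lt_or_ge (d / p) (d - 1) with hlt | hge
  · obtain ⟨C, hC, h⟩ := exists_lintegral_correctionWeight_mul_besselKD_le hd
    -- β = max(0, d/p - 1 + ε): the bound ½ keeps β below d/p, and the other bound keeps β at most d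
    -- - 2.
    set ε := min (1 / 2) (d - 1 - d / p) with hε
    have hε0 : 0 < ε := lt_min (by norm_num) (by linarith)
    have hε1 : ε ≤ 1 / 2 := min_le_left _ _
    have hε2 : ε ≤ d - 1 - d / p := min_le_right _ _
    obtain ⟨D, hD⟩ := exists_lintegral_powerKernel_le (d := d) (k := 1) (β := max 0 (d / p - 1 + ε))
      hp zero_le_one (le_max_left _ _) (max_le (by linarith) (by linarith))
      (lt_max_of_lt_right (by linarith)) (max_lt hdp (by linarith))
    refine ⟨Real.toNNReal C ^ p * D, fun G κ hκ => ?_⟩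
    calc _ ≤ ∫⁻ x in Ici 1, ENNReal.ofReal C ^ p * (∫⁻ y,
          ENNReal.ofReal (x ^ (2 - d) * y ^ (1 - d) * (x + y) ^ (-1 : ℝ)) * G y
            ∂radialMeasure d) ^ p ∂radialMeasure d := by
          refine setLIntegral_mono' measurableSet_Ici fun x (hx : 1 ≤ x) => ?_
          have hx0 : 0 < x := by linarith
          rw [← ENNReal.mul_rpow_of_nonneg _ _ hp0.le,
            ← lintegral_const_mul' _ _ ENNReal.ofReal_ne_top]
          refine ENNReal.rpow_le_rpow ?_ hp0.le
          simp only [← mul_assoc]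
          exact lintegral_correctionWeight_mul_le hd hx0 Ioc_subset_Ioi_self measurableSet_Ioc
            hκ.meas (φ := fun lam y => lam⁻¹ * besselKD d (lam * y)) (by fun_prop)
            hκ.le_deriv fun y hy _ => h x y hx0 hy
      _ ≤ _ := by
          rw [lintegral_const_mul' _ _ (ENNReal.rpow_ne_top_of_nonneg hp0.le ENNReal.ofReal_ne_top),
            ENNReal.coe_mul, mul_assoc, ENNReal.coe_rpow_of_nonneg _ hp0.le]
          exact mul_le_mul_right (hD G hκ.meas hκ.supp) _
  · have hpd : p < d := by
      have h1 : 1 < d / p := by linarith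
      exact (one_lt_div hp0).1 h1
    have hdp' : d / p < d := div_lt_self (by linarith) hp
    obtain ⟨C, hC, h⟩ := exists_lintegral_correctionWeight_mul_besselK_le hd
    -- The factor y taken from the kernel to form the Hardy average y⁻¹ F(y) turns y^{2-d} into
    -- y^{3-d}, so k = 3; then β = max(0, d/p - 2) is at most d - 2 since d/p < d.
    obtain ⟨D, hD⟩ := exists_lintegral_powerKernel_le (d := d) (k := 3) (β := max 0 (d / p - 2))
      hp (by norm_num) (le_max_left _ _) (max_le (by linarith) (by linarith))
      (lt_max_of_lt_right (by linarith)) (max_lt hdp (by linarith))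
    obtain ⟨B, hB⟩ := exists_lintegral_hardy_le hp hpd
    refine ⟨Real.toNNReal C ^ p * D * B, fun G κ hκ => ?_⟩
    have hFm := measurable_lintegral_Ioi G
    set F : ℝ → ℝ≥0∞ := fun y => ∫⁻ t in Ioi y, G t with hF
    set H : ℝ → ℝ≥0∞ := (Ici 1).indicator fun y => ENNReal.ofReal y⁻¹ * F y with hH
    have hHm : Measurable H := Measurable.indicator (by fun_prop) measurableSet_Ici
    calc _ ≤ ∫⁻ x in Ici 1, ENNReal.ofReal C ^ p * (∫⁻ y,
          ENNReal.ofReal (x ^ (2 - d) * y ^ (3 - d) * (x + y) ^ (-3 : ℝ)) * H y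
            ∂radialMeasure d) ^ p ∂radialMeasure d := by
          refine setLIntegral_mono' measurableSet_Ici fun x (hx : 1 ≤ x) => ?_
          have hx0 : 0 < x := by linarith
          rw [← ENNReal.mul_rpow_of_nonneg _ _ hp0.le,
            ← lintegral_const_mul' _ _ ENNReal.ofReal_ne_top]
          refine ENNReal.rpow_le_rpow ?_ hp0.le
          refine (lintegral_correctionWeight_mul_le hd hx0 Ioc_subset_Ioi_self measurableSet_Ioc
            (hFm.indicator measurableSet_Ici) (φ := fun lam y => besselK d (lam * y)) (by fun_prop)
            hκ.le_self fun y hy _ => h x y hx0 hy).trans (lintegral_mono fun y => ?_)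
          by_cases hy : y ∈ Ici (1 : ℝ)
          · have hy0 : 0 < y := one_pos.trans_le hy
            simp only [hH, indicator_of_mem hy]
            simp only [← mul_assoc]
            refine le_of_eq ?_
            congr 1
            rw [← ENNReal.ofReal_mul hC.le, ← ENNReal.ofReal_mul hC.le,
              ← ENNReal.ofReal_mul (by positivity)]
            congr 1
            rw [show 3 - d = 2 - d + 1 by ring, Real.rpow_add_one hy0.ne']
            field_simp
          · simp only [indicator_of_notMem hy, mul_zero, zero_le]
      _ ≤ Real.toNNReal C ^ p * (D * ∫⁻ y, H y ^ p ∂radialMeasure d) := by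
          rw [lintegral_const_mul' _ _ (ENNReal.rpow_ne_top_of_nonneg hp0.le ENNReal.ofReal_ne_top)]
          exact mul_le_mul_right (hD H hHm fun y hy => indicator_of_notMem (not_le.2 hy) _) _
      _ ≤ Real.toNNReal C ^ p * (D * (B * ∫⁻ y, G y ^ p ∂radialMeasure d)) := by
          gcongr
          refine (lintegral_mono fun y => ?_).trans (hB G hκ.meas)
          gcongr
          exact indicator_le_self' (fun _ _ => zero_le) y
      _ = _ := by
          push_cast
          rw [ENNReal.coe_rpow_of_nonneg _ hp0.le]
          ring

theorem exists_lintegral_correction_high_le {d p : ℝ} (hd : 2 < d) (hp : 1 < p) :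
    ∃ C : ℝ≥0, ∀ G κ : ℝ → ℝ≥0∞, IsBesselMoment d G κ →
      ∫⁻ x in Ici 1, (∫⁻ lam in Ioi (1 : ℝ), ENNReal.ofReal (correctionWeight d lam x) * κ lam) ^ p
        ∂radialMeasure d ≤ C * ∫⁻ y, G y ^ p ∂radialMeasure d := by
  have hp0 : 0 < p := by linarith
  have hKDm := measurable_besselKD d
  obtain ⟨C, hC, h⟩ := exists_lintegral_correctionWeight_mul_besselKD_le_exp hd
  obtain ⟨D, hD⟩ := exists_lintegral_expKernel_le d hp
  refine ⟨Real.toNNReal C ^ p * D, fun G κ hκ => ?_⟩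
  -- The exponential kernel is singular at x = y = 1; the null set x = 1 is discarded.
  have hne : ∀ᵐ x ∂radialMeasure d, x ≠ 1 :=
    ((withDensity_absolutelyContinuous _ _).trans
      Measure.restrict_le_self.absolutelyContinuous).ae_le (Measure.ae_ne volume 1)
  calc _ ≤ ∫⁻ x in Ici 1, ENNReal.ofReal C ^ p * (∫⁻ y,
        ENNReal.ofReal (x ^ (-((d - 1) / 2)) * y ^ (-((d - 1) / 2)) *
          (Real.exp (-(x + y - 2)) / (x + y - 2))) * G y
          ∂radialMeasure d) ^ p ∂radialMeasure d := by
        refine lintegral_mono_ae ?_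
        filter_upwards [ae_restrict_of_ae hne, ae_restrict_mem measurableSet_Ici] with x hx1 hx
        have hx' : 1 < x := lt_of_le_of_ne hx hx1.symm
        have hx0 : 0 < x := by linarith
        rw [← ENNReal.mul_rpow_of_nonneg _ _ hp0.le,
          ← lintegral_const_mul' _ _ ENNReal.ofReal_ne_top]
        refine ENNReal.rpow_le_rpow ?_ hp0.le
        simp only [← mul_assoc]
        refine lintegral_correctionWeight_mul_le hd hx0 (Ioi_subset_Ioi zero_le_one)
          measurableSet_Ioi hκ.meas (φ := fun lam y => lam⁻¹ * besselKD d (lam * y)) (by fun_prop)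
          hκ.le_deriv fun y _ hGy => h x y hx' ?_
        by_contra! hy
        exact hGy (hκ.supp y hy)
    _ ≤ _ := by
        rw [lintegral_const_mul' _ _ (ENNReal.rpow_ne_top_of_nonneg hp0.le ENNReal.ofReal_ne_top),
          ENNReal.coe_mul, mul_assoc, ENNReal.coe_rpow_of_nonneg _ hp0.le]
        exact mul_le_mul_right (hD G hκ.meas hκ.supp) _

theorem exists_lintegral_correction_le {d p : ℝ} (hd : 2 < d) (hp : 1 < p) :
    ∃ C : ℝ≥0, ∀ G κ : ℝ → ℝ≥0∞, Measurable κ → IsBesselMoment d G κ →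
      ∫⁻ x in Ici 1, (∫⁻ lam in Ioi (0 : ℝ), ENNReal.ofReal (correctionWeight d lam x) * κ lam) ^ p
        ∂radialMeasure d ≤ C * ∫⁻ y, G y ^ p ∂radialMeasure d := by
  have hp0 : 0 < p := by linarith
  obtain ⟨C, hC⟩ := exists_lintegral_correction_low_le hd hp
  obtain ⟨D, hD⟩ := exists_lintegral_correction_high_le hd hp
  refine ⟨2 ^ (p - 1) * (C + D), fun G κ hκm hκ => ?_⟩
  have hm : Measurable fun x => ∫⁻ lam in Ioc (0 : ℝ) 1,
      ENNReal.ofReal (correctionWeight d lam x) * κ lam :=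
    Measurable.lintegral_prod_left' (f := fun q : ℝ × ℝ =>
      ENNReal.ofReal (correctionWeight d q.1 q.2) * κ q.1)
      ((measurable_correctionWeight d).ennreal_ofReal.mul (hκm.comp measurable_fst))
  calc _ ≤ ∫⁻ x in Ici 1, 2 ^ (p - 1) *
        ((∫⁻ lam in Ioc (0 : ℝ) 1, ENNReal.ofReal (correctionWeight d lam x) * κ lam) ^ p +
        (∫⁻ lam in Ioi (1 : ℝ), ENNReal.ofReal (correctionWeight d lam x) * κ lam) ^ p)
          ∂radialMeasure d := by
        refine lintegral_mono fun x => ?_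
        refine le_trans (ENNReal.rpow_le_rpow ?_ hp0.le)
          (ENNReal.rpow_add_le_mul_rpow_add_rpow _ _ hp.le)
        rw [← Ioc_union_Ioi_eq_Ioi (zero_le_one (α := ℝ))]
        exact lintegral_union_le _ _ _
    _ ≤ 2 ^ (p - 1) * (C * (∫⁻ y, G y ^ p ∂radialMeasure d) +
        D * ∫⁻ y, G y ^ p ∂radialMeasure d) := by
        rw [lintegral_const_mul' _ _ (by simp), lintegral_add_left (hm.pow_const p)]
        gcongr
        · exact hC G κ hκ
        · exact hD G κ hκ
    _ = _ := by
        push_cast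
        rw [ENNReal.coe_rpow_of_ne_zero (by norm_num)]
        push_cast
        ring

/-! ### The square root as an integral of resolvents, by functional calculus -/

/-- The symbol of `A (A + λ²)⁻¹` as a function of `(1 + A)⁻¹`. -/
def resolventSymbol (lam t : ℝ) : ℝ := (1 - t) / (1 - t + lam ^ 2 * t)

theorem resolventSymbol_denom_pos {lam t : ℝ} (hl : 0 < lam) (h0 : 0 ≤ t) (h1 : t ≤ 1) :
    0 < 1 - t + lam ^ 2 * t := by
  rcases h0.eq_or_lt with rfl | h
  · simp
  · have : 0 < lam ^ 2 * t := by positivity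
    linarith

theorem resolventSymbol_nonneg {lam t : ℝ} (hl : 0 < lam) (h0 : 0 ≤ t) (h1 : t ≤ 1) :
    0 ≤ resolventSymbol lam t :=
  div_nonneg (by linarith) (resolventSymbol_denom_pos hl h0 h1).le

theorem resolventSymbol_le_one {lam t : ℝ} (hl : 0 < lam) (h0 : 0 ≤ t) (h1 : t ≤ 1) :
    resolventSymbol lam t ≤ 1 := by
  rw [resolventSymbol, div_le_one (resolventSymbol_denom_pos hl h0 h1)]
  have : 0 ≤ lam ^ 2 * t := by positivity
  linarith

theorem continuousOn_resolventSymbol :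
    ContinuousOn (Function.uncurry resolventSymbol) (Ioi 0 ×ˢ Icc 0 1) := by
  unfold resolventSymbol Function.uncurry
  refine ContinuousOn.div (by fun_prop) (by fun_prop) fun q hq => ?_
  exact (resolventSymbol_denom_pos hq.1 hq.2.1 hq.2.2).ne'

/-- With t = 1/(1+a) this is ∫₀^Λ a/(a+λ²) dλ = √a arctan(Λ/√a), multiplied by √t so that it stays
bounded. As Λ → ∞ and t > 0 it tends to (π/2)√(1-t), the symbol of A^{1/2}(1+A)^{-1/2} times π/2. -/
theorem integral_resolventSymbol {Λ t : ℝ} (hΛ : 0 < Λ) (h0 : 0 ≤ t) (h1 : t ≤ 1) :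
    ∫ lam in Ioc 0 Λ, resolventSymbol lam t * √t =
      √(1 - t) * Real.arctan (Λ * (√t / √(1 - t))) := by
  rcases h1.eq_or_lt with rfl | h1
  · simp [resolventSymbol]
  have hs : 0 < 1 - t := by linarith
  have hs' : 0 < √(1 - t) := Real.sqrt_pos.2 hs
  set c := √t / √(1 - t) with hc
  have hc2 : c ^ 2 = t / (1 - t) := by
    rw [hc, div_pow, Real.sq_sqrt h0, Real.sq_sqrt hs.le]
  rw [← intervalIntegral.integral_of_le hΛ.le]
  have hd : ∀ lam ∈ uIcc 0 Λ, HasDerivAt (fun lam => √(1 - t) * Real.arctan (lam * c))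
      (resolventSymbol lam t * √t) lam := by
    intro lam _
    have h1 : HasDerivAt (fun lam : ℝ => lam * c) (1 * c) lam := (hasDerivAt_id lam).mul_const c
    refine (h1.arctan.const_mul (√(1 - t))).congr_deriv ?_
    have hden : 0 < 1 - t + lam ^ 2 * t := by positivity
    rw [resolventSymbol, one_mul, mul_pow, hc2]
    have : √(1 - t) * c = √t := by rw [hc]; field_simp
    rw [mul_left_comm, this]
    field_simp
  rw [intervalIntegral.integral_eq_sub_of_hasDerivAt hd]
  · simp
  · refine ContinuousOn.intervalIntegrable ?_
    unfold resolventSymbol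
    refine ContinuousOn.mul (ContinuousOn.div (by fun_prop) (by fun_prop) fun lam _ => ?_)
      (by fun_prop)
    have : 0 < 1 - t + lam ^ 2 * t := by positivity
    exact this.ne'

section Calculus

variable {H K : Type*} [NormedAddCommGroup H] [InnerProductSpace ℂ H] [CompleteSpace H]
  [NormedAddCommGroup K] [InnerProductSpace ℂ K]

theorem inner_sqrt_left (V : Submodule ℂ (WithLp 2 (H × K))) [CompleteSpace V] (x y : H) :
    ⟪cfc (fun t : ℝ => √t) (formResolvent V) x, y⟫_ℂ =
      ⟪x, cfc (fun t : ℝ => √t) (formResolvent V) y⟫_ℂ := by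
  have hS : IsSelfAdjoint (cfc (fun t : ℝ => √t) (formResolvent V)) := cfc_predicate _ _
  rw [← ContinuousLinearMap.adjoint_inner_right, hS.adjoint_eq]

/-- Both squares equal ⟪x, R x⟫, where R is the resolvent. This is the polar decomposition that
identifies the form domain with the range of R^{1/2}. -/
theorem norm_adjoint_formInclusion (V : Submodule ℂ (WithLp 2 (H × K))) [CompleteSpace V] (x : H) :
    ‖ContinuousLinearMap.adjoint (formInclusion V) x‖ =
      ‖cfc (fun t : ℝ => √t) (formResolvent V) x‖ := by
  rw [← sq_eq_sq₀ (norm_nonneg _) (norm_nonneg _), ← inner_self_eq_norm_sq (𝕜 := ℂ),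
    ← inner_self_eq_norm_sq (𝕜 := ℂ), inner_sqrt_left, ContinuousLinearMap.adjoint_inner_left, ← mul_apply_eq_comp,
    cfc_sqrt_mul_self]
  rfl

theorem sqrt_injective (V : Submodule ℂ (WithLp 2 (H × K))) [CompleteSpace V]
    (hV : ∀ h : H, (∀ v ∈ V, ⟪v.fst, h⟫_ℂ = 0) → h = 0) :
    Function.Injective (cfc (fun t : ℝ => √t) (formResolvent V) : H →L[ℂ] H) := by
  refine (injective_iff_map_eq_zero _).2 fun x hx => formResolvent_injective V hV x ?_
  rw [← cfc_sqrt_mul_self V, mul_apply_eq_comp, hx, map_zero]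

/-- The form domain is contained in the range of the square root of the resolvent. -/
theorem exists_sqrt_eq_fst (V : Submodule ℂ (WithLp 2 (H × K))) [CompleteSpace V]
    (hV : ∀ h : H, (∀ v ∈ V, ⟪v.fst, h⟫_ℂ = 0) → h = 0) {z : WithLp 2 (H × K)} (hz : z ∈ V) :
    ∃ h : H, cfc (fun t : ℝ => √t) (formResolvent V) h = z.fst := by
  have hinj := sqrt_injective V hV
  have hsym := inner_sqrt_left V
  have hnorm := norm_adjoint_formInclusion V
  generalize cfc (fun t : ℝ => √t) (formResolvent V) = S at *
  let e := LinearEquiv.ofInjective S.toLinearMap hinj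
  -- A preimage of z.fst is found by Riesz representation: S x ↦ ⟪z.fst, x⟫ is bounded on the range
  -- of S, because the pairing is one with the adjoint inclusion in V and ‖ι* x‖ = ‖S x‖.
  -- Hahn–Banach extends it to H.
  let φ : LinearMap.range S.toLinearMap →ₗ[ℂ] ℂ :=
    (innerSL ℂ z.fst).toLinearMap ∘ₗ e.symm.toLinearMap
  have hφ : ∀ y, ‖φ y‖ ≤ ‖(⟨z, hz⟩ : V)‖ * ‖y‖ := by
    intro y
    obtain ⟨x, rfl⟩ := e.surjective y
    have e1 : φ (e x) = ⟪(⟨z, hz⟩ : V), ContinuousLinearMap.adjoint (formInclusion V) x⟫_ℂ := by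
      rw [ContinuousLinearMap.adjoint_inner_right]
      simp only [φ, LinearMap.comp_apply, LinearEquiv.coe_coe, LinearEquiv.symm_apply_apply]
      rfl
    have e2 : ‖e x‖ = ‖S x‖ := rfl
    rw [e1, e2, ← hnorm]
    exact norm_inner_le_norm (𝕜 := ℂ) (⟨z, hz⟩ : V) _
  obtain ⟨g, hg, -⟩ := exists_extension_norm_eq (𝕜 := ℂ) (LinearMap.range S.toLinearMap)
    (φ.mkContinuous _ hφ)
  refine ⟨(InnerProductSpace.toDual ℂ H).symm g, ext_inner_right ℂ fun x => ?_⟩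
  rw [hsym, InnerProductSpace.toDual_symm_apply]
  refine (hg (e x)).trans ?_
  simp only [φ, LinearMap.mkContinuous_apply, LinearMap.comp_apply, LinearEquiv.coe_coe,
    LinearEquiv.symm_apply_apply]
  rfl

theorem formResolvent_spectrum_subset (V : Submodule ℂ (WithLp 2 (H × K))) [CompleteSpace V] :
    spectrum ℝ (formResolvent V) ⊆ Icc 0 1 := fun _ ht => formResolvent_spectrum V ht

/-- The hypothesis says A z = f - λ² z, that is z = (A + λ²)⁻¹ f, so an explicit solution of the
equation identifies the functional calculus. In terms of R = (1+A)⁻¹ it suffices to check (1-R) f =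
(1 - R + λ²R)(f - λ²z), since the operator on the right is invertible. -/
theorem resolventSymbol_apply_eq (V : Submodule ℂ (WithLp 2 (H × K))) [CompleteSpace V] {lam : ℝ}
    (hl : 0 < lam) {f z : H} (h : (z, f - (lam : ℂ) ^ 2 • z) ∈ formGraph V) :
    cfc (resolventSymbol lam) (formResolvent V) f = f - (lam : ℂ) ^ 2 • z := by
  have hsa : IsSelfAdjoint (formResolvent V) := (formResolvent_isPositive V).isSelfAdjoint
  have hsp := formResolvent_spectrum_subset V
  rw [mem_formGraph_iff] at h
  have hc : ContinuousOn (fun t : ℝ => (1 - t + lam ^ 2 * t)⁻¹) (spectrum ℝ (formResolvent V)) :=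
    ContinuousOn.inv₀ (by fun_prop) fun t ht =>
      (resolventSymbol_denom_pos hl (hsp ht).1 (hsp ht).2).ne'
  have e1 : cfc (fun t : ℝ => 1 - t + lam ^ 2 * t) (formResolvent V) =
      1 - formResolvent V + (lam ^ 2) • formResolvent V := by
    rw [cfc_add _ _ _ (by fun_prop) (by fun_prop), cfc_sub _ _ _ (by fun_prop) (by fun_prop),
      cfc_const_one ℝ _ hsa, cfc_id' ℝ _ hsa, cfc_const_mul _ _ _ (by fun_prop), cfc_id' ℝ _ hsa]
  have e2 : cfc (fun t : ℝ => 1 - t) (formResolvent V) = 1 - formResolvent V := by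
    rw [cfc_sub _ _ _ (by fun_prop) (by fun_prop), cfc_const_one ℝ _ hsa, cfc_id' ℝ _ hsa]
  have e3 : cfc (resolventSymbol lam) (formResolvent V) =
      cfc (fun t : ℝ => (1 - t + lam ^ 2 * t)⁻¹) (formResolvent V) * (1 - formResolvent V) := by
    rw [← e2, ← cfc_mul _ _ _ hc (by fun_prop)]
    exact cfc_congr fun t _ => by simp only [resolventSymbol]; rw [div_eq_inv_mul]
  have e4 : cfc (fun t : ℝ => (1 - t + lam ^ 2 * t)⁻¹) (formResolvent V) *
      (1 - formResolvent V + (lam ^ 2) • formResolvent V) = 1 := by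
    rw [← e1, ← cfc_mul _ _ _ hc (by fun_prop), ← cfc_const_one ℝ (formResolvent V)]
    exact cfc_congr fun t ht =>
      inv_mul_cancel₀ (resolventSymbol_denom_pos hl (hsp ht).1 (hsp ht).2).ne'
  set R := formResolvent V with hR
  have e5 : (1 - R) f = (1 - R + (lam ^ 2) • R) (f - (lam : ℂ) ^ 2 • z) := by
    simp only [sub_apply, add_apply, one_apply_eq_self, smul_apply, map_sub, map_add, map_smul] at h ⊢
    have hreal : ∀ v : H, (lam ^ 2 : ℝ) • v = (lam : ℂ) ^ 2 • v := fun v => by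
      rw [← Complex.ofReal_pow]; exact (Complex.coe_smul _ _).symm
    rw [hreal]
    have h' : R f = z - R z + (lam : ℂ) ^ 2 • R z := by
      calc R f = (R z + (R f - (lam : ℂ) ^ 2 • R z)) - R z + (lam : ℂ) ^ 2 • R z := by abel
        _ = _ := by rw [h]
    rw [h']
    module
  rw [e3, mul_apply_eq_comp, e5, ← mul_apply_eq_comp, e4, one_apply_eq_self]

end Calculus

section Calculus

variable {H K : Type*} [NormedAddCommGroup H] [InnerProductSpace ℂ H] [CompleteSpace H]
  [NormedAddCommGroup K] [InnerProductSpace ℂ K]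

theorem dense_range_sqrt (V : Submodule ℂ (WithLp 2 (H × K))) [CompleteSpace V]
    (hV : ∀ h : H, (∀ v ∈ V, ⟪v.fst, h⟫_ℂ = 0) → h = 0) :
    DenseRange (cfc (fun t : ℝ => √t) (formResolvent V) : H →L[ℂ] H) := by
  have hinj := sqrt_injective V hV
  have hsym := inner_sqrt_left V
  generalize cfc (fun t : ℝ => √t) (formResolvent V) = S at *
  have h1 : (LinearMap.range S.toLinearMap)ᗮ = ⊥ := by
    refine (Submodule.eq_bot_iff _).2 fun x hx => hinj ?_
    rw [map_zero]
    refine ext_inner_left ℂ fun y => ?_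
    rw [← hsym, inner_zero_right]
    exact hx (S y) ⟨y, rfl⟩
  have h2 := Submodule.topologicalClosure_eq_top_iff.2 h1
  exact Submodule.dense_iff_topologicalClosure_eq_top.2 h2

theorem norm_cfc_apply_le {R : H →L[ℂ] H} {φ : ℝ → ℝ} {c : ℝ} (hc : 0 ≤ c)
    (h : ∀ t ∈ spectrum ℝ R, |φ t| ≤ c) (x : H) : ‖cfc φ R x‖ ≤ c * ‖x‖ :=
  (ContinuousLinearMap.le_opNorm _ _).trans
    (mul_le_mul_of_nonneg_right (norm_cfc_le hc h) (norm_nonneg x))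

theorem continuousOn_resolventSymbol_mul_sqrt {s : Set ℝ} (hs : s ⊆ Icc 0 1) (Λ : ℝ) :
    ContinuousOn (Function.uncurry fun lam t => resolventSymbol lam t * √t) (Ioc 0 Λ ×ˢ s) := by
  refine (continuousOn_resolventSymbol.mono (prod_mono Ioc_subset_Ioi_self hs)).mul ?_
  fun_prop

theorem continuousOn_integral_resolventSymbol {s : Set ℝ} (hs : s ⊆ Icc 0 1) (Λ : ℝ) :
    ContinuousOn (fun t => ∫ lam in Ioc 0 Λ, resolventSymbol lam t * √t) s := by
  have hc := continuousOn_resolventSymbol_mul_sqrt hs Λ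
  refine continuousOn_of_dominated (bound := fun _ => 1) ?_ ?_ (integrable_const _) ?_
  · intro t ht
    refine ContinuousOn.aestronglyMeasurable ?_ measurableSet_Ioc
    exact hc.comp (f := fun lam => (lam, t)) (by fun_prop) fun lam hl => ⟨hl, ht⟩
  · intro t ht
    refine ae_restrict_of_forall_mem measurableSet_Ioc fun lam hl => ?_
    have h1 := resolventSymbol_nonneg hl.1 (hs ht).1 (hs ht).2
    have h2 := resolventSymbol_le_one hl.1 (hs ht).1 (hs ht).2
    rw [Real.norm_of_nonneg (by positivity)]
    exact mul_le_one₀ h2 (Real.sqrt_nonneg t) (Real.sqrt_le_one.2 (hs ht).2)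
  · refine ae_restrict_of_forall_mem measurableSet_Ioc fun lam hl => ?_
    exact hc.comp (f := fun t => (lam, t)) (by fun_prop) fun t ht => ⟨hl, ht⟩

theorem abs_integral_resolventSymbol_le {Λ t : ℝ} (hΛ : 0 < Λ) (ht : t ∈ Icc (0 : ℝ) 1) :
    |∫ lam in Ioc 0 Λ, resolventSymbol lam t * √t| ≤ Real.pi / 2 := by
  rw [integral_resolventSymbol hΛ ht.1 ht.2, abs_mul, abs_of_nonneg (Real.sqrt_nonneg _)]
  have h1 : |Real.arctan (Λ * (√t / √(1 - t)))| ≤ Real.pi / 2 :=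
    abs_le.2 ⟨(Real.neg_pi_div_two_lt_arctan _).le, (Real.arctan_lt_pi_div_two _).le⟩
  have h2 : √(1 - t) ≤ 1 := Real.sqrt_le_one.2 (by linarith [ht.1])
  calc _ ≤ 1 * (Real.pi / 2) := by gcongr
    _ = _ := one_mul _

theorem arctan_le_self {x : ℝ} (hx : 0 ≤ x) : Real.arctan x ≤ x :=
  (Real.le_tan (Real.arctan_nonneg.2 hx) (Real.arctan_lt_pi_div_two x)).trans_eq (Real.tan_arctan x)

/-- The extra √t gives a uniform rate: π/2 - arctan c = arctan(1/c) ≤ 1/c, and √t/c = √(1-t)/Λ.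
Without it the convergence is not uniform near t = 0. -/
theorem abs_integral_resolventSymbol_sub_le {Λ t : ℝ} (hΛ : 0 < Λ) (ht : t ∈ Icc (0 : ℝ) 1) :
    |((∫ lam in Ioc 0 Λ, resolventSymbol lam t * √t) - Real.pi / 2 * √(1 - t)) * √t| ≤ 1 / Λ := by
  rw [integral_resolventSymbol hΛ ht.1 ht.2]
  rcases ht.1.eq_or_lt with rfl | h0
  · simp; positivity
  rcases ht.2.eq_or_lt with rfl | h1
  · simp; positivity
  have hs : 0 < 1 - t := by linarith
  have hs' : 0 < √(1 - t) := Real.sqrt_pos.2 hs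
  have ht' : 0 < √t := Real.sqrt_pos.2 h0
  set c := Λ * (√t / √(1 - t)) with hc
  have hc0 : 0 < c := by positivity
  have e1 : Real.pi / 2 - Real.arctan c = Real.arctan c⁻¹ := (Real.arctan_inv_of_pos hc0).symm
  have e2 : Real.arctan c⁻¹ ≤ c⁻¹ := arctan_le_self (by positivity)
  have e3 : 0 ≤ Real.arctan c⁻¹ := Real.arctan_nonneg.2 (by positivity)
  have e4 : (√(1 - t) * Real.arctan c - Real.pi / 2 * √(1 - t)) * √t =
      -(√(1 - t) * Real.arctan c⁻¹ * √t) := by rw [← e1]; ring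
  rw [e4, abs_neg, abs_of_nonneg (by positivity)]
  calc √(1 - t) * Real.arctan c⁻¹ * √t ≤ √(1 - t) * c⁻¹ * √t := by gcongr
    _ = √(1 - t) * √(1 - t) / Λ := by rw [hc]; field_simp
    _ ≤ 1 / Λ := by
        rw [Real.mul_self_sqrt hs.le]
        gcongr
        linarith

/-- The square root of `A` as a strong limit of integrals of `A (A + λ²)⁻¹`. -/
theorem exists_formSqrtGraph_tendsto (V : Submodule ℂ (WithLp 2 (H × K))) [CompleteSpace V]
    (hV : ∀ h : H, (∀ v ∈ V, ⟪v.fst, h⟫_ℂ = 0) → h = 0) {z : WithLp 2 (H × K)} (hz : z ∈ V) :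
    ∃ w : H, (z.fst, w) ∈ formSqrtGraph V ∧
      (∀ Λ : ℝ, IntegrableOn
        (fun lam => cfc (resolventSymbol lam) (formResolvent V) z.fst) (Ioc 0 Λ)) ∧
      Tendsto (fun Λ : ℝ => ∫ lam in Ioc 0 Λ, cfc (resolventSymbol lam) (formResolvent V) z.fst)
        atTop (𝓝 ((Real.pi / 2) • w)) := by
  obtain ⟨h, hh⟩ := exists_sqrt_eq_fst V hV hz
  have hdense := dense_range_sqrt V hV
  have hsa : IsSelfAdjoint (formResolvent V) := (formResolvent_isPositive V).isSelfAdjoint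
  have hsp := formResolvent_spectrum_subset V
  set R := formResolvent V with hR
  set S := cfc (fun t : ℝ => √t) R with hS
  set T := cfc (fun t : ℝ => √(1 - t)) R with hT
  -- Writing z.fst = R^{1/2} h transfers the factor √t to the symbol, which makes the integrals
  -- bounded operators applied to h.
  have hu : ∀ lam, 0 < lam → cfc (resolventSymbol lam) R z.fst =
      cfc (fun t => resolventSymbol lam t * √t) R h := by
    intro lam hl
    have hc : ContinuousOn (resolventSymbol lam) (spectrum ℝ R) :=
      (continuousOn_resolventSymbol.comp (f := fun t => (lam, t)) (by fun_prop)
        fun t ht => ⟨hl, ht⟩).mono hsp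
    rw [cfc_mul _ _ _ hc (by fun_prop), mul_apply_eq_comp, ← hS, hh]
  have hb : ∀ Λ : ℝ, ∀ᵐ lam ∂(volume.restrict (Ioc 0 Λ)), ∀ t ∈ spectrum ℝ R,
      ‖resolventSymbol lam t * √t‖ ≤ 1 := fun Λ =>
    ae_restrict_of_forall_mem measurableSet_Ioc fun lam hl t ht => by
      have h1 := resolventSymbol_nonneg hl.1 (hsp ht).1 (hsp ht).2
      have h2 := resolventSymbol_le_one hl.1 (hsp ht).1 (hsp ht).2
      rw [Real.norm_of_nonneg (by positivity)]
      exact mul_le_one₀ h2 (Real.sqrt_nonneg t) (Real.sqrt_le_one.2 (hsp ht).2)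
  have hi : ∀ Λ : ℝ, IntegrableOn (fun lam => cfc (fun t => resolventSymbol lam t * √t) R)
      (Ioc 0 Λ) := fun Λ =>
    integrableOn_cfc measurableSet_Ioc (fun lam t => resolventSymbol lam t * √t) (fun _ => 1) R
      (continuousOn_resolventSymbol_mul_sqrt hsp Λ) (hb Λ) (integrable_const _).2
  have hint : ∀ Λ : ℝ, ∫ lam in Ioc 0 Λ, cfc (resolventSymbol lam) R z.fst =
      cfc (fun t => ∫ lam in Ioc 0 Λ, resolventSymbol lam t * √t) R h := fun Λ => by
    rw [cfc_setIntegral measurableSet_Ioc (fun lam t => resolventSymbol lam t * √t) (fun _ => 1) R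
      (continuousOn_resolventSymbol_mul_sqrt hsp Λ) (hb Λ) (integrable_const _).2,
      ContinuousLinearMap.integral_apply (hi Λ)]
    exact setIntegral_congr_fun measurableSet_Ioc fun lam hl => hu lam hl.1
  refine ⟨T h, ⟨h, Prod.ext hh rfl⟩, fun Λ => ?_, ?_⟩
  · refine IntegrableOn.congr_fun ?_ (fun lam hl => (hu lam hl.1).symm) measurableSet_Ioc
    exact (ContinuousLinearMap.apply ℂ H h).integrable_comp (hi Λ)
  simp only [hint]
  set Φ : ℝ → H →L[ℂ] H := fun Λ =>
    cfc (fun t => ∫ lam in Ioc 0 Λ, resolventSymbol lam t * √t) R with hΦ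
  have hΦb : ∀ Λ, 0 < Λ → ∀ x, ‖Φ Λ x‖ ≤ Real.pi / 2 * ‖x‖ := fun Λ hΛ =>
    norm_cfc_apply_le (by positivity) fun t ht => abs_integral_resolventSymbol_le hΛ (hsp ht)
  have hTb : ∀ x, ‖T x‖ ≤ 1 * ‖x‖ := norm_cfc_apply_le zero_le_one fun t ht => by
    rw [abs_of_nonneg (Real.sqrt_nonneg _)]
    exact Real.sqrt_le_one.2 (by linarith [(hsp ht).1])
  have hΦS : ∀ Λ, 0 < Λ → ∀ x, ‖Φ Λ (S x) - (Real.pi / 2) • T (S x)‖ ≤ 1 / Λ * ‖x‖ := by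
    intro Λ hΛ x
    have hcΦ := continuousOn_integral_resolventSymbol hsp Λ
    have e : cfc (fun t => ((∫ lam in Ioc 0 Λ, resolventSymbol lam t * √t) -
        Real.pi / 2 * √(1 - t)) * √t) R = (Φ Λ - (Real.pi / 2) • T) * S := by
      have hcT : ContinuousOn (fun t : ℝ => Real.pi / 2 * √(1 - t)) (spectrum ℝ R) := by fun_prop
      rw [cfc_mul (fun t => (∫ lam in Ioc 0 Λ, resolventSymbol lam t * √t) -
        Real.pi / 2 * √(1 - t)) _ _ (hcΦ.sub hcT) (by fun_prop), cfc_sub _ _ _ hcΦ hcT,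
        cfc_const_mul _ _ _ (by fun_prop)]
    have := norm_cfc_apply_le (H := H) (R := R) (by positivity : 0 ≤ 1 / Λ)
      (fun t ht => abs_integral_resolventSymbol_sub_le hΛ (hsp ht)) x
    rw [e] at this
    exact this
  rw [Metric.tendsto_nhds]
  intro ε hε
  have hpi := Real.pi_pos
  -- Uniformly bounded operators that converge on a dense subspace converge strongly: norm
  -- convergence with rate 1/Λ holds on the range of S, and h is approximated by S x.
  obtain ⟨x, hx⟩ := hdense.exists_dist_lt h (show 0 < ε / (4 * Real.pi) by positivity)
  filter_upwards [eventually_gt_atTop 0, eventually_gt_atTop (2 * (‖x‖ + 1) / ε)] with Λ hΛ hΛ2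
  rw [dist_eq_norm] at hx ⊢
  have k1 := hΦb Λ hΛ (h - S x)
  have k2 := hTb (h - S x)
  have k3 := hΦS Λ hΛ x
  have k4 : 1 / Λ * ‖x‖ < ε / 2 := by
    rw [div_lt_iff₀ hε] at hΛ2
    rw [one_div, inv_mul_lt_iff₀ hΛ]
    nlinarith [norm_nonneg x]
  have k5 : Real.pi * ‖h - S x‖ < ε / 4 := by
    rw [lt_div_iff₀ (by positivity)] at hx
    linarith
  have e : Φ Λ h - (Real.pi / 2) • T h = Φ Λ (h - S x) - (Real.pi / 2) • T (h - S x) +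
      (Φ Λ (S x) - (Real.pi / 2) • T (S x)) := by
    simp only [map_sub, smul_sub]
    abel
  calc _ ≤ ‖Φ Λ (h - S x)‖ + ‖(Real.pi / 2) • T (h - S x)‖ +
        ‖Φ Λ (S x) - (Real.pi / 2) • T (S x)‖ := by
        change ‖Φ Λ h - (Real.pi / 2) • T h‖ ≤ _
        rw [e]
        exact (norm_add_le _ _).trans (add_le_add_left (norm_sub_le _ _) _)
    _ < ε := by
        rw [norm_smul, Real.norm_of_nonneg (by positivity)]
        nlinarith
 
end Calculus

/-! ### The resolvent on a half-line by variation of constants -/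

theorem ContinuousOn.hasDerivAt_integral_right {h : ℝ → ℂ} (hh : ContinuousOn h (Ioi 0)) {a x : ℝ}
    (ha : 0 < a) (hx : 0 < x) : HasDerivAt (fun x => ∫ y in a..x, h y) (h x) x :=
  intervalIntegral.integral_hasDerivAt_right
    ((hh.mono fun _ hy => (lt_min ha hx).trans_le hy.1).intervalIntegrable)
    (hh.stronglyMeasurableAtFilter isOpen_Ioi x hx) (hh.continuousAt (Ioi_mem_nhds hx))

theorem ContinuousOn.hasDerivAt_integral_left {h : ℝ → ℂ} (hh : ContinuousOn h (Ioi 0)) {b x : ℝ}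
    (hb : 0 < b) (hx : 0 < x) : HasDerivAt (fun x => ∫ y in x..b, h y) (-h x) x :=
  intervalIntegral.integral_hasDerivAt_left
    ((hh.mono fun _ hy => (lt_min hx hb).trans_le hy.1).intervalIntegrable)
    (hh.stronglyMeasurableAtFilter isOpen_Ioi x hx) (hh.continuousAt (Ioi_mem_nhds hx))

/-- `φ` is a continuous function supported in `[1, ρ]`, with bounded derivative `g` on `(1, ∞)`. -/
structure IsHalfLine (φ g : ℝ → ℂ) (M ρ : ℝ) : Prop where
  one_le : 1 ≤ ρ
  cont : Continuous φ
  zero_left : ∀ y ≤ 1, φ y = 0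
  zero_right : ∀ y, ρ ≤ y → φ y = 0
  deriv : ∀ y, 1 < y → HasDerivAt φ (g y) y
  bounded : IsBoundedCompact g M ρ
  deriv_zero : ∀ y ≤ 1, g y = 0

/-- The part of the resolvent to the left of `x`. -/
def leftMoment (d lam : ℝ) (φ : ℝ → ℂ) (x : ℝ) : ℂ :=
  ∫ y in (1)..x, ((besselI d (lam * y) * y ^ (d - 1) : ℝ) : ℂ) * φ y

/-- The part of the resolvent to the right of `x`. -/
def rightMoment (d lam : ℝ) (φ : ℝ → ℂ) (ρ x : ℝ) : ℂ :=
  ∫ y in x..ρ, ((besselK d (lam * y) * y ^ (d - 1) : ℝ) : ℂ) * φ y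

/-- A solution of `z'' + (d - 1) / x z' = λ² z - φ` that decays at infinity. -/
def halfResolvent (d lam : ℝ) (φ : ℝ → ℂ) (ρ : ℝ) (c : ℂ) (x : ℝ) : ℂ :=
  ((lam ^ (d - 2) : ℝ) : ℂ) * (besselK d (lam * x) * (leftMoment d lam φ x + c) +
    besselI d (lam * x) * rightMoment d lam φ ρ x)

/-- The derivative of `halfResolvent`. -/
def halfResolventDeriv (d lam : ℝ) (φ : ℝ → ℂ) (ρ : ℝ) (c : ℂ) (x : ℝ) : ℂ :=
  ((lam ^ (d - 1) : ℝ) : ℂ) * (-besselKD d (lam * x) * (leftMoment d lam φ x + c) +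
    besselID d (lam * x) * rightMoment d lam φ ρ x)

section HalfLine

variable {d lam M ρ x : ℝ} {φ g : ℝ → ℂ} {c : ℂ}

theorem continuousOn_comp_mul {b : ℝ → ℝ} (hb : ContinuousOn b (Ioi 0)) (hl : 0 < lam) :
    ContinuousOn (fun y => ((b (lam * y) * y ^ (d - 1) : ℝ) : ℂ)) (Ioi 0) := by
  refine Complex.continuous_ofReal.comp_continuousOn ?_
  refine (hb.comp (f := fun y => lam * y) (by fun_prop) fun y hy => mul_pos hl hy).mul ?_
  exact continuousOn_id.rpow_const fun y hy => Or.inl (ne_of_gt hy)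

theorem continuousOn_besselI (hd : 2 < d) : ContinuousOn (besselI d) (Ioi 0) := fun _ hs =>
  (hasDerivAt_besselI hd hs).continuousAt.continuousWithinAt

theorem IsHalfLine.hasDerivAt_leftMoment (h : IsHalfLine φ g M ρ) (hd : 2 < d) (hl : 0 < lam)
    (hx : 0 < x) : HasDerivAt (leftMoment d lam φ)
      (((besselI d (lam * x) * x ^ (d - 1) : ℝ) : ℂ) * φ x) x :=
  ContinuousOn.hasDerivAt_integral_right (h := fun y =>
    ((besselI d (lam * y) * y ^ (d - 1) : ℝ) : ℂ) * φ y)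
    ((continuousOn_comp_mul (continuousOn_besselI hd) hl).mul h.cont.continuousOn) one_pos hx

theorem IsHalfLine.hasDerivAt_rightMoment (h : IsHalfLine φ g M ρ) (hd : 2 < d) (hl : 0 < lam)
    (hx : 0 < x) : HasDerivAt (rightMoment d lam φ ρ)
      (-(((besselK d (lam * x) * x ^ (d - 1) : ℝ) : ℂ) * φ x)) x :=
  ContinuousOn.hasDerivAt_integral_left (h := fun y =>
    ((besselK d (lam * y) * y ^ (d - 1) : ℝ) : ℂ) * φ y)
    ((continuousOn_comp_mul (continuousOn_besselK hd) hl).mul h.cont.continuousOn)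
    (one_pos.trans_le h.one_le) hx

theorem hasDerivAt_ofReal_comp_mul {b : ℝ → ℝ} {b' : ℝ} (hb : HasDerivAt b b' (lam * x)) :
    HasDerivAt (fun x => (b (lam * x) : ℂ)) ((lam * b' : ℝ) : ℂ) x := by
  have h1 : HasDerivAt (fun x : ℝ => lam * x) lam x := by
    simpa using (hasDerivAt_id x).const_mul lam
  have h2 := hb.comp x h1
  rw [mul_comm] at h2
  exact h2.ofReal_comp

theorem IsHalfLine.hasDerivAt_halfResolvent (h : IsHalfLine φ g M ρ) (hd : 2 < d) (hl : 0 < lam)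
    (hx : 0 < x) :
    HasDerivAt (halfResolvent d lam φ ρ c) (halfResolventDeriv d lam φ ρ c x) x := by
  have hlx : 0 < lam * x := by positivity
  have hA := (h.hasDerivAt_leftMoment hd hl hx).add_const c
  have hB := h.hasDerivAt_rightMoment hd hl hx
  have hK := hasDerivAt_ofReal_comp_mul (hasDerivAt_besselK_neg hd hlx)
  have hI := hasDerivAt_ofReal_comp_mul (hasDerivAt_besselI hd hlx)
  refine (((hK.mul hA).add (hI.mul hB)).const_mul ((lam ^ (d - 2) : ℝ) : ℂ)).congr_deriv ?_
  rw [halfResolventDeriv, show d - 1 = d - 2 + 1 by ring, Real.rpow_add_one hl.ne']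
  push_cast
  ring

/-- The inhomogeneous equation in divergence form. The moments contribute φ times the Wronskian,
normalized to 1 after multiplication by (λx)^{d-1}; the remaining terms reproduce λ² z. -/
theorem IsHalfLine.hasDerivAt_rpow_mul_halfResolventDeriv (h : IsHalfLine φ g M ρ) (hd : 2 < d)
    (hl : 0 < lam) (hx : 0 < x) :
    HasDerivAt (fun x => ((x ^ (d - 1) : ℝ) : ℂ) * halfResolventDeriv d lam φ ρ c x)
      (((x ^ (d - 1) : ℝ) : ℂ) * ((lam : ℂ) ^ 2 * halfResolvent d lam φ ρ c x - φ x)) x := by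
  have hlx : 0 < lam * x := by positivity
  have hA := (h.hasDerivAt_leftMoment hd hl hx).add_const c
  have hB := h.hasDerivAt_rightMoment hd hl hx
  have hK := hasDerivAt_ofReal_comp_mul (hasDerivAt_rpow_mul_besselKD hd hlx)
  have hI := hasDerivAt_ofReal_comp_mul (hasDerivAt_rpow_mul_besselID hd hlx)
  have hW := besselI_wronskian hd hlx
  have key := (hI.mul hB).sub (hK.mul hA)
  have heq : (fun x => ((x ^ (d - 1) : ℝ) : ℂ) * halfResolventDeriv d lam φ ρ c x) =ᶠ[𝓝 x]
      fun x => ((((lam * x) ^ (d - 1) * besselID d (lam * x) : ℝ) : ℂ) * rightMoment d lam φ ρ x) -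
        (((lam * x) ^ (d - 1) * besselKD d (lam * x) : ℝ) : ℂ) * (leftMoment d lam φ x + c) := by
    filter_upwards [eventually_gt_nhds hx] with y hy
    rw [halfResolventDeriv, Real.mul_rpow hl.le hy.le]
    push_cast
    ring
  refine (key.congr_of_eventuallyEq heq).congr_deriv ?_
  have e1 : (lam * x) ^ (d - 1) = lam ^ (d - 1) * x ^ (d - 1) := Real.mul_rpow hl.le hx.le
  have e2 : lam ^ (d - 1) = lam ^ (d - 2) * lam := by
    rw [show d - 1 = d - 2 + 1 by ring, Real.rpow_add_one hl.ne']
  have e3 : (lam * x) ^ (d - 1) * (besselID d (lam * x) * besselK d (lam * x) +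
      besselI d (lam * x) * besselKD d (lam * x)) = 1 := by
    rw [hW, ← Real.rpow_add hlx]; simp
  have e4 : ((lam * x) ^ (d - 1) : ℝ) * ((besselID d (lam * x) : ℂ) * besselK d (lam * x) +
      besselI d (lam * x) * besselKD d (lam * x)) = 1 := by exact_mod_cast e3
  rw [halfResolvent]
  have e5 : (((lam * x) ^ (d - 1) : ℝ) : ℂ) =
      ((lam ^ (d - 2) : ℝ) : ℂ) * lam * ((x ^ (d - 1) : ℝ) : ℂ) := by
    rw [e1, e2]; push_cast; ring
  set P := (((lam * x) ^ (d - 1) : ℝ) : ℂ) with hP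
  have e6 : ((lam * ((lam * x) ^ (d - 1) * besselI d (lam * x)) : ℝ) : ℂ) =
      lam * (P * besselI d (lam * x)) := by push_cast; rfl
  have e7 : ((lam * -((lam * x) ^ (d - 1) * besselK d (lam * x)) : ℝ) : ℂ) =
      -(lam * (P * besselK d (lam * x))) := by rw [hP]; push_cast; ring
  have e8 : (((lam * x) ^ (d - 1) * besselID d (lam * x) : ℝ) : ℂ) = P * besselID d (lam * x) := by
    rw [hP]; push_cast; rfl
  have e9 : (((lam * x) ^ (d - 1) * besselKD d (lam * x) : ℝ) : ℂ) = P * besselKD d (lam * x) := by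
    rw [hP]; push_cast; rfl
  rw [e6, e7, e8, e9, Complex.ofReal_mul, Complex.ofReal_mul]
  linear_combination (-((x ^ (d - 1) : ℝ) : ℂ) * φ x) * e4 +
    (lam * besselI d (lam * x) * rightMoment d lam φ ρ x +
      lam * besselK d (lam * x) * (leftMoment d lam φ x + c)) * e5

theorem IsHalfLine.intervalIntegrable_mul (h : IsHalfLine φ g M ρ) {b : ℝ → ℝ}
    (hb : ContinuousOn b (Ioi 0)) (hl : 0 < lam) {a t : ℝ} (ha : 0 < a) (hat : a ≤ t) :
    IntervalIntegrable (fun y => (b (lam * y) : ℂ) * φ y) volume a t := by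
  refine ContinuousOn.intervalIntegrable_of_Icc hat (ContinuousOn.mul ?_ h.cont.continuousOn)
  refine Complex.continuous_ofReal.comp_continuousOn (hb.comp (f := fun y => lam * y) (by fun_prop)
    fun y hy => mul_pos hl (ha.trans_le hy.1))

theorem IsHalfLine.integral_mul_deriv (h : IsHalfLine φ g M ρ) {b e : ℝ → ℝ}
    (hb : ∀ s, 0 < s → HasDerivAt b (e s) s) (he : ContinuousOn e (Ioi 0)) (hl : 0 < lam) {a t : ℝ}
    (ha : 1 ≤ a) (hat : a ≤ t) :
    ∫ y in a..t, (b (lam * y) : ℂ) * g y = b (lam * t) * φ t - b (lam * a) * φ a -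
      lam * ∫ y in a..t, (e (lam * y) : ℂ) * φ y := by
  have ha0 : 0 < a := by linarith
  have hbc : ContinuousOn (fun y => (b (lam * y) : ℂ)) (Icc a t) := fun y hy =>
    (hasDerivAt_ofReal_comp_mul (hb _ (mul_pos hl (ha0.trans_le hy.1)))).continuousAt.continuousWithinAt
  have i1 := (h.intervalIntegrable_mul he hl ha0 hat).const_mul (lam : ℂ)
  have i2 : IntervalIntegrable (fun y => (b (lam * y) : ℂ) * g y) volume a t := by
    refine (h.bounded.integrable.intervalIntegrable).continuousOn_mul ?_
    rwa [uIcc_of_le hat]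
  have key := intervalIntegral.integral_eq_sub_of_hasDerivAt_of_le hat
    (f := fun y => (b (lam * y) : ℂ) * φ y)
    (f' := fun y => (lam : ℂ) * ((e (lam * y) : ℂ) * φ y) + (b (lam * y) : ℂ) * g y)
    (hbc.mul h.cont.continuousOn) (fun y hy => ?_) (i1.add i2)
  · rw [intervalIntegral.integral_add i1 i2, intervalIntegral.integral_const_mul] at key
    rw [← key]
    ring
  · have hy0 : 0 < y := ha0.trans hy.1
    refine ((hasDerivAt_ofReal_comp_mul (hb _ (mul_pos hl hy0))).mul
      (h.deriv y (ha.trans_lt hy.1))).congr_deriv ?_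
    push_cast
    ring

theorem continuousOn_rpow_mul {b : ℝ → ℝ} (hb : ContinuousOn b (Ioi 0)) :
    ContinuousOn (fun s => s ^ (d - 1) * b s) (Ioi 0) :=
  (continuousOn_id.rpow_const fun _ hy => Or.inl (ne_of_gt hy)).mul hb

theorem integral_rpow_mul_scale (hl : 0 < lam) (b : ℝ → ℝ) {a t : ℝ} (ha : 0 < a) (hat : a ≤ t) :
    ∫ y in a..t, (((lam * y) ^ (d - 1) * b (lam * y) : ℝ) : ℂ) * φ y =
      ((lam ^ (d - 1) : ℝ) : ℂ) * ∫ y in a..t, ((b (lam * y) * y ^ (d - 1) : ℝ) : ℂ) * φ y := by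
  rw [← intervalIntegral.integral_const_mul]
  refine intervalIntegral.integral_congr fun y hy => ?_
  rw [uIcc_of_le hat] at hy
  have hy0 : 0 < y := ha.trans_le hy.1
  rw [Real.mul_rpow hl.le hy0.le]
  push_cast
  ring

/-- Integration by parts with (s^{d-1} I')' = s^{d-1} I. The boundary term at 1 vanishes because
φ(1) = 0: the use made of the functions vanishing at ±1. -/
theorem IsHalfLine.integral_besselID_mul (h : IsHalfLine φ g M ρ) (hd : 2 < d) (hl : 0 < lam)
    (hx : 1 ≤ x) :
    ((lam ^ (d - 1) : ℝ) : ℂ) * ∫ y in (1)..x, ((besselID d (lam * y) * y ^ (d - 1) : ℝ) : ℂ) * g y =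
      (((lam * x) ^ (d - 1) * besselID d (lam * x) : ℝ) : ℂ) * φ x -
        lam * ((lam ^ (d - 1) : ℝ) : ℂ) * leftMoment d lam φ x := by
  rw [← integral_rpow_mul_scale hl _ one_pos hx, h.integral_mul_deriv
    (b := fun s => s ^ (d - 1) * besselID d s) (e := fun s => s ^ (d - 1) * besselI d s)
    (fun s hs => hasDerivAt_rpow_mul_besselID hd hs)
    (continuousOn_rpow_mul (continuousOn_besselI hd)) hl le_rfl hx, h.zero_left 1 le_rfl,
    integral_rpow_mul_scale hl _ one_pos hx, leftMoment]
  ring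

/-- The counterpart for K on [x, ρ], with no boundary term at ρ since φ vanishes there. -/
theorem IsHalfLine.integral_besselKD_mul (h : IsHalfLine φ g M ρ) (hd : 2 < d) (hl : 0 < lam)
    (hx : 1 ≤ x) (hxρ : x ≤ ρ) :
    ((lam ^ (d - 1) : ℝ) : ℂ) * ∫ y in x..ρ, ((besselKD d (lam * y) * y ^ (d - 1) : ℝ) : ℂ) * g y =
      -(((lam * x) ^ (d - 1) * besselKD d (lam * x) : ℝ) : ℂ) * φ x +
        lam * ((lam ^ (d - 1) : ℝ) : ℂ) * rightMoment d lam φ ρ x := by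
  have hx0 : 0 < x := by linarith
  rw [← integral_rpow_mul_scale hl _ hx0 hxρ, h.integral_mul_deriv
    (b := fun s => s ^ (d - 1) * besselKD d s) (e := fun s => s ^ (d - 1) * -besselK d s)
    (fun s hs => (hasDerivAt_rpow_mul_besselKD hd hs).congr_deriv (by ring))
    (continuousOn_rpow_mul (continuousOn_besselK hd).neg) hl hx hxρ, h.zero_right ρ le_rfl,
    integral_rpow_mul_scale hl (fun s => -besselK d s) hx0 hxρ, rightMoment]
  have : ∫ y in x..ρ, ((-besselK d (lam * y) * y ^ (d - 1) : ℝ) : ℂ) * φ y =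
      -∫ y in x..ρ, ((besselK d (lam * y) * y ^ (d - 1) : ℝ) : ℂ) * φ y := by
    rw [← intervalIntegral.integral_neg]
    congr 1
    funext y
    push_cast
    ring
  rw [this]
  push_cast
  ring

theorem IsHalfLine.rightMoment_eq_zero (h : IsHalfLine φ g M ρ) (hx : ρ ≤ x) :
    rightMoment d lam φ ρ x = 0 := by
  rw [rightMoment, intervalIntegral.integral_symm, intervalIntegral.integral_of_le hx,
    setIntegral_eq_zero_of_forall_eq_zero, neg_zero]
  intro y hy
  rw [h.zero_right y hy.1.le, mul_zero]

theorem IsHalfLine.leftMoment_eq (h : IsHalfLine φ g M ρ) (hd : 2 < d) (hl : 0 < lam)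
    (hx : ρ ≤ x) : leftMoment d lam φ x = leftMoment d lam φ ρ := by
  have hρ := h.one_le
  have hc : ContinuousOn (fun y => ((besselI d (lam * y) * y ^ (d - 1) : ℝ) : ℂ) * φ y) (Ioi 0) :=
    (continuousOn_comp_mul (continuousOn_besselI hd) hl).mul h.cont.continuousOn
  have hi : ∀ a b : ℝ, 1 ≤ a → a ≤ b → IntervalIntegrable
      (fun y => ((besselI d (lam * y) * y ^ (d - 1) : ℝ) : ℂ) * φ y) volume a b := fun a b ha hab =>
    (hc.mono fun y hy => one_pos.trans_le (ha.trans hy.1)).intervalIntegrable_of_Icc hab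
  rw [leftMoment, ← intervalIntegral.integral_add_adjacent_intervals (hi 1 ρ le_rfl hρ)
    (hi ρ x hρ hx), intervalIntegral.integral_of_le hx, setIntegral_eq_zero_of_forall_eq_zero,
    add_zero, leftMoment]
  intro y hy
  rw [h.zero_right y hy.1.le, mul_zero]

theorem IsHalfLine.integrable_gradKernel_mul (h : IsHalfLine φ g M ρ) (hd : 2 < d) (hl : 0 < lam) :
    IntegrableOn (fun y => ((gradKernel d lam x y * y ^ (d - 1) : ℝ) : ℂ) * g y) (Ioi 0) := by
  have hc : ∀ {b e : ℝ → ℝ}, (∀ s, 0 < s → HasDerivAt b (e s) s) →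
      ContinuousOn (fun y => b (lam * y)) (Icc 1 ρ) := fun {b e} hb y hy =>
    ((hb (lam * y) (mul_pos hl (one_pos.trans_le hy.1))).continuousAt.comp
      (f := fun y => lam * y) (by fun_prop)).continuousWithinAt
  obtain ⟨C₁, h₁⟩ := isCompact_Icc.exists_bound_of_continuousOn
    (hc fun s hs => hasDerivAt_rpow_mul_besselID hd hs)
  obtain ⟨C₂, h₂⟩ := isCompact_Icc.exists_bound_of_continuousOn
    (hc fun s hs => hasDerivAt_rpow_mul_besselKD hd hs)
  refine Integrable.mono' (h.bounded.integrable.norm.const_mul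
    (|besselK d (lam * x)| * |C₁| + |besselI d (lam * x)| * |C₂|)).integrableOn ?_ ?_
  · have hm : Measurable fun y : ℝ => (lam, x, y) := by fun_prop
    refine (StronglyMeasurable.mul ?_ h.bounded.meas).aestronglyMeasurable
    exact (Complex.measurable_ofReal.comp
      (((measurable_gradKernel d).comp hm).mul (by fun_prop))).stronglyMeasurable
  · refine ae_restrict_of_forall_mem measurableSet_Ioi fun y (hy : 0 < y) => ?_
    rw [norm_mul, Complex.norm_real]
    by_cases hy1 : y ≤ 1
    · simp [h.deriv_zero y hy1]
    by_cases hyρ : ρ < y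
    · simp [h.bounded.supp y (hyρ.trans_le (le_abs_self y))]
    have hmem : y ∈ Icc 1 ρ := ⟨(not_le.1 hy1).le, not_lt.1 hyρ⟩
    refine mul_le_mul_of_nonneg_right ?_ (norm_nonneg _)
    have e : lam ^ (d - 1) * y ^ (d - 1) = (lam * y) ^ (d - 1) := (Real.mul_rpow hl.le hy.le).symm
    rw [gradKernel]
    split_ifs
    · rw [show lam ^ (d - 1) * (besselID d (lam * y) * besselK d (lam * x)) * y ^ (d - 1) =
        besselK d (lam * x) * ((lam ^ (d - 1) * y ^ (d - 1)) * besselID d (lam * y)) by ring, e,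
        norm_mul]
      refine le_add_of_le_of_nonneg (mul_le_mul_of_nonneg_left ?_ (abs_nonneg _)) (by positivity)
      exact (h₁ y hmem).trans (le_abs_self _)
    · rw [show -(lam ^ (d - 1) * (besselI d (lam * x) * besselKD d (lam * y))) * y ^ (d - 1) =
        -(besselI d (lam * x) * ((lam ^ (d - 1) * y ^ (d - 1)) * besselKD d (lam * y))) by ring, e,
        norm_neg, norm_mul]
      refine le_add_of_nonneg_of_le (by positivity) (mul_le_mul_of_nonneg_left ?_ (abs_nonneg _))
      exact (h₂ y hmem).trans (le_abs_self _)

/-- `φ - λ² z` in terms of the derivative of `φ`. -/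
theorem IsHalfLine.sub_halfResolvent_eq (h : IsHalfLine φ g M ρ) (hd : 2 < d) (hl : 0 < lam)
    (hx : 1 ≤ x) :
    φ x - (lam : ℂ) ^ 2 * halfResolvent d lam φ ρ c x =
      gradTransform d lam g x - ((lam ^ d * besselK d (lam * x) : ℝ) : ℂ) * c := by
  have hx0 : 0 < x := by linarith
  have hlx : 0 < lam * x := by positivity
  have hρ := h.one_le
  set L := ∫ y in (1)..x, ((besselID d (lam * y) * y ^ (d - 1) : ℝ) : ℂ) * g y with hL
  set R := ∫ y in x..ρ, ((besselKD d (lam * y) * y ^ (d - 1) : ℝ) : ℂ) * g y with hR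
  have hRz : ρ ≤ x → R = 0 := fun hxρ => by
    rw [hR, intervalIntegral.integral_symm, intervalIntegral.integral_of_le hxρ,
      setIntegral_eq_zero_of_forall_eq_zero, neg_zero]
    intro y hy
    rw [h.bounded.supp y (hy.1.trans_le (le_abs_self y)), mul_zero]
  have e1 := h.integral_besselID_mul hd hl hx
  have e2 : ((lam ^ (d - 1) : ℝ) : ℂ) * R =
      -(((lam * x) ^ (d - 1) * besselKD d (lam * x) : ℝ) : ℂ) * φ x +
        lam * ((lam ^ (d - 1) : ℝ) : ℂ) * rightMoment d lam φ ρ x := by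
    rcases le_total x ρ with hxρ | hxρ
    · exact h.integral_besselKD_mul hd hl hx hxρ
    · rw [hRz hxρ, h.rightMoment_eq_zero hxρ, h.zero_right x hxρ]; simp
  have hgi := h.bounded.integrable
  have hi := h.integrable_gradKernel_mul (x := x) hd hl
  have e3 : ∫ y in Ioc 0 x, ((gradKernel d lam x y * y ^ (d - 1) : ℝ) : ℂ) * g y =
      ((lam ^ (d - 1) * besselK d (lam * x) : ℝ) : ℂ) * L := by
    rw [setIntegral_eq_of_subset_of_forall_sdiff_eq_zero measurableSet_Ioc
      (Ioc_subset_Ioc_left zero_le_one), hL, intervalIntegral.integral_of_le hx,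
      ← integral_const_mul]
    · refine integral_congr_ae ?_
      filter_upwards [ae_restrict_mem measurableSet_Ioc,
        ae_restrict_of_ae (Measure.ae_ne volume x)] with y hy hyx
      rw [gradKernel, if_pos (lt_of_le_of_ne hy.2 hyx)]
      push_cast
      ring
    · intro y hy
      rw [h.deriv_zero y (not_lt.1 fun h1 => hy.2 ⟨h1, hy.1.2⟩), mul_zero]
  have e4 : ∫ y in Ioi x, ((gradKernel d lam x y * y ^ (d - 1) : ℝ) : ℂ) * g y =
      -((lam ^ (d - 1) * besselI d (lam * x) : ℝ) : ℂ) * R := by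
    have hz : ∀ y ∈ Ioi x \ Ioc x ρ,
        ((gradKernel d lam x y * y ^ (d - 1) : ℝ) : ℂ) * g y = 0 := fun y hy => by
      have : ρ < y := not_le.1 fun h1 => hy.2 ⟨hy.1, h1⟩
      rw [h.bounded.supp y (this.trans_le (le_abs_self y)), mul_zero]
    rw [setIntegral_eq_of_subset_of_forall_sdiff_eq_zero measurableSet_Ioi Ioc_subset_Ioi_self hz]
    rcases le_total x ρ with hxρ | hxρ
    · rw [hR, intervalIntegral.integral_of_le hxρ, ← integral_const_mul]
      refine setIntegral_congr_fun measurableSet_Ioc fun y hy => ?_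
      rw [gradKernel, if_neg (not_lt.2 hy.1.le)]
      push_cast
      ring
    · rw [hRz hxρ, Ioc_eq_empty (not_lt.2 hxρ)]
      simp
  have hgt : gradTransform d lam g x = ((lam ^ (d - 1) * besselK d (lam * x) : ℝ) : ℂ) * L -
      ((lam ^ (d - 1) * besselI d (lam * x) : ℝ) : ℂ) * R := by
    rw [gradTransform, ← Ioc_union_Ioi_eq_Ioi hx0.le, setIntegral_union
      (Ioc_disjoint_Ioi le_rfl) measurableSet_Ioi
      (hi.mono_set Ioc_subset_Ioi_self) (hi.mono_set (Ioi_subset_Ioi hx0.le)), e3, e4]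
    ring
  have hW : (((lam * x) ^ (d - 1) : ℝ) : ℂ) * ((besselID d (lam * x) : ℂ) * besselK d (lam * x) +
      besselI d (lam * x) * besselKD d (lam * x)) = 1 := by
    have : (lam * x) ^ (d - 1) * (besselID d (lam * x) * besselK d (lam * x) +
      besselI d (lam * x) * besselKD d (lam * x)) = 1 := by
      rw [besselI_wronskian hd hlx, ← Real.rpow_add hlx]; simp
    exact_mod_cast this
  have e5 : ((lam ^ d : ℝ) : ℂ) = (lam : ℂ) ^ 2 * ((lam ^ (d - 2) : ℝ) : ℂ) := by
    have : lam ^ d = lam ^ 2 * lam ^ (d - 2) := by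
      rw [← Real.rpow_two, ← Real.rpow_add hl]; ring_nf
    rw [this]; push_cast; rfl
  have e6 : ((lam ^ (d - 1) : ℝ) : ℂ) = (lam : ℂ) * ((lam ^ (d - 2) : ℝ) : ℂ) := by
    rw [show d - 1 = d - 2 + 1 by ring, Real.rpow_add_one hl.ne']; push_cast; ring
  rw [hgt, halfResolvent, Complex.ofReal_mul, Complex.ofReal_mul, Complex.ofReal_mul, e5]
  rw [Complex.ofReal_mul] at e1 e2
  -- The two integrations by parts leave φ(x) times the Wronskian, which accounts for the term φ on
  -- the left; the moments then cancel against λ² z.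
  linear_combination (-φ x) * hW - (besselK d (lam * x) : ℂ) * e1 +
    (besselI d (lam * x) : ℂ) * e2 + (lam * besselK d (lam * x) * leftMoment d lam φ x +
      lam * besselI d (lam * x) * rightMoment d lam φ ρ x) * e6

end HalfLine

/-- Beyond ρ the solution is an exact multiple of K, so decay is explicit there; continuity on the
compact [1, ρ] extends the bound to [1, ∞). -/
theorem exists_norm_le_exp {F : ℝ → ℂ} {ρ C δ : ℝ} (hF : ContinuousOn F (Ici 1))
    (h : ∀ x, 1 ≤ x → ρ ≤ x → ‖F x‖ ≤ C * Real.exp (-(δ * x))) :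
    ∃ D : ℝ, ∀ x, 1 ≤ x → ‖F x‖ ≤ D * Real.exp (-(δ * x)) := by
  have hc : ContinuousOn (fun x => (Real.exp (δ * x) : ℂ) * F x) (Icc 1 ρ) :=
    ContinuousOn.mul (by fun_prop) (hF.mono Icc_subset_Ici_self)
  obtain ⟨B, hB⟩ := isCompact_Icc.exists_bound_of_continuousOn hc
  refine ⟨max B C, fun x hx => ?_⟩
  rcases le_total x ρ with hxρ | hxρ
  · have h1 := hB x ⟨hx, hxρ⟩
    rw [norm_mul, Complex.norm_real, Real.norm_of_nonneg (Real.exp_pos _).le] at h1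
    have h2 := h1.trans (le_max_left B C)
    rw [Real.exp_neg, ← div_eq_mul_inv, le_div_iff₀ (Real.exp_pos _)]
    linarith
  · refine (h x hx hxρ).trans ?_
    gcongr
    exact le_max_right B C

section HalfLine

variable {d lam M ρ x : ℝ} {φ g : ℝ → ℂ} {c : ℂ}

theorem IsHalfLine.continuousOn_halfResolvent (h : IsHalfLine φ g M ρ) (hd : 2 < d)
    (hl : 0 < lam) : ContinuousOn (halfResolvent d lam φ ρ c) (Ioi 0) := fun _ hx =>
  (h.hasDerivAt_halfResolvent hd hl hx).continuousAt.continuousWithinAt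

theorem IsHalfLine.continuousOn_halfResolventDeriv (h : IsHalfLine φ g M ρ) (hd : 2 < d)
    (hl : 0 < lam) : ContinuousOn (halfResolventDeriv d lam φ ρ c) (Ioi 0) := by
  have h1 : ContinuousOn (fun x => ((x ^ (d - 1) : ℝ) : ℂ) * halfResolventDeriv d lam φ ρ c x)
      (Ioi 0) := fun _ hx =>
    (h.hasDerivAt_rpow_mul_halfResolventDeriv hd hl hx).continuousAt.continuousWithinAt
  have h2 : ContinuousOn (fun x : ℝ => ((x ^ (1 - d) : ℝ) : ℂ)) (Ioi 0) :=
    Complex.continuous_ofReal.comp_continuousOn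
      (continuousOn_id.rpow_const fun _ hy => Or.inl (ne_of_gt hy))
  refine (h2.mul h1).congr fun x (hx : 0 < x) => ?_
  rw [Pi.mul_apply, ← mul_assoc, ← Complex.ofReal_mul, ← Real.rpow_add hx]
  simp

theorem IsHalfLine.exists_norm_halfResolvent_le (h : IsHalfLine φ g M ρ) (hd : 2 < d)
    (hl : 0 < lam) :
    ∃ C : ℝ, ∀ x, 1 ≤ x → ‖halfResolvent d lam φ ρ c x‖ ≤ C * Real.exp (-(lam / 2 * x)) := by
  obtain ⟨B, hB, hK⟩ := exists_besselK_le hd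
  refine exists_norm_le_exp (ρ := ρ)
    (C := lam ^ (d - 2) * (B * lam ^ (2 - d) * ‖leftMoment d lam φ ρ + c‖))
    ((h.continuousOn_halfResolvent hd hl).mono (Ici_subset_Ioi.2 one_pos)) fun x hx hxρ => ?_
  have hx0 : 0 < x := by linarith
  have hlx : 0 < lam * x := by positivity
  have h1 := hK _ hlx
  have h2 := besselK_pos (by linarith : 1 < d) hlx
  have h3 : x ^ (2 - d) ≤ 1 := Real.rpow_le_one_of_one_le_of_nonpos hx (by linarith)
  rw [halfResolvent, h.rightMoment_eq_zero hxρ, h.leftMoment_eq hd hl hxρ, mul_zero, add_zero,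
    norm_mul, norm_mul, Complex.norm_real, Complex.norm_real,
    Real.norm_of_nonneg h2.le, Real.norm_of_nonneg (by positivity)]
  rw [Real.mul_rpow hl.le hx0.le] at h1
  calc _ ≤ lam ^ (d - 2) * (B * (lam ^ (2 - d) * 1) * Real.exp (-(lam * x / 2)) *
        ‖leftMoment d lam φ ρ + c‖) := by
        gcongr
        refine h1.trans ?_
        gcongr
    _ = _ := by ring_nf

theorem IsHalfLine.exists_norm_halfResolventDeriv_le (h : IsHalfLine φ g M ρ) (hd : 2 < d)
    (hl : 0 < lam) :
    ∃ C : ℝ, ∀ x, 1 ≤ x → ‖halfResolventDeriv d lam φ ρ c x‖ ≤ C * Real.exp (-(lam / 2 * x)) := by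
  obtain ⟨B, hB, hK⟩ := exists_besselKD_le hd
  refine exists_norm_le_exp (ρ := ρ)
    (C := lam ^ (d - 1) * (B * lam ^ (1 - d) * ‖leftMoment d lam φ ρ + c‖))
    ((h.continuousOn_halfResolventDeriv hd hl).mono (Ici_subset_Ioi.2 one_pos)) fun x hx hxρ => ?_
  have hx0 : 0 < x := by linarith
  have hlx : 0 < lam * x := by positivity
  have h1 := hK _ hlx
  have h2 := besselKD_pos hd hlx
  have h3 : x ^ (1 - d) ≤ 1 := Real.rpow_le_one_of_one_le_of_nonpos hx (by linarith)
  rw [halfResolventDeriv, h.rightMoment_eq_zero hxρ, h.leftMoment_eq hd hl hxρ, mul_zero, add_zero,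
    norm_mul, norm_mul, norm_neg, Complex.norm_real, Complex.norm_real,
    Real.norm_of_nonneg h2.le, Real.norm_of_nonneg (by positivity)]
  rw [Real.mul_rpow hl.le hx0.le] at h1
  calc _ ≤ lam ^ (d - 1) * (B * (lam ^ (1 - d) * 1) * Real.exp (-(lam * x / 2)) *
        ‖leftMoment d lam φ ρ + c‖) := by
        gcongr
        refine h1.trans ?_
        gcongr
    _ = _ := by ring_nf

/-- φ is minus the integral of its derivative from x to the end of the support; this is where the
Hardy average of the derivative comes from. -/
theorem IsHalfLine.enorm_le_lintegral (h : IsHalfLine φ g M ρ) (hx : 1 ≤ x) :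
    ‖φ x‖ₑ ≤ ∫⁻ t in Ioi x, ‖g t‖ₑ := by
  rcases le_total x ρ with hxρ | hxρ
  · have e := intervalIntegral.integral_eq_sub_of_hasDerivAt_of_le hxρ h.cont.continuousOn
      (fun y hy => h.deriv y (hx.trans_lt hy.1)) h.bounded.integrable.intervalIntegrable
    rw [h.zero_right ρ le_rfl, zero_sub] at e
    rw [← enorm_neg, ← e, intervalIntegral.integral_of_le hxρ]
    exact (enorm_integral_le_lintegral_enorm _).trans (lintegral_mono_set Ioc_subset_Ioi_self)
  · rw [h.zero_right x hxρ, enorm_zero]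
    exact zero_le

theorem enorm_ofReal_of_nonneg {r : ℝ} (hr : 0 ≤ r) : ‖(r : ℂ)‖ₑ = ENNReal.ofReal r := by
  rw [← ofReal_norm, Complex.norm_real, Real.norm_of_nonneg hr]

theorem enorm_integral_Ioc_le_lintegral_radialMeasure {b : ℝ → ℝ} (hb : ∀ s, 0 < s → 0 ≤ b s)
    (ρ : ℝ) (φ : ℝ → ℂ) :
    ‖∫ y in Ioc 1 ρ, ((b y * y ^ (d - 1) : ℝ) : ℂ) * φ y‖ₑ ≤
      ∫⁻ y, ENNReal.ofReal (b y) * (Ici 1).indicator (fun y => ‖φ y‖ₑ) y ∂radialMeasure d := by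
  refine (enorm_integral_le_lintegral_enorm _).trans ?_
  rw [lintegral_radialMeasure_eq, ← lintegral_indicator measurableSet_Ioc,
    ← lintegral_indicator measurableSet_Ioi]
  refine lintegral_mono fun y => ?_
  by_cases hy : y ∈ Ioc 1 ρ
  · have hy0 : 0 < y := one_pos.trans hy.1
    have hb0 := hb y hy0
    rw [indicator_of_mem hy, indicator_of_mem (mem_Ioi.2 hy0),
      indicator_of_mem (mem_Ici.2 hy.1.le), enorm_mul, enorm_ofReal_of_nonneg (by positivity),
      mul_comm (b y), ENNReal.ofReal_mul (by positivity), mul_assoc]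
  · rw [indicator_of_notMem hy]
    exact zero_le

/-- The moment through the derivative comes from integration by parts on [1, ρ] with φ(1) = φ(ρ) =
0; the moment through φ uses φ(y) = -∫ g over (y, ρ). Which one is used depends on p. -/
theorem IsHalfLine.isBesselMoment (h : IsHalfLine φ g M ρ) (hd : 2 < d) :
    IsBesselMoment d (fun y => ‖g y‖ₑ) fun lam => ‖rightMoment d lam φ ρ 1‖ₑ where
  meas := h.bounded.meas.enorm
  supp := fun y hy => by rw [h.deriv_zero y hy.le, enorm_zero]
  le_deriv := fun lam hl => by
    have e := h.integral_besselKD_mul hd hl le_rfl h.one_le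
    rw [h.zero_left 1 le_rfl, mul_zero, zero_add] at e
    have hl1 : ((lam ^ (d - 1) : ℝ) : ℂ) ≠ 0 := by
      exact_mod_cast (Real.rpow_pos_of_pos hl _).ne'
    have hl2 : (lam : ℂ) ≠ 0 := by exact_mod_cast hl.ne'
    have e' : rightMoment d lam φ ρ 1 = ∫ y in Ioc 1 ρ,
        (((lam⁻¹ * besselKD d (lam * y)) * y ^ (d - 1) : ℝ) : ℂ) * g y := by
      have : ∀ y, (((lam⁻¹ * besselKD d (lam * y)) * y ^ (d - 1) : ℝ) : ℂ) * g y =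
          (lam : ℂ)⁻¹ * (((besselKD d (lam * y) * y ^ (d - 1) : ℝ) : ℂ) * g y) := fun y => by
        push_cast; ring
      simp only [this]
      rw [integral_const_mul, ← intervalIntegral.integral_of_le h.one_le,
        eq_inv_mul_iff_mul_eq₀ hl2]
      refine mul_left_cancel₀ hl1 ?_
      rw [e]
      ring
    rw [e']
    refine (enorm_integral_Ioc_le_lintegral_radialMeasure (fun y hy => ?_) ρ g).trans
      (lintegral_mono fun y => mul_le_mul_right (indicator_le_self' (fun _ _ => zero_le) y) _)
    have := besselKD_pos hd (mul_pos hl hy)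
    positivity
  le_self := fun lam hl => by
    rw [rightMoment, intervalIntegral.integral_of_le h.one_le]
    refine (enorm_integral_Ioc_le_lintegral_radialMeasure (b := fun y => besselK d (lam * y))
      (fun y hy => (besselK_pos (by linarith : 1 < d) (mul_pos hl hy)).le) ρ φ).trans
      (lintegral_mono fun y => mul_le_mul_right ?_ _)
    exact indicator_le_indicator' fun hy => h.enorm_le_lintegral hy

theorem IsBesselMoment.add {G₁ G₂ κ₁ κ₂ : ℝ → ℝ≥0∞} (h₁ : IsBesselMoment d G₁ κ₁)
    (h₂ : IsBesselMoment d G₂ κ₂) : IsBesselMoment d (G₁ + G₂) (κ₁ + κ₂) where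
  meas := h₁.meas.add h₂.meas
  supp := fun y hy => by rw [Pi.add_apply, h₁.supp y hy, h₂.supp y hy, add_zero]
  le_deriv := fun lam hl => by
    have hm := measurable_besselKD d
    have hm1 := h₁.meas
    simp only [Pi.add_apply, mul_add]
    rw [lintegral_add_left (by fun_prop)]
    exact add_le_add (h₁.le_deriv lam hl) (h₂.le_deriv lam hl)
  le_self := fun lam hl => by
    have hm := measurable_besselK d
    have hm1 : Measurable ((Ici (1 : ℝ)).indicator fun y => ∫⁻ t in Ioi y, G₁ t) :=
      (measurable_lintegral_Ioi G₁).indicator measurableSet_Ici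
    have e : (fun y => ∫⁻ t in Ioi y, (G₁ + G₂) t) =
        (fun y => ∫⁻ t in Ioi y, G₁ t) + fun y => ∫⁻ t in Ioi y, G₂ t := by
      funext y
      exact lintegral_add_left h₁.meas _
    rw [e]
    simp only [indicator_add', Pi.add_apply, mul_add]
    rw [lintegral_add_left (by fun_prop)]
    exact add_le_add (h₁.le_self lam hl) (h₂.le_self lam hl)

theorem IsHalfLine.measurable_rightMoment (h : IsHalfLine φ g M ρ) :
    Measurable fun lam => rightMoment d lam φ ρ 1 := by
  have hm := measurable_besselK d
  have hφ := h.cont.measurable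
  simp only [rightMoment, intervalIntegral.integral_of_le h.one_le]
  refine (StronglyMeasurable.integral_prod_right (ν := volume.restrict (Ioc 1 ρ))
    (f := fun lam y => ((besselK d (lam * y) * y ^ (d - 1) : ℝ) : ℂ) * φ y) ?_).measurable
  exact Measurable.stronglyMeasurable (by fun_prop)

theorem measurable_gradTransform (d : ℝ) {g : ℝ → ℂ} (hg : StronglyMeasurable g) :
    Measurable fun q : ℝ × ℝ => gradTransform d q.1 g q.2 := by
  refine (StronglyMeasurable.integral_prod_right' (ν := volume.restrict (Ioi 0))
    (f := fun q : (ℝ × ℝ) × ℝ =>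
      ((gradKernel d q.1.1 q.1.2 q.2 * q.2 ^ (d - 1) : ℝ) : ℂ) * g q.2) ?_).measurable
  refine StronglyMeasurable.mul ?_ (hg.comp_measurable measurable_snd)
  have hm : Measurable fun q : (ℝ × ℝ) × ℝ => (q.1.1, q.1.2, q.2) := by fun_prop
  exact (Complex.measurable_ofReal.comp
    (((measurable_gradKernel d).comp hm).mul (by fun_prop))).stronglyMeasurable

end HalfLine

/-! ### The broken line as two glued half-lines -/

/-- The measure `r ^ (d - 1) dr` on `[1, ∞)`. -/
def sideMeasure (d : ℝ) : Measure ℝ :=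
  (volume.restrict (Ioi 1)).withDensity fun r => ENNReal.ofReal (r ^ (d - 1))

theorem restrict_radialMeasure (d : ℝ) : (radialMeasure d).restrict (Ici 1) = sideMeasure d := by
  rw [radialMeasure, restrict_withDensity measurableSet_Ici,
    Measure.restrict_restrict measurableSet_Ici,
    inter_eq_left.2 (Ici_subset_Ioi.2 one_pos), sideMeasure,
    Measure.restrict_congr_set Ioi_ae_eq_Ici]

theorem lintegral_sideMeasure (d : ℝ) (F : ℝ → ℝ≥0∞) :
    ∫⁻ r, F r ∂sideMeasure d = ∫⁻ r in Ioi 1, ENNReal.ofReal (r ^ (d - 1)) * F r := by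
  rw [sideMeasure, lintegral_withDensity_eq_lintegral_mul_non_measurable _ (by fun_prop)
    (Eventually.of_forall fun _ => ENNReal.ofReal_lt_top)]
  rfl

theorem lineMeasure_eq (d : ℝ) :
    lineMeasure d = sideMeasure d + (sideMeasure d).map Neg.neg := by
  refine Measure.ext_of_lintegral _ fun F hF => ?_
  have hF' : Measurable fun r => F (-r) := hF.comp measurable_neg
  rw [lintegral_add_measure, lintegral_map hF measurable_neg, lineMeasure,
    lintegral_withDensity_eq_lintegral_mul _ (by fun_prop) hF, lintegral_sideMeasure,
    lintegral_sideMeasure]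
  have hdisj : Disjoint (Iic (-1 : ℝ)) (Ici 1) :=
    Set.disjoint_left.2 fun x h1 h2 => by
      have := mem_Iic.1 h1; have := mem_Ici.1 h2; linarith
  rw [line, lintegral_union measurableSet_Ici hdisj, add_comm]
  congr 1
  · rw [← Measure.restrict_congr_set (Ioi_ae_eq_Ici (a := (1 : ℝ)))]
    refine setLIntegral_congr_fun measurableSet_Ioi fun x (hx : 1 < x) => ?_
    simp only [Pi.mul_apply]
    rw [abs_of_pos (by linarith)]
  · rw [← Measure.restrict_congr_set (Iio_ae_eq_Iic (a := (-1 : ℝ))),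
      ← lintegral_indicator measurableSet_Iio, ← lintegral_indicator measurableSet_Ioi,
      ← lintegral_neg_eq_self]
    refine lintegral_congr fun x => ?_
    by_cases hx : 1 < x
    · rw [indicator_of_mem (mem_Iio.2 (neg_lt_neg hx)), indicator_of_mem (mem_Ioi.2 hx)]
      simp only [Pi.mul_apply]
      rw [abs_neg, abs_of_pos (by linarith)]
    · rw [indicator_of_notMem (fun h => hx (neg_lt_neg_iff.1 (mem_Iio.1 h))),
        indicator_of_notMem (fun h => hx (mem_Ioi.1 h))]

theorem lintegral_lineMeasure (d : ℝ) (F : ℝ → ℝ≥0∞) :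
    ∫⁻ r, F r ∂lineMeasure d = (∫⁻ r, F r ∂sideMeasure d) + ∫⁻ r, F (-r) ∂sideMeasure d := by
  rw [lineMeasure_eq, lintegral_add_measure]
  congr 1
  exact lintegral_map_equiv F (MeasurableEquiv.neg ℝ)

theorem integrable_lineMeasure {d : ℝ} {F : ℝ → ℂ} (hF : Integrable F (lineMeasure d)) :
    Integrable F (sideMeasure d) ∧ Integrable (fun r => F (-r)) (sideMeasure d) := by
  rw [lineMeasure_eq, integrable_add_measure] at hF
  exact ⟨hF.1, ((MeasurableEquiv.neg ℝ).measurableEmbedding.integrable_map_iff).1 hF.2⟩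

theorem integral_lineMeasure {d : ℝ} {F : ℝ → ℂ} (hF : Integrable F (lineMeasure d)) :
    ∫ r, F r ∂lineMeasure d = (∫ r, F r ∂sideMeasure d) + ∫ r, F (-r) ∂sideMeasure d := by
  rw [lineMeasure_eq, integrable_add_measure] at hF
  rw [lineMeasure_eq, integral_add_measure hF.1 hF.2]
  congr 1
  exact (MeasurableEquiv.neg ℝ).measurableEmbedding.integral_map F

theorem integral_sideMeasure (d : ℝ) (F : ℝ → ℂ) :
    ∫ r, F r ∂sideMeasure d = ∫ r in Ioi 1, ((r ^ (d - 1) : ℝ) : ℂ) * F r := by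
  rw [sideMeasure, integral_withDensity_eq_integral_toReal_smul (by fun_prop)
    (Eventually.of_forall fun _ => ENNReal.ofReal_lt_top)]
  refine setIntegral_congr_fun measurableSet_Ioi fun r (hr : 1 < r) => ?_
  have : 0 < r := by linarith
  rw [ENNReal.toReal_ofReal (by positivity)]
  exact (Complex.real_smul)

theorem integrable_sideMeasure {d : ℝ} {F : ℝ → ℂ} (hF : Integrable F (sideMeasure d)) :
    IntegrableOn (fun r => ((r ^ (d - 1) : ℝ) : ℂ) * F r) (Ioi 1) := by
  rw [sideMeasure, integrable_withDensity_iff_integrable_smul' (by fun_prop)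
    (Eventually.of_forall fun _ => ENNReal.ofReal_lt_top)] at hF
  refine IntegrableOn.congr_fun hF (fun r (hr : 1 < r) => ?_) measurableSet_Ioi
  have : 0 < r := by linarith
  rw [ENNReal.toReal_ofReal (by positivity)]
  exact (Complex.real_smul)

/-- The function on the broken line given by `p` on `[1, ∞)` and by `m` on the reflected side. -/
def glueFn (p m : ℝ → ℂ) (r : ℝ) : ℂ := if 0 ≤ r then p r else m (-r)

theorem glueFn_of_pos (p m : ℝ → ℂ) {r : ℝ} (hr : 0 < r) : glueFn p m r = p r := if_pos hr.le

theorem glueFn_neg_of_pos (p m : ℝ → ℂ) {r : ℝ} (hr : 0 < r) : glueFn p m (-r) = m r := by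
  rw [glueFn, if_neg (by linarith), neg_neg]

theorem hasDerivAt_glueFn {p m p' m' : ℝ → ℂ} (hp : ∀ x, 0 < x → HasDerivAt p (p' x) x)
    (hm : ∀ x, 0 < x → HasDerivAt m (m' x) x) {r : ℝ} (hr : r ≠ 0) :
    HasDerivAt (glueFn p m) (glueFn p' (fun x => -m' x) r) r := by
  rcases lt_or_gt_of_ne hr with h | h
  · have hr' : 0 < -r := by linarith
    have h1 : HasDerivAt (fun r => m (-r)) (-m' (-r)) r := by
      simpa using! (hm (-r) hr').scomp r (hasDerivAt_neg r)
    rw [glueFn, if_neg (not_le.2 h)]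
    refine h1.congr_of_eventuallyEq ?_
    filter_upwards [eventually_lt_nhds h] with y hy
    rw [glueFn, if_neg (not_le.2 hy)]
  · rw [glueFn_of_pos _ _ h]
    refine (hp r h).congr_of_eventuallyEq ?_
    filter_upwards [eventually_gt_nhds h] with y hy
    rw [glueFn_of_pos _ _ hy]

theorem continuousOn_glueFn {p m : ℝ → ℂ} (hp : ContinuousOn p (Ioi 0))
    (hm : ContinuousOn m (Ioi 0)) : ContinuousOn (glueFn p m) {0}ᶜ := by
  intro r hr
  refine ContinuousAt.continuousWithinAt ?_
  rcases lt_or_gt_of_ne (show r ≠ 0 from hr) with h | h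
  · have hr' : 0 < -r := by linarith
    have h1 : ContinuousAt (fun r => m (-r)) r :=
      (hm.continuousAt (Ioi_mem_nhds hr')).comp continuous_neg.continuousAt
    refine h1.congr ?_
    filter_upwards [eventually_lt_nhds h] with y hy
    rw [glueFn, if_neg (not_le.2 hy)]
  · refine (hp.continuousAt (Ioi_mem_nhds h)).congr ?_
    filter_upwards [eventually_gt_nhds h] with y hy
    rw [glueFn_of_pos _ _ hy]

theorem ne_zero_of_mem_line {r : ℝ} (hr : r ∈ line) : r ≠ 0 := by
  rcases hr with h | h
  · exact (by linarith [mem_Iic.1 h] : r < 0).ne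
  · exact (by linarith [mem_Ici.1 h] : 0 < r).ne'

theorem isC1_glueFn {p m p' m' : ℝ → ℂ} (hp : ∀ x, 0 < x → HasDerivAt p (p' x) x)
    (hm : ∀ x, 0 < x → HasDerivAt m (m' x) x) (hp' : ContinuousOn p' (Ioi 0))
    (hm' : ContinuousOn m' (Ioi 0)) (h0 : m 1 = p 1) (h1 : -m' 1 = p' 1) :
    IsC1 (glueFn p m) ∧ ∀ r ∈ line, lineDeriv (glueFn p m) r = glueFn p' (fun x => -m' x) r := by
  have hd : ∀ r ∈ line, lineDeriv (glueFn p m) r = glueFn p' (fun x => -m' x) r := fun r hr =>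
    (hasDerivAt_glueFn hp hm (ne_zero_of_mem_line hr)).hasDerivWithinAt.derivWithin
      (uniqueDiffOn_line r hr)
  refine ⟨⟨?_, ?_, ?_⟩, hd⟩
  · rw [contDiffOn_one_iff_derivWithin uniqueDiffOn_line]
    refine ⟨fun r hr => (hasDerivAt_glueFn hp hm
      (ne_zero_of_mem_line hr)).differentiableAt.differentiableWithinAt, ?_⟩
    exact ((continuousOn_glueFn hp' hm'.neg).mono fun r hr => ne_zero_of_mem_line hr).congr hd
  · rw [glueFn_neg_of_pos _ _ one_pos, glueFn_of_pos _ _ one_pos, h0]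
  · rw [hd _ neg_one_mem_line, hd _ one_mem_line, glueFn_neg_of_pos _ _ one_pos,
      glueFn_of_pos _ _ one_pos, h1]

/-- The extension by the constant F(1) = 0 to the left of 1 is continuous, but its derivative may
jump at 1. That is why the derivative is only required to be bounded and measurable, and is set to
zero on y ≤ 1. -/
theorem isHalfLine_of_hasDerivWithinAt {F F' : ℝ → ℂ} {ρ : ℝ} (hρ1 : 1 ≤ ρ)
    (hF : ∀ x, 1 ≤ x → HasDerivWithinAt F (F' x) (Ici 1) x) (hF' : ContinuousOn F' (Ici 1))
    (h0 : F 1 = 0) (hρ : ∀ x, ρ ≤ x → F x = 0) :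
    ∃ M, IsHalfLine (fun y => F (max y 1)) ((Ioi 1).indicator F') M ρ := by
  have hmax : ∀ y : ℝ, max y 1 ∈ Ici (1 : ℝ) := fun y => le_max_right y 1
  have hat : ∀ y, 1 < y → HasDerivAt F (F' y) y := fun y hy =>
    (hF y hy.le).hasDerivAt (Ici_mem_nhds hy)
  have hz : ∀ y, ρ < y → F' y = 0 := fun y hy => by
    refine (hat y (hρ1.trans_lt hy)).unique ?_
    refine (hasDerivAt_const y (0 : ℂ)).congr_of_eventuallyEq ?_
    filter_upwards [eventually_gt_nhds hy] with x hx using hρ x hx.le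
  obtain ⟨M, hM⟩ := isCompact_Icc.exists_bound_of_continuousOn
    (hF'.mono (Icc_subset_Ici_self : Icc 1 ρ ⊆ Ici 1))
  have hM0 : 0 ≤ M := (norm_nonneg _).trans (hM 1 ⟨le_rfl, hρ1⟩)
  refine ⟨M, hρ1, ?_, ?_, ?_, ?_, ⟨?_, ?_, ?_⟩, ?_⟩
  · exact ContinuousOn.comp_continuous (fun x hx => (hF x hx).continuousWithinAt) (by fun_prop) hmax
  · intro y hy
    simp only [max_eq_right hy, h0]
  · intro y hy
    simp only [max_eq_left (hρ1.trans hy), hρ y hy]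
  · intro y hy
    rw [indicator_of_mem (mem_Ioi.2 hy)]
    refine (hat y hy).congr_of_eventuallyEq ?_
    filter_upwards [eventually_gt_nhds hy] with x hx
    rw [max_eq_left hx.le]
  · have e : (Ioi 1).indicator F' = (Ioi 1).indicator fun y => F' (max y 1) :=
      indicator_congr fun y (hy : 1 < y) => by rw [max_eq_left hy.le]
    rw [e]
    exact (hF'.comp_continuous (by fun_prop) hmax).stronglyMeasurable.indicator measurableSet_Ioi
  · intro t
    by_cases ht : 1 < t
    · rw [indicator_of_mem (mem_Ioi.2 ht)]
      rcases le_or_gt t ρ with h | h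
      · exact hM t ⟨ht.le, h⟩
      · rwa [hz t h, norm_zero]
    · rwa [indicator_of_notMem (s := Ioi 1) ht, norm_zero]
  · intro t ht
    by_cases ht1 : 1 < t
    · rw [indicator_of_mem (mem_Ioi.2 ht1)]
      rw [abs_of_pos (by linarith)] at ht
      exact hz t ht
    · exact indicator_of_notMem ht1 _
  · intro y hy
    exact indicator_of_notMem (not_lt.2 hy) _

/-- The restriction of a function on the broken line to `[1, ∞)`, extended by a constant. -/
def posPart (f : ℝ → ℂ) (y : ℝ) : ℂ := f (max y 1)

/-- The restriction of a function on the broken line to `(-∞, -1]`, reflected and extended by a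
constant. -/
def negPart (f : ℝ → ℂ) (y : ℝ) : ℂ := f (-max y 1)

/-- The derivative of `posPart`. -/
def posDeriv (f : ℝ → ℂ) : ℝ → ℂ := (Ioi 1).indicator (lineDeriv f)

/-- The derivative of `negPart`. -/
def negDeriv (f : ℝ → ℂ) : ℝ → ℂ := (Ioi 1).indicator fun y => -lineDeriv f (-y)

theorem IsC1.hasDerivWithinAt_pos {f : ℝ → ℂ} (hf : IsC1 f) {x : ℝ} (hx : 1 ≤ x) :
    HasDerivWithinAt f (lineDeriv f x) (Ici 1) x :=
  (hf.differentiable (Or.inr hx)).hasDerivWithinAt.mono subset_union_right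

theorem neg_mem_line {x : ℝ} (hx : 1 ≤ x) : -x ∈ line := Or.inl (mem_Iic.2 (neg_le_neg hx))

theorem IsC1.hasDerivWithinAt_neg {f : ℝ → ℂ} (hf : IsC1 f) {x : ℝ} (hx : 1 ≤ x) :
    HasDerivWithinAt (fun y => f (-y)) (-lineDeriv f (-x)) (Ici 1) x := by
  have h := (hf.differentiable (neg_mem_line hx)).hasDerivWithinAt
  have := h.scomp x (_root_.hasDerivWithinAt_neg x (Ici 1)) fun y hy => neg_mem_line hy
  simpa using! this

theorem IsC1.continuousOn_lineDeriv {f : ℝ → ℂ} (hf : IsC1 f) : ContinuousOn (lineDeriv f) line :=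
  hf.contDiffOn.continuousOn_derivWithin uniqueDiffOn_line le_rfl

theorem IsC1.continuousOn_lineDeriv_neg {f : ℝ → ℂ} (hf : IsC1 f) :
    ContinuousOn (fun y => -lineDeriv f (-y)) (Ici 1) :=
  (hf.continuousOn_lineDeriv.comp continuous_neg.continuousOn fun _ hy => neg_mem_line hy).neg

theorem IsS0.isC1 {f : ℝ → ℂ} (hf : IsS0 f) : IsC1 f where
  contDiffOn := hf.contDiffOn.of_le (by norm_num)
  glue := by rw [hf.vanish_neg, hf.vanish_pos]
  glue_deriv := by simpa [iteratedDerivWithin_one, lineDeriv] using hf.glue 1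

theorem IsS0.exists_isHalfLine {f : ℝ → ℂ} (hf : IsS0 f) :
    ∃ M M' ρ, IsHalfLine (posPart f) (posDeriv f) M ρ ∧
      IsHalfLine (negPart f) (negDeriv f) M' ρ := by
  obtain ⟨ρ₀, h₀⟩ := hf.compactSupport
  -- The support hypothesis is strict in |r|, so the radius is enlarged by 1; this also places it
  -- beyond 1.
  have h1 : ∀ x, max ρ₀ 1 + 1 ≤ x → 1 ≤ x ∧ ρ₀ < x := fun x hx =>
    ⟨by linarith [le_max_right ρ₀ 1], by linarith [le_max_left ρ₀ 1]⟩
  have hρ : 1 ≤ max ρ₀ 1 + 1 := by linarith [le_max_right ρ₀ 1]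
  obtain ⟨M, hM⟩ := isHalfLine_of_hasDerivWithinAt hρ
    (fun x hx => hf.isC1.hasDerivWithinAt_pos hx)
    (hf.isC1.continuousOn_lineDeriv.mono subset_union_right) hf.vanish_pos fun x hx => by
      obtain ⟨h2, h3⟩ := h1 x hx
      exact h₀ x (Or.inr h2) (by rwa [abs_of_pos (by linarith)])
  obtain ⟨M', hM'⟩ := isHalfLine_of_hasDerivWithinAt (F := fun y => f (-y)) hρ
    (fun x hx => hf.isC1.hasDerivWithinAt_neg hx)
    hf.isC1.continuousOn_lineDeriv_neg hf.vanish_neg fun x hx => by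
      obtain ⟨h2, h3⟩ := h1 x hx
      exact h₀ _ (neg_mem_line h2) (by rwa [abs_neg, abs_of_pos (by linarith)])
  exact ⟨M, M', _, hM, hM'⟩

theorem lintegral_sideMeasure_sq_lt_top {d : ℝ} (hd : 0 < d) {F : ℝ → ℂ} {δ : ℝ} (hδ : 0 < δ)
    (h : ∃ C : ℝ, ∀ x, 1 ≤ x → ‖F x‖ ≤ C * Real.exp (-(δ * x))) :
    ∫⁻ r, ‖F r‖ₑ ^ (2 : ℝ) ∂sideMeasure d < ⊤ := by
  obtain ⟨C, hC⟩ := h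
  have hi := (integrableOn_rpow_mul_exp (b := d - 1) (by linarith) (s := 2 * δ)
    (by positivity)).const_mul (C ^ 2)
  rw [lintegral_sideMeasure]
  refine lt_of_le_of_lt ?_ hi.lintegral_lt_top
  refine (setLIntegral_mono' measurableSet_Ioi fun x (hx : 1 < x) => ?_).trans
    (lintegral_mono_set (Ioi_subset_Ioi zero_le_one))
  have hx0 : 0 < x := by linarith
  have h1 := hC x hx.le
  rw [← ofReal_norm, ENNReal.ofReal_rpow_of_nonneg (norm_nonneg _) two_pos.le,
    ← ENNReal.ofReal_mul (by positivity)]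
  refine ENNReal.ofReal_le_ofReal ?_
  have e : Real.exp (-(2 * δ * x)) = Real.exp (-(δ * x)) ^ 2 := by
    rw [← Real.exp_nat_mul]; congr 1; push_cast; ring
  rw [Real.rpow_two, e]
  calc x ^ (d - 1) * ‖F x‖ ^ 2 ≤ x ^ (d - 1) * (C * Real.exp (-(δ * x))) ^ 2 := by gcongr
    _ = _ := by ring

theorem ContinuousOn.aestronglyMeasurable_lineMeasure {F : ℝ → ℂ} (hF : ContinuousOn F line)
    (d : ℝ) : AEStronglyMeasurable F (lineMeasure d) :=
  (hF.aestronglyMeasurable measurableSet_line).mono_ac (withDensity_absolutelyContinuous _ _)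

theorem ContinuousOn.memLp_two_lineMeasure {d : ℝ} (hd : 0 < d) {F : ℝ → ℂ}
    (hF : ContinuousOn F line) {δ : ℝ} (hδ : 0 < δ)
    (h₁ : ∃ C : ℝ, ∀ x, 1 ≤ x → ‖F x‖ ≤ C * Real.exp (-(δ * x)))
    (h₂ : ∃ C : ℝ, ∀ x, 1 ≤ x → ‖F (-x)‖ ≤ C * Real.exp (-(δ * x))) :
    MemLp F 2 (lineMeasure d) := by
  refine ⟨ContinuousOn.aestronglyMeasurable_lineMeasure hF d, ?_⟩
  rw [eLpNorm_lt_top_iff_lintegral_rpow_enorm_lt_top (by norm_num) (by norm_num),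
    ENNReal.toReal_ofNat, lintegral_lineMeasure]
  exact ENNReal.add_lt_top.2 ⟨lintegral_sideMeasure_sq_lt_top hd hδ h₁,
    lintegral_sideMeasure_sq_lt_top hd hδ h₂⟩

theorem IsS0.memLp {f : ℝ → ℂ} (hf : IsS0 f) {d : ℝ} (hd : 0 < d) :
    MemLp f 2 (lineMeasure d) ∧ MemLp (lineDeriv f) 2 (lineMeasure d) := by
  obtain ⟨M, M', ρ, h, h'⟩ := hf.exists_isHalfLine
  have hc := hf.isC1.contDiffOn.continuousOn
  have hc' := hf.isC1.continuousOn_lineDeriv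
  have hneg : ∀ {F : ℝ → ℂ}, ContinuousOn F line → ContinuousOn (fun y => F (-y)) (Ici 1) :=
    fun hF => hF.comp continuous_neg.continuousOn fun _ hy => neg_mem_line hy
  -- Compact support counts as exponential decay with constant 0 beyond the support. The radius ρ +
  -- 1 is taken because derivatives are only known to vanish strictly beyond ρ.
  have hz : ∀ {F G : ℝ → ℂ}, ContinuousOn F (Ici 1) → (∀ x, 1 < x → ρ + 1 ≤ x → ‖F x‖ = ‖G x‖) →
      (∀ x, ρ + 1 ≤ x → G x = 0) →
      ∃ C : ℝ, ∀ x, 1 ≤ x → ‖F x‖ ≤ C * Real.exp (-(1 * x)) := fun hF hFG hG =>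
    exists_norm_le_exp (C := 0) (ρ := ρ + 1) hF fun x hx hxρ => by
      rw [hFG x (by linarith [h.one_le]) hxρ, hG x hxρ, norm_zero, zero_mul]
  have hsupp : ∀ {G : ℝ → ℂ} {M : ℝ}, IsBoundedCompact G M ρ → ∀ x, ρ + 1 ≤ x → G x = 0 :=
    fun hG x hx => hG.supp x (by linarith [le_abs_self x])
  refine ⟨ContinuousOn.memLp_two_lineMeasure hd hc one_pos
    (hz (G := posPart f) (hc.mono subset_union_right) (fun x hx _ => ?_)
      fun x hx => h.zero_right x (by linarith))
    (hz (G := negPart f) (hneg hc) (fun x hx _ => ?_) fun x hx => h'.zero_right x (by linarith)),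
    ContinuousOn.memLp_two_lineMeasure hd hc' one_pos
    (hz (G := posDeriv f) (hc'.mono subset_union_right) (fun x hx _ => ?_) (hsupp h.bounded))
    (hz (G := negDeriv f) (hneg hc') (fun x hx _ => ?_) (hsupp h'.bounded))⟩
  · rw [posPart, max_eq_left hx.le]
  · rw [negPart, max_eq_left hx.le]
  · rw [posDeriv, indicator_of_mem (mem_Ioi.2 hx)]
  · rw [negDeriv, indicator_of_mem (mem_Ioi.2 hx), norm_neg]

theorem ae_sideMeasure (d : ℝ) : ∀ᵐ r ∂sideMeasure d, 1 < r :=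
  (withDensity_absolutelyContinuous _ _).ae_le (ae_restrict_mem measurableSet_Ioi)

/-- Integration by parts on [1, ∞) without any pointwise decay of v: the product and its derivative
are both integrable, which forces the product to vanish at infinity. Only the boundary term at 1
remains. -/
theorem integral_sideMeasure_star_mul {d : ℝ} {v v' w q : ℝ → ℂ}
    (hv : ∀ x, 1 ≤ x → HasDerivWithinAt v (v' x) (Ici 1) x)
    (hw : ∀ x, 1 ≤ x → HasDerivAt (fun x => ((x ^ (d - 1) : ℝ) : ℂ) * w x)
      (((x ^ (d - 1) : ℝ) : ℂ) * q x) x)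
    (h₁ : Integrable (fun x => star (v' x) * w x) (sideMeasure d))
    (h₂ : Integrable (fun x => star (v x) * q x) (sideMeasure d))
    (h₃ : Integrable (fun x => star (v x) * w x) (sideMeasure d)) :
    ∫ x, star (v' x) * w x ∂sideMeasure d =
      -(star (v 1) * w 1) - ∫ x, star (v x) * q x ∂sideMeasure d := by
  have hD : ∀ x ∈ Ioi (1 : ℝ), HasDerivAt
      (fun x => star (v x) * (((x ^ (d - 1) : ℝ) : ℂ) * w x))
      (star (v' x) * (((x ^ (d - 1) : ℝ) : ℂ) * w x) +
        star (v x) * (((x ^ (d - 1) : ℝ) : ℂ) * q x)) x := fun x (hx : 1 < x) =>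
    ((hv x hx.le).hasDerivAt (Ici_mem_nhds hx)).star.mul (hw x hx.le)
  have i₁ : IntegrableOn (fun x => star (v' x) * (((x ^ (d - 1) : ℝ) : ℂ) * w x)) (Ioi 1) :=
    (integrable_sideMeasure h₁).congr (Eventually.of_forall fun x => mul_left_comm _ _ _)
  have i₂ : IntegrableOn (fun x => star (v x) * (((x ^ (d - 1) : ℝ) : ℂ) * q x)) (Ioi 1) :=
    (integrable_sideMeasure h₂).congr (Eventually.of_forall fun x => mul_left_comm _ _ _)
  have i₃ : IntegrableOn (fun x => star (v x) * (((x ^ (d - 1) : ℝ) : ℂ) * w x)) (Ioi 1) :=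
    (integrable_sideMeasure h₃).congr (Eventually.of_forall fun x => mul_left_comm _ _ _)
  have hc : ContinuousWithinAt (fun x => star (v x) * (((x ^ (d - 1) : ℝ) : ℂ) * w x)) (Ici 1) 1 :=
    (hv 1 le_rfl).continuousWithinAt.star.mul (hw 1 le_rfl).continuousAt.continuousWithinAt
  have key := integral_Ioi_of_hasDerivAt_of_tendsto hc hD (i₁.add i₂)
    (tendsto_zero_of_hasDerivAt_of_integrableOn_Ioi hD (i₁.add i₂) i₃)
  rw [integral_add i₁ i₂, Real.one_rpow, Complex.ofReal_one, one_mul, zero_sub] at key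
  rw [integral_sideMeasure, integral_sideMeasure, eq_sub_iff_add_eq, ← key]
  congr 1 <;> exact integral_congr_ae (Eventually.of_forall fun x => mul_left_comm _ _ _)

theorem integrable_star_mul {d : ℝ} {v w : ℝ → ℂ} (hv : MemLp v 2 (lineMeasure d))
    (hw : MemLp w 2 (lineMeasure d)) : Integrable (fun x => star (v x) * w x) (lineMeasure d) :=
  hv.star.integrable_mul hw

/-- Integration by parts on the broken line. -/
theorem integral_star_lineDeriv_mul {d : ℝ} {v p m P N : ℝ → ℂ} (hv : IsC1 v)
    (hv2 : MemLp v 2 (lineMeasure d)) (hv2' : MemLp (lineDeriv v) 2 (lineMeasure d))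
    (hp : ∀ x, 0 < x → HasDerivAt (fun x => ((x ^ (d - 1) : ℝ) : ℂ) * p x)
      (((x ^ (d - 1) : ℝ) : ℂ) * P x) x)
    (hm : ∀ x, 0 < x → HasDerivAt (fun x => ((x ^ (d - 1) : ℝ) : ℂ) * m x)
      (((x ^ (d - 1) : ℝ) : ℂ) * N x) x) (h1 : -m 1 = p 1)
    (hw : MemLp (glueFn p fun x => -m x) 2 (lineMeasure d))
    (hq : MemLp (glueFn P N) 2 (lineMeasure d)) :
    ∫ r, star (lineDeriv v r) * glueFn p (fun x => -m x) r ∂lineMeasure d =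
      -∫ r, star (v r) * glueFn P N r ∂lineMeasure d := by
  have i₁ := integrable_star_mul hv2' hw
  have i₂ := integrable_star_mul hv2 hq
  have i₃ := integrable_star_mul hv2 hw
  have hpos : ∀ u a b : ℝ → ℂ, (fun r => star (u r) * glueFn a b r) =ᵐ[sideMeasure d]
      fun r => star (u r) * a r := fun u a b => by
    filter_upwards [ae_sideMeasure d] with r hr
    rw [glueFn_of_pos _ _ (by linarith)]
  have hneg : ∀ u a b : ℝ → ℂ, (fun r => star (u (-r)) * glueFn a b (-r)) =ᵐ[sideMeasure d]
      fun r => star (u (-r)) * b r := fun u a b => by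
    filter_upwards [ae_sideMeasure d] with r hr
    rw [glueFn_neg_of_pos _ _ (by linarith)]
  have hns : ∀ r, star (lineDeriv v (-r)) * -m r = star (-lineDeriv v (-r)) * m r := fun r => by
    rw [star_neg]; ring
  have e₁ := integral_sideMeasure_star_mul (fun x hx => hv.hasDerivWithinAt_pos hx)
    (fun x hx => hp x (by linarith)) ((integrable_lineMeasure i₁).1.congr (hpos _ _ _))
    ((integrable_lineMeasure i₂).1.congr (hpos _ _ _))
    ((integrable_lineMeasure i₃).1.congr (hpos _ _ _))
  have e₂ := integral_sideMeasure_star_mul (fun x hx => hv.hasDerivWithinAt_neg hx)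
    (fun x hx => hm x (by linarith))
    (((integrable_lineMeasure i₁).2.congr (hneg _ _ _)).congr (Eventually.of_forall hns))
    ((integrable_lineMeasure i₂).2.congr (hneg _ _ _))
    ((((integrable_lineMeasure i₃).2.congr (hneg _ _ _)).neg).congr
      (Eventually.of_forall fun r => by simp))
  -- The boundary terms of the two sides cancel, because v takes equal values at ±1 and the outward
  -- derivatives of the solution add up to zero.
  rw [integral_lineMeasure i₁, integral_lineMeasure i₂, integral_congr_ae (hpos _ _ _),
    integral_congr_ae (hpos _ _ _), integral_congr_ae (hneg _ _ _),
    integral_congr_ae (hneg _ _ _), integral_congr_ae (Eventually.of_forall hns), e₁, e₂,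
    hv.glue, ← h1]
  ring

/-- A weak solution tested against the core of the form is tested against its closure. -/
theorem mem_formGraph_of_integral {d : ℝ} {Z Q : ℝ → ℂ} (hZ : IsC1 Z)
    (hZ2 : MemLp Z 2 (lineMeasure d)) (hZ2' : MemLp (lineDeriv Z) 2 (lineMeasure d))
    (hQ : MemLp Q 2 (lineMeasure d))
    (h : ∀ v, IsC1 v → MemLp v 2 (lineMeasure d) → MemLp (lineDeriv v) 2 (lineMeasure d) →
      ∫ r, star (lineDeriv v r) * lineDeriv Z r ∂lineMeasure d =
        ∫ r, star (v r) * Q r ∂lineMeasure d) :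
    (hZ2.toLp Z, hQ.toLp Q) ∈ formGraph (energySpace d) := by
  refine ⟨WithLp.toLp 2 (hZ2.toLp Z, hZ2'.toLp (lineDeriv Z)),
    Submodule.le_topologicalClosure _ ⟨Z, hZ, hZ2.coeFn_toLp, hZ2'.coeFn_toLp⟩, rfl, ?_⟩
  have hcl : IsClosed {v : WithLp 2 (L2 d × L2 d) |
      ⟪v.snd, hZ2'.toLp (lineDeriv Z)⟫_ℂ = ⟪v.fst, hQ.toLp Q⟫_ℂ} :=
    isClosed_eq (((WithLp.sndL 2 ℂ (L2 d) (L2 d)).continuous).inner continuous_const)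
      (((WithLp.fstL 2 ℂ (L2 d) (L2 d)).continuous).inner continuous_const)
  refine closure_minimal ?_ hcl
  rintro z ⟨v, hv, hv1, hv2⟩
  have hm1 : MemLp v 2 (lineMeasure d) := (memLp_congr_ae hv1).1 (Lp.memLp _)
  have hm2 : MemLp (lineDeriv v) 2 (lineMeasure d) := (memLp_congr_ae hv2).1 (Lp.memLp _)
  change ⟪z.snd, hZ2'.toLp (lineDeriv Z)⟫_ℂ = ⟪z.fst, hQ.toLp Q⟫_ℂ
  rw [L2.inner_def, L2.inner_def]
  refine Eq.trans (integral_congr_ae ?_) ((h v hv hm1 hm2).trans (integral_congr_ae ?_))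
  · filter_upwards [hv2, hZ2'.coeFn_toLp] with r h1 h2
    rw [h1, h2, RCLike.inner_apply, mul_comm]
    rfl
  · filter_upwards [hv1, hQ.coeFn_toLp] with r h1 h2
    rw [h1, h2, RCLike.inner_apply, mul_comm]
    rfl

/-- The constant that glues two half-line solutions with boundary moments `κ` and `κ'`. -/
def boundaryValue (d lam : ℝ) (κ κ' : ℂ) : ℂ :=
  ((besselID d lam / besselKD d lam : ℝ) * (κ + κ') - (besselM d lam : ℝ) * (κ - κ')) / 2

/-- The combination κ + κ' carries the Neumann coefficient of the even part, and κ - κ' the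
Dirichlet coefficient of the odd part. -/
theorem norm_boundaryValue_le {d lam : ℝ} (hd : 2 < d) (hl : 0 < lam) (κ κ' : ℂ) :
    ‖boundaryValue d lam κ κ'‖ ≤ boundaryCoeff d lam * (‖κ‖ + ‖κ'‖) := by
  have hN : 0 ≤ besselID d lam / besselKD d lam :=
    div_nonneg (besselID_nonneg hd hl) (besselKD_pos hd hl).le
  have hD := besselM_nonneg hd lam
  have h1 := norm_add_le κ κ'
  have h2 := norm_sub_le κ κ'
  rw [boundaryValue, norm_div, Complex.norm_ofNat, boundaryCoeff]
  have h3 : ‖((besselID d lam / besselKD d lam : ℝ) : ℂ) * (κ + κ') -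
      (besselM d lam : ℝ) * (κ - κ')‖ ≤ besselID d lam / besselKD d lam * (‖κ‖ + ‖κ'‖) +
        besselM d lam * (‖κ‖ + ‖κ'‖) := by
    refine (norm_sub_le _ _).trans ?_
    rw [norm_mul, norm_mul, Complex.norm_real, Complex.norm_real, Real.norm_of_nonneg hN,
      Real.norm_of_nonneg hD]
    gcongr
  have h4 : 0 ≤ (besselM d lam + besselID d lam / besselKD d lam) * (‖κ‖ + ‖κ'‖) := by positivity
  linarith

section Glue

variable {d lam M M' ρ : ℝ} {φ φ' g g' : ℝ → ℂ}

/-- The solution on one side of the broken line, glued with that of the other side. -/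
def sideResolvent (d lam : ℝ) (φ φ' : ℝ → ℂ) (ρ : ℝ) : ℝ → ℂ :=
  halfResolvent d lam φ ρ
    (boundaryValue d lam (rightMoment d lam φ ρ 1) (rightMoment d lam φ' ρ 1))

/-- The derivative of `sideResolvent`. -/
def sideResolventDeriv (d lam : ℝ) (φ φ' : ℝ → ℂ) (ρ : ℝ) : ℝ → ℂ :=
  halfResolventDeriv d lam φ ρ
    (boundaryValue d lam (rightMoment d lam φ ρ 1) (rightMoment d lam φ' ρ 1))

/-- At x = 1 the value is proportional to K(λ)c + I(λ)κ, so continuity demands c - c' = -(I/K)(κ -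
κ'). -/
theorem sideResolvent_one (d lam : ℝ) (φ φ' : ℝ → ℂ) (ρ : ℝ) :
    sideResolvent d lam φ' φ ρ 1 = sideResolvent d lam φ φ' ρ 1 := by
  simp only [sideResolvent, halfResolvent, leftMoment, intervalIntegral.integral_same, mul_one,
    boundaryValue, besselI]
  push_cast
  ring

/-- Reflection reverses the sign of the derivative, so matching demands c + c' = (I'/(-K'))(κ + κ').
This and the continuity condition determine c and c'. -/
theorem neg_sideResolventDeriv_one (hd : 2 < d) (hl : 0 < lam) (φ φ' : ℝ → ℂ) (ρ : ℝ) :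
    -sideResolventDeriv d lam φ' φ ρ 1 = sideResolventDeriv d lam φ φ' ρ 1 := by
  have hK : (besselKD d lam : ℂ) ≠ 0 := by exact_mod_cast (besselKD_pos hd hl).ne'
  simp only [sideResolventDeriv, halfResolventDeriv, leftMoment, intervalIntegral.integral_same,
    mul_one, boundaryValue]
  push_cast
  field_simp
  ring

theorem isC1_glueFn_sideResolvent (h : IsHalfLine φ g M ρ) (h' : IsHalfLine φ' g' M' ρ)
    (hd : 2 < d) (hl : 0 < lam) :
    IsC1 (glueFn (sideResolvent d lam φ φ' ρ) (sideResolvent d lam φ' φ ρ)) ∧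
      ∀ r ∈ line, lineDeriv (glueFn (sideResolvent d lam φ φ' ρ) (sideResolvent d lam φ' φ ρ)) r =
        glueFn (sideResolventDeriv d lam φ φ' ρ) (fun x => -sideResolventDeriv d lam φ' φ ρ x) r :=
  isC1_glueFn (fun _ hx => h.hasDerivAt_halfResolvent hd hl hx)
    (fun _ hx => h'.hasDerivAt_halfResolvent hd hl hx) (h.continuousOn_halfResolventDeriv hd hl)
    (h'.continuousOn_halfResolventDeriv hd hl) (sideResolvent_one d lam φ φ' ρ)
    (neg_sideResolventDeriv_one hd hl φ φ' ρ)

theorem memLp_glueFn (hd : 0 < d) {p m : ℝ → ℂ} (hp : ContinuousOn p (Ioi 0))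
    (hm : ContinuousOn m (Ioi 0)) {δ : ℝ} (hδ : 0 < δ)
    (h₁ : ∃ C : ℝ, ∀ x, 1 ≤ x → ‖p x‖ ≤ C * Real.exp (-(δ * x)))
    (h₂ : ∃ C : ℝ, ∀ x, 1 ≤ x → ‖m x‖ ≤ C * Real.exp (-(δ * x))) :
    MemLp (glueFn p m) 2 (lineMeasure d) := by
  refine ContinuousOn.memLp_two_lineMeasure hd
    ((continuousOn_glueFn hp hm).mono fun r hr => ne_zero_of_mem_line hr) hδ ?_ ?_
  · obtain ⟨C, hC⟩ := h₁
    refine ⟨C, fun x hx => ?_⟩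
    rw [glueFn_of_pos _ _ (by linarith)]
    exact hC x hx
  · obtain ⟨C, hC⟩ := h₂
    refine ⟨C, fun x hx => ?_⟩
    rw [glueFn_neg_of_pos _ _ (by linarith)]
    exact hC x hx

theorem glueFn_parts (f : ℝ → ℂ) {r : ℝ} (hr : r ∈ line) :
    glueFn (posPart f) (negPart f) r = f r := by
  rcases hr with h | h
  · have h : r ≤ -1 := h
    rw [glueFn, if_neg (by linarith), negPart, max_eq_left (by linarith), neg_neg]
  · have h : 1 ≤ r := h
    rw [glueFn, if_pos (by linarith), posPart, max_eq_left h]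

/-- The values on one side of the broken line of `f - λ² (λ² + A)⁻¹ f`. -/
def sideSymbol (d : ℝ) (φ φ' g : ℝ → ℂ) (ρ lam x : ℝ) : ℂ :=
  gradTransform d lam g x - ((lam ^ d * besselK d (lam * x) : ℝ) : ℂ) *
    boundaryValue d lam (rightMoment d lam φ ρ 1) (rightMoment d lam φ' ρ 1)

theorem measurable_sideSymbol (h : IsHalfLine φ g M ρ) (h' : IsHalfLine φ' g' M' ρ) :
    Measurable fun q : ℝ × ℝ => sideSymbol d φ φ' g ρ q.1 q.2 := by
  have h1 := h.measurable_rightMoment (d := d)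
  have h2 := h'.measurable_rightMoment (d := d)
  have h3 := measurable_besselK d
  have h4 := measurable_besselM d
  have h5 := measurable_besselID d
  have h6 := measurable_besselKD d
  refine (measurable_gradTransform d h.bounded.meas).sub (Measurable.mul (by fun_prop) ?_)
  have h7 : Measurable fun lam =>
      boundaryValue d lam (rightMoment d lam φ ρ 1) (rightMoment d lam φ' ρ 1) := by
    unfold boundaryValue
    fun_prop
  exact h7.comp measurable_fst

end Glue

/-! ### The bound for the truncated integrals and the limit -/

/-- The operator `A (λ² + A)⁻¹`. -/
def symbolOperator {H K : Type*} [NormedAddCommGroup H] [InnerProductSpace ℂ H] [CompleteSpace H]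
    [NormedAddCommGroup K] [InnerProductSpace ℂ K] (V : Submodule ℂ (WithLp 2 (H × K)))
    [CompleteSpace V] (lam : ℝ) : H →L[ℂ] H :=
  cfc (resolventSymbol lam) (formResolvent V)

/-- The values of `f - λ² (λ² + A)⁻¹ f` on the broken line. -/
def lineSymbol (d : ℝ) (f : ℝ → ℂ) (ρ lam : ℝ) : ℝ → ℂ :=
  glueFn (sideSymbol d (posPart f) (negPart f) (posDeriv f) ρ lam)
    (sideSymbol d (negPart f) (posPart f) (negDeriv f) ρ lam)

/-- The glued solution is C¹ across ±1, decays exponentially with its derivative, and satisfies the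
weak equation by integration by parts. Hence it is (Δ+λ²)⁻¹ f, and the half-line formulas apply on
each side. -/
theorem IsS0.symbolOperator_ae_eq {f : ℝ → ℂ} (hf : IsS0 f) {d lam M M' ρ : ℝ} (hd : 2 < d)
    (h : IsHalfLine (posPart f) (posDeriv f) M ρ) (h' : IsHalfLine (negPart f) (negDeriv f) M' ρ)
    (hl : 0 < lam) {F : L2 d} (hF : F =ᵐ[lineMeasure d] f) :
    symbolOperator (energySpace d) lam F =ᵐ[lineMeasure d] lineSymbol d f ρ lam := by
  have hd0 : 0 < d := by linarith
  have hl2 : 0 < lam / 2 := by positivity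
  obtain ⟨hZ, hZD⟩ := isC1_glueFn_sideResolvent h h' hd hl
  set Z := glueFn (sideResolvent d lam (posPart f) (negPart f) ρ)
    (sideResolvent d lam (negPart f) (posPart f) ρ) with hZdef
  have hZ2 : MemLp Z 2 (lineMeasure d) := memLp_glueFn hd0 (h.continuousOn_halfResolvent hd hl)
    (h'.continuousOn_halfResolvent hd hl) hl2 (h.exists_norm_halfResolvent_le hd hl)
    (h'.exists_norm_halfResolvent_le hd hl)
  have hZ2'' : MemLp (glueFn (sideResolventDeriv d lam (posPart f) (negPart f) ρ)
      fun x => -sideResolventDeriv d lam (negPart f) (posPart f) ρ x) 2 (lineMeasure d) :=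
    memLp_glueFn hd0 (h.continuousOn_halfResolventDeriv hd hl)
      (h'.continuousOn_halfResolventDeriv hd hl).neg hl2
      (h.exists_norm_halfResolventDeriv_le hd hl) (by
        simp only [norm_neg]
        exact h'.exists_norm_halfResolventDeriv_le hd hl)
  have hDae := (ae_mem_line d).mono hZD
  have hZ2' : MemLp (lineDeriv Z) 2 (lineMeasure d) := (memLp_congr_ae hDae).2 hZ2''
  have hf2 := (hf.memLp hd0).1
  have hQ : MemLp (f - (lam : ℂ) ^ 2 • Z) 2 (lineMeasure d) := hf2.sub (hZ2.const_smul _)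
  have hgr : (hZ2.toLp Z, hQ.toLp _) ∈ formGraph (energySpace d) := by
    refine mem_formGraph_of_integral hZ hZ2 hZ2' hQ fun v hv hv2 hv2' => ?_
    have hQae : glueFn
        (fun x => (lam : ℂ) ^ 2 * sideResolvent d lam (posPart f) (negPart f) ρ x - posPart f x)
        (fun x => (lam : ℂ) ^ 2 * sideResolvent d lam (negPart f) (posPart f) ρ x - negPart f x)
        =ᵐ[lineMeasure d] -(f - (lam : ℂ) ^ 2 • Z) := by
      filter_upwards [ae_mem_line d] with r hr
      rw [Pi.neg_apply, Pi.sub_apply, Pi.smul_apply, smul_eq_mul, neg_sub, ← glueFn_parts f hr,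
        hZdef]
      unfold glueFn
      split_ifs <;> rfl
    have := integral_star_lineDeriv_mul hv hv2 hv2'
      (fun x hx => h.hasDerivAt_rpow_mul_halfResolventDeriv hd hl hx)
      (fun x hx => h'.hasDerivAt_rpow_mul_halfResolventDeriv hd hl hx)
      (neg_sideResolventDeriv_one hd hl (posPart f) (negPart f) ρ) hZ2''
      ((memLp_congr_ae hQae).2 hQ.neg)
    refine Eq.trans (integral_congr_ae ?_) (this.trans ?_)
    · filter_upwards [hDae] with r hr
      rw [hr]
      rfl
    · rw [← integral_neg]
      refine integral_congr_ae ?_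
      filter_upwards [hQae] with r hr
      have hr' := hr
      simp only [sideResolvent] at hr'
      rw [hr', Pi.neg_apply, mul_neg, neg_neg]
  have hFf : F = hf2.toLp f := Lp.ext (hF.trans hf2.coeFn_toLp.symm)
  have hQeq : hQ.toLp _ = F - (lam : ℂ) ^ 2 • hZ2.toLp Z := by
    rw [hFf]
    rfl
  rw [hQeq] at hgr
  rw [symbolOperator, resolventSymbol_apply_eq _ hl hgr, ← hQeq]
  refine hQ.coeFn_toLp.trans ?_
  filter_upwards [ae_mem_line d] with r hr
  rw [Pi.sub_apply, Pi.smul_apply, smul_eq_mul, ← glueFn_parts f hr, hZdef, lineSymbol]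
  unfold glueFn
  rcases hr with hr | hr
  · have hr : r ≤ -1 := hr
    rw [if_neg (by linarith), if_neg (by linarith), if_neg (by linarith)]
    exact h'.sub_halfResolvent_eq hd hl (by linarith)
  · have hr : 1 ≤ r := hr
    rw [if_pos (by linarith), if_pos (by linarith), if_pos (by linarith)]
    exact h.sub_halfResolvent_eq hd hl hr

theorem lintegral_restrict_enorm_le {α : Type*} [MeasurableSpace α] {μ : Measure α}
    (f : Lp ℂ 2 μ) (s : Set α) :
    ∫⁻ x in s, ‖f x‖ₑ ∂μ ≤ ‖f‖ₑ * μ s ^ (1 / 2 : ℝ) := by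
  have h := eLpNorm_le_eLpNorm_mul_rpow_measure_univ (μ := μ.restrict s) (p := 1) (q := 2)
    (f := f) (by norm_num) (Lp.aestronglyMeasurable f).restrict
  rw [eLpNorm_one_eq_lintegral_enorm, Measure.restrict_apply_univ] at h
  refine h.trans ?_
  rw [Lp.enorm_def]
  norm_num
  gcongr
  exact Measure.restrict_le_self

/-- The Bochner integral of an `L²`-valued function is the pointwise integral of a jointly
measurable version of it. -/
theorem integral_Lp_ae_eq {α : Type*} [MeasurableSpace α] {μ : Measure α} [SigmaFinite μ]
    {ι : Type*} [MeasurableSpace ι] {ν : Measure ι} [SFinite ν] {U : ι → Lp ℂ 2 μ}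
    (hU : Integrable U ν) {F : ι → α → ℂ} (hF : Measurable (Function.uncurry F))
    (h : ∀ᵐ i ∂ν, U i =ᵐ[μ] F i) :
    (∫ i, U i ∂ν : Lp ℂ 2 μ) =ᵐ[μ] fun x => ∫ i, F i x ∂ν := by
  -- On sets of finite measure L² norms control L¹ norms, so Fubini applies; the two sides are then
  -- compared through their integrals over such sets.
  have hint : ∀ s, MeasurableSet s → μ s < ⊤ →
      Integrable (Function.uncurry F) (ν.prod (μ.restrict s)) := fun s hs hμs => by
    refine ⟨hF.aestronglyMeasurable, ?_⟩
    rw [hasFiniteIntegral_iff_enorm, lintegral_prod _ hF.enorm.aemeasurable]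
    have hb : ∫⁻ i, ‖U i‖ₑ * μ s ^ (1 / 2 : ℝ) ∂ν < ⊤ := by
      rw [lintegral_mul_const' _ _ (ENNReal.rpow_ne_top_of_nonneg (by norm_num) hμs.ne)]
      exact ENNReal.mul_lt_top hU.2 (ENNReal.rpow_lt_top_of_nonneg (by norm_num) hμs.ne)
    refine lt_of_le_of_lt (lintegral_mono_ae ?_) hb
    filter_upwards [h] with i hi
    refine le_trans (le_of_eq ?_) (lintegral_restrict_enorm_le (U i) s)
    refine lintegral_congr_ae ?_
    filter_upwards [ae_restrict_of_ae hi] with x hx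
    rw [hx]
    rfl
  refine ae_eq_of_forall_setIntegral_eq_of_sigmaFinite
    (fun s hs hμs => ?_) (fun s hs hμs => (hint s hs hμs).integral_prod_right) fun s hs hμs => ?_
  · exact integrableOn_Lp_of_measure_ne_top _ (by norm_num) hμs.ne
  · rw [← L2.inner_indicatorConstLp_one (𝕜 := ℂ) hs hμs.ne, ← integral_inner hU,
      ← integral_integral_swap (hint s hs hμs)]
    refine integral_congr_ae ?_
    filter_upwards [h] with i hi
    rw [L2.inner_indicatorConstLp_one]
    exact integral_congr_ae (ae_restrict_of_ae hi)

theorem enorm_integral_sub_le {ι : Type*} [MeasurableSpace ι] {ν : Measure ι} {a b : ι → ℂ}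
    (hb : AEStronglyMeasurable b ν) :
    ‖∫ i, (a i - b i) ∂ν‖ₑ ≤ ‖∫ i, a i ∂ν‖ₑ + ∫⁻ i, ‖b i‖ₑ ∂ν := by
  rcases eq_top_or_lt_top (∫⁻ i, ‖b i‖ₑ ∂ν) with h | h
  · rw [h, add_top]
    exact le_top
  have hbi : Integrable b ν := ⟨hb, h⟩
  by_cases ha : Integrable a ν
  · rw [integral_sub ha hbi]
    exact (enorm_sub_le).trans (by gcongr; exact enorm_integral_le_lintegral_enorm b)
  -- If a is not integrable while b is, then a - b is not integrable and its integral is 0 by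
  -- convention, so the inequality holds with no integrability assumption on a.
  · rw [integral_undef fun hab => ha ?_, enorm_zero]
    · exact zero_le
    · exact (hab.add hbi).congr (Eventually.of_forall fun i => sub_add_cancel _ _)

/-- The gradient transform sees the derivative on its own side only; the gluing term couples the
sides through both moments. The latter is extended from (0, Λ] to all λ > 0, which removes the
dependence on Λ. -/
theorem exists_lintegral_sideSymbol_le {d p : ℝ} (hd : 2 < d) (hp : 1 < p) :
    ∃ C : ℝ≥0, ∀ (φ φ' g g' : ℝ → ℂ) (M M' ρ Λ : ℝ), 0 < Λ → IsHalfLine φ g M ρ →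
      IsHalfLine φ' g' M' ρ →
      ∫⁻ x, ‖∫ lam in Ioc 0 Λ, sideSymbol d φ φ' g ρ lam x‖ₑ ^ p ∂sideMeasure d ≤
        C * (∫⁻ y, ‖g y‖ₑ ^ p ∂radialMeasure d + ∫⁻ y, ‖g' y‖ₑ ^ p ∂radialMeasure d) := by
  obtain ⟨C₁, h₁⟩ := exists_lintegral_gradTransform_le hd hp
  obtain ⟨C₂, h₂⟩ := exists_lintegral_correction_le hd hp
  have hp0 : 0 < p := by linarith
  set A : ℝ≥0 := 2 ^ (p - 1) with hA
  have hAe : (A : ℝ≥0∞) = 2 ^ (p - 1) := by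
    rw [hA, ENNReal.coe_rpow_of_nonneg _ (by linarith)]
    rfl
  refine ⟨A * (C₁ + C₂ * A), fun φ φ' g g' M M' ρ Λ hΛ h h' => ?_⟩
  set κ : ℝ → ℝ≥0∞ := (fun lam => ‖rightMoment d lam φ ρ 1‖ₑ) +
    fun lam => ‖rightMoment d lam φ' ρ 1‖ₑ with hκ
  have hκm : Measurable κ := h.measurable_rightMoment.enorm.add h'.measurable_rightMoment.enorm
  have hB := (h.isBesselMoment hd).add (h'.isBesselMoment hd)
  set X : ℝ → ℝ≥0∞ := fun x => ‖∫ lam in Ioc 0 Λ, gradTransform d lam g x‖ₑ with hX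
  set Y : ℝ → ℝ≥0∞ := fun x =>
    ∫⁻ lam in Ioi 0, ENNReal.ofReal (correctionWeight d lam x) * κ lam with hY
  have hXm : Measurable X := by
    have : Measurable fun x => ∫ lam in Ioc 0 Λ, gradTransform d lam g x :=
      ((measurable_gradTransform d h.bounded.meas).comp
        measurable_swap).stronglyMeasurable.integral_prod_right'.measurable
    exact this.enorm
  have hpt : ∀ x, 1 < x → ‖∫ lam in Ioc 0 Λ, sideSymbol d φ φ' g ρ lam x‖ₑ ≤ X x + Y x := by
    intro x hx
    have hx0 : 0 < x := by linarith
    have hm : Measurable fun lam => ((lam ^ d * besselK d (lam * x) : ℝ) : ℂ) *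
        boundaryValue d lam (rightMoment d lam φ ρ 1) (rightMoment d lam φ' ρ 1) := by
      have e1 := (measurable_sideSymbol (d := d) h h').comp
        (measurable_id.prodMk (measurable_const (a := x)))
      have e2 := (measurable_gradTransform d h.bounded.meas).comp
        (measurable_id.prodMk (measurable_const (a := x)))
      convert e2.sub e1 using 1
      funext lam
      simp [sideSymbol]
    refine (enorm_integral_sub_le hm.aestronglyMeasurable).trans (add_le_add le_rfl ?_)
    refine (setLIntegral_mono' measurableSet_Ioc fun lam hlam => ?_).trans
      (lintegral_mono_set Ioc_subset_Ioi_self)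
    have hl : 0 < lam := hlam.1
    have hK := besselK_pos (by linarith : 1 < d) (mul_pos hl hx0)
    have hb := boundaryCoeff_nonneg hd hl
    rw [enorm_mul, enorm_ofReal_of_nonneg (by positivity), hκ, Pi.add_apply]
    calc _ ≤ ENNReal.ofReal (lam ^ d * besselK d (lam * x)) *
          (ENNReal.ofReal (boundaryCoeff d lam) *
            (‖rightMoment d lam φ ρ 1‖ₑ + ‖rightMoment d lam φ' ρ 1‖ₑ)) := by
          gcongr
          rw [← ofReal_norm, ← ofReal_norm, ← ofReal_norm,
            ← ENNReal.ofReal_add (norm_nonneg _) (norm_nonneg _), ← ENNReal.ofReal_mul hb]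
          exact ENNReal.ofReal_le_ofReal (norm_boundaryValue_le hd hl _ _)
      _ = _ := by
          rw [← mul_assoc, ← ENNReal.ofReal_mul (by positivity), correctionWeight]
          congr 2
          ring
  have hside : ∀ G : ℝ → ℝ≥0∞, ∫⁻ x, G x ∂sideMeasure d = ∫⁻ x in Ici 1, G x ∂radialMeasure d :=
    fun G => by rw [restrict_radialMeasure]
  calc _ ≤ ∫⁻ x, A * (X x ^ p + Y x ^ p) ∂sideMeasure d := by
        refine lintegral_mono_ae ?_
        filter_upwards [ae_sideMeasure d] with x hx
        rw [hAe]
        exact (ENNReal.rpow_le_rpow (hpt x hx) hp0.le).trans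
          (ENNReal.rpow_add_le_mul_rpow_add_rpow _ _ hp.le)
    _ = A * (∫⁻ x, X x ^ p ∂sideMeasure d + ∫⁻ x, Y x ^ p ∂sideMeasure d) := by
        rw [lintegral_const_mul' _ _ ENNReal.coe_ne_top, lintegral_add_left (hXm.pow_const p)]
    _ ≤ A * (C₁ * ∫⁻ y, ‖g y‖ₑ ^ p ∂radialMeasure d + C₂ * (A * (∫⁻ y, ‖g y‖ₑ ^ p ∂radialMeasure d +
          ∫⁻ y, ‖g' y‖ₑ ^ p ∂radialMeasure d))) := by
        gcongr
        · rw [hside]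
          exact (setLIntegral_le_lintegral _ _).trans (h₁ Λ hΛ g M ρ h.bounded)
        · rw [hside]
          refine (h₂ _ κ hκm hB).trans ?_
          gcongr
          rw [← lintegral_add_left (h.bounded.meas.measurable.enorm.pow_const p),
            ← lintegral_const_mul' _ _ ENNReal.coe_ne_top]
          refine lintegral_mono fun y => ?_
          rw [hAe]
          exact ENNReal.rpow_add_le_mul_rpow_add_rpow _ _ hp.le
    _ ≤ A * (C₁ * (∫⁻ y, ‖g y‖ₑ ^ p ∂radialMeasure d + ∫⁻ y, ‖g' y‖ₑ ^ p ∂radialMeasure d) +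
          C₂ * (A * (∫⁻ y, ‖g y‖ₑ ^ p ∂radialMeasure d +
          ∫⁻ y, ‖g' y‖ₑ ^ p ∂radialMeasure d))) := by
        gcongr
        exact le_self_add
    _ = _ := by
        push_cast
        ring

theorem lintegral_radialMeasure_indicator_le {d p : ℝ} (hp : 0 < p) (F : ℝ → ℂ) :
    ∫⁻ y, ‖(Ioi 1).indicator F y‖ₑ ^ p ∂radialMeasure d ≤ ∫⁻ y, ‖F y‖ₑ ^ p ∂sideMeasure d := by
  rw [← restrict_radialMeasure]
  have e : ∀ y, ‖(Ioi 1).indicator F y‖ₑ ^ p = (Ioi 1).indicator (fun y => ‖F y‖ₑ ^ p) y :=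
    fun y => by
      by_cases hy : y ∈ Ioi (1 : ℝ)
      · rw [indicator_of_mem hy, indicator_of_mem hy]
      · rw [indicator_of_notMem hy, indicator_of_notMem hy, enorm_zero, ENNReal.zero_rpow_of_pos hp]
  simp only [e]
  rw [lintegral_indicator measurableSet_Ioi]
  exact lintegral_mono_set Ioi_subset_Ici_self

theorem lintegral_parts_deriv_le {d p : ℝ} (hp : 0 < p) (f : ℝ → ℂ) :
    ∫⁻ y, ‖posDeriv f y‖ₑ ^ p ∂radialMeasure d + ∫⁻ y, ‖negDeriv f y‖ₑ ^ p ∂radialMeasure d ≤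
      ∫⁻ r, ‖lineDeriv f r‖ₑ ^ p ∂lineMeasure d := by
  rw [lintegral_lineMeasure]
  refine add_le_add (lintegral_radialMeasure_indicator_le hp _)
    ((lintegral_radialMeasure_indicator_le hp _).trans (le_of_eq ?_))
  simp only [enorm_neg]

theorem exists_lintegral_lineSymbol_le {d p : ℝ} (hd : 2 < d) (hp : 1 < p) :
    ∃ C : ℝ≥0, ∀ (f : ℝ → ℂ) (M M' ρ Λ : ℝ), 0 < Λ →
      IsHalfLine (posPart f) (posDeriv f) M ρ → IsHalfLine (negPart f) (negDeriv f) M' ρ →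
      ∫⁻ r, ‖∫ lam in Ioc 0 Λ, lineSymbol d f ρ lam r‖ₑ ^ p ∂lineMeasure d ≤
        C * ∫⁻ r, ‖lineDeriv f r‖ₑ ^ p ∂lineMeasure d := by
  obtain ⟨C, hC⟩ := exists_lintegral_sideSymbol_le hd hp
  have hp0 : 0 < p := by linarith
  refine ⟨2 * C, fun f M M' ρ Λ hΛ h h' => ?_⟩
  have hpos : ∫⁻ r, ‖∫ lam in Ioc 0 Λ, lineSymbol d f ρ lam r‖ₑ ^ p ∂sideMeasure d =
      ∫⁻ r, ‖∫ lam in Ioc 0 Λ, sideSymbol d (posPart f) (negPart f) (posDeriv f) ρ lam r‖ₑ ^ p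
        ∂sideMeasure d := by
    refine lintegral_congr_ae ?_
    filter_upwards [ae_sideMeasure d] with r hr
    simp only [lineSymbol, glueFn_of_pos _ _ (zero_lt_one.trans hr)]
  have hneg : ∫⁻ r, ‖∫ lam in Ioc 0 Λ, lineSymbol d f ρ lam (-r)‖ₑ ^ p ∂sideMeasure d =
      ∫⁻ r, ‖∫ lam in Ioc 0 Λ, sideSymbol d (negPart f) (posPart f) (negDeriv f) ρ lam r‖ₑ ^ p
        ∂sideMeasure d := by
    refine lintegral_congr_ae ?_
    filter_upwards [ae_sideMeasure d] with r hr
    simp only [lineSymbol, glueFn_neg_of_pos _ _ (zero_lt_one.trans hr)]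
  have hle := lintegral_parts_deriv_le (d := d) hp0 f
  rw [lintegral_lineMeasure, hpos, hneg, ENNReal.coe_mul, ENNReal.coe_ofNat, mul_assoc, two_mul]
  refine add_le_add ((hC _ _ _ _ M M' ρ Λ hΛ h h').trans (mul_le_mul_right hle _))
    ((hC _ _ _ _ M' M ρ Λ hΛ h' h).trans (mul_le_mul_right ?_ _))
  rwa [add_comm]

theorem measurable_lineSymbol {f : ℝ → ℂ} {d M M' ρ : ℝ}
    (h : IsHalfLine (posPart f) (posDeriv f) M ρ) (h' : IsHalfLine (negPart f) (negDeriv f) M' ρ) :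
    Measurable (Function.uncurry (lineSymbol d f ρ)) := by
  refine Measurable.ite (measurableSet_le measurable_const measurable_snd)
    (measurable_sideSymbol h h') ((measurable_sideSymbol h' h).comp
      (measurable_fst.prodMk measurable_snd.neg))

/-- Fatou's lemma for a limit in `L²` of functions that are bounded in another Lebesgue space. -/
theorem eLpNorm_le_of_tendsto_Lp {α : Type*} [MeasurableSpace α] {μ : Measure α} {q B : ℝ≥0∞}
    {U : ℝ → Lp ℂ 2 μ} {w : Lp ℂ 2 μ} (hU : Tendsto U atTop (𝓝 w))
    (hB : ∀ Λ, 0 < Λ → eLpNorm (U Λ) q μ ≤ B) : eLpNorm w q μ ≤ B := by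
  obtain ⟨ns, hns, hae⟩ := (tendstoInMeasure_of_tendsto_Lp hU).exists_seq_tendsto_ae'
  refine (Lp.eLpNorm_lim_le_liminf_eLpNorm (fun _ => Lp.aestronglyMeasurable _) _ hae).trans ?_
  refine liminf_le_of_frequently_le' (Eventually.frequently ?_)
  filter_upwards [hns.eventually (eventually_gt_atTop 0)] with n hn using hB _ hn

theorem eLpNorm_le_rpow_mul_of_lintegral_le {α : Type*} [MeasurableSpace α] {μ : Measure α} {p : ℝ}
    (hp : 0 < p) {C : ℝ≥0} {u v : α → ℂ} (h : ∫⁻ x, ‖u x‖ₑ ^ p ∂μ ≤ C * ∫⁻ x, ‖v x‖ₑ ^ p ∂μ) :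
    eLpNorm u (ENNReal.ofReal p) μ ≤
      ENNReal.ofReal ((C : ℝ) ^ (1 / p)) * eLpNorm v (ENNReal.ofReal p) μ := by
  have hp1 : ENNReal.ofReal p ≠ 0 := by simpa using hp
  rw [eLpNorm_eq_lintegral_rpow_enorm_toReal hp1 ENNReal.ofReal_ne_top,
    eLpNorm_eq_lintegral_rpow_enorm_toReal hp1 ENNReal.ofReal_ne_top, ENNReal.toReal_ofReal hp.le,
    ← ENNReal.ofReal_rpow_of_nonneg C.coe_nonneg (by positivity), ENNReal.ofReal_coe_nnreal,
    ← ENNReal.mul_rpow_of_nonneg _ _ (by positivity)]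
  exact ENNReal.rpow_le_rpow h (by positivity)

theorem reverseRiesz {d p : ℝ} (hd : 2 < d) (hp : 1 < p) : ReverseRiesz d p := by
  obtain ⟨C, hC⟩ := exists_lintegral_lineSymbol_le hd hp
  have hp0 : 0 < p := by linarith
  refine ⟨(C : ℝ) ^ (1 / p), fun f hf => ?_⟩
  obtain ⟨M, M', ρ, h, h'⟩ := hf.exists_isHalfLine
  obtain ⟨hf2, hf2'⟩ := hf.memLp (d := d) (by linarith)
  have hmem : WithLp.toLp 2 (hf2.toLp f, hf2'.toLp (lineDeriv f)) ∈ energySpace d :=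
    Submodule.le_topologicalClosure _ ⟨f, hf.isC1, hf2.coeFn_toLp, hf2'.coeFn_toLp⟩
  obtain ⟨w, hw, hint, hlim⟩ := exists_formSqrtGraph_tendsto _ (energySpace_dense d) hmem
  rw [← sqrtLaplacian_graph, LinearPMap.mem_graph_iff] at hw
  obtain ⟨u, hu, huw⟩ := hw
  refine ⟨u, ?_, ?_⟩
  · rw [hu]
    exact hf2.coeFn_toLp
  have hΛ : ∀ Λ, 0 < Λ → eLpNorm (∫ lam in Ioc 0 Λ,
      symbolOperator (energySpace d) lam (hf2.toLp f) : L2 d) (ENNReal.ofReal p) (lineMeasure d) ≤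
        ENNReal.ofReal ((C : ℝ) ^ (1 / p)) *
          eLpNorm (lineDeriv f) (ENNReal.ofReal p) (lineMeasure d) := fun Λ hΛ => by
    have hae := integral_Lp_ae_eq (hint Λ) (measurable_lineSymbol (d := d) h h')
      ((ae_restrict_mem measurableSet_Ioc).mono fun lam hlam =>
        hf.symbolOperator_ae_eq hd h h' hlam.1 hf2.coeFn_toLp)
    refine (eLpNorm_congr_ae hae).trans_le ?_
    exact eLpNorm_le_rpow_mul_of_lintegral_le hp0 (hC f M M' ρ Λ hΛ h h')
  -- The real scalar π/2 is read as a complex one, so that the coordinate formula for scalar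
  -- multiplication in L² applies.
  replace hlim : Tendsto (fun Λ : ℝ => (∫ lam in Ioc 0 Λ,
      symbolOperator (energySpace d) lam (hf2.toLp f) : L2 d)) atTop
        (𝓝 (((Real.pi / 2 : ℝ) : ℂ) • w)) := hlim
  -- The limit is (π/2) Δ^{1/2} f; since π/2 ≥ 1, the factor is simply dropped.
  refine le_trans ?_ (eLpNorm_le_of_tendsto_Lp hlim hΛ)
  rw [huw]
  refine eLpNorm_mono_ae ?_
  filter_upwards [Lp.coeFn_smul ((Real.pi / 2 : ℝ) : ℂ) w] with r hr
  rw [hr, Pi.smul_apply, norm_smul, Complex.norm_real, Real.norm_of_nonneg (by positivity)]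
  exact le_mul_of_one_le_left (norm_nonneg _) (by linarith [Real.pi_gt_three])

end BrokenLine

end

theorem mainTheorem7 (d : ℝ) (hd : 2 < d) :
    (∀ p : ℝ, max (d / (2 * d - 3)) 1 < p → BrokenLine.ReverseRiesz d p) ∧
      (3 ≤ d → ∀ p : ℝ, 1 < p → BrokenLine.ReverseRiesz d p) := by
  exact ⟨fun _ hp => BrokenLine.reverseRiesz hd ((le_max_right _ _).trans_lt hp),
    fun _ _ hp => BrokenLine.reverseRiesz hd hp⟩
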